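/- Let $m$ be a square-free positive integer, $\mathcal{O}_{-m}$ the ring of integers of $\mathbb{Q}(\sqrt{-m})$, $\Gamma=\mathrm{PSL}_2(\mathcal{O}_{-m})$, and let $\ell$ be a prime number. Let $Z$ be a refined cell complex for $\Gamma$: a $\Gamma$-invariant, locally finite cell structure on hyperbolic three-space $\mathcal{H}$ by geodesic polyhedral cells with finitely many faces (ideal vertices are allowed), in which the stabiliser of each cell fixes this cell pointwise, and in which the $\Gamma$-translates of the bottom facets of the Bianchi fundamental polyhedron (those which do not touch the cusp $\infty$) form a subcomplex. Let $X$ be the Flöge cellular complex: the subcomplex of $Z$ formed by the cells in these translates, together with the singular cusps $\lambda/\mu$ (those for which the ideal $(\lambda,\mu)$ is not principal) as additional vertices. The $\ell$-torsion subcomplex $T$ is the graph in $\Gamma\backslash Z$ that consists of the cells whose pre-images have stabilisers containing elements of order $\ell$. If exactly two edges $(a,v)$ and $(v',b)$, with $\Gamma v=\Gamma v'$, are adjacent to the vertex orbit of $v$ (two different edges, each with just one end at this orbit), then an edge fusion at $v$ replaces these two edges by one edge $(a,b)$ and forgets $v$; for this, pre-images of the two edges with the common end $v$ are taken on a common axis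 of rotations of order $\ell$, and the pre-image of the new edge is their union with $v$. A reduced $\ell$-torsion subcomplex $R$ is a graph obtained from $T$ by finitely many edge fusions, and in which no further edge fusion is permitted. For a $\Gamma$-stable family $K$ of such cells, with cellular chain modules $C_\bullet(K)$, let $$E^1_{p,q}(K)=H_q(\Gamma;C_p(K))\cong\bigoplus_{\sigma\in\Gamma\backslash K^p}H_q(\Gamma_\sigma;\mathbb{Z}),$$ with the differential $d^1$ induced by the cellular boundary, let $E^2_{p,q}(K)$ be the homology of $(E^1(K),d^1)$, and let $E^2_{p,q}(K;\ell)$ be the homology of the $\ell$-primary part $\big((E^1(K))_{(\ell)},(d^1)_{(\ell)}\big)$. For $K=X$, this is the second page of the equivariant spectral sequence converging to $H_{p+q}(\Gamma;\mathbb{Z})$. For $K=T$ and $K=R$, take the families of the pre-images of the cells. Then, after any sequence of edge fusions starting from $T$, an edge fusion can be carried out at every vertex at which exactly two edges are adjacent as above. For every reduced $\ell$-torsion subcomplex $R$, all $p\ge 0$ and all $q\geq 1$, $$E^2_{p,q}(T;\ell)\;\cong\;E^2_{p,q}(R;\ell),$$ and, except in the two cases $(m,\ell)=(1,2)$ and $(m,\ell)=(3,3)$,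 $$\big(E^2_{p,q}(X)\big)_{(\ell)}\;\cong\;E^2_{p,q}(R;\ell).$$ -/

import Mathlib

open scoped ComplexOrder Topology Matrix

noncomputable section

namespace TorsionReduction

/-! ### Equivariant families of cells in a real representation and their first two pages -/

/-- A family of subsets ("cells") of a real representation `V` of `G` which is stable under `G`. -/
structure CellFamily {G V : Type} [Group G] [AddCommGroup V] [Module ℝ V]
    (ρ : Representation ℝ G V) where
  cells : Set (Set V)
  image_mem : ∀ (g : G), ∀ σ ∈ cells, ρ g '' σ ∈ cells

section Chains

variable {G V : Type} [Group G] [AddCommGroup V] [Module ℝ V] {ρ : Representation ℝ G V}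

/-- A framed `p`-cell. The cells are convex cones, and a point of hyperbolic space is a ray, so
that a `p`-cell spans a subspace of dimension `p + 1`. The frame, a basis of this subspace, is only
used for the orientation of the cell that it determines. -/
@[ext]
structure FramedCell (K : CellFamily ρ) (p : ℕ) where
  cell : Set V
  mem : cell ∈ K.cells
  dim : Module.finrank ℝ (Submodule.span ℝ cell) = p + 1
  vec : Fin (p + 1) → V
  indep : LinearIndependent ℝ vec
  mem_span : ∀ i, vec i ∈ Submodule.span ℝ cell

/-- The action of the group on framed cells. -/
def FramedCell.translate {K : CellFamily ρ} {p : ℕ} (g : G) (f : FramedCell K p) :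
    FramedCell K p where
  cell := ρ g '' f.cell
  mem := K.image_mem g _ f.mem
  dim := by
    have hinj : Function.Injective (ρ g) := by
      intro x y h
      have := congrArg (ρ g⁻¹) h
      simpa using this
    rw [← f.dim, Submodule.span_image]
    exact (Submodule.equivMapOfInjective (ρ g) hinj _).finrank_eq.symm
  vec := fun i => ρ g (f.vec i)
  indep := by
    have hinj : Function.Injective (ρ g) := by
      intro x y h
      have := congrArg (ρ g⁻¹) h
      simpa using this
    exact f.indep.map' _ (LinearMap.ker_eq_bot.mpr hinj)
  mem_span := fun i => by
    rw [Submodule.span_image]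
    exact Submodule.mem_map_of_mem (f.mem_span i)

/-- The frame of `f'` is `c` times that of `f` in the top exterior power: the two frames of one
cell define the same orientation if `0 < c`, and opposite orientations if `c < 0`. -/
def FramesDiffer {p : ℕ} (v v' : Fin (p + 1) → V) (c : ℝ) : Prop :=
  exteriorPower.ιMulti ℝ (p + 1) v' = c • exteriorPower.ιMulti ℝ (p + 1) v

/-- Identify framed cells up to orientation: two frames of the same cell are identified up to the
sign that compares their orientations. -/
def orientationRelations (K : CellFamily ρ) (p : ℕ) : Submodule ℤ (FramedCell K p →₀ ℤ) :=
  Submodule.span ℤ {x | ∃ (f f' : FramedCell K p) (c : ℝ), f'.cell = f.cell ∧ c ≠ 0 ∧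
    FramesDiffer f.vec f'.vec c ∧
    x = Finsupp.single f' 1 - Finsupp.single f (SignType.sign c : ℤ)}

/-- The group of cellular `p`-chains: free abelian on the `p`-cells, with orientations. -/
abbrev Chains (K : CellFamily ρ) (p : ℕ) : Type :=
  (FramedCell K p →₀ ℤ) ⧸ orientationRelations K p

/-- The chain given by a framed cell. -/
def FramedCell.chain {K : CellFamily ρ} {p : ℕ} (f : FramedCell K p) : Chains K p :=
  Submodule.Quotient.mk (Finsupp.single f 1)

/-- The action on finite sums of framed cells. -/
def framedRep (K : CellFamily ρ) (p : ℕ) : Representation ℤ G (FramedCell K p →₀ ℤ) where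
  toFun g := Finsupp.lmapDomain ℤ ℤ (FramedCell.translate g)
  map_one' := by
    ext f : 2
    have : FramedCell.translate (1 : G) f = f := by
      ext <;> simp [FramedCell.translate]
    simp [this]
  map_mul' g h := by
    ext f : 2
    have : FramedCell.translate (g * h) f =
        FramedCell.translate g (FramedCell.translate h f) := by
      ext <;> simp [FramedCell.translate]
    simp [this]

lemma FramesDiffer.map {p : ℕ} {v v' : Fin (p + 1) → V} {c : ℝ} (h : FramesDiffer v v' c)
    (T : V →ₗ[ℝ] V) : FramesDiffer (fun i => T (v i)) (fun i => T (v' i)) c := by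
  have := congrArg (exteriorPower.map (p + 1) T) h
  simpa [FramesDiffer, exteriorPower.map_apply_ιMulti, Function.comp_def] using! this

lemma orientationRelations_le (K : CellFamily ρ) (p : ℕ) (g : G) :
    orientationRelations K p ≤ (orientationRelations K p).comap (framedRep K p g) := by
  refine Submodule.span_le.mpr ?_
  rintro _ ⟨f, f', c, hc, hc0, hd, rfl⟩
  refine Submodule.subset_span ⟨f.translate g, f'.translate g, c, ?_, hc0, hd.map (ρ g), ?_⟩
  · simp [FramedCell.translate, hc]
  · rw [map_sub]
    simp [framedRep]

/-- The `G`-module of cellular `p`-chains. -/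
def chainsRep (K : CellFamily ρ) (p : ℕ) : Representation ℤ G (Chains K p) :=
  (framedRep K p).quotient (orientationRelations K p) (orientationRelations_le K p)

lemma chainsRep_chain {K : CellFamily ρ} {p : ℕ} (g : G) (f : FramedCell K p) :
    chainsRep K p g f.chain = (f.translate g).chain := by
  simp [chainsRep, Representation.quotient, FramedCell.chain, framedRep]

lemma FramesDiffer.pos_iff {p : ℕ} {v v' w : Fin (p + 1) → V} {c : ℝ} (hc : 0 < c)
    (h : FramesDiffer v v' c) :
    (∃ a : ℝ, 0 < a ∧ FramesDiffer v' w a) ↔ ∃ a : ℝ, 0 < a ∧ FramesDiffer v w a := by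
  unfold FramesDiffer at *
  constructor
  · rintro ⟨a, ha, h'⟩
    exact ⟨a * c, by positivity, by rw [h', h, smul_smul]⟩
  · rintro ⟨a, ha, h'⟩
    refine ⟨a * c⁻¹, by positivity, ?_⟩
    rw [h', h, smul_smul, mul_assoc, inv_mul_cancel₀ hc.ne', mul_one]

/-- Reversing the orientation of a framed cell. -/
def FramedCell.reverse {K : CellFamily ρ} {p : ℕ} (f : FramedCell K p) : FramedCell K p where
  cell := f.cell
  mem := f.mem
  dim := f.dim
  vec := Function.update f.vec 0 (-f.vec 0)
  indep := by
    have h := f.indep.units_smul (Function.update (fun _ => (1 : ℝˣ)) 0 (-1))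
    convert h using 1
    funext i
    by_cases hi : i = 0
    · subst hi; simp
    · simp [hi]
  mem_span := fun i => by
    by_cases hi : i = 0
    · subst hi; simpa using f.mem_span 0
    · simpa [hi] using f.mem_span i

lemma FramedCell.reverse_chain {K : CellFamily ρ} {p : ℕ} (f : FramedCell K p) :
    f.reverse.chain = -f.chain := by
  rw [eq_neg_iff_add_eq_zero]
  unfold FramedCell.chain
  rw [← Submodule.Quotient.mk_add, Submodule.Quotient.mk_eq_zero]
  refine Submodule.subset_span ⟨f, f.reverse, -1, rfl, by norm_num, ?_, ?_⟩
  · simp only [FramesDiffer, FramedCell.reverse, AlternatingMap.map_update_neg,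
      Function.update_eq_self]
    exact (neg_one_smul ℝ _).symm
  · simp

variable [TopologicalSpace V]

/-- The oriented codimension-one faces of a framed cell, with the induced orientation: a face `t`
in the closure of the cell is so oriented that a vector of the cell, followed by a positive frame
of `t`, is a positive frame of the cell. -/
def facets {K : CellFamily ρ} {p : ℕ} (f : FramedCell K (p + 1)) : Set (Chains K p) :=
  {y | ∃ t : FramedCell K p, t.cell ⊆ closure f.cell ∧
    (∃ x ∈ f.cell, ∃ c : ℝ, 0 < c ∧ FramesDiffer f.vec (Fin.cons x t.vec) c) ∧ y = t.chain}

/-- The cellular boundary of a framed cell: the sum of its oriented faces in codimension one. -/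
def boundaryCell {K : CellFamily ρ} {p : ℕ} (f : FramedCell K (p + 1)) : Chains K p :=
  ∑ᶠ y ∈ facets f, y

lemma facets_of_pos {K : CellFamily ρ} {p : ℕ} {f f' : FramedCell K (p + 1)} {c : ℝ} (hc : 0 < c)
    (hcell : f'.cell = f.cell) (h : FramesDiffer f.vec f'.vec c) : facets f' = facets f := by
  ext y
  simp only [facets, Set.mem_ofPred_eq, hcell, h.pos_iff hc]

lemma neg_mem_facets {K : CellFamily ρ} {p : ℕ} {f f' : FramedCell K (p + 1)} {c : ℝ} (hc : c < 0)
    (hcell : f'.cell = f.cell) (h : FramesDiffer f.vec f'.vec c) {y : Chains K p}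
    (hy : y ∈ facets f) : -y ∈ facets f' := by
  obtain ⟨t, ht, ⟨x, hx, a, ha, hd⟩, rfl⟩ := hy
  refine ⟨t.reverse, by rw [hcell]; exact ht, ⟨x, by rw [hcell]; exact hx, a * (-c)⁻¹,
    mul_pos ha (inv_pos.mpr (neg_pos.mpr hc)), ?_⟩, t.reverse_chain.symm⟩
  have e : (Fin.cons x t.reverse.vec : Fin (p + 1 + 1) → V) =
      Function.update (Fin.cons x t.vec) (Fin.succ 0) (-t.vec 0) := by
    rw [← Fin.cons_update]; rfl
  have e2 : exteriorPower.ιMulti ℝ (p + 1 + 1) (Fin.cons x t.reverse.vec : Fin (p + 1 + 1) → V) =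
      -exteriorPower.ιMulti ℝ (p + 1 + 1) (Fin.cons x t.vec : Fin (p + 1 + 1) → V) := by
    rw [e, AlternatingMap.map_update_neg]
    have e3 : Function.update (Fin.cons x t.vec : Fin (p + 1 + 1) → V) (Fin.succ 0) (t.vec 0) =
        Fin.cons x t.vec := by
      rw [← Fin.cons_update, Function.update_eq_self]
    rw [e3]
  unfold FramesDiffer at *
  rw [e2, hd, h, smul_smul]
  have : a * (-c)⁻¹ * c = -a := by
    rw [inv_neg, mul_neg, neg_mul, mul_assoc, inv_mul_cancel₀ hc.ne, mul_one]
  rw [this]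
  exact (neg_smul a _).symm

lemma facets_of_neg {K : CellFamily ρ} {p : ℕ} {f f' : FramedCell K (p + 1)} {c : ℝ} (hc : c < 0)
    (hcell : f'.cell = f.cell) (h : FramesDiffer f.vec f'.vec c) :
    facets f' = Neg.neg '' facets f := by
  have h' : FramesDiffer f'.vec f.vec c⁻¹ := by
    unfold FramesDiffer at *
    rw [h, smul_smul, inv_mul_cancel₀ hc.ne, one_smul]
  ext y
  constructor
  · intro hy
    exact ⟨-y, neg_mem_facets (inv_lt_zero.mpr hc) hcell.symm h' hy, neg_neg y⟩
  · rintro ⟨y, hy, rfl⟩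
    exact neg_mem_facets hc hcell h hy

lemma boundaryCell_relation {K : CellFamily ρ} {p : ℕ} {f f' : FramedCell K (p + 1)} {c : ℝ}
    (hc : c ≠ 0) (hcell : f'.cell = f.cell) (h : FramesDiffer f.vec f'.vec c) :
    boundaryCell f' = (SignType.sign c : ℤ) • boundaryCell f := by
  unfold boundaryCell
  rcases lt_or_gt_of_ne hc with hc | hc
  · rw [facets_of_neg hc hcell h, finsum_mem_image neg_injective.injOn, sign_neg hc]
    simp only [SignType.coe_neg, SignType.coe_one, neg_smul, one_smul]
    simp only [← finsum_neg_distrib]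
  · rw [facets_of_pos hc hcell h, sign_pos hc]
    simp

lemma boundary_aux (K : CellFamily ρ) (p : ℕ) : orientationRelations K (p + 1) ≤
    LinearMap.ker (Finsupp.linearCombination ℤ (boundaryCell : FramedCell K (p + 1) → _)) := by
  refine Submodule.span_le.mpr ?_
  rintro _ ⟨f, f', c, hc, hc0, hd, rfl⟩
  simp [boundaryCell_relation hc0 hc hd]

/-- The cellular boundary map. -/
def boundary (K : CellFamily ρ) (p : ℕ) : Chains K (p + 1) →ₗ[ℤ] Chains K p :=
  (orientationRelations K (p + 1)).liftQ (Finsupp.linearCombination ℤ boundaryCell)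
    (boundary_aux K p)

lemma boundary_chain {K : CellFamily ρ} {p : ℕ} (f : FramedCell K (p + 1)) :
    boundary K p f.chain = boundaryCell f := by
  simp [boundary, FramedCell.chain]

variable [IsTopologicalAddGroup V] [T2Space V] [ContinuousSMul ℝ V] [FiniteDimensional ℝ V]

lemma chainsRep_facets {K : CellFamily ρ} {p : ℕ} (g : G) (f : FramedCell K (p + 1))
    {y : Chains K p} (hy : y ∈ facets f) : chainsRep K p g y ∈ facets (f.translate g) := by
  obtain ⟨t, ht, ⟨x, hx, a, ha, hd⟩, rfl⟩ := hy
  refine ⟨t.translate g, ?_, ⟨ρ g x, ⟨x, hx, rfl⟩, a, ha, ?_⟩, chainsRep_chain g t⟩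
  · exact (Set.image_mono ht).trans
      (image_closure_subset_closure_image (LinearMap.continuous_of_finiteDimensional (ρ g)))
  · have e : (Fin.cons (ρ g x) (t.translate g).vec : Fin (p + 1 + 1) → V) =
        fun i => ρ g ((Fin.cons x t.vec : Fin (p + 1 + 1) → V) i) := by
      funext i
      refine Fin.cases ?_ (fun j => ?_) i <;> simp [FramedCell.translate]
    rw [e]
    exact hd.map (ρ g)

lemma boundary_equivariant (K : CellFamily ρ) (p : ℕ) (g : G) (x : Chains K (p + 1)) :
    boundary K p (chainsRep K (p + 1) g x) = chainsRep K p g (boundary K p x) := by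
  have inv_apply : ∀ (h : G) (y : Chains K p), chainsRep K p h⁻¹ (chainsRep K p h y) = y :=
    fun h y => by simp
  have key : ∀ f : FramedCell K (p + 1), boundaryCell (f.translate g) =
      chainsRep K p g (boundaryCell f) := by
    intro f
    have himg : facets (f.translate g) = chainsRep K p g '' facets f := by
      ext y
      constructor
      · intro hy
        refine ⟨chainsRep K p g⁻¹ y, ?_, by simp⟩
        have h2 := chainsRep_facets g⁻¹ _ hy
        have h3 : (f.translate g).translate g⁻¹ = f := by
          ext <;> simp [FramedCell.translate]
        rwa [h3] at h2
      · rintro ⟨y, hy, rfl⟩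
        exact chainsRep_facets g f hy
    have hinj : Function.Injective (chainsRep K p g) :=
      Function.LeftInverse.injective (inv_apply g)
    let e : Chains K p ≃+ Chains K p :=
      { toFun := chainsRep K p g
        invFun := chainsRep K p g⁻¹
        left_inv := inv_apply g
        right_inv := fun y => by simp
        map_add' := map_add _ }
    unfold boundaryCell
    rw [himg, finsum_mem_image hinj.injOn]
    have h1 := e.map_finsum (fun y => ∑ᶠ (_ : y ∈ facets f), y)
    refine Eq.trans ?_ h1.symm
    refine finsum_congr fun y => ?_
    by_cases hy : y ∈ facets f
    · simp [hy, e]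
    · simp [hy]
  obtain ⟨x, rfl⟩ := Submodule.Quotient.mk_surjective _ x
  induction x using Finsupp.induction_linear with
  | zero => simp
  | add a b ha hb => simp only [Submodule.Quotient.mk_add, map_add, ha, hb]
  | single f n =>
    have : (Submodule.Quotient.mk (Finsupp.single f n) : Chains K (p + 1)) = n • f.chain := by
      rw [FramedCell.chain, ← Submodule.Quotient.mk_smul]; simp
    rw [this]
    simp only [map_zsmul, chainsRep_chain, boundary_chain, key]

/-- The cellular boundary as a morphism of `G`-modules. -/
def boundaryHom (K : CellFamily ρ) (p : ℕ) :
    Rep.of (chainsRep K (p + 1)) ⟶ Rep.of (chainsRep K p) :=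
  Rep.ofHom ⟨boundary K p, fun g => LinearMap.ext fun x => boundary_equivariant K p g x⟩

/-- The first page `E¹_{p,q} = H_q(G; C_p)` of the equivariant spectral sequence; by Shapiro's lemma
it is the sum over the orbits of `p`-cells of the homology of the stabilisers. -/
def E1 (K : CellFamily ρ) (p q : ℕ) : ModuleCat ℤ :=
  groupHomology (Rep.of (chainsRep K p)) q

/-- The differential `d¹_{p+1,q} : E¹_{p+1,q} ⟶ E¹_{p,q}`, induced by the cellular boundary. -/
def d1 (K : CellFamily ρ) (p q : ℕ) : E1 K (p + 1) q →+ E1 K p q :=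
  ((groupHomology.functor ℤ G q).map (boundaryHom K p)).hom.toAddMonoidHom

/-- The cycles of `d¹` in `E¹_{p,q}`. -/
def d1Cycles (K : CellFamily ρ) : (p q : ℕ) → AddSubgroup (E1 K p q)
  | 0, _ => ⊤
  | p + 1, q => (d1 K p q).ker

/-- The second page `E²_{p,q}`: the homology of `(E¹, d¹)`. -/
abbrev E2 (K : CellFamily ρ) (p q : ℕ) : Type :=
  d1Cycles K p q ⧸ (d1 K p q).range.addSubgroupOf (d1Cycles K p q)

end Chains

/-- The `ℓ`-primary part of an abelian group: the elements of `ℓ`-power order. -/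
def primaryPart (ℓ : ℕ) (A : Type) [AddCommGroup A] : AddSubgroup A where
  carrier := {x | ∃ n : ℕ, ℓ ^ n • x = 0}
  zero_mem' := ⟨0, smul_zero _⟩
  add_mem' := by
    rintro x y ⟨a, ha⟩ ⟨b, hb⟩
    refine ⟨a + b, ?_⟩
    rw [smul_add, pow_add, mul_comm, mul_smul, ha, mul_comm, mul_smul, hb]
    simp
  neg_mem' := by
    rintro x ⟨a, ha⟩
    exact ⟨a, by rw [smul_neg, ha, neg_zero]⟩

/-- The homology in the place `(p, q)` of the `ℓ`-primary part of `(E¹, d¹)`, that is, of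
the restrictions of the differentials to the `ℓ`-primary parts of the groups `E¹`. -/
abbrev E2Primary {G V : Type} [Group G] [AddCommGroup V] [Module ℝ V] [TopologicalSpace V]
    [IsTopologicalAddGroup V] [T2Space V] [ContinuousSMul ℝ V] [FiniteDimensional ℝ V]
    {ρ : Representation ℝ G V} (ℓ : ℕ) (K : CellFamily ρ) (p q : ℕ) : Type :=
  ↥(d1Cycles K p q ⊓ primaryPart ℓ (E1 K p q)) ⧸
    ((primaryPart ℓ (E1 K (p + 1) q)).map (d1 K p q)).addSubgroupOf
      (d1Cycles K p q ⊓ primaryPart ℓ (E1 K p q))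

/-! ### Torsion subcomplexes and edge fusions -/

section Fusion

variable {G V : Type} [Group G] [AddCommGroup V] [Module ℝ V] {ρ : Representation ℝ G V}

/-- The cells whose stabiliser contains an element of order `ℓ`. A subcomplex of the orbit space is
always represented by its pre-image, a `G`-stable family of cells. -/
def torsionSubcomplex (ℓ : ℕ) (K : CellFamily ρ) : CellFamily ρ where
  cells := {σ ∈ K.cells | ∃ g : G, orderOf g = ℓ ∧ ρ g '' σ = σ}
  image_mem := by
    rintro h σ ⟨hσ, g, hg, hgσ⟩
    refine ⟨K.image_mem h σ hσ, h * g * h⁻¹, ?_, ?_⟩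
    · rw [← hg]
      exact orderOf_injective (MulAut.conj h).toMonoidHom (MulAut.conj h).injective g
    · rw [Set.image_image]
      conv_rhs => rw [← hgσ, Set.image_image]
      simp

/-- `σ` and `τ` lie in one orbit of cells. -/
def SameOrbit (ρ : Representation ℝ G V) (σ τ : Set V) : Prop := ∃ g : G, ρ g '' σ = τ

def IsVertex (K : CellFamily ρ) (v : Set V) : Prop :=
  v ∈ K.cells ∧ Module.finrank ℝ (Submodule.span ℝ v) = 1

def IsEdge (K : CellFamily ρ) (e : Set V) : Prop :=
  e ∈ K.cells ∧ Module.finrank ℝ (Submodule.span ℝ e) = 2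

variable [TopologicalSpace V]

/-- The edge `e` is adjacent to the vertex `v`. -/
def IsAdjacent (K : CellFamily ρ) (v e : Set V) : Prop :=
  IsVertex K v ∧ IsEdge K e ∧ v ⊆ closure e

/-- In the orbit space, exactly two edges are adjacent to the orbit of `v`, namely the orbits
of `e₁` and `e₂`, which are distinct, and each of them has only one end at the orbit of `v`: each
edge adjacent to `v` is taken to `e₁` or to `e₂` by the stabiliser of `v`. -/
def ExactlyTwoEdges (K : CellFamily ρ) (v e₁ e₂ : Set V) : Prop :=
  IsAdjacent K v e₁ ∧ IsAdjacent K v e₂ ∧ ¬ SameOrbit ρ e₁ e₂ ∧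
    ∀ e, IsAdjacent K v e → ∃ g : G, ρ g '' v = v ∧ (ρ g '' e = e₁ ∨ ρ g '' e = e₂)

/-- `K'` arises from `K` by an edge fusion at the vertex `v`: the orbits of `v`, of `e₁ = (a, v)`
and of `e₂ = (v, b)` are replaced by the orbit of the edge `(a, b) = e₁ ∪ v ∪ e₂`. The
representatives `e₁` and `e₂` of the two adjacent edges are taken on a common axis of rotations of
order `ℓ`, so that also the new edge has `ℓ`-torsion in its stabiliser. -/
def IsEdgeFusionAt (ℓ : ℕ) (v : Set V) (K K' : CellFamily ρ) : Prop :=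
  ∃ e₁ e₂ : Set V, ExactlyTwoEdges K v e₁ e₂ ∧
    (∃ g : G, orderOf g = ℓ ∧ ρ g '' e₁ = e₁ ∧ ρ g '' e₂ = e₂) ∧
    K'.cells = {σ ∈ K.cells | ¬ SameOrbit ρ v σ ∧ ¬ SameOrbit ρ e₁ σ ∧ ¬ SameOrbit ρ e₂ σ} ∪
      {σ | SameOrbit ρ (e₁ ∪ v ∪ e₂) σ}

/-- `K'` is obtained from `K` by finitely many edge fusions. -/
def FusesTo (ℓ : ℕ) : CellFamily ρ → CellFamily ρ → Prop :=
  Relation.ReflTransGen fun K K' => ∃ v, IsEdgeFusionAt ℓ v K K'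

/-- `R` is obtained from `T` by edge fusions, iterated until there is no vertex left with exactly
two adjacent edges. -/
def IsReduced (ℓ : ℕ) (T R : CellFamily ρ) : Prop :=
  FusesTo ℓ T R ∧ ¬ ∃ v e₁ e₂, ExactlyTwoEdges R v e₁ e₂

end Fusion

/-! ### The Bianchi groups and their action on hyperbolic three-space -/

/-- The ring of integers of the field `ℚ(√-m)`, as a subring of `ℂ`. -/
def imagQuadRing (m : ℕ) : Subring ℂ :=
  (integralClosure ℤ ℂ).toSubring ⊓
    (IntermediateField.adjoin ℚ {(Real.sqrt m : ℂ) * Complex.I}).toSubfield.toSubring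

/-- The Bianchi group `PSL₂` over the ring of integers of `ℚ(√-m)`. -/
abbrev BianchiGroup (m : ℕ) : Type :=
  Matrix.ProjectiveSpecialLinearGroup (Fin 2) (imagQuadRing m)

/-- A matrix over the ring of integers as a complex matrix. -/
def toComplex {m : ℕ} (g : Matrix.SpecialLinearGroup (Fin 2) (imagQuadRing m)) :
    Matrix (Fin 2) (Fin 2) ℂ :=
  g.1.map (imagQuadRing m).subtype

lemma toComplex_mul {m : ℕ} (g h : Matrix.SpecialLinearGroup (Fin 2) (imagQuadRing m)) :
    toComplex (g * h) = toComplex g * toComplex h := by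
  unfold toComplex
  rw [Matrix.SpecialLinearGroup.coe_mul, Matrix.map_mul]

/-- The action `g · A = g A gᴴ` on complex `2 × 2` matrices. -/
def slRep (m : ℕ) : Representation ℝ (Matrix.SpecialLinearGroup (Fin 2) (imagQuadRing m))
    (Matrix (Fin 2) (Fin 2) ℂ) where
  toFun g :=
    { toFun := fun A => toComplex g * A * (toComplex g)ᴴ
      map_add' := fun A B => by rw [mul_add, add_mul]
      map_smul' := fun c A => by simp }
  map_one' := by
    ext1 A
    simp [toComplex]
  map_mul' g h := by
    ext1 A
    simp [toComplex_mul, Matrix.conjTranspose_mul, mul_assoc]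

lemma slRep_center (m : ℕ) :
    Subgroup.center (Matrix.SpecialLinearGroup (Fin 2) (imagQuadRing m)) ≤ (slRep m).ker := by
  intro g hg
  obtain ⟨r, hr, hrg⟩ := Matrix.SpecialLinearGroup.mem_center_iff.mp hg
  have h2 : (r : ℂ) ^ 2 = 1 := by
    have := congrArg (imagQuadRing m).subtype hr
    simpa using this
  have hg' : toComplex g = (r : ℂ) • (1 : Matrix (Fin 2) (Fin 2) ℂ) := by
    unfold toComplex
    rw [← hrg]
    ext i j
    by_cases h : i = j <;> simp [h]
  rw [MonoidHom.mem_ker]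
  ext1 A
  have : slRep m g A = toComplex g * A * (toComplex g)ᴴ := rfl
  rw [this, hg']
  rcases (eq_or_eq_neg_of_sq_eq_sq (r : ℂ) 1 (by rw [h2, one_pow])) with h | h <;> simp [h]

/-- The action of the Bianchi group. Hyperbolic three-space is the space of positive definite
Hermitian matrices up to positive scalars. The point `(z, ζ)` of the upper half-space
corresponds to the ray of `!![|z|² + ζ², z; conj z, 1]`, and the cusp `z` to that of
`!![|z|², z; conj z, 1]`; then `g · A = g A gᴴ` is the action by Poincaré's formula. Geodesically
convex subsets of hyperbolic space are convex cones of positive definite matrices. -/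
def hermRep (m : ℕ) : Representation ℝ (BianchiGroup m) (Matrix (Fin 2) (Fin 2) ℂ) :=
  QuotientGroup.lift _ (slRep m) (slRep_center m)

/-- The cone over hyperbolic three-space. -/
def hyperbolicCone : Set (Matrix (Fin 2) (Fin 2) ℂ) := {A | A.PosDef}

/-- The open polyhedral cone with generators `s`: the relative interior of the convex cone spanned
by `s`. -/
def openCone (s : Finset (Matrix (Fin 2) (Fin 2) ℂ)) : Set (Matrix (Fin 2) (Fin 2) ℂ) :=
  {A | ∃ t : Matrix (Fin 2) (Fin 2) ℂ → ℝ, (∀ w ∈ s, 0 < t w) ∧ A = ∑ w ∈ s, t w • w}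

/-- For `A` the matrix of the point `(z, ζ)` and `u = (c, d)`, this is `|cz + d|² + |c|² ζ²`. -/
def formValue {m : ℕ} (A : Matrix (Fin 2) (Fin 2) ℂ) (u : Fin 2 → imagQuadRing m) : ℝ :=
  ((fun i => (u i : ℂ)) ᵥ* A ⬝ᵥ fun i => star (u i : ℂ)).re

/-- `u` is a unimodular row which attains the minimum of the form `A` on unimodular rows. For
`u = (0, 1)`, these are the points `(z, ζ)` with `|cz + d|² + |c|² ζ² ≥ 1` for all unimodular
`(c, d)`, that is, the translates of the Bianchi fundamental polyhedron under the stabiliser of the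
cusp `∞`. -/
def IsMinimal {m : ℕ} (A : Matrix (Fin 2) (Fin 2) ℂ) (u : Fin 2 → imagQuadRing m) : Prop :=
  IsCoprime (u 0) (u 1) ∧
    ∀ w : Fin 2 → imagQuadRing m, IsCoprime (w 0) (w 1) → formValue A u ≤ formValue A w

/-- The union of the translates of the bottom facets of the Bianchi fundamental polyhedron, those
which do not touch the cusp `∞`: the points of hyperbolic space at which two unimodular
rows, not proportional by a unit, are minimal. -/
def bottom (m : ℕ) : Set (Matrix (Fin 2) (Fin 2) ℂ) :=
  {A | A.PosDef ∧ ∃ u w : Fin 2 → imagQuadRing m, IsMinimal A u ∧ IsMinimal A w ∧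
    ¬ ∃ ε : (imagQuadRing m)ˣ, w = fun i => (ε : imagQuadRing m) * u i}

/-- The singular cusps, as rays: the cusps `λ/μ` for which the ideal `(λ, μ)` is not principal. -/
def singularCusps (m : ℕ) : Set (Set (Matrix (Fin 2) (Fin 2) ℂ)) :=
  {σ | ∃ w : Fin 2 → imagQuadRing m, ¬ (Ideal.span {w 0, w 1}).IsPrincipal ∧
    σ = {A | ∃ t : ℝ, 0 < t ∧
      A = t • Matrix.vecMulVec (fun i => (w i : ℂ)) (fun i => star (w i : ℂ))}}

/-- The refined cell complexes: the locally finite cell structures on hyperbolic three-space by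
geodesic polyhedral cells, possibly with ideal vertices, which are invariant under the Bianchi
group, in which each cell is fixed pointwise by its stabiliser, and in which the bottom facets of
the Bianchi fundamental polyhedron and their translates form a subcomplex. -/
structure IsRefinedComplex {m : ℕ} (Z : CellFamily (hermRep m)) : Prop where
  polyhedral : ∀ σ ∈ Z.cells, ∃ s : Finset (Matrix (Fin 2) (Fin 2) ℂ),
    (∀ w ∈ s, w.PosSemidef) ∧ σ = openCone s
  subset : ∀ σ ∈ Z.cells, σ ⊆ hyperbolicCone
  cover : ∀ A ∈ hyperbolicCone, ∃ σ ∈ Z.cells, A ∈ σ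
  disjoint : ∀ σ ∈ Z.cells, ∀ τ ∈ Z.cells, σ ≠ τ → Disjoint σ τ
  frontier : ∀ σ ∈ Z.cells, ∀ τ ∈ Z.cells, (τ ∩ closure σ).Nonempty → τ ⊆ closure σ
  finite_faces : ∀ σ ∈ Z.cells, {τ ∈ Z.cells | τ ⊆ closure σ}.Finite
  locally_finite : ∀ A ∈ hyperbolicCone, ∃ U ∈ 𝓝 A, {σ ∈ Z.cells | (σ ∩ U).Nonempty}.Finite
  fixed_pointwise : ∀ (g : BianchiGroup m), ∀ σ ∈ Z.cells, hermRep m g '' σ = σ →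
    ∀ A ∈ σ, hermRep m g A = A
  bottom_subcomplex : ∀ σ ∈ Z.cells, σ ⊆ bottom m ∨ Disjoint σ (bottom m)

lemma hermRep_mk {m : ℕ} (g : Matrix.SpecialLinearGroup (Fin 2) (imagQuadRing m))
    (A : Matrix (Fin 2) (Fin 2) ℂ) :
    hermRep m (QuotientGroup.mk g) A = toComplex g * A * (toComplex g)ᴴ := rfl

lemma formValue_smul {m : ℕ} (g : Matrix.SpecialLinearGroup (Fin 2) (imagQuadRing m))
    (A : Matrix (Fin 2) (Fin 2) ℂ) (u : Fin 2 → imagQuadRing m) :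
    formValue (toComplex g * A * (toComplex g)ᴴ) u = formValue A (u ᵥ* g.1) := by
  unfold formValue toComplex
  congr 1
  simp [Matrix.vecMul, dotProduct, Matrix.mul_apply, Fin.sum_univ_two]
  ring

lemma isMinimal_smul {m : ℕ} (g : Matrix.SpecialLinearGroup (Fin 2) (imagQuadRing m))
    (A : Matrix (Fin 2) (Fin 2) ℂ) (u : Fin 2 → imagQuadRing m) (h : IsMinimal A u) :
    IsMinimal (toComplex g * A * (toComplex g)ᴴ) (u ᵥ* (g⁻¹).1) := by
  have hmul : u ᵥ* (g⁻¹).1 ᵥ* g.1 = u := by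
    rw [Matrix.vecMul_vecMul, ← Matrix.SpecialLinearGroup.coe_mul]
    simp
  refine ⟨h.1.vecMulSL g⁻¹, fun w hw => ?_⟩
  rw [formValue_smul, formValue_smul, hmul]
  exact h.2 _ (hw.vecMulSL g)

lemma bottom_smul {m : ℕ} (g : BianchiGroup m) {A : Matrix (Fin 2) (Fin 2) ℂ}
    (hA : A ∈ bottom m) : hermRep m g A ∈ bottom m := by
  obtain ⟨g, rfl⟩ := QuotientGroup.mk_surjective g
  obtain ⟨hpos, u, w, hu, hw, huw⟩ := hA
  rw [hermRep_mk]
  refine ⟨?_, _, _, isMinimal_smul g A u hu, isMinimal_smul g A w hw, ?_⟩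
  · have hdet : IsUnit (toComplex g) := by
      rw [Matrix.isUnit_iff_isUnit_det]
      have : (toComplex g).det = 1 := by
        have h := congrArg (imagQuadRing m).subtype g.2
        rw [RingHom.map_det] at h
        simpa [toComplex] using h
      simp [this]
    exact (Matrix.IsUnit.posDef_star_right_conjugate_iff hdet).mpr hpos
  · rintro ⟨ε, hε⟩
    refine huw ⟨ε, ?_⟩
    have h := congrArg (fun x => x ᵥ* g.1) hε
    have hmul : ∀ x : Fin 2 → imagQuadRing m, x ᵥ* (g⁻¹).1 ᵥ* g.1 = x := fun x => by
      rw [Matrix.vecMul_vecMul, ← Matrix.SpecialLinearGroup.coe_mul]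
      simp
    have h2 : (fun i => (ε : imagQuadRing m) * (u ᵥ* (g⁻¹).1) i) =
        (ε : imagQuadRing m) • (u ᵥ* (g⁻¹).1) := rfl
    simp only [hmul, h2, Matrix.smul_vecMul] at h
    exact h

lemma span_mulVec_le {R : Type} [CommRing R] (g : Matrix.SpecialLinearGroup (Fin 2) R)
    (w : Fin 2 → R) :
    Ideal.span {(g.1 *ᵥ w) 0, (g.1 *ᵥ w) 1} ≤ Ideal.span {w 0, w 1} := by
  rw [Ideal.span_le]
  have h0 : w 0 ∈ Ideal.span {w 0, w 1} := Ideal.subset_span (by simp)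
  have h1 : w 1 ∈ Ideal.span {w 0, w 1} := Ideal.subset_span (by simp)
  rintro x (rfl | rfl) <;>
  · simp only [Matrix.mulVec, dotProduct, Fin.sum_univ_two, SetLike.mem_coe]
    exact add_mem (Ideal.mul_mem_left _ _ h0) (Ideal.mul_mem_left _ _ h1)

lemma span_mulVec {R : Type} [CommRing R] (g : Matrix.SpecialLinearGroup (Fin 2) R)
    (w : Fin 2 → R) :
    Ideal.span {(g.1 *ᵥ w) 0, (g.1 *ᵥ w) 1} = Ideal.span {w 0, w 1} := by
  refine le_antisymm (span_mulVec_le g w) ?_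
  have h := span_mulVec_le g⁻¹ (g.1 *ᵥ w)
  rwa [Matrix.mulVec_mulVec, ← Matrix.SpecialLinearGroup.coe_mul, inv_mul_cancel,
    Matrix.SpecialLinearGroup.coe_one, Matrix.one_mulVec] at h

lemma singularCusps_smul {m : ℕ} (g : BianchiGroup m) {σ : Set (Matrix (Fin 2) (Fin 2) ℂ)}
    (hσ : σ ∈ singularCusps m) : hermRep m g '' σ ∈ singularCusps m := by
  obtain ⟨g, rfl⟩ := QuotientGroup.mk_surjective g
  obtain ⟨w, hw, rfl⟩ := hσ
  refine ⟨g.1 *ᵥ w, by rwa [span_mulVec], ?_⟩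
  have key : ∀ t : ℝ, hermRep m (QuotientGroup.mk g)
      (t • Matrix.vecMulVec (fun i => (w i : ℂ)) (fun i => star (w i : ℂ))) =
      t • Matrix.vecMulVec (fun i => ((g.1 *ᵥ w) i : ℂ)) (fun i => star ((g.1 *ᵥ w) i : ℂ)) := by
    intro t
    rw [map_smul, hermRep_mk]
    congr 1
    ext i j
    simp [toComplex, Matrix.mul_apply, Matrix.vecMulVec, Matrix.mulVec, dotProduct,
      Fin.sum_univ_two]
    ring
  ext A
  constructor
  · rintro ⟨_, ⟨t, ht, rfl⟩, rfl⟩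
    exact ⟨t, ht, key t⟩
  · rintro ⟨t, ht, rfl⟩
    exact ⟨_, ⟨t, ht, rfl⟩, key t⟩

/-- The Flöge cellular complex: the cells of the refined cell complex in the translates
of the bottom facets, onto which hyperbolic space is retracted, and the singular cusps. -/
def floegeComplex {m : ℕ} (Z : CellFamily (hermRep m)) : CellFamily (hermRep m) where
  cells := {σ ∈ Z.cells | σ ⊆ bottom m} ∪ singularCusps m
  image_mem := by
    rintro g σ (⟨hσ, hb⟩ | hσ)
    · refine Or.inl ⟨Z.image_mem g σ hσ, ?_⟩
      rintro _ ⟨A, hA, rfl⟩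
      exact bottom_smul g (hb hA)
    · exact Or.inr (singularCusps_smul g hσ)

end TorsionReduction

end

noncomputable section

namespace TorsionReduction

open CategoryTheory

/-! ### Additivity of group homology; permutation modules and the acyclicity of the free ones -/

section Homology

variable {G : Type} [Group G]

/-! Cell stabilisers preserve orientations, so the chain modules are permutation modules, and the
first page is the homology of the stabilisers. All comparisons are made on `ℓ`-primary parts in
degrees `q ≥ 1`.

Geometry. If an element of order `ℓ` fixes a point of hyperbolic space, the trace of a lift is a
rational integer of absolute value less than two (`trace_cases`). Hence `ℓ` is 2 or 3, and the fixed
Hermitian matrices form a real plane, the axis (`exists_axis`). Since stabilisers fix their cells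
pointwise, the torsion cells are points and segments on such axes. `IsTorsionGraph` records what is
needed of such a family, above all that from a vertex an edge leaves along each axis through it, in
either direction. This is inherited by an edge fusion (`FusionFrame.fuse_isTorsionGraph`), so that
induction over the fusions is possible.

One fusion. Let the edges `e₁` and `e₂` meet at `v` on a common axis. The chains before the fusion
are those after it, together with the orbit of `e₁` in degree one and the orbit of `v` in degree
zero. It remains to see that the map from the homology of the stabiliser of `e₁` to that of `v` is
bijective on `ℓ`-primary parts. On the axis of `e₁`, the edge opposite to it at `v` is `e₂`, which
lies in another orbit. So different edges at `v` in the orbit of `e₁` lie on different axes, and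
only the identity fixes two of them. Hence the composite of the inclusion with the sum over the
fibre is the identity up to a map through a free module (`homologyMap_sum_fibre`), whereas the
composite in the other order is multiplication by the index, which is congruent to 1 modulo `ℓ`
(`fibre_coprime`).

Existence of fusions. At a vertex with exactly two edges, either the edge opposite to one of them
lies in the orbit of the other, and a fusion is possible, or both axes are reversed by the
stabiliser of the vertex. In the second case the rotations about the two axes generate conjugate
subgroups of the stabiliser: for `ℓ = 3` by the trace identity for products (`conj_of_order_three`),
for `ℓ = 2` by an argument with Klein four-groups (`isConj_of_involutions`). A conjugation of the
axes, combined with a reversal, puts the two edges into one orbit, a contradiction.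

The Flöge complex. A rotation which fixes a point takes a minimal row of the corresponding form to a
minimal row. Were the two proportional by a unit, the rotation would have an eigenvalue in the
field, which occurs only in the two excluded cases; so the torsion cells lie in the bottom
(`mem_bottom_of_fixed`). Of the remaining cells, those in hyperbolic space have stabilisers of order
prime to `ℓ`, and the singular cusps have stabilisers which are free abelian of rank two, with
torsion-free homology. Neither contributes an `ℓ`-primary part. Finally the cusps occur only for `p
= 0`, so that the groups of the first page with positive `p` and `q` have finite exponent, and
taking `ℓ`-primary parts commutes with taking the second page. -/

instance : (groupHomology.chainsFunctor ℤ G).Additive where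
  map_add {A B f g} := by
    ext n : 1
    refine ModuleCat.hom_ext (LinearMap.ext fun (x : (Fin n → G) →₀ A.V) => ?_)
    have h := fun (f : A ⟶ B) a b => groupHomology.chainsMap_f_single (MonoidHom.id G) f n a b
    let F := fun f : A ⟶ B => (((groupHomology.chainsFunctor ℤ G).map f).f n).hom.toAddMonoidHom
    suffices hF : F (f + g) = F f + F g from DFunLike.congr_fun hF x
    refine Finsupp.addHom_ext fun a b => ?_
    refine (h (f + g) a b).trans (Eq.trans ?_ (congrArg₂ (· + ·) (h f a b).symm (h g a b).symm))
    exact Finsupp.single_add _ _ _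

/-- The map induced by a morphism of `G`-modules in group homology. -/
def homologyMap (q : ℕ) {A B : Rep.{0} ℤ G} (f : A ⟶ B) : groupHomology A q →+ groupHomology B q :=
  ((groupHomology.functor ℤ G q).map f).hom.toAddMonoidHom

instance (q : ℕ) : (groupHomology.functor ℤ G q).Additive where
  map_add {A B f g} := by
    have h := (groupHomology.chainsFunctor ℤ G ⋙
      HomologicalComplex.homologyFunctor (ModuleCat ℤ) (ComplexShape.down ℕ) q).map_add (f := f) (g := g)
    exact h

@[simp]
lemma homologyMap_id (q : ℕ) (A : Rep.{0} ℤ G) (x : groupHomology A q) :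
    homologyMap q (𝟙 A) x = x := by
  simp only [homologyMap, CategoryTheory.Functor.map_id]
  rfl

lemma homologyMap_comp (q : ℕ) {A B C : Rep.{0} ℤ G} (f : A ⟶ B) (g : B ⟶ C)
    (x : groupHomology A q) :
    homologyMap q (f ≫ g) x = homologyMap q g (homologyMap q f x) := by
  simp only [homologyMap, CategoryTheory.Functor.map_comp]
  rfl

lemma homologyMap_add (q : ℕ) {A B : Rep.{0} ℤ G} (f g : A ⟶ B) (x : groupHomology A q) :
    homologyMap q (f + g) x = homologyMap q f x + homologyMap q g x := by
  simp only [homologyMap, Functor.map_add]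
  rfl

lemma homologyMap_neg (q : ℕ) {A B : Rep.{0} ℤ G} (f : A ⟶ B) (x : groupHomology A q) :
    homologyMap q (-f) x = -homologyMap q f x := by
  simp only [homologyMap, Functor.map_neg]
  rfl

lemma homologyMap_sub (q : ℕ) {A B : Rep.{0} ℤ G} (f g : A ⟶ B) (x : groupHomology A q) :
    homologyMap q (f - g) x = homologyMap q f x - homologyMap q g x := by
  simp only [homologyMap, Functor.map_sub]
  rfl

lemma homologyMap_nsmul (q n : ℕ) {A B : Rep.{0} ℤ G} (f : A ⟶ B) (x : groupHomology A q) :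
    homologyMap q (n • f) x = n • homologyMap q f x := by
  simp only [homologyMap, Functor.map_nsmul]
  rfl

lemma homologyMap_zero (q : ℕ) {A B : Rep.{0} ℤ G} (x : groupHomology A q) :
    homologyMap q (0 : A ⟶ B) x = 0 := by
  simp only [homologyMap, Functor.map_zero]
  rfl

/-- The permutation module of a `G`-set. -/
def permRepresentation (G Y : Type) [Group G] [MulAction G Y] : Representation ℤ G (Y →₀ ℤ) where
  toFun g := Finsupp.lmapDomain ℤ ℤ (g • ·)
  map_one' := by ext; simp
  map_mul' g h := by ext; simp [mul_smul]

abbrev permModule (G Y : Type) [Group G] [MulAction G Y] : Rep.{0} ℤ G :=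
  Rep.of (permRepresentation G Y)

lemma permRepresentation_single {Y : Type} [MulAction G Y] (g : G) (y : Y) (n : ℤ) :
    permRepresentation G Y g (Finsupp.single y n) = Finsupp.single (g • y) n := by
  simp [permRepresentation]

lemma permModule_hom_ext {Y : Type} [MulAction G Y] {A : Rep.{0} ℤ G} {f g : permModule G Y ⟶ A}
    (h : ∀ y, f.hom (Finsupp.single y 1) = g.hom (Finsupp.single y 1)) : f = g := by
  refine Rep.hom_ext (DFunLike.ext _ _ fun x => ?_)
  induction x using Finsupp.induction_linear with
  | zero => simp only [map_zero]
  | add a b ha hb => simp only [map_add, ha, hb]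
  | single y n =>
    have : (Finsupp.single y n : Y →₀ ℤ) = n • Finsupp.single y 1 := by simp
    rw [this, map_zsmul, map_zsmul, h]

/-- The free `G`-set on a set `I`. -/
@[ext]
structure FreeSet (G I : Type) : Type where
  elt : G
  idx : I

instance {I : Type} : MulAction G (FreeSet G I) where
  smul g x := ⟨g * x.elt, x.idx⟩
  one_smul _ := FreeSet.ext (one_mul _) rfl
  mul_smul _ _ _ := FreeSet.ext (mul_assoc _ _ _) rfl

@[simp] lemma FreeSet.smul_mk {I : Type} (g h : G) (i : I) :
    g • (⟨h, i⟩ : FreeSet G I) = ⟨g * h, i⟩ := rfl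

/-- The contraction of the inhomogeneous chains with values in a free permutation module. -/
def freeContraction (G I : Type) [Group G] (n : ℕ) :
    ((Fin n → G) →₀ (FreeSet G I →₀ ℤ)) →+ ((Fin (n + 1) → G) →₀ (FreeSet G I →₀ ℤ)) :=
  Finsupp.liftAddHom fun g => Finsupp.liftAddHom fun x => (Finsupp.singleAddHom
    (Fin.cons x.elt⁻¹ g : Fin (n + 1) → G)).comp (Finsupp.singleAddHom ⟨1, x.idx⟩)

lemma freeContraction_single {I : Type} (n : ℕ) (g : Fin n → G) (h : G) (i : I) (c : ℤ) :
    freeContraction G I n (Finsupp.single g (Finsupp.single ⟨h, i⟩ c)) =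
      Finsupp.single (Fin.cons h⁻¹ g : Fin (n + 1) → G) (Finsupp.single ⟨1, i⟩ c) := by
  rw [freeContraction, Finsupp.liftAddHom_apply_single, Finsupp.liftAddHom_apply_single]
  rfl

lemma contractNth_zero_cons {α : Type} (n : ℕ) (op : α → α → α) (a : α) (g : Fin (n + 1) → α) :
    Fin.contractNth 0 op (Fin.cons a g : Fin (n + 1 + 1) → α) =
      Fin.cons (op a (g 0)) (fun i => g i.succ) := by
  funext k
  refine Fin.cases ?_ (fun k => ?_) k
  · rw [Fin.contractNth_apply_of_eq _ _ _ _ (by simp)]; simp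
  · rw [Fin.contractNth_apply_of_gt _ _ _ _ (by simp)]; simp

lemma contractNth_succ_cons {α : Type} (n : ℕ) (op : α → α → α) (a : α) (g : Fin (n + 1) → α)
    (j : Fin (n + 1)) :
    Fin.contractNth j.succ op (Fin.cons a g : Fin (n + 1 + 1) → α) =
      Fin.cons a (Fin.contractNth j op g) := by
  funext k
  refine Fin.cases ?_ (fun k => ?_) k
  · rw [Fin.contractNth_apply_of_lt _ _ _ _ (by simp)]; simp
  · simp only [Fin.contractNth, Fin.cons_succ, Fin.val_succ, add_lt_add_iff_right, add_left_inj,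
      ← Fin.succ_castSucc]

/-- The differential of the inhomogeneous chains with values in a permutation module. -/
def permDifferential (G Y : Type) [Group G] [MulAction G Y] (n : ℕ) :
    ((Fin (n + 1) → G) →₀ (Y →₀ ℤ)) →+ ((Fin n → G) →₀ (Y →₀ ℤ)) :=
  (groupHomology.inhomogeneousChains.d (permModule G Y) n).hom.toAddMonoidHom

lemma permDifferential_single {Y : Type} [MulAction G Y] (n : ℕ) (g : Fin (n + 1) → G) (y : Y) (c : ℤ) :
    permDifferential G Y n (Finsupp.single g (Finsupp.single y c)) =
      Finsupp.single (fun i => g i.succ) (Finsupp.single ((g 0)⁻¹ • y) c) +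
      ∑ j : Fin (n + 1), (-1 : ℤ) ^ ((j : ℕ) + 1) •
        Finsupp.single (Fin.contractNth j (· * ·) g) (Finsupp.single y c) := by
  have h := groupHomology.inhomogeneousChains.d_single (A := permModule G Y) n g
    (Finsupp.single y c)
  rw [Rep.of_ρ, permRepresentation_single] at h
  exact h

/-- The prepended entry `h⁻¹` is such that the first term of the differential lets `h` act on the
value `⟨1, i⟩` and restores `⟨h, i⟩`. The face which multiplies the first two entries cancels
against the contraction of the first term of the differential, and the other faces cancel one by
one. -/
lemma freeContraction_homotopy {I : Type} (n : ℕ) (c : (Fin (n + 1) → G) →₀ (FreeSet G I →₀ ℤ)) :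
    permDifferential G (FreeSet G I) (n + 1) (freeContraction G I (n + 1) c) +
      freeContraction G I n (permDifferential G (FreeSet G I) n c) = c := by
  suffices h : (permDifferential G (FreeSet G I) (n + 1)).comp (freeContraction G I (n + 1)) +
      (freeContraction G I n).comp (permDifferential G (FreeSet G I) n) = AddMonoidHom.id _ from
    DFunLike.congr_fun h c
  refine Finsupp.addHom_ext' fun g => Finsupp.addHom_ext fun ⟨h, i⟩ m => ?_
  simp only [AddMonoidHom.comp_apply, AddMonoidHom.add_apply, Finsupp.singleAddHom_apply,
    AddMonoidHom.id_apply, freeContraction_single, permDifferential_single, map_add, map_sum,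
    map_zsmul, FreeSet.smul_mk]
  rw [Fin.sum_univ_succ]
  simp only [contractNth_zero_cons, contractNth_succ_cons, Fin.cons_zero, Fin.cons_succ, inv_inv,
    mul_one, Fin.val_zero, Fin.val_succ, pow_succ _ (_ + 1), mul_neg, neg_smul,
    Finset.sum_neg_distrib, mul_inv_rev, zero_add, pow_one, one_smul]
  abel

lemma isZero_groupHomology_freeSet (I : Type) (n : ℕ) (x : groupHomology (permModule G (FreeSet G I)) (n + 1)) :
    x = 0 := by
  have h : (groupHomology.inhomogeneousChains (permModule G (FreeSet G I))).ExactAt (n + 1) := by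
    rw [HomologicalComplex.exactAt_iff' _ (n + 2) (n + 1) n (by simp) (by simp),
      ShortComplex.moduleCat_exact_iff]
    intro c hc
    refine ⟨freeContraction G I (n + 1) c, ?_⟩
    have h2 := freeContraction_homotopy n c
    have h3 : permDifferential G (FreeSet G I) n c = 0 := by
      refine Eq.trans ?_ hc
      exact (DFunLike.congr_fun (congrArg ModuleCat.Hom.hom
        (groupHomology.inhomogeneousChains.d_def (permModule G (FreeSet G I)) n)) c).symm
    rw [h3, map_zero, add_zero] at h2
    refine Eq.trans ?_ h2
    exact (DFunLike.congr_fun (congrArg ModuleCat.Hom.hom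
        (groupHomology.inhomogeneousChains.d_def (permModule G (FreeSet G I)) (n + 1))) _)
  exact @Subsingleton.elim _ (ModuleCat.subsingleton_of_isZero h.isZero_homology) _ _

end Homology

/-! ### Morphisms of permutation modules and the transfer -/

section Perm
variable {G : Type} [Group G]

/-- The morphism from a permutation module determined by an equivariant function. -/
def permLift {Y : Type} [MulAction G Y] {A : Type} [AddCommGroup A] [Module ℤ A]
    {τ : Representation ℤ G A} (F : Y → A) (hF : ∀ g y, F (g • y) = τ g (F y)) :
    permModule G Y ⟶ Rep.of τ :=
  Rep.ofHom ⟨Finsupp.linearCombination ℤ F, fun g => by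
    ext y
    simp [permRepresentation, hF]⟩

lemma permLift_single {Y : Type} [MulAction G Y] {A : Type} [AddCommGroup A] [Module ℤ A]
    {τ : Representation ℤ G A} (F : Y → A) (hF : ∀ g y, F (g • y) = τ g (F y)) (y : Y) :
    (permLift F hF).hom (Finsupp.single y 1) = F y := by
  have : (permLift F hF).hom (Finsupp.single y 1) =
    Finsupp.linearCombination ℤ F (Finsupp.single y 1) := rfl
  rw [this, Finsupp.linearCombination_single]
  exact @one_smul ℤ A _ Module.toDistribMulAction.toMulAction (F y)

/-- The morphism of permutation modules induced by an equivariant function. -/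
def permMap {X Y : Type} [MulAction G X] [MulAction G Y] (f : X → Y)
    (hf : ∀ (g : G) x, f (g • x) = g • f x) : permModule G X ⟶ permModule G Y :=
  permLift (fun x => Finsupp.single (f x) 1) fun g x => by rw [permRepresentation_single, hf]

lemma permMap_single {X Y : Type} [MulAction G X] [MulAction G Y] (f : X → Y)
    (hf : ∀ (g : G) x, f (g • x) = g • f x) (x : X) :
    (permMap f hf).hom (Finsupp.single x 1) = Finsupp.single (f x) 1 :=
  permLift_single _ _ _

section Transfer

variable {Y : Type} [MulAction G Y]

/-- The group elements which take the chosen point of the orbit of `y` to `y`. -/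
def orbitFibre (G : Type) [Group G] {Y : Type} [MulAction G Y] (y : Y) : Set G :=
  {g | g • (Quotient.mk (MulAction.orbitRel G Y) y).out = y}

lemma orbitFibre_smul (h : G) (y : Y) : orbitFibre G (h • y) = (h * ·) '' orbitFibre G y := by
  have e : (Quotient.mk (MulAction.orbitRel G Y) (h • y)) = Quotient.mk _ y :=
    Quotient.sound ⟨h, rfl⟩
  ext g
  simp only [orbitFibre, Set.mem_ofPred_eq, Set.mem_image, e]
  constructor
  · intro hg
    exact ⟨h⁻¹ * g, by rw [mul_smul, hg, inv_smul_smul], by group⟩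
  · rintro ⟨g, hg, rfl⟩
    rw [mul_smul, hg]

lemma exists_mem_orbitFibre (y : Y) : ∃ g, g ∈ orbitFibre G y := by
  have h := @Quotient.exact _ (MulAction.orbitRel G Y) _ _
    (Quotient.out_eq (Quotient.mk (MulAction.orbitRel G Y) y))
  have h := (MulAction.orbitRel G Y).symm h
  obtain ⟨g, hg⟩ := MulAction.orbitRel_apply.mp h
  exact ⟨g, hg⟩

/-- The fibre is a left coset of the stabiliser of the chosen representative. -/
lemma ncard_orbitFibre (y : Y) : (orbitFibre G y).ncard =
    Nat.card (MulAction.stabilizer G (Quotient.mk (MulAction.orbitRel G Y) y).out) := by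
  obtain ⟨g, hg⟩ := exists_mem_orbitFibre (G := G) y
  have : orbitFibre G y = (g * ·) ''
      (MulAction.stabilizer G (Quotient.mk (MulAction.orbitRel G Y) y).out : Set G) := by
    ext h
    simp only [Set.mem_image, SetLike.mem_coe, MulAction.mem_stabilizer_iff]
    constructor
    · intro hh
      refine ⟨g⁻¹ * h, ?_, by group⟩
      rw [mul_smul, Set.mem_ofPred_eq.mp hh, inv_smul_eq_iff]
      exact hg.symm
    · rintro ⟨s, hs, rfl⟩
      change (g * s) • _ = y
      rw [mul_smul, hs]; exact hg
  rw [this, Set.ncard_image_of_injective _ (mul_right_injective g)]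
  rfl

/-- Transfer: multiplication by `N` factors through the free permutation module on the set of
orbits, which has no homology in positive degrees. A point goes to the sum of all group elements
which take the representative of its orbit to it. -/
lemma nsmul_homology_permModule (N : ℕ)
    (hN : ∀ y : Y, Finite (MulAction.stabilizer G y) ∧ Nat.card (MulAction.stabilizer G y) ∣ N)
    (q : ℕ) (x : groupHomology (permModule G Y) (q + 1)) : N • x = 0 := by
  have hfin : ∀ y : Y, (orbitFibre G y).Finite := fun y => by
    have := (hN (Quotient.mk (MulAction.orbitRel G Y) y).out).1
    refine Set.finite_of_ncard_pos ?_
    rw [ncard_orbitFibre]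
    exact Nat.card_pos
  let Ω := Quotient (MulAction.orbitRel G Y)
  -- The fibre over `y` has as many elements as the stabiliser, and each of them comes back to `y`;
  -- the weight turns their number into `N`.
  let c : Ω → ℕ := fun i => N / Nat.card (MulAction.stabilizer G i.out)
  let pull : permModule G Y ⟶ permModule G (FreeSet G Ω) := permLift
    (fun y => ∑ g ∈ (hfin y).toFinset, Finsupp.single ⟨g, Quotient.mk _ y⟩ 1) fun h y => by
      classical
      have e : (Quotient.mk (MulAction.orbitRel G Y) (h • y)) = Quotient.mk _ y :=
        Quotient.sound ⟨h, rfl⟩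
      have e2 : (hfin (h • y)).toFinset = (hfin y).toFinset.image (h * ·) := by
        ext g; simp [orbitFibre_smul]
      rw [e2, Finset.sum_image (mul_right_injective h).injOn, map_sum]
      simp only [permRepresentation_single, FreeSet.smul_mk, e]
  let push : permModule G (FreeSet G Ω) ⟶ permModule G Y := permLift
    (fun z => c z.idx • Finsupp.single (z.elt • z.idx.out) 1) fun h z => by
      rw [map_nsmul, permRepresentation_single, ← mul_smul]; rfl
  have key : pull ≫ push = N • 𝟙 _ := by
    refine permModule_hom_ext fun y => ?_
    have e1 : pull.hom (Finsupp.single y 1) = _ := permLift_single _ _ y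
    have e2 : ∀ z, push.hom (Finsupp.single z 1) = _ := permLift_single _ _
    have e3 : (pull ≫ push).hom (Finsupp.single y 1) = push.hom (pull.hom (Finsupp.single y 1)) :=
      rfl
    rw [e3, e1, map_sum]
    simp only [e2]
    have e4 : ∀ g ∈ (hfin y).toFinset, c (Quotient.mk _ y) •
        (Finsupp.single (g • (Quotient.mk (MulAction.orbitRel G Y) y).out) 1 : Y →₀ ℤ) =
        c (Quotient.mk _ y) • Finsupp.single y 1 := fun g hg => by
      rw [(Set.Finite.mem_toFinset _).mp hg]
    rw [Finset.sum_congr rfl e4, Finset.sum_const, ← Set.ncard_eq_toFinset_card _ (hfin y), ncard_orbitFibre,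
      smul_smul, Nat.mul_div_cancel' (hN _).2]
    rfl
  have h := homologyMap_nsmul (q + 1) N (𝟙 (permModule G Y)) x
  rw [homologyMap_id, ← key, homologyMap_comp, isZero_groupHomology_freeSet Ω q (homologyMap _ pull x),
    map_zero] at h
  exact h.symm

lemma homology_permModule_eq_zero (hY : ∀ (g : G) (y : Y), g • y = y → g = 1) (q : ℕ)
    (x : groupHomology (permModule G Y) (q + 1)) : x = 0 := by
  refine (one_nsmul x).symm.trans (nsmul_homology_permModule 1 (fun y => ?_) q x)
  have : MulAction.stabilizer G y = ⊥ :=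
    (Subgroup.eq_bot_iff_forall _).mpr fun g hg => hY g y hg
  rw [this]
  exact ⟨inferInstance, by simp⟩

end Transfer
end Perm
-- Long exact sequences and the absence of torsion in homology
lemma rep_exact_of_exact {k G : Type} [CommRing k] [Group G] (X : ShortComplex (Rep.{0} k G))
    (h : ∀ x : X.X₂, X.g.hom x = 0 → ∃ y : X.X₁, X.f.hom y = x) : X.Exact := by
  refine (ShortComplex.exact_map_iff_of_faithful _
    (forget₂ (Rep.{0} k G) (ModuleCat.{0} k))).1 ?_
  rw [ShortComplex.moduleCat_exact_iff]
  exact h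

lemma H0π_eq_zero_iff {k G : Type} [CommRing k] [Group G] (A : Rep.{0} k G) (a : A.V) :
    groupHomology.H0π A a = 0 ↔ a ∈ Representation.Coinvariants.ker A.ρ := by
  have hinj : Function.Injective (groupHomology.H0Iso A).hom :=
    (ModuleCat.mono_iff_injective _).1 inferInstance
  have h : (groupHomology.H0Iso A).hom (groupHomology.H0π A a) =
      Representation.Coinvariants.mk A.ρ a := groupHomology.H0π_comp_H0Iso_hom_apply A a
  rw [← Representation.Coinvariants.mk_eq_zero, ← h]
  exact ⟨fun h0 => by rw [h0, map_zero], fun h0 => hinj (h0.trans (map_zero _).symm)⟩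

section TorsionFree
variable {G : Type} [Group G]

lemma homologyMap_exact₂ {X : ShortComplex (Rep.{0} ℤ G)} (hX : X.ShortExact) (q : ℕ)
    (x : groupHomology X.X₂ q) (hx : homologyMap q X.g x = 0) : ∃ y, homologyMap q X.f y = x :=
  (ShortComplex.moduleCat_exact_iff _).1 (groupHomology.mapShortComplex₂_exact (X := X) hX q) x hx

/-- The connecting homomorphism in the long exact homology sequence. -/
def connecting {X : ShortComplex (Rep.{0} ℤ G)} (hX : X.ShortExact) (q : ℕ) :
    groupHomology X.X₃ (q + 1) →+ groupHomology X.X₁ q :=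
  (groupHomology.δ hX (q + 1) q rfl).hom.toAddMonoidHom

lemma homologyMap_exact₃ {X : ShortComplex (Rep.{0} ℤ G)} (hX : X.ShortExact) (q : ℕ)
    (x : groupHomology X.X₃ (q + 1)) (hx : connecting hX q x = 0) :
    ∃ y, homologyMap (q + 1) X.g y = x :=
  (ShortComplex.moduleCat_exact_iff _).1 (groupHomology.mapShortComplex₃_exact hX rfl) x hx

lemma connecting_naturality {X : ShortComplex (Rep.{0} ℤ G)} (hX : X.ShortExact) (φ : X ⟶ X)
    (q : ℕ) (x : groupHomology X.X₃ (q + 1)) :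
    connecting hX q (homologyMap (q + 1) φ.τ₃ x) =
      homologyMap q φ.τ₁ (connecting hX q x) := by
  have h := HomologicalComplex.HomologySequence.δ_naturality
    ((groupHomology.chainsFunctor ℤ G).mapShortComplex.map φ)
    (groupHomology.map_chainsFunctor_shortExact hX) (groupHomology.map_chainsFunctor_shortExact hX)
    (q + 1) q rfl
  exact (DFunLike.congr_fun (congrArg ModuleCat.Hom.hom h) x).symm

/-- As `X.f` induces zero, the middle homology embeds into that of `X.X₃`, with a quotient which
embeds into the homology of `X.X₁` one degree lower. Neither part has `ℓ`-torsion. -/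
lemma torsionFree_of_shortExact {X : ShortComplex (Rep.{0} ℤ G)} (hX : X.ShortExact) (ℓ q : ℕ)
    (h0 : ∀ x : groupHomology X.X₁ q, ℓ • x = 0 → x = 0)
    (h1 : ∀ x : groupHomology X.X₂ (q + 1), ℓ • x = 0 → x = 0)
    (hf : ∀ x, homologyMap (q + 1) X.f x = 0)
    (x : groupHomology X.X₃ (q + 1)) (hx : ℓ • x = 0) : x = 0 := by
  have e := h0 (connecting hX q x) (by rw [← map_nsmul, hx, map_zero])
  obtain ⟨y, rfl⟩ := homologyMap_exact₃ hX q x e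
  rw [← map_nsmul] at hx
  obtain ⟨z, hz⟩ := homologyMap_exact₂ hX (q + 1) _ hx
  rw [hf] at hz
  rw [h1 y hz.symm, map_zero]

lemma permMap_apply {X Y : Type} [MulAction G X] [MulAction G Y] (f : X → Y)
    (hf : ∀ (g : G) x, f (g • x) = g • f x) (x : X →₀ ℤ) :
    (permMap f hf).hom x = Finsupp.mapDomain f x := by
  induction x using Finsupp.induction_linear with
  | zero => rw [Finsupp.mapDomain_zero]; exact map_zero _
  | add a b ha hb => rw [Finsupp.mapDomain_add, ← ha, ← hb]; exact map_add _ _ _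
  | single y n =>
    have e : (Finsupp.single y n : X →₀ ℤ) = n • Finsupp.single y 1 := by simp
    rw [Finsupp.mapDomain_single, e]
    refine (map_zsmul _ _ _).trans ?_
    rw [permMap_single]; simp

lemma permMap_comp_eq {X Y Z : Type} [MulAction G X] [MulAction G Y] [MulAction G Z] (f : X → Y)
    (hf : ∀ (g : G) x, f (g • x) = g • f x) (f' : Y → Z) (hf' : ∀ (g : G) x, f' (g • x) = g • f' x)
    (k : X → Z) (hk : ∀ (g : G) x, k (g • x) = g • k x) (h : ∀ x, f' (f x) = k x) :
    permMap f hf ≫ permMap f' hf' = permMap k hk := by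
  refine permModule_hom_ext fun x => ?_
  rw [Rep.hom_comp, permMap_single, Representation.IntertwiningMap.comp_apply, permMap_single,
    permMap_single, h]

section Shift

variable {Q Q' : Type} [MulAction G Q] [MulAction G Q'] (β : Equiv.Perm Q)
  (hβ : ∀ (g : G) x, β (g • x) = g • β x) (π : Q → Q') (hπ : ∀ (g : G) x, π (g • x) = g • π x)
  (hπβ : ∀ x, π (β x) = π x)

/-- The sequence `ℤ[Q] ⟶ ℤ[Q] ⟶ ℤ[Q']`, whose first map is `β - 1`. -/
def shiftComplex : ShortComplex (Rep.{0} ℤ G) :=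
  ShortComplex.mk (permMap β hβ - 𝟙 _) (permMap π hπ) <| by
    rw [Preadditive.sub_comp, Category.id_comp, permMap_comp_eq β hβ π hπ π hπ hπβ, sub_self]

lemma shiftComplex_f_apply (x : Q →₀ ℤ) :
    (shiftComplex β hβ π hπ hπβ).f.hom x = Finsupp.mapDomain β x - x :=
  congrArg (· - x) (permMap_apply β hβ x)

variable {β π} in
include hβ hπ hπβ in
-- This is the resolution of length one for an infinite cyclic group, generated by `β` and acting
-- freely with orbit set `Q'`.
lemma shiftComplex_shortExact (hsurj : Function.Surjective π)
    (hfib : ∀ x y, π x = π y → ∃ n : ℤ, (β ^ n) x = y) (hfree : ∀ x, ∀ n : ℤ, (β ^ n) x = x → n = 0) :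
    (shiftComplex β hβ π hπ hπβ).ShortExact := by
  have hmono : Mono (shiftComplex β hβ π hπ hπβ).f := by
    rw [Rep.mono_iff_injective]
    refine (injective_iff_map_eq_zero (shiftComplex β hβ π hπ hπβ).f.hom).mpr
      fun (f : Q →₀ ℤ) hf => ?_
    have hf : Finsupp.mapDomain β f = f :=
      sub_eq_zero.mp ((shiftComplex_f_apply β hβ π hπ hπβ f).symm.trans hf)
    have h1 : ∀ x, f (β x) = f x := fun x => by
      conv_lhs => rw [← hf]
      exact Finsupp.mapDomain_apply β.injective f x
    have h2 : ∀ n : ℤ, ∀ x, f ((β ^ n) x) = f x := by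
      intro n
      induction n using Int.induction_on with
      | zero => simp
      | succ n ih => intro x; rw [zpow_add_one, Equiv.Perm.mul_apply, ih, h1]
      | pred n ih =>
        intro x
        rw [zpow_sub_one, Equiv.Perm.mul_apply, ih, ← h1 (β⁻¹ x), ← Equiv.Perm.mul_apply, mul_inv_cancel, Equiv.Perm.one_apply]
    -- A nonzero value of a `β`-invariant function would be repeated along an infinite orbit,
    -- against the finiteness of the support.
    refine Finsupp.ext fun x => by_contra fun hx => ?_
    refine Set.infinite_of_injective_forall_mem (f := fun n : ℤ => (β ^ n) x) ?_ (fun n => ?_)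
      f.hasFiniteSupport
    · intro a b hab
      have : (β ^ (-b + a)) x = x := by
        rw [zpow_add, Equiv.Perm.mul_apply, show (β ^ a) x = (β ^ b) x from hab, zpow_neg,
          ← Equiv.Perm.mul_apply, inv_mul_cancel, Equiv.Perm.one_apply]
      have := hfree x _ this
      omega
    · rw [Function.mem_support, h2]; exact hx
  have hepi : Epi (shiftComplex β hβ π hπ hπβ).g := by
    rw [Rep.epi_iff_surjective]
    intro (y : Q' →₀ ℤ)
    refine ⟨Finsupp.mapDomain (Function.surjInv hsurj) y, ?_⟩
    refine (permMap_apply π hπ _).trans ?_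
    rw [← Finsupp.mapDomain_comp, (Function.rightInverse_surjInv hsurj).comp_eq_id,
      Finsupp.mapDomain_id]
  refine { exact := rep_exact_of_exact _ fun (x : Q →₀ ℤ) hx => ?_, mono_f := hmono, epi_g := hepi }
  have hx : Finsupp.mapDomain π x = 0 := (permMap_apply π hπ x).symm.trans hx
  let B : (Q →₀ ℤ) →+ (Q →₀ ℤ) := (shiftComplex β hβ π hπ hπβ).f.hom.toLinearMap.toAddMonoidHom
  have hB : ∀ x, B x = Finsupp.mapDomain β x - x := shiftComplex_f_apply β hβ π hπ hπβ
  change ∃ y, B y = x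
  -- Modulo the image of `β - 1`, a generator can be moved along its `β`-orbit, hence to the chosen
  -- point of its fibre; so an element which dies in `ℤ[Q']` is in this image.
  have h1 : ∀ (n : ℤ) (y : Q) (c : ℤ), Finsupp.single ((β ^ n) y) c - Finsupp.single y c ∈ B.range := by
    intro n y c
    induction n using Int.induction_on with
    | zero => simp
    | succ n ih =>
      convert add_mem ih (⟨Finsupp.single ((β ^ (n : ℤ)) y) c, hB _⟩ : _ ∈ B.range) using 1
      rw [Finsupp.mapDomain_single, ← Equiv.Perm.mul_apply, add_comm, zpow_one_add]
      abel
    | pred n ih =>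
      convert sub_mem ih (⟨Finsupp.single ((β ^ (-(n : ℤ) - 1)) y) c, hB _⟩ : _ ∈ B.range) using 1
      rw [Finsupp.mapDomain_single, ← Equiv.Perm.mul_apply, ← zpow_one_add]
      rw [add_sub_cancel]
      abel
  have h2 : ∀ x : Q →₀ ℤ, x - Finsupp.mapDomain (Function.surjInv hsurj) (Finsupp.mapDomain π x) ∈
      B.range := by
    intro x
    induction x using Finsupp.induction_linear with
    | zero => simp
    | add a b ha hb =>
      rw [Finsupp.mapDomain_add, Finsupp.mapDomain_add, add_sub_add_comm]
      exact add_mem ha hb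
    | single y c =>
      rw [Finsupp.mapDomain_single, Finsupp.mapDomain_single]
      obtain ⟨n, hn⟩ := hfib _ y (Function.surjInv_eq hsurj (π y))
      have h := h1 n (Function.surjInv hsurj (π y)) c
      rwa [hn] at h
  have h3 := h2 x
  rwa [hx, Finsupp.mapDomain_zero, sub_zero] at h3

variable {β π} in
include hπ hπβ in
/-- If `β` acts freely on `Q` with quotient `Q'`, and trivially on the homology of `ℤ[Q]`, which has
no `ℓ`-torsion, then the homology of `ℤ[Q']` has no `ℓ`-torsion. -/
lemma torsionFree_of_shift (hsurj : Function.Surjective π)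
    (hfib : ∀ x y, π x = π y → ∃ n : ℤ, (β ^ n) x = y) (hfree : ∀ x, ∀ n : ℤ, (β ^ n) x = x → n = 0)
    (ℓ q : ℕ) (h0 : ∀ x : groupHomology (permModule G Q) q, ℓ • x = 0 → x = 0)
    (h1 : ∀ x : groupHomology (permModule G Q) (q + 1), ℓ • x = 0 → x = 0)
    (hid : ∀ x, homologyMap (q + 1) (permMap β hβ) x = x)
    (x : groupHomology (permModule G Q') (q + 1)) (hx : ℓ • x = 0) : x = 0 := by
  have hX := shiftComplex_shortExact hβ hπ hπβ hsurj hfib hfree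
  refine torsionFree_of_shortExact hX ℓ q h0 h1 (fun z => ?_) x hx
  exact (homologyMap_sub (q + 1) (permMap β hβ) (𝟙 _) z).trans
    (sub_eq_zero.mpr ((hid z).trans (homologyMap_id _ _ _).symm))

end Shift

section DegreeZero

variable {Q : Type} [MulAction G Q]

/-- The projection to degree-zero homology. -/
def toHomologyZero (A : Rep.{0} ℤ G) : A.V →+ groupHomology A 0 :=
  (groupHomology.H0π A).hom.toAddMonoidHom

lemma toHomologyZero_surjective (A : Rep.{0} ℤ G) : Function.Surjective (toHomologyZero A) :=
  fun x => groupHomology.H0_induction_on A x fun a => ⟨a, rfl⟩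

lemma homologyMap_toHomologyZero {A B : Rep.{0} ℤ G} (f : A ⟶ B) (a : A.V) :
    homologyMap 0 f (toHomologyZero A a) = toHomologyZero B (f.hom a) :=
  DFunLike.congr_fun (congrArg ModuleCat.Hom.hom (groupHomology.H0π_comp_map (MonoidHom.id G) f)) a

lemma toHomologyZero_smul (g : G) (a : Q →₀ ℤ) :
    toHomologyZero (permModule G Q) (permRepresentation G Q g a) =
      toHomologyZero (permModule G Q) a := by
  refine sub_eq_zero.mp ((map_sub _ _ _).symm.trans ((H0π_eq_zero_iff (permModule G Q) _).mpr ?_))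
  exact Representation.Coinvariants.sub_mem_ker (ρ := permRepresentation G Q) g a

lemma toHomologyZero_single_of_mem_orbit {x y : Q} (h : ∃ g : G, g • x = y) (n : ℤ) :
    toHomologyZero (permModule G Q) (Finsupp.single y n) =
      toHomologyZero (permModule G Q) (Finsupp.single x n) := by
  obtain ⟨g, rfl⟩ := h
  rw [← permRepresentation_single, toHomologyZero_smul]

lemma homologyMap_zero_permMap_of_mem_orbit (f : Q → Q) (hf : ∀ (g : G) x, f (g • x) = g • f x)
    (h : ∀ x, ∃ g : G, g • x = f x) (x : groupHomology (permModule G Q) 0) :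
    homologyMap 0 (permMap f hf) x = x := by
  obtain ⟨a, rfl⟩ := toHomologyZero_surjective _ x
  rw [homologyMap_toHomologyZero, permMap_apply]
  induction a using Finsupp.induction_linear with
  | zero => rw [Finsupp.mapDomain_zero]
  | add a b ha hb =>
    rw [Finsupp.mapDomain_add]
    exact (map_add _ _ _).trans ((congrArg₂ _ ha hb).trans (map_add _ _ _).symm)
  | single y n => rw [Finsupp.mapDomain_single, toHomologyZero_single_of_mem_orbit (h y)]

/-- The coinvariants of a permutation module are free abelian on the orbits, which is seen by
choosing representatives. -/
lemma torsionFree_homology_zero (ℓ : ℕ) (hℓ : ℓ ≠ 0) (x : groupHomology (permModule G Q) 0)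
    (hx : ℓ • x = 0) : x = 0 := by
  obtain ⟨a, rfl⟩ := toHomologyZero_surjective _ x
  let Ω := Quotient (MulAction.orbitRel G Q)
  let ψ : (Q →₀ ℤ) →ₗ[ℤ] (Ω →₀ ℤ) := Finsupp.lmapDomain ℤ ℤ (Quotient.mk (MulAction.orbitRel G Q))
  have h1 : ∀ a : Q →₀ ℤ, toHomologyZero (permModule G Q) (Finsupp.mapDomain Quotient.out (ψ a)) =
      toHomologyZero (permModule G Q) a := fun a => by
    induction a using Finsupp.induction_linear with
    | zero => rw [map_zero, Finsupp.mapDomain_zero]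
    | add a b ha hb =>
      rw [map_add, Finsupp.mapDomain_add]
      exact (map_add _ _ _).trans ((congrArg₂ _ ha hb).trans (map_add _ _ _).symm)
    | single y n =>
      obtain ⟨g, hg⟩ := exists_mem_orbitFibre (G := G) y
      rw [Finsupp.lmapDomain_apply, Finsupp.mapDomain_single, Finsupp.mapDomain_single]
      exact (toHomologyZero_single_of_mem_orbit ⟨g, hg⟩ n).symm
  have h2 : Representation.Coinvariants.ker (permRepresentation G Q) ≤ LinearMap.ker ψ := by
    refine Submodule.span_le.mpr ?_
    rintro _ ⟨⟨g, x⟩, rfl⟩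
    rw [SetLike.mem_coe, LinearMap.mem_ker, map_sub, sub_eq_zero]
    change Finsupp.mapDomain _ (Finsupp.mapDomain _ x) = Finsupp.mapDomain _ x
    rw [← Finsupp.mapDomain_comp]
    congr 1
    funext y
    exact Quotient.sound ⟨g, rfl⟩
  have h3 : ψ (ℓ • a) = 0 := by
    refine h2 ?_
    exact (H0π_eq_zero_iff (permModule G Q) _).mp ((map_nsmul (toHomologyZero _) _ _).trans hx)
  rw [map_nsmul, smul_eq_zero_iff_right hℓ] at h3
  rw [← h1, h3, Finsupp.mapDomain_zero]
  exact map_zero _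

end DegreeZero

end TorsionFree
-- Homology for stabilisers which are free abelian of rank two
section RankTwo
variable {G : Type} [Group G] {I : Type} (a b : I → G)

/-- Right multiplication by `a` on a free `G`-set. -/
def FreeSet.rightMul : Equiv.Perm (FreeSet G I) where
  toFun x := ⟨x.elt * a x.idx, x.idx⟩
  invFun x := ⟨x.elt * (a x.idx)⁻¹, x.idx⟩
  left_inv x := by simp
  right_inv x := by simp

lemma FreeSet.rightMul_zpow (n : ℤ) (x : FreeSet G I) :
    (FreeSet.rightMul a ^ n) x = ⟨x.elt * a x.idx ^ n, x.idx⟩ := by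
  induction n using Int.induction_on generalizing x with
  | zero => simp
  | succ n ih => rw [zpow_add_one, Equiv.Perm.mul_apply, ih, add_comm, zpow_one_add]; simp [rightMul, mul_assoc]
  | pred n ih =>
    rw [zpow_sub_one, Equiv.Perm.mul_apply, ih, sub_eq_neg_add, zpow_add, zpow_neg_one]
    change (⟨x.elt * (a x.idx)⁻¹ * a x.idx ^ (-(n : ℤ)), x.idx⟩ : FreeSet G I) = _
    rw [mul_assoc]

/-- The union of the `G`-sets `G ⧸ ⟨aᵢ⟩`. -/
abbrev CyclicCosets : Type := Σ i, G ⧸ Subgroup.zpowers (a i)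

/-- Right multiplication by elements commuting with the `aᵢ`. -/
def CyclicCosets.rightMul (hab : ∀ i, a i * b i = b i * a i) : Equiv.Perm (CyclicCosets a) :=
  Equiv.sigmaCongrRight fun i =>
    { toFun := Quotient.map' (· * b i) fun x y h => by
        rw [QuotientGroup.leftRel_apply] at h ⊢
        obtain ⟨n, hn⟩ := h
        have hc : Commute (a i ^ n) (b i) := (show Commute (a i) (b i) from hab i).zpow_left n
        refine ⟨n, ?_⟩
        simp only at hn ⊢
        rw [mul_inv_rev, mul_assoc, ← mul_assoc x⁻¹, ← hn, hc.eq, inv_mul_cancel_left]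
      invFun := Quotient.map' (· * (b i)⁻¹) fun x y h => by
        rw [QuotientGroup.leftRel_apply] at h ⊢
        obtain ⟨n, hn⟩ := h
        have hc : Commute (a i ^ n) (b i)⁻¹ :=
          ((show Commute (a i) (b i) from hab i).inv_right).zpow_left n
        refine ⟨n, ?_⟩
        simp only at hn ⊢
        rw [mul_inv_rev, mul_assoc, ← mul_assoc x⁻¹, ← hn, hc.eq, inv_mul_cancel_left]
      left_inv := fun x => Quotient.inductionOn' x fun x => by
        simp [Quotient.map'_mk'']
      right_inv := fun x => Quotient.inductionOn' x fun x => by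
        simp [Quotient.map'_mk''] }

variable {a b}

lemma CyclicCosets.rightMul_mk (hab : ∀ i, a i * b i = b i * a i) (i : I) (g : G) :
    CyclicCosets.rightMul a b hab ⟨i, (g : G ⧸ Subgroup.zpowers (a i))⟩ =
      ⟨i, ((g * b i : G) : G ⧸ Subgroup.zpowers (a i))⟩ := rfl

lemma CyclicCosets.rightMul_zpow_mk (hab : ∀ i, a i * b i = b i * a i) (n : ℤ) (i : I) (g : G) :
    (CyclicCosets.rightMul a b hab ^ n) ⟨i, (g : G ⧸ Subgroup.zpowers (a i))⟩ =
      ⟨i, ((g * b i ^ n : G) : G ⧸ Subgroup.zpowers (a i))⟩ := by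
  induction n using Int.induction_on generalizing g with
  | zero => simp
  | succ n ih => rw [zpow_add_one, Equiv.Perm.mul_apply, rightMul_mk, ih, add_comm, zpow_one_add, mul_assoc]
  | pred n ih =>
    have h : (CyclicCosets.rightMul a b hab)⁻¹ ⟨i, (g : G ⧸ Subgroup.zpowers (a i))⟩ =
      ⟨i, ((g * (b i)⁻¹ : G) : G ⧸ Subgroup.zpowers (a i))⟩ := by
      rw [Equiv.Perm.inv_eq_iff_eq, rightMul_mk, inv_mul_cancel_right]
    rw [zpow_sub_one, Equiv.Perm.mul_apply, h, ih, sub_eq_neg_add, zpow_add, zpow_neg_one, mul_assoc]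

/-- If the stabilisers are free abelian of rank two, the homology of the permutation module is
torsion-free in positive degrees. -/
lemma torsionFree_homology_of_stabilizer_rank_two {Y : Type} [MulAction G Y]
    (hY : ∀ y : Y, ∃ a b : G, a * b = b * a ∧ (∀ m n : ℤ, a ^ m * b ^ n = 1 → m = 0 ∧ n = 0) ∧
      ∀ g : G, g • y = y ↔ ∃ m n : ℤ, g = a ^ m * b ^ n)
    (ℓ : ℕ) (hℓ : ℓ ≠ 0) (q : ℕ) (x : groupHomology (permModule G Y) (q + 1)) (hx : ℓ • x = 0) :
    x = 0 := by
  let I := Quotient (MulAction.orbitRel G Y)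
  choose a b hab hfree hstab using fun i : I => hY i.out
  have ha : ∀ (i : I), a i • i.out = i.out := fun i => (hstab i _).mpr ⟨1, 0, by simp⟩
  have hb : ∀ (i : I), b i • i.out = i.out := fun i => (hstab i _).mpr ⟨0, 1, by simp⟩
  let α := FreeSet.rightMul a
  let β₀ := FreeSet.rightMul b
  let β := CyclicCosets.rightMul a b hab
  have hα : ∀ (g : G) x, α (g • x) = g • α x := fun g x => FreeSet.ext (mul_assoc _ _ _) rfl
  have hβ₀ : ∀ (g : G) x, β₀ (g • x) = g • β₀ x := fun g x => FreeSet.ext (mul_assoc _ _ _) rfl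
  have hβ : ∀ (g : G) x, β (g • x) = g • β x := by
    rintro g ⟨i, x⟩
    induction x using QuotientGroup.induction_on with | H x => ?_
    change β ⟨i, ((g * x : G) : G ⧸ Subgroup.zpowers (a i))⟩ = _
    rw [CyclicCosets.rightMul_mk, mul_assoc]
    rfl
  -- There are two stages: from `G` to the cosets of `⟨a⟩` by right multiplication with `a`, and
  -- from these to the cosets of `⟨a, b⟩`, that is, to the orbits in `Y`, by right multiplication
  -- with `b`.
  let π₀ : FreeSet G I → CyclicCosets a := fun x => ⟨x.idx, (x.elt : G ⧸ Subgroup.zpowers _)⟩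
  have hπ₀ : ∀ (g : G) x, π₀ (g • x) = g • π₀ x := fun g x => rfl
  have hπ₀α : ∀ x, π₀ (α x) = π₀ x := fun x => by
    refine Sigma.ext rfl (heq_of_eq ?_)
    exact QuotientGroup.eq.mpr ⟨-1, by simp [α, FreeSet.rightMul]⟩
  have hsurj₀ : Function.Surjective π₀ := by
    rintro ⟨i, x⟩
    induction x using QuotientGroup.induction_on with | H x => exact ⟨⟨x, i⟩, rfl⟩
  have hfib₀ : ∀ x y, π₀ x = π₀ y → ∃ n : ℤ, (α ^ n) x = y := by
    rintro ⟨x, i⟩ ⟨y, j⟩ h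
    obtain ⟨rfl, h⟩ := Sigma.mk.inj_iff.mp h
    obtain ⟨n, hn⟩ := QuotientGroup.eq.mp (eq_of_heq h)
    refine ⟨n, ?_⟩
    rw [FreeSet.rightMul_zpow]
    simp only at hn ⊢
    rw [hn, mul_inv_cancel_left]
  have hfree₀ : ∀ x, ∀ n : ℤ, (α ^ n) x = x → n = 0 := by
    intro x n h
    rw [FreeSet.rightMul_zpow] at h
    have h := congrArg FreeSet.elt h
    simp only [mul_eq_left] at h
    exact (hfree x.idx n 0 (by simpa using h)).1
  let π : CyclicCosets a → Y := fun x => Quotient.liftOn' x.2 (fun g => g • x.1.out) fun g h hgh => by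
    rw [QuotientGroup.leftRel_apply] at hgh
    obtain ⟨n, hn⟩ := hgh
    have : (a x.1 ^ n) • x.1.out = x.1.out := (hstab _ _).mpr ⟨n, 0, by simp⟩
    simp only at hn ⊢
    rw [hn, mul_smul, inv_smul_eq_iff] at this
    exact this.symm
  have hπmk : ∀ i (g : G), π ⟨i, (g : G ⧸ Subgroup.zpowers (a i))⟩ = g • i.out := fun i g => rfl
  have hπ : ∀ (g : G) x, π (g • x) = g • π x := by
    rintro g ⟨i, x⟩
    induction x using QuotientGroup.induction_on with | H x => ?_
    rw [hπmk, ← mul_smul]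
    rfl
  have hπβ : ∀ x, π (β x) = π x := by
    rintro ⟨i, x⟩
    induction x using QuotientGroup.induction_on with | H x => ?_
    rw [CyclicCosets.rightMul_mk, hπmk, hπmk, mul_smul, hb]
  have hsurj : Function.Surjective π := by
    intro y
    obtain ⟨g, hg⟩ := exists_mem_orbitFibre (G := G) y
    exact ⟨⟨_, (g : G ⧸ Subgroup.zpowers _)⟩, hg⟩
  have hfib : ∀ x y, π x = π y → ∃ n : ℤ, (β ^ n) x = y := by
    rintro ⟨i, x⟩ ⟨j, y⟩ h
    induction x using QuotientGroup.induction_on with | H x => ?_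
    induction y using QuotientGroup.induction_on with | H y => ?_
    rw [hπmk, hπmk] at h
    have hij : i = j := by
      rw [← Quotient.out_eq i, ← Quotient.out_eq j]
      refine Quotient.sound ⟨x⁻¹ * y, ?_⟩
      change (x⁻¹ * y) • _ = _
      rw [mul_smul, ← h, inv_smul_smul]
    subst hij
    obtain ⟨m, n, hmn⟩ := (hstab i (x⁻¹ * y)).mp (by rw [mul_smul, ← h, inv_smul_smul])
    refine ⟨n, ?_⟩
    rw [CyclicCosets.rightMul_zpow_mk]
    refine Sigma.ext rfl (heq_of_eq (QuotientGroup.eq.mpr ⟨m, ?_⟩))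
    simp only
    have hc : Commute (a i ^ m) (b i ^ n) :=
      ((show Commute (a i) (b i) from hab i).zpow_left m).zpow_right n
    rw [mul_inv_rev, mul_assoc, hmn, hc.eq, inv_mul_cancel_left]
  have hfree' : ∀ x, ∀ n : ℤ, (β ^ n) x = x → n = 0 := by
    rintro ⟨i, x⟩ n h
    induction x using QuotientGroup.induction_on with | H x => ?_
    rw [CyclicCosets.rightMul_zpow_mk] at h
    obtain ⟨m, hm⟩ := QuotientGroup.eq.mp (eq_of_heq (Sigma.mk.inj_iff.mp h).2)
    simp only [mul_inv_rev, inv_mul_cancel_right] at hm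
    exact (hfree i m n (by rw [hm, inv_mul_cancel])).2
  have hzero := fun q => isZero_groupHomology_freeSet (G := G) I q
  have hTF : ∀ q (x : groupHomology (permModule G (CyclicCosets a)) q), ℓ • x = 0 → x = 0 := by
    rintro (_ | q) x hx
    · exact torsionFree_homology_zero ℓ hℓ x hx
    · refine torsionFree_of_shift hα hπ₀ hπ₀α hsurj₀ hfib₀ hfree₀ ℓ q (fun z hz => ?_)
        (fun z _ => hzero q z) (fun z => (hzero q _).trans (hzero q z).symm) x hx
      cases q with
      | zero => exact torsionFree_homology_zero ℓ hℓ z hz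
      | succ q => exact hzero q z
  refine torsionFree_of_shift hβ hπ hπβ hsurj hfib hfree' ℓ q (hTF q) (hTF (q + 1)) (fun z => ?_) x hx
  -- It remains that `β` acts trivially on the homology of the first quotient. The connecting map is
  -- injective, since the free module has no homology in degree `q + 1`, and by naturality it turns
  -- `β` into right multiplication by `b` on the free module one degree lower.
  have hX := shiftComplex_shortExact hα hπ₀ hπ₀α hsurj₀ hfib₀ hfree₀
  have hcomm : permMap α hα ≫ permMap β₀ hβ₀ = permMap β₀ hβ₀ ≫ permMap α hα := by
    rw [permMap_comp_eq α hα β₀ hβ₀ (β₀ ∘ α) (fun g x => by simp [hα, hβ₀]) fun _ => rfl,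
      permMap_comp_eq β₀ hβ₀ α hα (β₀ ∘ α) (fun g x => by simp [hα, hβ₀]) fun x => ?_]
    exact FreeSet.ext (by simp [α, β₀, FreeSet.rightMul, mul_assoc, hab]) rfl
  let φ : shiftComplex α hα π₀ hπ₀ hπ₀α ⟶ shiftComplex α hα π₀ hπ₀ hπ₀α :=
    { τ₁ := permMap β₀ hβ₀
      τ₂ := permMap β₀ hβ₀
      τ₃ := permMap β hβ
      comm₁₂ := by
        change permMap β₀ hβ₀ ≫ (permMap α hα - 𝟙 _) = (permMap α hα - 𝟙 _) ≫ permMap β₀ hβ₀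
        rw [Preadditive.comp_sub, Preadditive.sub_comp, hcomm, Category.comp_id, Category.id_comp]
      comm₂₃ := by
        change permMap β₀ hβ₀ ≫ permMap π₀ hπ₀ = permMap π₀ hπ₀ ≫ permMap β hβ
        rw [permMap_comp_eq β₀ hβ₀ π₀ hπ₀ (π₀ ∘ β₀) (fun g x => by simp [hπ₀, hβ₀]) fun _ => rfl,
          permMap_comp_eq π₀ hπ₀ β hβ (π₀ ∘ β₀) (fun g x => by simp [hπ₀, hβ₀]) fun x => rfl] }
  have hnat := connecting_naturality hX φ q z
  have hid : ∀ w, homologyMap q φ.τ₁ w = w := by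
    intro w
    cases q with
    | zero =>
      -- In degree zero only the orbit matters, and `h * b` is the translate of `h` by `h * b *
      -- h⁻¹`.
      refine homologyMap_zero_permMap_of_mem_orbit β₀ hβ₀ (fun x => ⟨x.elt * b x.idx * x.elt⁻¹, ?_⟩) w
      exact FreeSet.ext (inv_mul_cancel_right _ _) rfl
    | succ q => exact (hzero q _).trans (hzero q w).symm
  rw [hid] at hnat
  let z' : groupHomology (shiftComplex α hα π₀ hπ₀ hπ₀α).X₃ (q + 1) := z
  have h0 : connecting hX q (homologyMap (q + 1) φ.τ₃ z - z') = 0 :=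
    (map_sub _ _ _).trans (sub_eq_zero.mpr hnat)
  obtain ⟨w, hw⟩ := homologyMap_exact₃ hX q _ h0
  have hw0 : w = 0 := hzero q w
  rw [hw0, map_zero] at hw
  exact sub_eq_zero.mp hw.symm

end RankTwo
-- Comparison of second pages and their primary parts
section Pages

lemma map_mem_primaryPart {ℓ : ℕ} {A B : Type} [AddCommGroup A] [AddCommGroup B] (f : A →+ B)
    {x : A} (hx : x ∈ primaryPart ℓ A) : f x ∈ primaryPart ℓ B := by
  obtain ⟨n, hn⟩ := hx
  exact ⟨n, by rw [← map_nsmul, hn, map_zero]⟩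

variable {G V : Type} [Group G] [AddCommGroup V] [Module ℝ V] {ρ : Representation ℝ G V}
  [TopologicalSpace V] [IsTopologicalAddGroup V] [T2Space V] [ContinuousSMul ℝ V]
  [FiniteDimensional ℝ V] (ℓ : ℕ) {K L : CellFamily ρ} {p q : ℕ}

/-- By `h1` and `h2` the map `ψ` induces a homomorphism of the subquotients, surjective by `h3` and
injective by `h4`. Only one place of the page is involved, so `ψ` need not be part of a chain map.
-/
lemma E2Primary_equiv (ψ : E1 K p q →+ E1 L p q)
    (h1 : ∀ x ∈ d1Cycles K p q ⊓ primaryPart ℓ (E1 K p q), ψ x ∈ d1Cycles L p q)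
    (h2 : ∀ y ∈ primaryPart ℓ (E1 K (p + 1) q), ∃ y' ∈ primaryPart ℓ (E1 L (p + 1) q),
      d1 L p q y' = ψ (d1 K p q y))
    (h3 : ∀ z ∈ d1Cycles L p q ⊓ primaryPart ℓ (E1 L p q),
      ∃ x ∈ d1Cycles K p q ⊓ primaryPart ℓ (E1 K p q),
        ∃ y ∈ primaryPart ℓ (E1 L (p + 1) q), z = ψ x + d1 L p q y)
    (h4 : ∀ x ∈ d1Cycles K p q ⊓ primaryPart ℓ (E1 K p q),
      ∀ y ∈ primaryPart ℓ (E1 L (p + 1) q), ψ x = d1 L p q y →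
        ∃ y' ∈ primaryPart ℓ (E1 K (p + 1) q), x = d1 K p q y') :
    Nonempty (E2Primary ℓ K p q ≃+ E2Primary ℓ L p q) := by
  let f : ↥(d1Cycles K p q ⊓ primaryPart ℓ (E1 K p q)) →+
      ↥(d1Cycles L p q ⊓ primaryPart ℓ (E1 L p q)) :=
    (ψ.comp (AddSubgroup.subtype _)).codRestrict _
      fun x => ⟨h1 x x.2, map_mem_primaryPart ψ x.2.2⟩
  have hf : ∀ x, (f x : E1 L p q) = ψ x := fun _ => rfl
  have hle : ((primaryPart ℓ (E1 K (p + 1) q)).map (d1 K p q)).addSubgroupOf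
      (d1Cycles K p q ⊓ primaryPart ℓ (E1 K p q)) ≤
      AddSubgroup.comap f (((primaryPart ℓ (E1 L (p + 1) q)).map (d1 L p q)).addSubgroupOf
      (d1Cycles L p q ⊓ primaryPart ℓ (E1 L p q))) := by
    rintro x hx
    rw [AddSubgroup.mem_addSubgroupOf] at hx
    obtain ⟨y, hy, hxy⟩ := hx
    obtain ⟨y', hy', h⟩ := h2 y hy
    rw [AddSubgroup.mem_comap, AddSubgroup.mem_addSubgroupOf]
    exact ⟨y', hy', by rw [h, hxy, hf]⟩
  refine ⟨AddEquiv.ofBijective (QuotientAddGroup.map _ _ f hle) ⟨?_, ?_⟩⟩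
  · rw [injective_iff_map_eq_zero]
    intro x hx
    induction x using QuotientAddGroup.induction_on with | H x => ?_
    rw [QuotientAddGroup.map_mk, QuotientAddGroup.eq_zero_iff, AddSubgroup.mem_addSubgroupOf] at hx
    obtain ⟨y, hy, hxy⟩ := hx
    obtain ⟨y', hy', h⟩ := h4 x x.2 y hy hxy.symm
    rw [QuotientAddGroup.eq_zero_iff, AddSubgroup.mem_addSubgroupOf]
    exact ⟨y', hy', h.symm⟩
  · intro z
    induction z using QuotientAddGroup.induction_on with | H z => ?_
    obtain ⟨x, hx, y, hy, h⟩ := h3 z z.2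
    refine ⟨QuotientAddGroup.mk ⟨x, hx⟩, ?_⟩
    rw [QuotientAddGroup.map_mk, QuotientAddGroup.eq, AddSubgroup.mem_addSubgroupOf]
    refine ⟨y, hy, ?_⟩
    rw [AddSubgroup.coe_add, AddSubgroup.coe_neg, hf, h]
    simp

/-- A chain map which is bijective on the `ℓ`-primary parts of the first pages induces an
isomorphism of the homology of these parts. -/
lemma E2Primary_equiv_of_bijOn (Φ : ∀ p, E1 K p q →+ E1 L p q)
    (hd : ∀ p x, Φ p (d1 K p q x) = d1 L p q (Φ (p + 1) x))
    (hinj : ∀ p, ∀ x ∈ primaryPart ℓ (E1 K p q), Φ p x = 0 → x = 0)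
    (hsurj : ∀ p, ∀ z ∈ primaryPart ℓ (E1 L p q), ∃ x ∈ primaryPart ℓ (E1 K p q), Φ p x = z) :
    Nonempty (E2Primary ℓ K p q ≃+ E2Primary ℓ L p q) := by
  refine E2Primary_equiv ℓ (Φ p) ?_ ?_ ?_ ?_
  · rintro x ⟨hx, -⟩
    cases p with
    | zero => exact AddSubgroup.mem_top _
    | succ p => exact (hd p x).symm.trans ((congrArg _ hx).trans (map_zero _))
  · exact fun y hy => ⟨Φ (p + 1) y, map_mem_primaryPart _ hy, (hd p y).symm⟩
  · rintro z ⟨hz, hz'⟩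
    obtain ⟨x, hx, rfl⟩ := hsurj p z hz'
    refine ⟨x, ⟨?_, hx⟩, 0, zero_mem _, by rw [map_zero, add_zero]⟩
    cases p with
    | zero => exact AddSubgroup.mem_top _
    | succ p => exact hinj p _ (map_mem_primaryPart _ hx) ((hd p x).trans hz)
  · rintro x ⟨-, hx⟩ y hy hxy
    obtain ⟨y', hy', rfl⟩ := hsurj (p + 1) y hy
    refine ⟨y', hy', ?_⟩
    rw [← hd] at hxy
    have := hinj p (x - d1 K p q y') (sub_mem hx (map_mem_primaryPart _ hy')) (by
      rw [map_sub, hxy, sub_self])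
    exact sub_eq_zero.mp this

/-- The factor `u * N'` acts as the identity on whatever `ℓ ^ M` annihilates, while `N'` makes
everything annihilated by `N` into an `ℓ`-primary element. -/
lemma exists_primary_decomposition (hℓ : ℓ.Prime) (N : ℕ) (hN : N ≠ 0) (M : ℕ) :
    ∃ (N' : ℕ) (a : ℕ) (u v : ℤ), N = ℓ ^ a * N' ∧ u * N' + v * (ℓ ^ M : ℕ) = 1 := by
  obtain ⟨a, N', hc, h⟩ := Nat.exists_eq_pow_mul_and_not_dvd hN ℓ hℓ.ne_one
  have hcop : IsCoprime (N' : ℤ) ((ℓ ^ M : ℕ) : ℤ) := by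
    rw [Nat.isCoprime_iff_coprime]
    exact (((Nat.Prime.coprime_iff_not_dvd hℓ).mpr hc).pow_left M).symm
  obtain ⟨u, v, huv⟩ := hcop
  exact ⟨N', a, u, v, h, huv⟩

/-- If the source of `d` has finite exponent, taking the `ℓ`-primary part commutes with the
quotient by the image of `d`. -/
lemma primaryPart_quotient_equiv {A B : Type} [AddCommGroup A] [AddCommGroup B] (d : A →+ B)
    (Z : AddSubgroup B) (hℓ : ℓ.Prime) (N : ℕ) (hN : N ≠ 0) (h : ∀ x : A, N • x = 0) :
    Nonempty (primaryPart ℓ (Z ⧸ d.range.addSubgroupOf Z) ≃+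
      ↥(Z ⊓ primaryPart ℓ B) ⧸ ((primaryPart ℓ A).map d).addSubgroupOf (Z ⊓ primaryPart ℓ B)) := by
  let f : ↥(Z ⊓ primaryPart ℓ B) →+ Z := AddSubgroup.inclusion inf_le_left
  have hle : ((primaryPart ℓ A).map d).addSubgroupOf (Z ⊓ primaryPart ℓ B) ≤
      AddSubgroup.comap f (d.range.addSubgroupOf Z) := by
    intro x hx
    rw [AddSubgroup.mem_addSubgroupOf] at hx
    obtain ⟨y, -, hxy⟩ := hx
    exact ⟨y, hxy⟩
  let F := QuotientAddGroup.map _ _ f hle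
  let F' : (↥(Z ⊓ primaryPart ℓ B) ⧸ ((primaryPart ℓ A).map d).addSubgroupOf
      (Z ⊓ primaryPart ℓ B)) →+ primaryPart ℓ (Z ⧸ d.range.addSubgroupOf Z) :=
    F.codRestrict _ fun x => by
      refine map_mem_primaryPart F ?_
      induction x using QuotientAddGroup.induction_on with | H x => ?_
      obtain ⟨n, hn⟩ := x.2.2
      exact map_mem_primaryPart (QuotientAddGroup.mk' _) ⟨n, Subtype.ext hn⟩
  refine ⟨(AddEquiv.ofBijective F' ⟨?_, ?_⟩).symm⟩
  · rw [injective_iff_map_eq_zero]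
    intro x hx
    have hx : F x = 0 := congrArg Subtype.val hx
    induction x using QuotientAddGroup.induction_on with | H x => ?_
    rw [QuotientAddGroup.map_mk, QuotientAddGroup.eq_zero_iff, AddSubgroup.mem_addSubgroupOf] at hx
    obtain ⟨y, hxy⟩ := hx
    obtain ⟨M, hM⟩ := x.2.2
    obtain ⟨N', a, u, v, hNN, huv⟩ := exists_primary_decomposition ℓ hℓ N hN M
    rw [QuotientAddGroup.eq_zero_iff, AddSubgroup.mem_addSubgroupOf]
    -- This multiple of `y` is killed by `ℓ ^ a`, since `N` kills `y`, and it still has the image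
    -- `x`, on which `u * N'` acts as the identity.
    refine ⟨u • (N' • y), ⟨a, ?_⟩, ?_⟩
    · rw [smul_comm, ← mul_smul (ℓ ^ a) N', ← hNN, h, smul_zero]
    · have hxy' : d y = (x : B) := hxy
      rw [map_zsmul, map_nsmul, hxy']
      calc u • N' • (x : B) = (u * N') • (x : B) + v • (ℓ ^ M) • (x : B) := by
            rw [hM, smul_zero, add_zero, mul_smul, natCast_zsmul]
        _ = x := by rw [← natCast_zsmul, ← mul_smul, ← add_smul, huv, one_smul]
  · rintro ⟨x, n, hx⟩
    induction x using QuotientAddGroup.induction_on with | H x => ?_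
    have hx' : (QuotientAddGroup.mk (ℓ ^ n • x) : Z ⧸ d.range.addSubgroupOf Z) = 0 := hx
    rw [QuotientAddGroup.eq_zero_iff, AddSubgroup.mem_addSubgroupOf] at hx'
    obtain ⟨y, hy⟩ := hx'
    have hy : d y = ℓ ^ n • (x : B) := hy
    obtain ⟨N', a, u, v, hNN, huv⟩ := exists_primary_decomposition ℓ hℓ N hN n
    -- The class of `x` is also represented by `u • N' • x`, which differs from it by the image of
    -- `v • y`. It is `ℓ`-primary because `ℓ ^ n • x` comes from the source of `d`, which has
    -- exponent `N`.
    have h0 : ℓ ^ (a + n) • (u • N' • (x : B)) = 0 := by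
      have e : ℓ ^ (a + n) • (u • N' • (x : B)) = u • N • (ℓ ^ n • (x : B)) := by
        rw [smul_comm, ← mul_smul, ← mul_smul, hNN]
        congr 2
        ring
      rw [e, ← hy, ← map_nsmul, h, map_zero, smul_zero]
    refine ⟨QuotientAddGroup.mk ⟨u • N' • (x : B), ?_, ⟨_, h0⟩⟩, Subtype.ext ?_⟩
    · exact zsmul_mem (nsmul_mem x.2 _) _
    · change F _ = _
      rw [QuotientAddGroup.map_mk]
      rw [QuotientAddGroup.eq, AddSubgroup.mem_addSubgroupOf]
      refine ⟨v • y, ?_⟩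
      rw [map_zsmul, hy]
      change _ = -(u • N' • (x : B)) + (x : B)
      rw [eq_neg_add_iff_add_eq, ← natCast_zsmul, ← natCast_zsmul, ← mul_smul, ← mul_smul,
        ← add_smul, huv, one_smul]

/-- If the group `E¹_{p+1,q}` has finite exponent, taking the `ℓ`-primary part commutes with taking
the second page. -/
lemma E2Primary_equiv_primaryPart_E2 (hℓ : ℓ.Prime) (N : ℕ) (hN : N ≠ 0)
    (h : ∀ x : E1 K (p + 1) q, N • x = 0) :
    Nonempty (primaryPart ℓ (E2 K p q) ≃+ E2Primary ℓ K p q) :=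
  primaryPart_quotient_equiv ℓ (d1 K p q) (d1Cycles K p q) hℓ N hN h

end Pages

/-! ### Elimination of a direct summand with bijective differential -/

section Split

/-- Elimination of direct summands `B₁`, `B₀` on which the `ℓ`-primary part of the differential is
bijective. -/
lemma primary_split {ℓ : ℕ} {K₁ K₀ L₁ L₀ B₁ B₀ : Type} [AddCommGroup K₁] [AddCommGroup K₀]
    [AddCommGroup L₁] [AddCommGroup L₀] [AddCommGroup B₁] [AddCommGroup B₀]
    (dK : K₁ →+ K₀) (dL : L₁ →+ L₀) (φ₁ : L₁ →+ K₁) (φ₀ : L₀ →+ K₀) (r₁ : K₁ →+ L₁) (r₀ : K₀ →+ L₀)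
    (s : K₁ →+ B₁) (j : B₁ →+ K₁) (π : K₀ →+ B₀) (ι : B₀ →+ K₀)
    (eK : ∀ x, φ₁ (r₁ x) + j (s x) = x) (eK0 : ∀ x, φ₀ (r₀ x) + ι (π x) = x)
    (eL0 : ∀ x, r₀ (φ₀ x) = x) (eπ : ∀ x, π (φ₀ x) = 0)
    (ed : ∀ x, dK (φ₁ x) = φ₀ (dL x))
    (hinj : ∀ x ∈ primaryPart ℓ B₁, π (dK (j x)) = 0 → x = 0)
    (hsurj : ∀ z ∈ primaryPart ℓ B₀, ∃ x ∈ primaryPart ℓ B₁, π (dK (j x)) = z) :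
    (∀ z ∈ primaryPart ℓ K₀, ∃ x ∈ primaryPart ℓ L₀, ∃ y ∈ primaryPart ℓ K₁, z = φ₀ x + dK y) ∧
    (∀ x ∈ primaryPart ℓ L₀, ∀ y ∈ primaryPart ℓ K₁, φ₀ x = dK y →
      ∃ y' ∈ primaryPart ℓ L₁, x = dL y') ∧
    (∀ z ∈ primaryPart ℓ K₁, dK z = 0 → ∃ x ∈ primaryPart ℓ L₁, dL x = 0 ∧ z = φ₁ x) := by
  -- The part of `x` in `L₁` has its boundary in the image of `φ₀`, which `π` kills; so a vanishing
  -- `π (dK x)` is that of the part in `B₁`, which must then be zero.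
  have es : ∀ x ∈ primaryPart ℓ K₁, π (dK x) = 0 → φ₁ (r₁ x) = x := by
    intro x hx hx0
    have hs : s x = 0 := by
      refine hinj _ (map_mem_primaryPart _ hx) ?_
      rw [eq_sub_of_add_eq' (eK x), map_sub, map_sub, hx0, ed, eπ, sub_zero]
    have := eK x
    rwa [hs, map_zero, add_zero] at this
  refine ⟨fun z hz => ?_, fun x hx y hy hxy => ?_, fun z hz hz0 => ?_⟩
  · obtain ⟨b, hb, hbz⟩ := hsurj (π z) (map_mem_primaryPart _ hz)
    have hjb : j b ∈ primaryPart ℓ K₁ := map_mem_primaryPart _ hb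
    have hdb := map_mem_primaryPart dK hjb
    refine ⟨r₀ (z - dK (j b)), map_mem_primaryPart _ (sub_mem hz hdb), j b, hjb, ?_⟩
    have e1 := eK0 (z - dK (j b))
    rw [map_sub π, hbz, sub_self, map_zero, add_zero] at e1
    exact (sub_eq_iff_eq_add.mp e1.symm)
  · have := es y hy (by rw [← hxy, eπ])
    refine ⟨r₁ y, map_mem_primaryPart _ hy, ?_⟩
    rw [← eL0 x, hxy]
    conv_lhs => rw [← this]
    rw [ed, eL0]
  · have := es z hz (by rw [hz0, map_zero])
    refine ⟨r₁ z, map_mem_primaryPart _ hz, ?_, this.symm⟩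
    rw [← eL0 (dL _), ← ed, this, hz0, map_zero]

variable {G V : Type} [Group G] [AddCommGroup V] [Module ℝ V] {ρ : Representation ℝ G V}
  [TopologicalSpace V] [IsTopologicalAddGroup V] [T2Space V] [ContinuousSMul ℝ V]
  [FiniteDimensional ℝ V] (ℓ : ℕ) {K L : CellFamily ρ} {p q : ℕ}

/-- The form in which one fusion is treated: `φ₁` and `φ₀` make up a chain map, but the projections
and the complements need not respect the differentials. Only `j ≫ boundaryHom K 0 ≫ π` has to be
bijective, and both complexes are concentrated in `p = 0, 1`. -/
lemma E2Primary_equiv_of_split {B₁ B₀ : Rep.{0} ℤ G}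
    (φ₁ : Rep.of (chainsRep L 1) ⟶ Rep.of (chainsRep K 1))
    (φ₀ : Rep.of (chainsRep L 0) ⟶ Rep.of (chainsRep K 0))
    (r₁ : Rep.of (chainsRep K 1) ⟶ Rep.of (chainsRep L 1))
    (r₀ : Rep.of (chainsRep K 0) ⟶ Rep.of (chainsRep L 0))
    (s : Rep.of (chainsRep K 1) ⟶ B₁) (j : B₁ ⟶ Rep.of (chainsRep K 1))
    (π : Rep.of (chainsRep K 0) ⟶ B₀) (ι : B₀ ⟶ Rep.of (chainsRep K 0))
    (hcomm : φ₁ ≫ boundaryHom K 0 = boundaryHom L 0 ≫ φ₀)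
    (h1 : r₁ ≫ φ₁ + s ≫ j = 𝟙 _) (h1' : φ₁ ≫ r₁ = 𝟙 _)
    (h0 : r₀ ≫ φ₀ + π ≫ ι = 𝟙 _) (h0' : φ₀ ≫ r₀ = 𝟙 _) (hπ : φ₀ ≫ π = 0)
    (hinj : ∀ x ∈ primaryPart ℓ (groupHomology B₁ q),
      homologyMap q (j ≫ boundaryHom K 0 ≫ π) x = 0 → x = 0)
    (hsurj : ∀ z ∈ primaryPart ℓ (groupHomology B₀ q), ∃ x ∈ primaryPart ℓ (groupHomology B₁ q),
      homologyMap q (j ≫ boundaryHom K 0 ≫ π) x = z)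
    (hK : ∀ p, 2 ≤ p → ∀ x : E1 K p q, x = 0) (hL : ∀ p, 2 ≤ p → ∀ x : E1 L p q, x = 0) :
    Nonempty (E2Primary ℓ L p q ≃+ E2Primary ℓ K p q) := by
  have ej : ∀ x, homologyMap q (j ≫ boundaryHom K 0 ≫ π) x =
      homologyMap q π (homologyMap q (boundaryHom K 0) (homologyMap q j x)) := fun x => by
    rw [homologyMap_comp, homologyMap_comp]
  have ed : ∀ x, homologyMap q (boundaryHom K 0) (homologyMap q φ₁ x) =
      homologyMap q φ₀ (homologyMap q (boundaryHom L 0) x) := fun x => by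
    rw [← homologyMap_comp, ← homologyMap_comp, hcomm]
  have eL : ∀ x, homologyMap q r₁ (homologyMap q φ₁ x) = x := fun x => by
    rw [← homologyMap_comp, h1', homologyMap_id]
  obtain ⟨c1, c2, c3⟩ := primary_split (ℓ := ℓ) (homologyMap q (boundaryHom K 0))
    (homologyMap q (boundaryHom L 0)) (homologyMap q φ₁) (homologyMap q φ₀) (homologyMap q r₁)
    (homologyMap q r₀) (homologyMap q s) (homologyMap q j) (homologyMap q π) (homologyMap q ι)
    (fun x => by
      rw [← homologyMap_comp, ← homologyMap_comp, ← homologyMap_add, h1, homologyMap_id])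
    (fun x => by
      rw [← homologyMap_comp, ← homologyMap_comp, ← homologyMap_add, h0, homologyMap_id])
    (fun x => by rw [← homologyMap_comp, h0', homologyMap_id])
    (fun x => by rw [← homologyMap_comp, hπ, homologyMap_zero]) ed
    (fun x hx h => hinj x hx ((ej x).trans h))
    (fun z hz => by
      obtain ⟨x, hx, h⟩ := hsurj z hz
      exact ⟨x, hx, (ej x).symm.trans h⟩)
  obtain _ | _ | p := p
  · exact E2Primary_equiv ℓ (homologyMap q φ₀) (fun _ _ => AddSubgroup.mem_top _)
      (fun y hy => ⟨homologyMap q φ₁ y, map_mem_primaryPart _ hy, ed y⟩)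
      (fun z hz => by
        obtain ⟨x, hx, h⟩ := c1 z hz.2
        exact ⟨x, ⟨AddSubgroup.mem_top _, hx⟩, h⟩)
      (fun x hx => c2 x hx.2)
  · refine E2Primary_equiv ℓ (homologyMap q φ₁) ?_ ?_ ?_ ?_
    · rintro x ⟨hx, -⟩
      exact (ed x).trans ((congrArg _ hx).trans (map_zero _))
    · intro y _
      refine ⟨0, zero_mem _, ?_⟩
      rw [hL 2 le_rfl y, map_zero, map_zero]
      exact (map_zero (homologyMap q φ₁)).symm
    · rintro z ⟨hz, hz'⟩
      obtain ⟨x, hx, hx0, h⟩ := c3 z hz' hz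
      exact ⟨x, ⟨hx0, hx⟩, 0, zero_mem _, by rw [map_zero, add_zero]; exact h⟩
    · rintro x - y - hxy
      refine ⟨0, zero_mem _, ?_⟩
      rw [hK 2 le_rfl y, map_zero] at hxy
      rw [map_zero]
      exact (eL x).symm.trans ((congrArg (homologyMap q r₁) hxy).trans (map_zero _))
  · refine E2Primary_equiv ℓ 0 (fun _ _ => zero_mem _)
      (fun y _ => ⟨0, zero_mem _, (map_zero _).trans rfl⟩) ?_ ?_
    · intro z _
      exact ⟨0, zero_mem _, 0, zero_mem _,
        (hK (p + 1 + 1) (by omega) z).trans (hK (p + 1 + 1) (by omega) _).symm⟩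
    · intro x _ y _ _
      exact ⟨0, zero_mem _, (hL (p + 1 + 1) (by omega) x).trans (map_zero _).symm⟩

end Split
-- Comparison of orientations in the top exterior power
section Frames

variable {V : Type} [AddCommGroup V] [Module ℝ V]

lemma ιMulti_ne_zero {n : ℕ} {v : Fin n → V} (hv : LinearIndependent ℝ v) :
    exteriorPower.ιMulti ℝ n v ≠ 0 := by
  have h := exteriorPower.ιMulti_family_linearIndependent_field (n := n) hv
  have h1 := h.ne_zero (Set.powersetCard.ofFinEmbEquiv (RelEmbedding.refl _))
  rw [exteriorPower.ιMulti_family, Equiv.symm_apply_apply] at h1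
  exact h1

lemma FramesDiffer.eq_of_indep {p : ℕ} {v v' : Fin (p + 1) → V} {c c' : ℝ}
    (hv : LinearIndependent ℝ v) (h : FramesDiffer v v' c) (h' : FramesDiffer v v' c') : c = c' :=
  smul_left_injective ℝ (ιMulti_ne_zero hv) (h.symm.trans h')

lemma FramesDiffer.refl {p : ℕ} (v : Fin (p + 1) → V) : FramesDiffer v v 1 := (one_smul ℝ _).symm

lemma FramesDiffer.trans {p : ℕ} {v v' v'' : Fin (p + 1) → V} {c c' : ℝ}
    (h : FramesDiffer v v' c) (h' : FramesDiffer v' v'' c') : FramesDiffer v v'' (c' * c) := by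
  unfold FramesDiffer at *
  rw [h', h, smul_smul]

lemma FramesDiffer.symm {p : ℕ} {v v' : Fin (p + 1) → V} {c : ℝ} (hc : c ≠ 0)
    (h : FramesDiffer v v' c) : FramesDiffer v' v c⁻¹ := by
  unfold FramesDiffer at *
  rw [h, smul_smul, inv_mul_cancel₀ hc, one_smul]

/-- Both frames lie in the span of `v`, whose top exterior power is a line, and the wedge product of
independent vectors is not zero. -/
lemma exists_framesDiffer {p : ℕ} {v v' : Fin (p + 1) → V} (hv : LinearIndependent ℝ v)
    (hv' : LinearIndependent ℝ v')
    (h : ∀ i, v' i ∈ Submodule.span ℝ (Set.range v)) : ∃ c : ℝ, c ≠ 0 ∧ FramesDiffer v v' c := by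
  set W := Submodule.span ℝ (Set.range v) with hW
  let b : Fin (p + 1) → W := fun i => ⟨v i, Submodule.subset_span ⟨i, rfl⟩⟩
  let b' : Fin (p + 1) → W := fun i => ⟨v' i, h i⟩
  have hb : LinearIndependent ℝ b := LinearIndependent.of_comp W.subtype hv
  have : Module.Finite ℝ W := FiniteDimensional.span_of_finite ℝ (Set.finite_range v)
  have hfin : Module.finrank ℝ W = p + 1 := by
    rw [hW, finrank_span_eq_card hv, Fintype.card_fin]
  have hone : Module.finrank ℝ (⋀[ℝ]^(p + 1) W) = 1 := by
    rw [exteriorPower.finrank_eq, hfin, Nat.choose_self]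
  obtain ⟨c, hc⟩ := (finrank_eq_one_iff_of_nonzero' _ (ιMulti_ne_zero hb)).mp hone
    (exteriorPower.ιMulti ℝ (p + 1) b')
  have hd : FramesDiffer v v' c := by
    have := congrArg (exteriorPower.map (p + 1) W.subtype) hc.symm
    simpa [FramesDiffer, exteriorPower.map_apply_ιMulti, Function.comp_def, b, b'] using! this
  refine ⟨c, ?_, hd⟩
  rintro rfl
  exact ιMulti_ne_zero hv' (by simpa [FramesDiffer] using hd)

end Frames

/-! ### Morphisms out of the modules of cellular chains -/

section Lift

variable {G V : Type} [Group G] [AddCommGroup V] [Module ℝ V] {ρ : Representation ℝ G V}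
  {K L M : CellFamily ρ} {p : ℕ}

lemma FramedCell.span_range (f : FramedCell K p) :
    Submodule.span ℝ (Set.range f.vec) = Submodule.span ℝ f.cell := by
  have : FiniteDimensional ℝ (Submodule.span ℝ f.cell) :=
    FiniteDimensional.of_finrank_pos (by rw [f.dim]; omega)
  refine Submodule.eq_of_le_of_finrank_eq (Submodule.span_le.mpr ?_) ?_
  · rintro _ ⟨i, rfl⟩
    exact f.mem_span i
  · rw [finrank_span_eq_card f.indep, f.dim, Fintype.card_fin]

lemma FramedCell.exists_framesDiffer (f : FramedCell K p) (f' : FramedCell L p)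
    (h : Submodule.span ℝ f'.cell = Submodule.span ℝ f.cell) :
    ∃ c : ℝ, c ≠ 0 ∧ FramesDiffer f.vec f'.vec c :=
  TorsionReduction.exists_framesDiffer f.indep f'.indep fun i => by
    rw [f.span_range, ← h]
    exact f'.mem_span i

lemma FramedCell.chain_eq_smul (f f' : FramedCell K p) {c : ℝ} (hc : c ≠ 0)
    (h : f'.cell = f.cell) (hd : FramesDiffer f.vec f'.vec c) :
    f'.chain = (SignType.sign c : ℤ) • f.chain := by
  rw [← sub_eq_zero]
  unfold FramedCell.chain
  rw [← Submodule.Quotient.mk_smul, ← Submodule.Quotient.mk_sub, Submodule.Quotient.mk_eq_zero]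
  exact Submodule.subset_span ⟨f, f', c, h, hc, hd, by simp⟩

lemma FramedCell.chain_eq_of_pos (f f' : FramedCell K p) {c : ℝ} (hc : 0 < c)
    (h : f'.cell = f.cell) (hd : FramesDiffer f.vec f'.vec c) : f'.chain = f.chain := by
  rw [f.chain_eq_smul f' hc.ne' h hd, sign_pos hc]
  simp

lemma FramedCell.translate_translate (g h : G) (f : FramedCell K p) :
    (f.translate h).translate g = f.translate (g * h) := by
  ext <;> simp [FramedCell.translate]

/-- The morphism out of the cellular chains given by an equivariant function of the framed cells
which changes its sign with the orientation. -/
def chainLift {A : Type} [AddCommGroup A] [Module ℤ A] {τ : Representation ℤ G A}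
    (F : FramedCell K p → A)
    (hF : ∀ (f f' : FramedCell K p) (c : ℝ), f'.cell = f.cell → c ≠ 0 →
      FramesDiffer f.vec f'.vec c → F f' = (SignType.sign c : ℤ) • F f)
    (hg : ∀ g f, F (f.translate g) = τ g (F f)) : Rep.of (chainsRep K p) ⟶ Rep.of τ :=
  have h : orientationRelations K p ≤ LinearMap.ker (Finsupp.linearCombination ℤ F) := by
    refine Submodule.span_le.mpr ?_
    rintro _ ⟨f, f', c, hc, hc0, hd, rfl⟩
    rw [SetLike.mem_coe, LinearMap.mem_ker, map_sub, Finsupp.linearCombination_single,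
      Finsupp.linearCombination_single, hF f f' c hc hc0 hd, sub_eq_zero]
    refine (@one_smul ℤ A _ Module.toDistribMulAction.toMulAction _).trans ?_
    exact (int_smul_eq_zsmul _ _ _).symm
  Rep.ofHom ⟨(orientationRelations K p).liftQ (Finsupp.linearCombination ℤ F) h, fun g => by
    refine LinearMap.ext fun x => ?_
    obtain ⟨x, rfl⟩ := Submodule.Quotient.mk_surjective _ x
    induction x using Finsupp.induction_linear with
    | zero => simp
    | add a b ha hb => simp only [Submodule.Quotient.mk_add, map_add, ha, hb]
    | single f n =>
      have e : (Submodule.Quotient.mk (Finsupp.single f n) : Chains K p) = n • f.chain := by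
        rw [FramedCell.chain, ← Submodule.Quotient.mk_smul]; simp
      have e2 : ∀ f : FramedCell K p, Submodule.liftQ (orientationRelations K p)
          (Finsupp.linearCombination ℤ F) h f.chain = F f := fun f => by
        refine (Submodule.liftQ_apply _ _ _).trans ?_
        rw [Finsupp.linearCombination_single]
        exact @one_smul ℤ A _ Module.toDistribMulAction.toMulAction _
      change _ = τ g _
      rw [e]
      simp only [LinearMap.comp_apply, map_zsmul]
      erw [chainsRep_chain, e2, e2, hg]⟩

lemma chainLift_chain {A : Type} [AddCommGroup A] [Module ℤ A] {τ : Representation ℤ G A}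
    (F : FramedCell K p → A) (hF) (hg) (f : FramedCell K p) :
    (chainLift (τ := τ) F hF hg).hom f.chain = F f := by
  have : (chainLift (τ := τ) F hF hg).hom f.chain =
    Finsupp.linearCombination ℤ F (Finsupp.single f 1) := rfl
  rw [this, Finsupp.linearCombination_single]
  exact @one_smul ℤ A _ Module.toDistribMulAction.toMulAction (F f)

lemma chains_hom_ext {A : Rep.{0} ℤ G} {a b : Rep.of (chainsRep K p) ⟶ A}
    (h : ∀ f : FramedCell K p, a.hom f.chain = b.hom f.chain) : a = b := by
  refine Rep.hom_ext (DFunLike.ext _ _ fun x => ?_)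
  obtain ⟨x, rfl⟩ := Submodule.Quotient.mk_surjective _ x
  induction x using Finsupp.induction_linear with
  | zero => simp only [Submodule.Quotient.mk_zero, map_zero]
  | add a b ha hb => simp only [Submodule.Quotient.mk_add, map_add, ha, hb]
  | single f n =>
    have : (Submodule.Quotient.mk (Finsupp.single f n) : Chains K p) = n • f.chain := by
      rw [FramedCell.chain, ← Submodule.Quotient.mk_smul]; simp
    rw [this, map_zsmul, map_zsmul, h]

/-- Replace the cell of a framed cell by one with the same linear span. -/
@[simps]
def FramedCell.withCell (f : FramedCell K p) (L : CellFamily ρ) (τ : Set V) (h : τ ∈ L.cells)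
    (hs : Submodule.span ℝ τ = Submodule.span ℝ f.cell) : FramedCell L p where
  cell := τ
  mem := h
  dim := by rw [hs, f.dim]
  vec := f.vec
  indep := f.indep
  mem_span i := by rw [hs]; exact f.mem_span i

open Classical in
/-- The chain of the cell `τ` with the orientation of `f`, or zero if `τ` is not a cell of `L` with
the same linear span as `f`. -/
def FramedCell.move (f : FramedCell K p) (L : CellFamily ρ) (τ : Set V) : Chains L p :=
  if h : τ ∈ L.cells ∧ Submodule.span ℝ τ = Submodule.span ℝ f.cell then
    (f.withCell L τ h.1 h.2).chain else 0

lemma FramedCell.move_of_mem (f : FramedCell K p) {τ : Set V} (h : τ ∈ L.cells)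
    (hs : Submodule.span ℝ τ = Submodule.span ℝ f.cell) :
    f.move L τ = (f.withCell L τ h hs).chain := dif_pos ⟨h, hs⟩

lemma FramedCell.move_of_not (f : FramedCell K p) {τ : Set V}
    (h : ¬ (τ ∈ L.cells ∧ Submodule.span ℝ τ = Submodule.span ℝ f.cell)) :
    f.move L τ = 0 := dif_neg h

lemma FramedCell.move_self (f : FramedCell K p) : f.move K f.cell = f.chain :=
  f.move_of_mem f.mem rfl

lemma FramedCell.move_rel {f f' : FramedCell K p} {c : ℝ} (h : f'.cell = f.cell) (hc : c ≠ 0)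
    (hd : FramesDiffer f.vec f'.vec c) (τ : Set V) :
    f'.move L τ = (SignType.sign c : ℤ) • f.move L τ := by
  by_cases hτ : τ ∈ L.cells ∧ Submodule.span ℝ τ = Submodule.span ℝ f.cell
  · rw [f.move_of_mem hτ.1 hτ.2, f'.move_of_mem hτ.1 (by rw [h, hτ.2])]
    exact FramedCell.chain_eq_smul _ _ hc rfl hd
  · rw [f.move_of_not hτ, f'.move_of_not (by rwa [h]), smul_zero]

lemma image_image_inv (g : G) (σ : Set V) : ρ g⁻¹ '' (ρ g '' σ) = σ := by
  rw [Set.image_image]; simp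

lemma image_inv_image (g : G) (σ : Set V) : ρ g '' (ρ g⁻¹ '' σ) = σ := by
  rw [Set.image_image]; simp

lemma image_mul (g h : G) (σ : Set V) : ρ (g * h) '' σ = ρ g '' (ρ h '' σ) := by
  rw [Set.image_image]; simp

lemma CellFamily.image_mem_iff (K : CellFamily ρ) (g : G) {σ : Set V} :
    ρ g '' σ ∈ K.cells ↔ σ ∈ K.cells :=
  ⟨fun h => by simpa [image_image_inv] using K.image_mem g⁻¹ _ h, K.image_mem g σ⟩

lemma rho_injective (ρ : Representation ℝ G V) (g : G) : Function.Injective (ρ g) := by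
  intro x y h
  simpa using congrArg (ρ g⁻¹) h

lemma span_image_eq_iff (g : G) {σ τ : Set V} :
    Submodule.span ℝ (ρ g '' σ) = Submodule.span ℝ (ρ g '' τ) ↔
      Submodule.span ℝ σ = Submodule.span ℝ τ := by
  rw [Submodule.span_image, Submodule.span_image]
  exact (Submodule.map_injective_of_injective (rho_injective ρ g)).eq_iff

lemma finrank_span_image (g : G) (σ : Set V) :
    Module.finrank ℝ (Submodule.span ℝ (ρ g '' σ)) = Module.finrank ℝ (Submodule.span ℝ σ) := by
  rw [Submodule.span_image]
  exact (Submodule.equivMapOfInjective (ρ g) (rho_injective ρ g) _).finrank_eq.symm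

lemma FramedCell.move_translate (f : FramedCell K p) (g : G) (τ : Set V) :
    (f.translate g).move L (ρ g '' τ) = chainsRep L p g (f.move L τ) := by
  by_cases hτ : τ ∈ L.cells ∧ Submodule.span ℝ τ = Submodule.span ℝ f.cell
  · have h2 : Submodule.span ℝ (ρ g '' τ) = Submodule.span ℝ (f.translate g).cell :=
      (span_image_eq_iff g).mpr hτ.2
    rw [f.move_of_mem hτ.1 hτ.2, chainsRep_chain, FramedCell.move_of_mem _ (L.image_mem g _ hτ.1) h2]
    rfl
  · rw [f.move_of_not hτ, map_zero, FramedCell.move_of_not]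
    rwa [L.image_mem_iff, show (f.translate g).cell = ρ g '' f.cell from rfl, span_image_eq_iff]

/-- The morphism of chain modules which takes a cell `σ` to the sum of the cells `τ` with `r σ τ` and
the same linear span. -/
def correspondence (K L : CellFamily ρ) (p : ℕ) (r : Set V → Set V → Prop)
    (hr : ∀ (g : G) σ τ, r σ τ → r (ρ g '' σ) (ρ g '' τ)) :
    Rep.of (chainsRep K p) ⟶ Rep.of (chainsRep L p) :=
  chainLift (fun f => ∑ᶠ τ ∈ {τ | r f.cell τ}, f.move L τ)
    (fun f f' c h hc hd => by
      simp only [FramedCell.move_rel h hc hd, h]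
      rcases lt_or_gt_of_ne hc with hc | hc
      · simp only [sign_neg hc, SignType.coe_neg, SignType.coe_one, neg_smul, one_smul,
          ← finsum_neg_distrib]
      · simp only [sign_pos hc, SignType.coe_one, one_smul])
    (fun g f => by
      have hinj : Function.Injective (fun τ : Set V => ρ g '' τ) := fun σ τ h => by
        have := congrArg (fun τ => ρ g⁻¹ '' τ) h
        simpa only [image_image_inv] using this
      have e : {τ | r (f.translate g).cell τ} = (fun τ => ρ g '' τ) '' {τ | r f.cell τ} := by
        ext τ
        constructor
        · intro h
          refine ⟨ρ g⁻¹ '' τ, ?_, image_inv_image g τ⟩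
          have := hr g⁻¹ _ _ h
          rwa [show (f.translate g).cell = ρ g '' f.cell from rfl, image_image_inv] at this
        · rintro ⟨τ, h, rfl⟩
          exact hr g _ _ h
      rw [e, finsum_mem_image hinj.injOn]
      simp only [FramedCell.move_translate]
      let e : Chains L p ≃+ Chains L p :=
        { toFun := chainsRep L p g
          invFun := chainsRep L p g⁻¹
          left_inv := fun y => by simp
          right_inv := fun y => by simp
          map_add' := map_add _ }
      refine Eq.trans ?_ (e.map_finsum (fun τ => ∑ᶠ (_ : τ ∈ {τ | r f.cell τ}), f.move L τ)).symm
      refine finsum_congr fun τ => ?_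
      by_cases hτ : τ ∈ {τ | r f.cell τ}
      · simp only [hτ, finsum_true]; rfl
      · simp only [hτ, finsum_false, map_zero])

/-- Sets which are not cells of `L`, or have a different linear span, contribute zero; so the
formally infinite sum is one over any finite set of related sets which contains all relevant ones.
-/
lemma correspondence_chain {r : Set V → Set V → Prop}
    (hr : ∀ (g : G) σ τ, r σ τ → r (ρ g '' σ) (ρ g '' τ)) (f : FramedCell K p)
    (S : Finset (Set V)) (h1 : ∀ τ ∈ S, r f.cell τ) (h2 : ∀ τ ∈ L.cells, r f.cell τ →
      Submodule.span ℝ τ = Submodule.span ℝ f.cell → τ ∈ S) :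
    (correspondence K L p r hr).hom f.chain = ∑ τ ∈ S, f.move L τ := by
  refine (chainLift_chain _ _ _ f).trans ?_
  rw [← finsum_mem_coe_finset]
  refine finsum_congr fun τ => ?_
  by_cases hS : τ ∈ S
  · have hτ : τ ∈ {τ | r f.cell τ} := h1 τ hS
    simp only [hτ, Finset.mem_coe, hS]
  · by_cases hτ : τ ∈ {τ | r f.cell τ}
    · simp only [hτ, finsum_true, Finset.mem_coe, hS, finsum_false]
      exact f.move_of_not fun h => hS (h2 τ h.1 hτ h.2)
    · simp only [hτ, Finset.mem_coe, hS]

lemma correspondence_chain_single {r : Set V → Set V → Prop}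
    (hr : ∀ (g : G) σ τ, r σ τ → r (ρ g '' σ) (ρ g '' τ)) (f : FramedCell K p)
    {τ : Set V} (h1 : r f.cell τ) (h2 : ∀ υ ∈ L.cells, r f.cell υ →
      Submodule.span ℝ υ = Submodule.span ℝ f.cell → υ = τ) :
    (correspondence K L p r hr).hom f.chain = f.move L τ := by
  rw [correspondence_chain hr f {τ} (by simpa using h1) (by simpa using h2), Finset.sum_singleton]

lemma correspondence_chain_zero {r : Set V → Set V → Prop}
    (hr : ∀ (g : G) σ τ, r σ τ → r (ρ g '' σ) (ρ g '' τ)) (f : FramedCell K p)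
    (h2 : ∀ υ ∈ L.cells, r f.cell υ → ¬ Submodule.span ℝ υ = Submodule.span ℝ f.cell) :
    (correspondence K L p r hr).hom f.chain = 0 := by
  rw [correspondence_chain hr f ∅ (by simp) (by simpa using h2), Finset.sum_empty]

lemma correspondence_chain_pair {r : Set V → Set V → Prop}
    (hr : ∀ (g : G) σ τ, r σ τ → r (ρ g '' σ) (ρ g '' τ)) (f : FramedCell K p)
    {τ τ' : Set V} (hne : τ ≠ τ') (h1 : r f.cell τ) (h1' : r f.cell τ')
    (h2 : ∀ υ ∈ L.cells, r f.cell υ →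
      Submodule.span ℝ υ = Submodule.span ℝ f.cell → υ = τ ∨ υ = τ') :
    (correspondence K L p r hr).hom f.chain = f.move L τ + f.move L τ' := by
  classical
  rw [correspondence_chain hr f {τ, τ'} (by simp [h1, h1']) (by simpa using h2),
    Finset.sum_pair hne]

end Lift

/-! ### Chain modules as permutation modules -/

section Permutation

variable {G V : Type} [Group G] [AddCommGroup V] [Module ℝ V] {ρ : Representation ℝ G V}

/-- The `p`-cells of a family. -/
def PCell (K : CellFamily ρ) (p : ℕ) : Type :=
  {σ : Set V // σ ∈ K.cells ∧ Module.finrank ℝ (Submodule.span ℝ σ) = p + 1}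

instance (K : CellFamily ρ) (p : ℕ) : MulAction G (PCell K p) where
  smul g σ := ⟨ρ g '' σ.1, K.image_mem g _ σ.2.1, by rw [finrank_span_image, σ.2.2]⟩
  one_smul σ := Subtype.ext (show ρ 1 '' σ.1 = σ.1 by simp)
  mul_smul g h σ := Subtype.ext (image_mul g h σ.1)

variable {K : CellFamily ρ} {p : ℕ}

lemma PCell.coe_smul (g : G) (σ : PCell K p) : (g • σ).1 = ρ g '' σ.1 := rfl

/-- The stabilisers of the `p`-cells preserve the orientations. -/
def IsOriented (K : CellFamily ρ) (p : ℕ) : Prop :=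
  ∀ (f : FramedCell K p) (g : G), ρ g '' f.cell = f.cell →
    ∃ c : ℝ, 0 < c ∧ FramesDiffer f.vec (f.translate g).vec c

/-- The cell of a framed cell. -/
def FramedCell.toPCell (f : FramedCell K p) : PCell K p := ⟨f.cell, f.mem, f.dim⟩

lemma FramedCell.toPCell_eq {f : FramedCell K p} {σ : PCell K p} (h : f.cell = σ.1) :
    f.toPCell = σ := Subtype.ext h

lemma PCell.exists_framedCell (σ : PCell K p) : ∃ f : FramedCell K p, f.cell = σ.1 := by
  have : FiniteDimensional ℝ (Submodule.span ℝ σ.1) :=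
    FiniteDimensional.of_finrank_pos (by rw [σ.2.2]; omega)
  let b := Module.finBasisOfFinrankEq ℝ (Submodule.span ℝ σ.1) σ.2.2
  exact ⟨⟨σ.1, σ.2.1, σ.2.2, fun i => b i, b.linearIndependent.map' (Submodule.subtype _)
    (Submodule.ker_subtype _), fun i => (b i).2⟩, rfl⟩

/-- A frame is chosen for one cell in each orbit and transported along the orbit. Different
transports to the same cell differ by an element of a stabiliser, which preserves the orientation.
-/
lemma exists_equivariant_orientation (h : IsOriented K p) :
    ∃ o : PCell K p → FramedCell K p, (∀ σ, (o σ).cell = σ.1) ∧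
      ∀ (g : G) σ, ∃ c : ℝ, 0 < c ∧ FramesDiffer ((o σ).translate g).vec (o (g • σ)).vec c := by
  choose f hf using PCell.exists_framedCell (K := K) (p := p)
  choose e he using exists_mem_orbitFibre (G := G) (Y := PCell K p)
  let r : PCell K p → PCell K p := fun σ => (Quotient.mk (MulAction.orbitRel G _) σ).out
  have he' : ∀ σ, ρ (e σ) '' (r σ).1 = σ.1 := fun σ => congrArg Subtype.val (he σ)
  refine ⟨fun σ => (f (r σ)).translate (e σ), fun σ => ?_, fun g σ => ?_⟩
  · change ρ (e σ) '' (f (r σ)).cell = _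
    rw [hf, he']
  · have hr : r (g • σ) = r σ := congrArg Quotient.out (Quotient.sound ⟨g, rfl⟩)
    -- The frame at `g • σ` arises in two ways, directly and by way of `σ`; this stabiliser element
    -- compares them.
    obtain ⟨c, hc, hd⟩ := h (f (r σ)) ((g * e σ)⁻¹ * e (g • σ)) (by
      rw [hf, image_mul]
      have := he' (g • σ)
      rw [hr] at this
      rw [this, PCell.coe_smul]
      conv_rhs => rw [← image_image_inv (ρ := ρ) (g * e σ) (r σ).1, image_mul, he'])
    refine ⟨c, hc, ?_⟩
    change FramesDiffer (((f (r σ)).translate (e σ)).translate g).vec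
      ((f (r (g • σ))).translate (e (g • σ))).vec c
    rw [hr, FramedCell.translate_translate]
    have := hd.map (ρ (g * e σ))
    have e1 : ((f (r σ)).translate (e (g • σ))).vec = fun i =>
        ρ (g * e σ) (((f (r σ)).translate ((g * e σ)⁻¹ * e (g • σ))).vec i) := by
      funext i
      simp [FramedCell.translate, ← Module.End.mul_apply, ← map_mul, mul_assoc]
    rw [e1]
    exact this

/-- The module of `p`-chains is the permutation module of the set of `p`-cells, if the stabilisers
preserve the orientations. -/
lemma exists_chains_iso (h : IsOriented K p) :
    ∃ (o : PCell K p → FramedCell K p) (e : permModule G (PCell K p) ≅ Rep.of (chainsRep K p)),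
      (∀ σ, (o σ).cell = σ.1) ∧ ∀ σ, e.hom.hom (Finsupp.single σ 1) = (o σ).chain := by
  obtain ⟨o, ho, hg⟩ := exists_equivariant_orientation h
  have hfc : ∀ f : FramedCell K p, (o f.toPCell).cell = f.cell := fun f => ho _
  choose c hc hd using fun f : FramedCell K p =>
    (o f.toPCell).exists_framesDiffer f (by rw [hfc])
  let F : FramedCell K p → (PCell K p →₀ ℤ) := fun f =>
    Finsupp.single f.toPCell (SignType.sign (c f) : ℤ)
  have hF : ∀ (f : FramedCell K p) (σ : PCell K p) (a : ℝ), f.cell = σ.1 →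
      FramesDiffer (o σ).vec f.vec a → F f = Finsupp.single σ (SignType.sign a : ℤ) := by
    rintro f σ a h1 hd'
    obtain rfl := FramedCell.toPCell_eq h1
    rw [← (hd f).eq_of_indep (o _).indep hd']
  have hFc : ∀ f : FramedCell K p, (SignType.sign (c f) : ℤ) • (o f.toPCell).chain =
      f.chain := fun f => (FramedCell.chain_eq_smul _ f (hc f) (hfc f).symm (hd f)).symm
  have hFo : ∀ σ, F (o σ) = Finsupp.single σ 1 := fun σ => by
    rw [hF (o σ) σ 1 (ho σ) (FramesDiffer.refl _)]
    simp
  let a : permModule G (PCell K p) ⟶ Rep.of (chainsRep K p) :=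
    permLift (fun σ => (o σ).chain) fun g σ => by
      obtain ⟨c, hc, hd⟩ := hg g σ
      rw [chainsRep_chain]
      refine FramedCell.chain_eq_of_pos _ _ hc ?_ hd
      rw [ho]
      exact congrArg (ρ g '' ·) (ho σ).symm
  have ha : ∀ σ, a.hom (Finsupp.single σ 1) = (o σ).chain := fun σ => permLift_single _ _ σ
  let b : Rep.of (chainsRep K p) ⟶ permModule G (PCell K p) :=
    chainLift F (fun f f' a h ha hd' => by
      rw [hF f' f.toPCell _ h ((hd f).trans hd'), sign_mul]
      change _ = _ • Finsupp.single f.toPCell _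
      rw [Finsupp.smul_single]
      simp) (fun g f => by
      change _ = permRepresentation G _ g (Finsupp.single f.toPCell _)
      rw [permRepresentation_single]
      obtain ⟨a, ha, hda⟩ := hg g f.toPCell
      rw [hF (f.translate g) (g • f.toPCell) (c f * a⁻¹) rfl
        ((hda.symm ha.ne').trans ((hd f).map (ρ g))), sign_mul, sign_pos (inv_pos.mpr ha), mul_one])
  have hb : ∀ f : FramedCell K p, b.hom f.chain = F f := fun f => chainLift_chain _ _ _ f
  refine ⟨o, ⟨a, b, permModule_hom_ext fun σ => ?_, chains_hom_ext fun f => ?_⟩, ho, ha⟩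
  · change b.hom (a.hom _) = _
    rw [ha, hb, hFo]
    rfl
  · change a.hom (b.hom _) = _
    rw [hb]
    have : F f = (SignType.sign (c f) : ℤ) • Finsupp.single f.toPCell 1 := by
      change Finsupp.single f.toPCell _ = _
      rw [Finsupp.smul_single]
      simp
    rw [this, map_zsmul]
    exact (congrArg _ (ha _)).trans (hFc f)

lemma nsmul_homology_chains (h : IsOriented K p) (N : ℕ)
    (hN : ∀ σ : PCell K p, Finite (MulAction.stabilizer G σ) ∧
      Nat.card (MulAction.stabilizer G σ) ∣ N) (q : ℕ)
    (x : groupHomology (Rep.of (chainsRep K p)) (q + 1)) : N • x = 0 := by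
  obtain ⟨o, e, -, -⟩ := exists_chains_iso h
  have hx : homologyMap (q + 1) e.hom (homologyMap (q + 1) e.inv x) = x := by
    rw [← homologyMap_comp, e.inv_hom_id, homologyMap_id]
  have := nsmul_homology_permModule N hN q (homologyMap (q + 1) e.inv x)
  rw [← hx, ← map_nsmul, this, map_zero]

lemma homology_chains_eq_zero (h : ∀ σ ∈ K.cells, Module.finrank ℝ (Submodule.span ℝ σ) ≠ p + 1)
    (q : ℕ) (x : groupHomology (Rep.of (chainsRep K p)) q) : x = 0 := by
  have : 𝟙 (Rep.of (chainsRep K p)) = 0 := chains_hom_ext fun f => absurd f.dim (h _ f.mem)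
  rw [← homologyMap_id q _ x, this, homologyMap_zero]

end Permutation
-- Rays and open segments, as cones
section Segments

variable {V : Type} [AddCommGroup V] [Module ℝ V]

/-- The open ray through `A`. -/
def ray (A : V) : Set V := {x | ∃ t : ℝ, 0 < t ∧ x = t • A}

/-- The open cone over a segment. -/
def seg (P Q : V) : Set V := {x | ∃ a b : ℝ, 0 < a ∧ 0 < b ∧ x = a • P + b • Q}

lemma mem_ray_self (A : V) : A ∈ ray A := ⟨1, one_pos, (one_smul ℝ A).symm⟩

lemma ray_smul (A : V) {t : ℝ} (ht : 0 < t) : ray (t • A) = ray A := by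
  ext x
  constructor
  · rintro ⟨s, hs, rfl⟩
    exact ⟨s * t, by positivity, by rw [smul_smul]⟩
  · rintro ⟨s, hs, rfl⟩
    exact ⟨s * t⁻¹, by positivity, by rw [smul_smul, mul_assoc, inv_mul_cancel₀ ht.ne', mul_one]⟩

lemma ray_eq_of_mem {A B : V} (h : B ∈ ray A) : ray B = ray A := by
  obtain ⟨t, ht, rfl⟩ := h
  exact ray_smul A ht

lemma ray_eq_iff_mem {A B : V} : ray B = ray A ↔ B ∈ ray A :=
  ⟨fun h => h ▸ mem_ray_self B, ray_eq_of_mem⟩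

lemma seg_comm (P Q : V) : seg P Q = seg Q P := by
  ext x
  constructor <;> rintro ⟨a, b, ha, hb, rfl⟩ <;> exact ⟨b, a, hb, ha, add_comm _ _⟩

lemma seg_smul_left (P Q : V) {t : ℝ} (ht : 0 < t) : seg (t • P) Q = seg P Q := by
  ext x
  constructor
  · rintro ⟨a, b, ha, hb, rfl⟩
    exact ⟨a * t, b, by positivity, hb, by rw [smul_smul]⟩
  · rintro ⟨a, b, ha, hb, rfl⟩
    exact ⟨a * t⁻¹, b, by positivity, hb,
      by rw [smul_smul, mul_assoc, inv_mul_cancel₀ ht.ne', mul_one]⟩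

lemma seg_left_of_ray_eq {P P' : V} (Q : V) (h : ray P' = ray P) : seg P' Q = seg P Q := by
  obtain ⟨t, ht, rfl⟩ := ray_eq_iff_mem.mp h
  exact seg_smul_left P Q ht

lemma image_ray (f : V →ₗ[ℝ] V) (A : V) : f '' ray A = ray (f A) := by
  ext x
  constructor
  · rintro ⟨_, ⟨t, ht, rfl⟩, rfl⟩
    exact ⟨t, ht, map_smul _ _ _⟩
  · rintro ⟨t, ht, rfl⟩
    exact ⟨_, ⟨t, ht, rfl⟩, map_smul _ _ _⟩

lemma image_seg (f : V →ₗ[ℝ] V) (P Q : V) : f '' seg P Q = seg (f P) (f Q) := by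
  ext x
  constructor
  · rintro ⟨_, ⟨a, b, ha, hb, rfl⟩, rfl⟩
    exact ⟨a, b, ha, hb, by simp⟩
  · rintro ⟨a, b, ha, hb, rfl⟩
    exact ⟨_, ⟨a, b, ha, hb, rfl⟩, by simp⟩

lemma span_ray (A : V) : Submodule.span ℝ (ray A) = Submodule.span ℝ {A} := by
  refine le_antisymm (Submodule.span_le.mpr ?_) (Submodule.span_le.mpr ?_)
  · rintro _ ⟨t, -, rfl⟩
    exact Submodule.smul_mem _ _ (Submodule.subset_span rfl)
  · rintro _ rfl
    exact Submodule.subset_span (mem_ray_self _)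

lemma finrank_span_ray {A : V} (hA : A ≠ 0) :
    Module.finrank ℝ (Submodule.span ℝ (ray A)) = 1 := by
  rw [span_ray, finrank_span_singleton hA]

lemma span_seg (P Q : V) : Submodule.span ℝ (seg P Q) = Submodule.span ℝ {P, Q} := by
  refine le_antisymm (Submodule.span_le.mpr ?_) (Submodule.span_le.mpr ?_)
  · rintro _ ⟨a, b, -, -, rfl⟩
    exact add_mem (Submodule.smul_mem _ _ (Submodule.subset_span (by simp)))
      (Submodule.smul_mem _ _ (Submodule.subset_span (by simp)))
  · have h1 : P + Q ∈ Submodule.span ℝ (seg P Q) :=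
      Submodule.subset_span ⟨1, 1, one_pos, one_pos, by simp⟩
    have h2 : (2 : ℝ) • P + Q ∈ Submodule.span ℝ (seg P Q) :=
      Submodule.subset_span ⟨2, 1, two_pos, one_pos, by simp⟩
    have hP : P ∈ Submodule.span ℝ (seg P Q) := by
      have := sub_mem h2 h1
      rwa [two_smul, add_sub_add_right_eq_sub, add_sub_cancel_right] at this
    rintro _ (rfl | rfl)
    · exact hP
    · simpa using sub_mem h1 hP

lemma finrank_span_seg {P Q : V} (h : LinearIndependent ℝ ![P, Q]) :
    Module.finrank ℝ (Submodule.span ℝ (seg P Q)) = 2 := by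
  have := finrank_span_eq_card h
  have e : Set.range ![P, Q] = {P, Q} := by simp [Set.pair_comm]
  rwa [e, ← span_seg] at this

lemma coeff_eq {P Q : V} (h : LinearIndependent ℝ ![P, Q]) {a b c d : ℝ}
    (e : a • P + b • Q = c • P + d • Q) : a = c ∧ b = d := by
  have h1 := LinearIndependent.pair_iff.mp h (a - c) (b - d) (by
    rw [← sub_eq_zero.mpr e]
    module)
  exact ⟨sub_eq_zero.mp h1.1, sub_eq_zero.mp h1.2⟩

lemma indep_symm {P Q : V} (h : LinearIndependent ℝ ![P, Q]) : LinearIndependent ℝ ![Q, P] := by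
  rw [LinearIndependent.pair_iff] at h ⊢
  intro s t e
  exact (h t s (by rw [add_comm]; exact e)).symm

lemma mem_span_seg {P Q x : V} : x ∈ Submodule.span ℝ (seg P Q) ↔ ∃ a b : ℝ, x = a • P + b • Q := by
  rw [span_seg, Submodule.mem_span_pair]
  exact ⟨fun ⟨a, b, h⟩ => ⟨a, b, h.symm⟩, fun ⟨a, b, h⟩ => ⟨a, b, h.symm⟩⟩

lemma ιMulti_pair (P Q : V) (a b c d : ℝ) :
    exteriorPower.ιMulti ℝ 2 ![a • P + b • Q, c • P + d • Q] =
      (a * d - b * c) • exteriorPower.ιMulti ℝ 2 ![P, Q] := by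
  set f := exteriorPower.ιMulti (M := V) ℝ 2
  have swap : ∀ x y : V, f ![x, y] = - f ![y, x] := fun x y => by
    have := f.map_swap ![y, x] (i := 0) (j := 1) (by simp)
    rw [← this]
    congr 1
    funext i
    fin_cases i <;> rfl
  have same : ∀ x : V, f ![x, x] = 0 := fun x =>
    f.map_eq_zero_of_eq ![x, x] (i := 0) (j := 1) rfl (by simp)
  have left : ∀ (x y : ℝ) (z : V), f ![x • P + y • Q, z] = x • f ![P, z] + y • f ![Q, z] := by
    intro x y z
    have h1 := f.map_update_add ![0, z] 0 (x • P) (y • Q)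
    have h2 := f.map_update_smul ![0, z] 0 x P
    have h3 := f.map_update_smul ![0, z] 0 y Q
    have e : ∀ w : V, Function.update ![0, z] 0 w = ![w, z] := fun w => by
      funext i; fin_cases i <;> rfl
    simp only [e] at h1 h2 h3
    rw [h1, h2, h3]
  rw [left, swap P, swap Q, left, left, same, same, swap Q P]
  module

lemma framesDiffer_pair {P Q : V} {v v' : Fin 2 → V} (a b c d : ℝ) (h0 : v 0 = P) (h1 : v 1 = Q)
    (h0' : v' 0 = a • P + b • Q) (h1' : v' 1 = c • P + d • Q) :
    FramesDiffer (p := 1) v v' (a * d - b * c) := by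
  have e : v = ![P, Q] := by funext i; fin_cases i; exacts [h0, h1]
  have e' : v' = ![a • P + b • Q, c • P + d • Q] := by funext i; fin_cases i; exacts [h0', h1']
  rw [e, e']
  exact ιMulti_pair P Q a b c d

lemma framesDiffer_single {v v' : Fin 1 → V} {c : ℝ} (h : v' 0 = c • v 0) :
    FramesDiffer (p := 0) v v' c := by
  have h3 := (exteriorPower.ιMulti (M := V) ℝ 1).map_update_smul v 0 c (v 0)
  have e : Function.update v 0 (c • v 0) = v' := by
    funext i; fin_cases i; simp [h]
  rw [e, Function.update_eq_self] at h3
  exact h3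

section Closure

variable [TopologicalSpace V] [IsTopologicalAddGroup V] [T2Space V] [ContinuousSMul ℝ V]

/-- The coordinate map from the real plane is a closed embedding, so the closure can be taken of the
open quadrant. -/
lemma closure_seg {P Q : V} (h : LinearIndependent ℝ ![P, Q]) :
    closure (seg P Q) = {x | ∃ a b : ℝ, 0 ≤ a ∧ 0 ≤ b ∧ x = a • P + b • Q} := by
  let f : ℝ × ℝ →ₗ[ℝ] V := (LinearMap.fst ℝ ℝ ℝ).smulRight P + (LinearMap.snd ℝ ℝ ℝ).smulRight Q
  have hf : ∀ x, f x = x.1 • P + x.2 • Q := fun x => rfl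
  have hinj : LinearMap.ker f = ⊥ := by
    rw [LinearMap.ker_eq_bot']
    intro x hx
    have := LinearIndependent.pair_iff.mp h _ _ hx
    exact Prod.ext this.1 this.2
  have e := LinearMap.isClosedEmbedding_of_injective hinj
  have h1 : seg P Q = f '' (Set.Ioi 0 ×ˢ Set.Ioi 0) := by
    ext x
    constructor
    · rintro ⟨a, b, ha, hb, rfl⟩
      exact ⟨(a, b), ⟨ha, hb⟩, hf _⟩
    · rintro ⟨⟨a, b⟩, ⟨ha, hb⟩, rfl⟩
      exact ⟨a, b, ha, hb, hf _⟩
  rw [h1, e.closure_image_eq, closure_prod_eq, closure_Ioi]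
  ext x
  constructor
  · rintro ⟨⟨a, b⟩, ⟨ha, hb⟩, rfl⟩
    exact ⟨a, b, ha, hb, hf _⟩
  · rintro ⟨a, b, ha, hb, rfl⟩
    exact ⟨(a, b), ⟨ha, hb⟩, hf _⟩

/-- A ray in the closure of a segment which does not meet the segment is one of its ends. -/
lemma eq_end_of_mem_closure {P Q A : V} (h : LinearIndependent ℝ ![P, Q]) (hA : A ≠ 0)
    (hcl : A ∈ closure (seg P Q)) (hn : A ∉ seg P Q) : ray A = ray P ∨ ray A = ray Q := by
  rw [closure_seg h] at hcl
  obtain ⟨a, b, ha, hb, rfl⟩ := hcl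
  rcases ha.eq_or_lt with rfl | ha
  · rcases hb.eq_or_lt with rfl | hb
    · simp at hA
    · right; rw [zero_smul, zero_add, ray_smul _ hb]
  · rcases hb.eq_or_lt with rfl | hb
    · left; rw [zero_smul, add_zero, ray_smul _ ha]
    · exact absurd ⟨a, b, ha, hb, rfl⟩ hn

lemma ray_left_subset_closure {P Q : V} (h : LinearIndependent ℝ ![P, Q]) :
    ray P ⊆ closure (seg P Q) := by
  rw [closure_seg h]
  rintro _ ⟨t, ht, rfl⟩
  exact ⟨t, 0, ht.le, le_rfl, by simp⟩

lemma ray_right_subset_closure {P Q : V} (h : LinearIndependent ℝ ![P, Q]) :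
    ray Q ⊆ closure (seg P Q) := by
  rw [seg_comm]
  exact ray_left_subset_closure (indep_symm h)

end Closure

end Segments
-- The boundary of an edge
section Boundary

variable {G V : Type} [Group G] [AddCommGroup V] [Module ℝ V] {ρ : Representation ℝ G V}
  {K L : CellFamily ρ} {p : ℕ}

/-- It suffices to compare morphisms of chain modules on one framed cell in each orbit. -/
lemma chains_hom_ext_orbit {A : Rep.{0} ℤ G} {a b : Rep.of (chainsRep K p) ⟶ A}
    (h : ∀ σ ∈ K.cells, Module.finrank ℝ (Submodule.span ℝ σ) = p + 1 →
      ∃ (g : G) (f : FramedCell K p), f.cell = ρ g '' σ ∧ a.hom f.chain = b.hom f.chain) :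
    a = b := by
  refine chains_hom_ext fun f => ?_
  obtain ⟨g, f', hf, hab⟩ := h f.cell f.mem f.dim
  have hcell : f.cell = (f'.translate g⁻¹).cell := by
    change _ = ρ g⁻¹ '' f'.cell
    rw [hf, image_image_inv]
  obtain ⟨c, hc, hd⟩ := (f'.translate g⁻¹).exists_framesDiffer f (by rw [hcell])
  rw [FramedCell.chain_eq_smul _ f hc hcell hd, map_zsmul, map_zsmul, ← chainsRep_chain]
  have ha := Rep.hom_comm_apply a g⁻¹ f'.chain
  have hb := Rep.hom_comm_apply b g⁻¹ f'.chain
  congr 1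
  exact ha.trans ((congrArg _ hab).trans hb.symm)

/-- With orientations preserved, the chain module is free on the cells, and the chain of a framed
cell is a nonzero multiple of its generator. -/
lemma FramedCell.cell_eq_of_chain_eq (h : IsOriented K p) {f f' : FramedCell K p}
    (e : f.chain = -f'.chain) : f.cell = f'.cell := by
  obtain ⟨o, i, ho, hi⟩ := exists_chains_iso h
  have key : ∀ f : FramedCell K p, ∃ n : ℤ, n ≠ 0 ∧
      i.inv.hom f.chain = Finsupp.single f.toPCell n := fun f => by
    obtain ⟨c, hc, hd⟩ := (o f.toPCell).exists_framesDiffer f (by rw [ho]; rfl)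
    refine ⟨SignType.sign c, ?_, ?_⟩
    · rcases lt_or_gt_of_ne hc with hc | hc
      · simp [sign_neg hc]
      · simp [sign_pos hc]
    · rw [FramedCell.chain_eq_smul _ f hc (ho f.toPCell).symm hd, map_zsmul, ← hi]
      have : i.inv.hom (i.hom.hom (Finsupp.single f.toPCell 1)) = Finsupp.single f.toPCell 1 :=
        congrArg (fun φ => φ.hom (Finsupp.single f.toPCell 1)) i.hom_inv_id
      rw [this]
      refine (Finsupp.smul_single _ _ _).trans ?_
      simp
  obtain ⟨n, hn, h1⟩ := key f
  obtain ⟨n', hn', h2⟩ := key f'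
  rw [e, map_neg, h2] at h1
  have h3 := DFunLike.congr_fun h1 f.toPCell
  by_contra hne
  have hne' : f'.toPCell ≠ f.toPCell := fun h => hne (congrArg Subtype.val h.symm)
  have h4 : -(Finsupp.single f'.toPCell n') f.toPCell = (Finsupp.single f.toPCell n) f.toPCell := h3
  rw [Finsupp.single_eq_same, Finsupp.single_eq_of_ne hne'.symm, neg_zero] at h4
  exact hn h4.symm

lemma linearIndependent_single {A : V} (hA : A ≠ 0) :
    LinearIndependent ℝ (fun _ : Fin (0 + 1) => A) :=
  (linearIndependent_unique_iff (ι := Fin 1) (v := fun _ => A)).mpr hA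

/-- The vertex given by the ray through `A`. -/
@[simps]
def vertexCell (K : CellFamily ρ) {A : V} (hA : A ≠ 0) (h : ray A ∈ K.cells) : FramedCell K 0 where
  cell := ray A
  mem := h
  dim := finrank_span_ray hA
  vec _ := A
  indep := linearIndependent_single hA
  mem_span _ := Submodule.subset_span (mem_ray_self A)

open Classical in
/-- The chain of the vertex given by the ray through `A`, or zero if this is not a vertex. -/
def vertexChain (K : CellFamily ρ) (A : V) : Chains K 0 :=
  if h : A ≠ 0 ∧ ray A ∈ K.cells then (vertexCell K h.1 h.2).chain else 0

lemma vertexChain_of_mem {A : V} (hA : A ≠ 0) (h : ray A ∈ K.cells) :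
    vertexChain K A = (vertexCell K hA h).chain := dif_pos ⟨hA, h⟩

lemma vertexChain_of_not_mem {A : V} (h : ray A ∉ K.cells) : vertexChain K A = 0 :=
  dif_neg fun h' => h h'.2

lemma vertexChain_eq (f : FramedCell K 0) {A : V} (hA : A ≠ 0) (hcell : f.cell = ray A) {c : ℝ}
    (hc : c ≠ 0) (h : f.vec 0 = c • A) : f.chain = (SignType.sign c : ℤ) • vertexChain K A := by
  rw [vertexChain, dif_pos ⟨hA, hcell ▸ f.mem⟩]
  exact FramedCell.chain_eq_smul _ f hc hcell (framesDiffer_single h)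

/-- The framed edge from `P` to `Q`. -/
@[simps]
def edgeCell (K : CellFamily ρ) {P Q : V} (hPQ : LinearIndependent ℝ ![P, Q])
    (h : seg P Q ∈ K.cells) : FramedCell K 1 where
  cell := seg P Q
  mem := h
  dim := finrank_span_seg hPQ
  vec := ![P, Q]
  indep := hPQ
  mem_span i := by
    rw [mem_span_seg]
    fin_cases i
    · exact ⟨1, 0, by simp⟩
    · exact ⟨0, 1, by simp⟩

variable [TopologicalSpace V] [IsTopologicalAddGroup V] [T2Space V] [ContinuousSMul ℝ V]

/-- An interior vector followed by `t • P` is a frame of the sign of `-t`, and one followed by `t •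
Q` has the sign of `t`; hence the signs of the two ends. An ideal end, or any other end which is not
a cell of the family, contributes zero. -/
lemma boundaryCell_edge (hK : IsOriented K 0) {P Q : V} (f : FramedCell K 1)
    (hPQ : LinearIndependent ℝ ![P, Q]) (hcell : f.cell = seg P Q) (h0 : f.vec 0 = P)
    (h1 : f.vec 1 = Q)
    (hv : ∀ τ ∈ K.cells, Module.finrank ℝ (Submodule.span ℝ τ) = 1 → τ ⊆ closure (seg P Q) →
      τ = ray P ∨ τ = ray Q) :
    boundaryCell f = vertexChain K Q - vertexChain K P := by
  classical
  have hP : P ≠ 0 := hPQ.ne_zero 0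
  have hQ : Q ≠ 0 := hPQ.ne_zero 1
  have hmem : ∀ y, y ∈ facets f ↔ (ray P ∈ K.cells ∧ y = -vertexChain K P) ∨
      (ray Q ∈ K.cells ∧ y = vertexChain K Q) := by
    intro y
    constructor
    · rintro ⟨t, ht, ⟨x, hx, c, hc, hd⟩, rfl⟩
      rw [hcell] at ht hx
      obtain ⟨a, b, ha, hb, rfl⟩ := hx
      have hspan := t.mem_span 0
      rcases hv t.cell t.mem t.dim ht with h | h
      · rw [h, span_ray, Submodule.mem_span_singleton] at hspan
        obtain ⟨α, hα⟩ := hspan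
        have hd' := framesDiffer_pair (v := f.vec) (v' := Fin.cons (a • P + b • Q) t.vec)
          a b α 0 h0 h1 rfl (by simpa using! hα.symm)
        have := hd.eq_of_indep f.indep hd'
        have hα' : α < 0 := by nlinarith
        refine Or.inl ⟨h ▸ t.mem, ?_⟩
        rw [vertexChain_eq t hP h hα'.ne hα.symm, sign_neg hα']
        simp
      · rw [h, span_ray, Submodule.mem_span_singleton] at hspan
        obtain ⟨α, hα⟩ := hspan
        have hd' := framesDiffer_pair (v := f.vec) (v' := Fin.cons (a • P + b • Q) t.vec)
          a b 0 α h0 h1 rfl (by simpa using! hα.symm)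
        have := hd.eq_of_indep f.indep hd'
        have hα' : 0 < α := by nlinarith
        refine Or.inr ⟨h ▸ t.mem, ?_⟩
        rw [vertexChain_eq t hQ h hα'.ne' hα.symm, sign_pos hα']
        simp
    · have hx : (1 : ℝ) • P + (1 : ℝ) • Q ∈ f.cell := by
        rw [hcell]; exact ⟨1, 1, one_pos, one_pos, rfl⟩
      rintro (⟨h, rfl⟩ | ⟨h, rfl⟩)
      · let t : FramedCell K 0 := ⟨ray P, h, finrank_span_ray hP, fun _ => (-1 : ℝ) • P,
          linearIndependent_single (by simpa using hP),
          fun _ => Submodule.smul_mem _ _ (Submodule.subset_span (mem_ray_self P))⟩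
        refine ⟨t, hcell ▸ ray_left_subset_closure hPQ, ⟨_, hx, _, ?_,
          framesDiffer_pair (v := f.vec) (v' := Fin.cons _ t.vec) 1 1 (-1) 0 h0 h1 rfl
          (by simp [t])⟩, ?_⟩
        · norm_num
        · rw [vertexChain_eq t hP rfl (by norm_num) rfl, sign_neg (by norm_num)]
          simp
      · let t : FramedCell K 0 := ⟨ray Q, h, finrank_span_ray hQ, fun _ => (1 : ℝ) • Q,
          linearIndependent_single (by simpa using hQ),
          fun _ => Submodule.smul_mem _ _ (Submodule.subset_span (mem_ray_self Q))⟩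
        refine ⟨t, hcell ▸ ray_right_subset_closure hPQ, ⟨_, hx, _, ?_,
          framesDiffer_pair (v := f.vec) (v' := Fin.cons _ t.vec) 1 1 0 1 h0 h1 rfl
          (by simp [t])⟩, ?_⟩
        · norm_num
        · rw [vertexChain_eq t hQ rfl (by norm_num) rfl, sign_pos (by norm_num)]
          simp
  have hvP : ∀ A : V, A ≠ 0 → ray A ∈ K.cells → ∃ f : FramedCell K 0, f.cell = ray A ∧
      f.chain = vertexChain K A := fun A hA h =>
    ⟨vertexCell K hA h, rfl, (vertexChain_of_mem hA h).symm⟩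
  -- The boundary is a sum over a set of chains, where equal summands would be counted once; so the
  -- contributions of the two ends have to be different.
  have hne : ray P ∈ K.cells → ray Q ∈ K.cells → -vertexChain K P ≠ vertexChain K Q := by
    intro h h' e
    obtain ⟨f₁, hf₁, e₁⟩ := hvP P hP h
    obtain ⟨f₂, hf₂, e₂⟩ := hvP Q hQ h'
    have := FramedCell.cell_eq_of_chain_eq hK (f := f₂) (f' := f₁) (by rw [e₁, e₂, e])
    rw [hf₁, hf₂, ray_eq_iff_mem] at this
    obtain ⟨t, ht, rfl⟩ := this
    have := LinearIndependent.pair_iff.mp hPQ t (-1) (by module)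
    linarith [this.2]
  unfold boundaryCell
  by_cases h : ray P ∈ K.cells <;> by_cases h' : ray Q ∈ K.cells
  · have e : facets f = {-vertexChain K P, vertexChain K Q} := by
      ext y; simp [hmem, h, h']
    rw [e, finsum_mem_pair (hne h h')]
    abel
  · have e : facets f = {-vertexChain K P} := by
      ext y; simp [hmem, h, h']
    rw [e, finsum_mem_singleton, vertexChain_of_not_mem h', zero_sub]
  · have e : facets f = {vertexChain K Q} := by
      ext y; simp [hmem, h, h']
    rw [e, finsum_mem_singleton, vertexChain_of_not_mem h, sub_zero]
  · have e : facets f = ∅ := by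
      ext y; simp [hmem, h, h']
    rw [e, finsum_mem_empty, vertexChain_of_not_mem h, vertexChain_of_not_mem h', sub_zero]

end Boundary

/-! ### Restriction of chains to another family of cells -/

section Restriction

variable {G V : Type} [Group G] [AddCommGroup V] [Module ℝ V] {ρ : Representation ℝ G V}

/-- The morphism which keeps the common cells of two families and kills the other ones. -/
def restriction (K L : CellFamily ρ) (p : ℕ) : Rep.of (chainsRep K p) ⟶ Rep.of (chainsRep L p) :=
  correspondence K L p (fun σ τ => τ = σ) fun _ _ _ h => by rw [h]

variable {K L : CellFamily ρ} {p : ℕ}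

lemma restriction_chain (f : FramedCell K p) :
    (restriction K L p).hom f.chain = f.move L f.cell :=
  correspondence_chain_single _ f rfl fun _ _ h _ => h

lemma restriction_chain_of_mem (f : FramedCell K p) (h : f.cell ∈ L.cells) :
    (restriction K L p).hom f.chain = (f.withCell L f.cell h rfl).chain := by
  rw [restriction_chain, f.move_of_mem h rfl]

lemma restriction_chain_of_not_mem (f : FramedCell K p) (h : f.cell ∉ L.cells) :
    (restriction K L p).hom f.chain = 0 := by
  rw [restriction_chain, f.move_of_not fun h' => h h'.1]

lemma restriction_vertexChain {A : V} (h : ray A ∈ L.cells → ray A ∈ K.cells) :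
    (restriction K L 0).hom (vertexChain K A) = vertexChain L A := by
  by_cases hK : A ≠ 0 ∧ ray A ∈ K.cells
  · rw [vertexChain_of_mem hK.1 hK.2]
    by_cases hL : ray A ∈ L.cells
    · rw [restriction_chain_of_mem _ hL, vertexChain_of_mem hK.1 hL]
      rfl
    · rw [restriction_chain_of_not_mem _ hL, vertexChain_of_not_mem hL]
  · rw [vertexChain, dif_neg hK, map_zero, vertexChain, dif_neg fun h' => hK ⟨h'.1, h h'.2⟩]

lemma restriction_vertexChain_of_not_mem {A : V} (h : ray A ∉ L.cells) :
    (restriction K L 0).hom (vertexChain K A) = 0 := by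
  by_cases hK : A ≠ 0 ∧ ray A ∈ K.cells
  · rw [vertexChain_of_mem hK.1 hK.2, restriction_chain_of_not_mem _ h]
  · rw [vertexChain, dif_neg hK, map_zero]

end Restriction
-- Matrices of determinant one which fix a positive definite form
section TwoByTwo

variable {M N A B : Matrix (Fin 2) (Fin 2) ℂ}

lemma adjugate_eq_trace_sub (M : Matrix (Fin 2) (Fin 2) ℂ) : M.adjugate = M.trace • 1 - M := by
  rw [Matrix.adjugate_fin_two]
  ext i j
  fin_cases i <;> fin_cases j <;> simp [Matrix.trace, Fin.sum_univ_two]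

lemma sq_eq_trace_smul_sub (hM : M.det = 1) : M * M = M.trace • M - 1 := by
  have h := M.mul_adjugate
  rw [adjugate_eq_trace_sub, hM, one_smul, mul_sub, Matrix.mul_smul, mul_one] at h
  rw [← h]
  abel

/-- The hypothesis says that `M * A` is `A` times the adjoint of the inverse of `M`, and this
inverse is the adjugate `M.trace • 1 - M`. -/
lemma mul_add_mul_conjTranspose (hM : M.det = 1) (h : M * A * Mᴴ = A) :
    M * A + A * Mᴴ = star M.trace • A := by
  have h1 : Mᴴ * (M.adjugate)ᴴ = 1 := by
    rw [← Matrix.conjTranspose_mul, Matrix.adjugate_mul, hM, one_smul, Matrix.conjTranspose_one]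
  have h2 : M * A = A * (M.adjugate)ᴴ := by
    conv_rhs => rw [← h]
    rw [mul_assoc (M * A), h1, mul_one]
  rw [h2, adjugate_eq_trace_sub, Matrix.conjTranspose_sub, Matrix.conjTranspose_smul,
    Matrix.conjTranspose_one, mul_sub, Matrix.mul_smul, mul_one, sub_add_cancel]

/-- The sum `M * A + A * Mᴴ` is Hermitian and equals `star M.trace • A`, with `A` Hermitian and
nonzero. -/
lemma trace_real_of_fixes (hM : M.det = 1) (hA : A.IsHermitian) (hA0 : A ≠ 0)
    (h : M * A * Mᴴ = A) : star M.trace = M.trace := by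
  have h1 := mul_add_mul_conjTranspose hM h
  have h2 := congrArg Matrix.conjTranspose h1
  rw [Matrix.conjTranspose_add, Matrix.conjTranspose_mul, Matrix.conjTranspose_mul,
    Matrix.conjTranspose_conjTranspose, hA.eq, Matrix.conjTranspose_smul, star_star, hA.eq,
    add_comm, h1] at h2
  exact smul_left_injective ℂ hA0 h2

/-- The traceless part of a matrix. -/
def traceless (M : Matrix (Fin 2) (Fin 2) ℂ) : Matrix (Fin 2) (Fin 2) ℂ := M - (M.trace / 2) • 1

lemma traceless_mul_add (hM : M.det = 1) (ht : star M.trace = M.trace) (h : M * A * Mᴴ = A) :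
    traceless M * A + A * (traceless M)ᴴ = 0 := by
  have h1 := mul_add_mul_conjTranspose hM h
  have h2 : star (M.trace / 2) = M.trace / 2 := by rw [star_div₀, ht]; simp
  rw [traceless, Matrix.conjTranspose_sub, Matrix.conjTranspose_smul, Matrix.conjTranspose_one, h2,
    sub_mul, mul_sub, Matrix.smul_mul, Matrix.mul_smul, one_mul, mul_one, sub_add_sub_comm, h1, ht,
    ← add_smul, add_halves, sub_self]

lemma traceless_sq (hM : M.det = 1) :
    traceless M * traceless M = (M.trace ^ 2 / 4 - 1) • 1 := by
  rw [traceless, sub_mul, mul_sub, mul_sub, sq_eq_trace_smul_sub hM]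
  simp only [Matrix.smul_mul, Matrix.mul_smul, one_mul, mul_one]
  module

lemma eq_zero_of_mul_mul_conjTranspose (hA : A.PosDef) (h : N * A * Nᴴ = 0) : N = 0 := by
  have h1 : ∀ x, Nᴴ *ᵥ x = 0 := by
    intro x
    by_contra hx
    have := hA.dotProduct_mulVec_pos hx
    rw [Matrix.mulVec_mulVec, Matrix.star_mulVec, Matrix.conjTranspose_conjTranspose,
      ← Matrix.dotProduct_mulVec, Matrix.mulVec_mulVec, ← mul_assoc, h] at this
    simp at this
  have h2 : Nᴴ = 0 := by
    ext i j
    have := congrFun (h1 (Pi.single j 1)) i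
    simpa using this
  exact Matrix.conjTranspose_eq_zero.mp h2

/-- For the traceless part `h` of `M` one has `h A hᴴ = (1 - t ^ 2 / 4) A`. The left-hand side is
positive semidefinite, so the factor is nonnegative; if the factor is zero, then so is `h`. -/
lemma trace_bound (hM : M.det = 1) (hA : A.PosDef) (h : M * A * Mᴴ = A) :
    ∃ t : ℝ, M.trace = t ∧ t ^ 2 ≤ 4 ∧ (t ^ 2 = 4 → M = ((t / 2 : ℝ) : ℂ) • 1) := by
  have hA0 : A ≠ 0 := by
    rintro rfl
    have := hA.trace_pos
    simp at this
  have ht := trace_real_of_fixes hM hA.isHermitian hA0 h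
  obtain ⟨t, ht'⟩ := Complex.conj_eq_iff_real.mp ht
  have key : traceless M * A * (traceless M)ᴴ = ((1 - t ^ 2 / 4 : ℝ) : ℂ) • A := by
    have h1 := eq_neg_of_add_eq_zero_right (traceless_mul_add hM ht h)
    rw [mul_assoc, h1, mul_neg, ← mul_assoc, traceless_sq hM, ht', Matrix.smul_mul, one_mul]
    push_cast
    module
  refine ⟨t, ht', ?_, ?_⟩
  · have h1 : (traceless M * A * (traceless M)ᴴ).PosSemidef :=
      hA.posSemidef.mul_mul_conjTranspose_same _
    have h2 := h1.trace_nonneg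
    rw [key, Matrix.trace_smul, smul_eq_mul] at h2
    have h3 := hA.trace_pos
    rw [Complex.lt_def] at h3
    rw [Complex.le_def] at h2
    have h4 := h2.1
    rw [Complex.re_ofReal_mul] at h4
    have h5 : 0 < A.trace.re := h3.1
    by_contra hcon
    have : (1 - t ^ 2 / 4) * A.trace.re < 0 := mul_neg_of_neg_of_pos (by linarith) h5
    simp at h4
    linarith
  · intro h4
    rw [h4] at key
    norm_num at key
    have := eq_zero_of_mul_mul_conjTranspose hA key
    rw [traceless, sub_eq_zero, ht'] at this
    rw [this]
    push_cast
    rfl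

/-- The commutant of a matrix which is not scalar. -/
lemma exists_eq_add_smul_of_commute (hM : ∀ x : ℂ, M ≠ x • 1) (h : N * M = M * N) :
    ∃ x y : ℂ, N = x • 1 + y • M := by
  have e00 := congrFun (congrFun h 0) 0
  have e01 := congrFun (congrFun h 0) 1
  have e10 := congrFun (congrFun h 1) 0
  have e11 := congrFun (congrFun h 1) 1
  simp only [Matrix.mul_apply, Fin.sum_univ_two] at e00 e01 e10 e11
  by_cases hb : M 0 1 = 0
  · by_cases hc : M 1 0 = 0
    · have hd : M 0 0 - M 1 1 ≠ 0 := by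
        intro hd
        refine hM (M 0 0) ?_
        ext i j
        fin_cases i <;> fin_cases j <;> simp [hb, hc, (sub_eq_zero.mp hd).symm]
      have h01 : N 0 1 = 0 := by
        have : N 0 1 * (M 0 0 - M 1 1) = 0 := by rw [hb] at e01; linear_combination -e01
        exact (mul_eq_zero.mp this).resolve_right hd
      have h10 : N 1 0 = 0 := by
        have : N 1 0 * (M 0 0 - M 1 1) = 0 := by rw [hc] at e10; linear_combination e10
        exact (mul_eq_zero.mp this).resolve_right hd
      refine ⟨N 0 0 - (N 0 0 - N 1 1) / (M 0 0 - M 1 1) * M 0 0,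
        (N 0 0 - N 1 1) / (M 0 0 - M 1 1), ?_⟩
      ext i j
      fin_cases i <;> fin_cases j <;> simp [hb, hc, h01, h10]
      field_simp
      ring
    · refine ⟨N 0 0 - N 1 0 / M 1 0 * M 0 0, N 1 0 / M 1 0, ?_⟩
      ext i j
      fin_cases i <;> fin_cases j <;> simp [hc]
      · rw [hb] at e00 ⊢
        have : N 0 1 * M 1 0 = 0 := by linear_combination e00
        simpa [hc] using this
      · field_simp
        linear_combination e10
  · refine ⟨N 0 0 - N 0 1 / M 0 1 * M 0 0, N 0 1 / M 0 1, ?_⟩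
    ext i j
    fin_cases i <;> fin_cases j <;> simp [hb]
    · field_simp
      linear_combination -e00
    · field_simp
      linear_combination -e01

/-- Both `A` and `B` intertwine `M` with the adjoint of its inverse, so their quotient `B * A⁻¹`
commutes with `M`. -/
lemma fixes_commute (hM : M.det = 1) (hA : A.PosDef) (h : M * A * Mᴴ = A) (hB : M * B * Mᴴ = B) :
    (B * A⁻¹) * M = M * (B * A⁻¹) := by
  have ht := trace_real_of_fixes hM hA.isHermitian (fun h0 => by
    have := hA.trace_pos
    simp [h0] at this) h
  have hu : IsUnit A.det := A.isUnit_iff_isUnit_det.mp hA.isUnit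
  have h1 := mul_add_mul_conjTranspose hM h
  have h2 := mul_add_mul_conjTranspose hM hB
  have e1 : A⁻¹ * M = star M.trace • A⁻¹ - Mᴴ * A⁻¹ := by
    have := congrArg (fun X => A⁻¹ * X * A⁻¹) h1
    simp only [mul_add, add_mul] at this
    rw [← mul_assoc A⁻¹ M A, mul_assoc (A⁻¹ * M), A.mul_nonsing_inv hu, mul_one,
      ← mul_assoc A⁻¹ A, A.nonsing_inv_mul hu, one_mul, Matrix.mul_smul, A.nonsing_inv_mul hu,
      Matrix.smul_mul, one_mul] at this
    rw [← this]
    abel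
  rw [mul_assoc, e1, mul_sub, ← mul_assoc, Matrix.mul_smul, ← mul_assoc]
  rw [eq_sub_of_add_eq' h2, sub_mul, Matrix.smul_mul]
  abel

/-- A Hermitian matrix fixed by `M` is a real combination of `A` and `i h A` with the traceless
part `h` of `M`. -/
lemma exists_real_combination (hM : M.det = 1) (hA : A.PosDef) (h : M * A * Mᴴ = A)
    (hM1 : ∀ x : ℂ, M ≠ x • 1) (hBh : B.IsHermitian) (hB : M * B * Mᴴ = B) :
    ∃ x y : ℝ, B = x • A + y • (Complex.I • (traceless M * A)) := by
  have hu : IsUnit A.det := A.isUnit_iff_isUnit_det.mp hA.isUnit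
  have hA0 : A ≠ 0 := fun h0 => by
    have := hA.trace_pos
    simp [h0] at this
  have ht := trace_real_of_fixes hM hA.isHermitian hA0 h
  obtain ⟨x', y, hxy⟩ := exists_eq_add_smul_of_commute hM1 (fixes_commute hM hA h hB)
  obtain ⟨x, hx⟩ : ∃ x : ℂ, B * A⁻¹ = x • 1 + y • traceless M :=
    ⟨x' + y * (M.trace / 2), by rw [hxy, traceless]; module⟩
  have hBA : B = x • A + y • (traceless M * A) := by
    have := congrArg (· * A) hx
    simp only [mul_assoc, A.nonsing_inv_mul hu, mul_one, add_mul, Matrix.smul_mul, one_mul] at this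
    exact this
  have h1 := eq_neg_of_add_eq_zero_right (traceless_mul_add hM ht h)
  have hS : (traceless M * A)ᴴ = -(traceless M * A) := by
    rw [Matrix.conjTranspose_mul, hA.isHermitian.eq, h1]
  have h2 := hBh.eq
  rw [hBA, Matrix.conjTranspose_add, Matrix.conjTranspose_smul, Matrix.conjTranspose_smul,
    hA.isHermitian.eq, hS] at h2
  -- Here `A` is Hermitian and `traceless M * A` is anti-Hermitian, and they are independent over
  -- `ℂ` because `M` is not scalar. Comparison with the adjoint makes `x` real and `y` purely
  -- imaginary.
  have h3 : (star x - x) • A = (star y + y) • (traceless M * A) := by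
    rw [← sub_eq_zero, ← sub_eq_zero.mpr h2]
    module
  have h4 : star y + y = 0 := by
    by_contra hy
    have h5 := congrArg (· * A⁻¹) h3
    simp only [Matrix.smul_mul, mul_assoc, A.mul_nonsing_inv hu, mul_one] at h5
    refine hM1 ((star x - x) / (star y + y) + M.trace / 2) ?_
    have h6 : traceless M = ((star x - x) / (star y + y)) • 1 := by
      rw [div_eq_inv_mul, mul_smul, h5, smul_smul, inv_mul_cancel₀ hy, one_smul]
    rw [add_smul, ← h6, traceless, sub_add_cancel]
  rw [h4, zero_smul] at h3
  have h5 : star x = x := sub_eq_zero.mp ((smul_eq_zero.mp h3).resolve_right hA0)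
  obtain ⟨x₀, hx₀⟩ := Complex.conj_eq_iff_real.mp h5
  have h6 : y = ((y.im : ℝ) : ℂ) * Complex.I := by
    apply Complex.ext
    · have := congrArg Complex.re h4
      simp at this ⊢
      linarith
    · simp
  refine ⟨x₀, y.im, ?_⟩
  rw [hBA, hx₀]
  conv_lhs => rw [h6]
  rw [← Complex.coe_smul x₀, ← Complex.coe_smul y.im, smul_smul]

lemma axis_isHermitian (hM : M.det = 1) (hA : A.PosDef) (h : M * A * Mᴴ = A) :
    (Complex.I • (traceless M * A)).IsHermitian := by
  have hA0 : A ≠ 0 := fun h0 => by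
    have := hA.trace_pos
    simp [h0] at this
  have ht := trace_real_of_fixes hM hA.isHermitian hA0 h
  have h1 := eq_neg_of_add_eq_zero_right (traceless_mul_add hM ht h)
  rw [Matrix.IsHermitian, Matrix.conjTranspose_smul, Matrix.conjTranspose_mul,
    hA.isHermitian.eq, h1]
  simp

lemma axis_fixed (h : M * A * Mᴴ = A) :
    M * (Complex.I • (traceless M * A)) * Mᴴ = Complex.I • (traceless M * A) := by
  have e : M * traceless M = traceless M * M := by
    rw [traceless, mul_sub, sub_mul]
    simp
  rw [Matrix.mul_smul, Matrix.smul_mul, ← mul_assoc M, e, mul_assoc (traceless M), mul_assoc,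
    h]

lemma axis_not_smul (hA : A.PosDef) (hM1 : ∀ x : ℂ, M ≠ x • 1) (x : ℂ) :
    Complex.I • (traceless M * A) ≠ x • A := by
  intro e
  have hu : IsUnit A.det := A.isUnit_iff_isUnit_det.mp hA.isUnit
  have h5 := congrArg (· * A⁻¹) e
  simp only [Matrix.smul_mul, mul_assoc, A.mul_nonsing_inv hu, mul_one] at h5
  refine hM1 (-Complex.I * x + M.trace / 2) ?_
  have h6 : traceless M = (-Complex.I * x) • 1 := by
    rw [mul_smul, ← h5, smul_smul]
    simp
  rw [add_smul, ← h6, traceless, sub_add_cancel]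

end TwoByTwo
-- Integers of an imaginary quadratic field
section QuadraticIntegers

/-- The square root of `-m`. -/
def sqrtNeg (m : ℕ) : ℂ := (Real.sqrt m : ℂ) * Complex.I

variable {m : ℕ}

lemma sqrtNeg_mul_self (m : ℕ) : sqrtNeg m * sqrtNeg m = -(m : ℂ) := by
  have h : (Real.sqrt m : ℂ) * (Real.sqrt m : ℂ) = (m : ℂ) := by
    rw [← Complex.ofReal_mul, Real.mul_self_sqrt (Nat.cast_nonneg m)]
    simp
  rw [sqrtNeg, mul_mul_mul_comm, h, Complex.I_mul_I]
  ring

lemma star_sqrtNeg (m : ℕ) : star (sqrtNeg m) = -sqrtNeg m := by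
  simp [sqrtNeg]

lemma sqrtNeg_re (m : ℕ) : (sqrtNeg m).re = 0 := by simp [sqrtNeg]

lemma sqrtNeg_im (m : ℕ) : (sqrtNeg m).im = Real.sqrt m := by simp [sqrtNeg]

lemma exists_rat_coords {x : ℂ} (h : x ∈ IntermediateField.adjoin ℚ {sqrtNeg m}) :
    ∃ r s : ℚ, x = r + s * sqrtNeg m := by
  have hθ := sqrtNeg_mul_self m
  induction h using IntermediateField.adjoin_induction with
  | mem x hx =>
    obtain rfl := Set.mem_singleton_iff.mp hx
    exact ⟨0, 1, by simp⟩
  | algebraMap x => exact ⟨x, 0, by simp⟩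
  | add x y _ _ hx hy =>
    obtain ⟨r, s, rfl⟩ := hx
    obtain ⟨r', s', rfl⟩ := hy
    exact ⟨r + r', s + s', by push_cast; ring⟩
  | inv x _ hx =>
    obtain ⟨r, s, rfl⟩ := hx
    refine ⟨r / (r ^ 2 + m * s ^ 2), -s / (r ^ 2 + m * s ^ 2), ?_⟩
    by_cases h0 : (r ^ 2 + m * s ^ 2 : ℚ) = 0
    · have hr : r = 0 := by nlinarith [sq_nonneg r, mul_nonneg (Nat.cast_nonneg (α := ℚ) m) (sq_nonneg s)]
      have hs : (m : ℚ) * s ^ 2 = 0 := by rw [hr] at h0; simpa using h0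
      have : (s : ℂ) * sqrtNeg m = 0 := by
        rw [← mul_self_eq_zero]
        have : (s : ℂ) * sqrtNeg m * (s * sqrtNeg m) = -((m * s ^ 2 : ℚ) : ℂ) := by
          push_cast
          linear_combination (s : ℂ) ^ 2 * hθ
        rw [this, hs]
        simp
      rw [this, h0]
      simp [hr]
    · have h0' : (r ^ 2 + m * s ^ 2 : ℂ) ≠ 0 := by exact_mod_cast h0
      have e : ((r : ℂ) + s * sqrtNeg m) * (r - s * sqrtNeg m) = r ^ 2 + m * s ^ 2 := by
        linear_combination -(s : ℂ) ^ 2 * hθ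
      push_cast
      refine inv_eq_of_mul_eq_one_right ?_
      rw [← div_self h0', ← e]
      ring
  | mul x y _ _ hx hy =>
    obtain ⟨r, s, rfl⟩ := hx
    obtain ⟨r', s', rfl⟩ := hy
    exact ⟨r * r' - m * s * s', r * s' + s * r', by
      push_cast
      linear_combination (s : ℂ) * s' * hθ⟩

lemma mem_imagQuadRing {x : ℂ} : x ∈ imagQuadRing m ↔
    IsIntegral ℤ x ∧ x ∈ IntermediateField.adjoin ℚ {sqrtNeg m} := Iff.rfl

lemma star_mem_imagQuadRing {x : ℂ} (hx : x ∈ imagQuadRing m) : star x ∈ imagQuadRing m := by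
  rw [mem_imagQuadRing] at hx ⊢
  refine ⟨map_isIntegral_int (starRingEnd ℂ) hx.1, ?_⟩
  obtain ⟨r, s, rfl⟩ := exists_rat_coords hx.2
  have : star ((r : ℂ) + s * sqrtNeg m) = r + (-s : ℚ) * sqrtNeg m := by
    rw [star_add, star_mul, star_sqrtNeg]
    simp
    ring
  rw [this]
  have hθ : sqrtNeg m ∈ IntermediateField.adjoin ℚ {sqrtNeg m} :=
    IntermediateField.mem_adjoin_simple_self ℚ _
  refine add_mem ?_ (mul_mem ?_ hθ)
  · exact IntermediateField.algebraMap_mem _ r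
  · exact IntermediateField.algebraMap_mem _ (-s)

lemma int_of_isIntegral_rat {q : ℚ} (h : IsIntegral ℤ (q : ℂ)) : ∃ n : ℤ, q = n := by
  have h1 : IsIntegral ℤ q := by
    have : IsIntegral ℤ (algebraMap ℚ ℂ q) := by simpa using h
    exact (isIntegral_algebraMap_iff (algebraMap ℚ ℂ).injective).mp this
  obtain ⟨n, hn⟩ := IsIntegrallyClosed.isIntegral_iff.mp h1
  exact ⟨n, by simpa using hn.symm⟩

/-- The square of the denominator of `q` is prime to that of the numerator, so it divides `m`, which
is squarefree. -/
lemma int_of_squarefree_mul_sq (hm : Squarefree m) {q : ℚ} {n : ℤ} (h : m * q ^ 2 = n) :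
    ∃ b : ℤ, q = b := by
  have hden : q.den * q.den ∣ m := by
    have h1 : (m : ℤ) * q.num ^ 2 = n * (q.den : ℤ) ^ 2 := by
      have h2 := Rat.num_div_den q
      have h3 : (q.den : ℚ) ≠ 0 := by exact_mod_cast q.den_ne_zero
      rw [← h2] at h
      field_simp at h
      rw [mul_comm n]
      exact_mod_cast h
    have h2 : IsCoprime ((q.den : ℤ) ^ 2) (q.num ^ 2) := by
      refine IsCoprime.pow ?_
      rw [Int.isCoprime_iff_gcd_eq_one, Int.gcd_comm]
      exact q.reduced
    have h3 : ((q.den : ℤ) ^ 2) ∣ m * q.num ^ 2 := ⟨n, by rw [h1]; ring⟩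
    have h4 := h2.dvd_of_dvd_mul_right h3
    rw [← sq]
    exact_mod_cast h4
  have := Nat.isUnit_iff.mp (hm _ hden)
  exact ⟨q.num, by rw [Rat.coe_int_num_of_den_eq_one this]⟩

/-- The coordinates of a quadratic integer. -/
lemma exists_int_coords (hm : Squarefree m) {x : ℂ} (hx : x ∈ imagQuadRing m) :
    ∃ a b n : ℤ, 2 * x = a + b * sqrtNeg m ∧ Complex.normSq x = n ∧ a ^ 2 + m * b ^ 2 = 4 * n := by
  have hx' := star_mem_imagQuadRing hx
  rw [mem_imagQuadRing] at hx hx'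
  obtain ⟨r, s, hrs⟩ := exists_rat_coords hx.2
  have hθ := sqrtNeg_mul_self m
  have hst : star x = r - s * sqrtNeg m := by
    rw [hrs, star_add, star_mul, star_sqrtNeg]
    simp
    ring
  -- The trace `2 * r` and the norm `r ^ 2 + m * s ^ 2` are rational and integral, hence integers.
  -- Then `m * (2 * s) ^ 2` is an integer too, and so is `2 * s`.
  obtain ⟨a, ha⟩ := int_of_isIntegral_rat (q := 2 * r) (by
    have := hx.1.add hx'.1
    rw [hst, hrs] at this
    have e : ((2 * r : ℚ) : ℂ) = r + s * sqrtNeg m + (r - s * sqrtNeg m) := by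
      push_cast
      ring
    rwa [e])
  have hn' : x * star x = ((r ^ 2 + m * s ^ 2 : ℚ) : ℂ) := by
    rw [hst, hrs]
    push_cast
    linear_combination -(s : ℂ) ^ 2 * hθ
  obtain ⟨n, hn⟩ := int_of_isIntegral_rat (q := r ^ 2 + m * s ^ 2) (by
    have := hx.1.mul hx'.1
    rwa [hn'] at this)
  obtain ⟨b, hb⟩ := int_of_squarefree_mul_sq hm (q := 2 * s) (n := 4 * n - a ^ 2) (by
    push_cast
    rw [← hn, ← ha]
    ring)
  refine ⟨a, b, n, ?_, ?_, ?_⟩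
  · have ha' : (2 * r : ℂ) = a := by exact_mod_cast ha
    have hb' : (2 * s : ℂ) = b := by exact_mod_cast hb
    rw [hrs, ← ha', ← hb']
    ring
  · have h1 : ((Complex.normSq x : ℝ) : ℂ) = x * star x := (Complex.mul_conj x).symm
    rw [hn', hn] at h1
    exact_mod_cast h1
  · have h1 : ((a : ℚ) ^ 2 + m * b ^ 2) = 4 * n := by
      rw [← hn, ← ha, ← hb]; ring
    exact_mod_cast h1

lemma sqrtNeg_mem (m : ℕ) : sqrtNeg m ∈ imagQuadRing m := by
  refine mem_imagQuadRing.mpr ⟨?_, IntermediateField.mem_adjoin_simple_self ℚ _⟩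
  refine IsIntegral.of_pow two_pos ?_
  rw [sq, sqrtNeg_mul_self]
  have h : -(m : ℂ) = algebraMap ℤ ℂ (-m) := by simp
  rw [h]
  exact isIntegral_algebraMap

lemma int_of_real (hm : Squarefree m) {x : ℂ} (hx : x ∈ imagQuadRing m) (hr : x.im = 0) :
    ∃ n : ℤ, x = n := by
  obtain ⟨a, b, n, h1, h2, h3⟩ := exists_int_coords hm hx
  have hx' : x = ((a / 2 : ℝ) : ℂ) := by
    apply Complex.ext
    · have := congrArg Complex.re h1
      simp [sqrtNeg_re] at this
      simp only [Complex.ofReal_re]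
      linarith
    · rw [hr, Complex.ofReal_im]
  have h4 : IsIntegral ℤ (((a / 2 : ℚ) : ℚ) : ℂ) := by
    have := (mem_imagQuadRing.mp hx).1
    rw [hx'] at this
    push_cast at this ⊢
    exact this
  obtain ⟨k, hk⟩ := int_of_isIntegral_rat h4
  refine ⟨k, ?_⟩
  rw [hx']
  have : ((a / 2 : ℝ)) = k := by exact_mod_cast congrArg (Rat.cast (K := ℝ)) hk
  rw [this]
  simp

lemma one_le_normSq (hm : Squarefree m) {x : ℂ} (hx : x ∈ imagQuadRing m) (h0 : x ≠ 0) :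
    1 ≤ Complex.normSq x := by
  obtain ⟨a, b, n, h1, h2, h3⟩ := exists_int_coords hm hx
  have := Complex.normSq_pos.mpr h0
  rw [h2] at this ⊢
  have h4 : 0 < n := by exact_mod_cast this
  exact_mod_cast h4

/-- A bound on the norm bounds the two integral coordinates of `2 * x`. -/
lemma finite_bounded (hm : Squarefree m) (C : ℝ) :
    {x : imagQuadRing m | Complex.normSq (x : ℂ) ≤ C}.Finite := by
  have hm0 : 0 < m := Nat.pos_of_ne_zero hm.ne_zero
  choose a b n h1 h2 h3 using fun x : imagQuadRing m => exists_int_coords hm x.2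
  have hinj : Function.Injective fun x => (a x, b x) := by
    intro x y h
    rw [Prod.mk.injEq] at h
    have hx := h1 x
    rw [h.1, h.2, ← h1 y] at hx
    exact Subtype.ext (mul_left_cancel₀ two_ne_zero hx)
  let N : ℤ := ⌊4 * C⌋
  refine Set.Finite.of_finite_image (f := fun x => (a x, b x)) (Set.Finite.subset
    ((Set.finite_Icc (-N) N).prod (Set.finite_Icc (-N) N)) ?_) hinj.injOn
  rintro _ ⟨x, hx, rfl⟩
  have hx : Complex.normSq (x : ℂ) ≤ C := hx
  have h4 : 4 * n x ≤ N := by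
    rw [Int.le_floor]
    push_cast
    rw [← h2]
    linarith
  have h5 := h3 x
  have hm1 : (1 : ℤ) ≤ m := by exact_mod_cast hm0
  have ha : a x ^ 2 ≤ N := by nlinarith [sq_nonneg (b x)]
  have hb : b x ^ 2 ≤ N := by nlinarith [sq_nonneg (b x), sq_nonneg (a x)]
  refine ⟨⟨?_, ?_⟩, ⟨?_, ?_⟩⟩
  · nlinarith [Int.le_self_sq (-a x)]
  · exact (Int.le_self_sq _).trans ha
  · nlinarith [Int.le_self_sq (-b x)]
  · exact (Int.le_self_sq _).trans hb

/-- If the field contains a square root of `-n`, then `m = n`. -/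
lemma eq_of_sq_eq_neg {n : ℕ} (hm : Squarefree m) (hn : Squarefree n) {x : ℂ}
    (hx : x ∈ IntermediateField.adjoin ℚ {sqrtNeg m}) (h : x * x = -n) : m = n := by
  obtain ⟨r, s, rfl⟩ := exists_rat_coords hx
  have hθ := sqrtNeg_mul_self m
  have hn0 : 0 < n := Nat.pos_of_ne_zero hn.ne_zero
  have hm0 : 0 < m := Nat.pos_of_ne_zero hm.ne_zero
  have hsq : 0 < Real.sqrt m := Real.sqrt_pos.mpr (by exact_mod_cast hm0)
  have hre := congrArg Complex.re h
  have him := congrArg Complex.im h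
  simp [sqrtNeg_re, sqrtNeg_im] at hre him
  have h1 : (r : ℝ) * s = 0 := by nlinarith
  have hr : r = 0 := by
    rcases mul_eq_zero.mp h1 with h1 | h1
    · exact_mod_cast h1
    · exfalso
      rw [h1] at hre
      have : (0 : ℝ) < n := by exact_mod_cast hn0
      nlinarith
  have hs : (m : ℚ) * s ^ 2 = n := by
    have h2 : (m : ℝ) * s ^ 2 = n := by
      have := Real.mul_self_sqrt (Nat.cast_nonneg (α := ℝ) m)
      rw [hr] at hre
      simp at hre
      nlinarith
    exact_mod_cast h2
  obtain ⟨b, rfl⟩ := int_of_squarefree_mul_sq hm (n := n) (by exact_mod_cast hs)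
  have h3 : m * b.natAbs ^ 2 = n := by
    have : (m : ℤ) * b ^ 2 = n := by exact_mod_cast hs
    zify
    rw [sq_abs]
    exact this
  have := hn b.natAbs ⟨m, by rw [← h3]; ring⟩
  rw [Nat.isUnit_iff] at this
  rw [this] at h3
  simpa using h3

end QuadraticIntegers
-- Traces, orders and axes of elements which fix a point
section Lifts

variable {m : ℕ}

lemma toComplex_injective :
    Function.Injective (toComplex : Matrix.SpecialLinearGroup (Fin 2) (imagQuadRing m) → _) := by
  intro g h e
  ext i j
  exact congrFun (congrFun e i) j

@[simp]
lemma toComplex_one : toComplex (1 : Matrix.SpecialLinearGroup (Fin 2) (imagQuadRing m)) = 1 := by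
  simp [toComplex]

lemma det_toComplex (g : Matrix.SpecialLinearGroup (Fin 2) (imagQuadRing m)) :
    (toComplex g).det = 1 := by
  have h := congrArg (imagQuadRing m).subtype g.2
  rw [RingHom.map_det] at h
  simpa [toComplex] using h

lemma toComplex_apply (g : Matrix.SpecialLinearGroup (Fin 2) (imagQuadRing m)) (i j : Fin 2) :
    toComplex g i j = (g.1 i j : ℂ) := rfl

lemma trace_toComplex_mem (g : Matrix.SpecialLinearGroup (Fin 2) (imagQuadRing m)) :
    (toComplex g).trace ∈ imagQuadRing m :=
  sum_mem fun i _ => (g.1 i i).2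

lemma toComplex_inv (g : Matrix.SpecialLinearGroup (Fin 2) (imagQuadRing m)) :
    toComplex g⁻¹ = (toComplex g).trace • 1 - toComplex g := by
  rw [← adjugate_eq_trace_sub]
  have h1 : toComplex g⁻¹ * toComplex g = 1 := by rw [← toComplex_mul, inv_mul_cancel, toComplex_one]
  have h2 := (toComplex g).mul_adjugate
  rw [det_toComplex, one_smul] at h2
  calc toComplex g⁻¹ = toComplex g⁻¹ * (toComplex g * (toComplex g).adjugate) := by rw [h2, mul_one]
    _ = _ := by rw [← mul_assoc, h1, one_mul]

lemma scalar_of_toComplex {g : Matrix.SpecialLinearGroup (Fin 2) (imagQuadRing m)} {x : ℂ}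
    (h : toComplex g = x • 1) : toComplex g = 1 ∨ toComplex g = -1 := by
  have h1 := det_toComplex g
  rw [h, Matrix.det_smul, Matrix.det_one, Fintype.card_fin, mul_one] at h1
  rcases eq_or_eq_neg_of_sq_eq_sq x 1 (by rw [h1, one_pow]) with rfl | rfl
  · left; rw [h, one_smul]
  · right; rw [h, neg_one_smul]

lemma mk_eq_one_iff (g : Matrix.SpecialLinearGroup (Fin 2) (imagQuadRing m)) :
    (QuotientGroup.mk g : BianchiGroup m) = 1 ↔ toComplex g = 1 ∨ toComplex g = -1 := by
  rw [QuotientGroup.eq_one_iff, Matrix.SpecialLinearGroup.mem_center_iff]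
  constructor
  · rintro ⟨r, hr, hrg⟩
    refine scalar_of_toComplex (x := r) ?_
    unfold toComplex
    rw [← hrg]
    ext i j
    by_cases h : i = j <;> simp [h]
  · rintro (h | h)
    · refine ⟨1, by simp, ?_⟩
      have : g = 1 := toComplex_injective (by rw [h, toComplex_one])
      rw [this]
      simp
    · refine ⟨-1, by simp, ?_⟩
      ext i j
      have := congrFun (congrFun h i) j
      rw [toComplex_apply] at this
      rw [this]
      by_cases h : i = j <;> simp [h]

lemma mk_eq_mk_iff (g h : Matrix.SpecialLinearGroup (Fin 2) (imagQuadRing m)) :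
    (QuotientGroup.mk g : BianchiGroup m) = QuotientGroup.mk h ↔
      toComplex g = toComplex h ∨ toComplex g = -toComplex h := by
  have e : (QuotientGroup.mk g : BianchiGroup m) = QuotientGroup.mk h ↔
      (QuotientGroup.mk (h⁻¹ * g) : BianchiGroup m) = 1 := by
    rw [QuotientGroup.mk_mul, QuotientGroup.mk_inv, inv_mul_eq_one, eq_comm]
  have e2 : toComplex h * toComplex (h⁻¹ * g) = toComplex g := by
    rw [← toComplex_mul, mul_inv_cancel_left]
  have e3 : toComplex h⁻¹ * toComplex h = 1 := by
    rw [← toComplex_mul, inv_mul_cancel, toComplex_one]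
  rw [e, mk_eq_one_iff]
  constructor
  · rintro (h' | h')
    · left; rw [← e2, h', mul_one]
    · right; rw [← e2, h', mul_neg, mul_one]
  · rintro (h' | h')
    · left; rw [toComplex_mul, h', e3]
    · right; rw [toComplex_mul, h', mul_neg, e3]

lemma hermRep_isHermitian (g : BianchiGroup m) {A : Matrix (Fin 2) (Fin 2) ℂ}
    (hA : A.IsHermitian) : (hermRep m g A).IsHermitian := by
  obtain ⟨g, rfl⟩ := QuotientGroup.mk_surjective g
  rw [hermRep_mk]
  exact Matrix.isHermitian_mul_mul_conjTranspose _ hA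

variable {A B P Q : Matrix (Fin 2) (Fin 2) ℂ}

/-- The fixed vectors of a nontrivial element which fixes a point of hyperbolic space. -/
lemma trace_cases (hm : Squarefree m) (hA : A.PosDef)
    {g : Matrix.SpecialLinearGroup (Fin 2) (imagQuadRing m)}
    (h : toComplex g * A * (toComplex g)ᴴ = A) (hg : (QuotientGroup.mk g : BianchiGroup m) ≠ 1) :
    (toComplex g).trace = 0 ∨ (toComplex g).trace = 1 ∨ (toComplex g).trace = -1 := by
  obtain ⟨t, ht, h4, h5⟩ := trace_bound (det_toComplex g) hA h
  -- A real quadratic integer is a rational integer. Its square is at most 4, and the value 4 is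
  -- excluded because the element would be scalar.
  obtain ⟨n, hn⟩ := int_of_real hm (trace_toComplex_mem g) (by rw [ht]; simp)
  have htn : t = n := by
    rw [hn] at ht
    exact_mod_cast ht.symm
  have hne : t ^ 2 ≠ 4 := fun h => hg ((mk_eq_one_iff g).mpr (scalar_of_toComplex (h5 h)))
  rw [htn] at h4 hne
  have h4' : n ^ 2 ≤ 4 := by exact_mod_cast h4
  have hne' : n ^ 2 ≠ 4 := by exact_mod_cast hne
  have h6 : n ≤ 1 := by nlinarith [lt_of_le_of_ne h4' hne']
  have h7 : -1 ≤ n := by nlinarith [lt_of_le_of_ne h4' hne']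
  rw [hn]
  interval_cases n <;> simp

lemma not_scalar {g : Matrix.SpecialLinearGroup (Fin 2) (imagQuadRing m)}
    (hg : (QuotientGroup.mk g : BianchiGroup m) ≠ 1) (x : ℂ) : toComplex g ≠ x • 1 :=
  fun h => hg ((mk_eq_one_iff g).mpr (scalar_of_toComplex h))

/-- As `M * M = M.trace • M - 1` and `M` is not scalar, the square is scalar only for trace zero. -/
lemma mul_self_eq_one_iff {g : Matrix.SpecialLinearGroup (Fin 2) (imagQuadRing m)}
    (hg : (QuotientGroup.mk g : BianchiGroup m) ≠ 1) :
    (QuotientGroup.mk g : BianchiGroup m) * QuotientGroup.mk g = 1 ↔ (toComplex g).trace = 0 := by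
  rw [← QuotientGroup.mk_mul, mk_eq_one_iff, toComplex_mul, sq_eq_trace_smul_sub (det_toComplex g)]
  constructor
  · intro h
    by_contra ht
    obtain ⟨x, hx⟩ : ∃ x : ℂ, (toComplex g).trace • toComplex g = x • 1 := by
      rcases h with h | h
      · exact ⟨2, by rw [eq_add_of_sub_eq h]; module⟩
      · exact ⟨0, by rw [eq_add_of_sub_eq h]; module⟩
    refine not_scalar hg ((toComplex g).trace⁻¹ * x) ?_
    rw [mul_smul, ← hx, smul_smul, inv_mul_cancel₀ ht, one_smul]
  · intro h
    right
    rw [h, zero_smul, zero_sub]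

lemma mul_mul_self_eq_one {g : Matrix.SpecialLinearGroup (Fin 2) (imagQuadRing m)}
    (h : (toComplex g).trace = 1 ∨ (toComplex g).trace = -1) :
    (QuotientGroup.mk g : BianchiGroup m) * QuotientGroup.mk g * QuotientGroup.mk g = 1 := by
  have hs := sq_eq_trace_smul_sub (det_toComplex g)
  rw [← QuotientGroup.mk_mul, ← QuotientGroup.mk_mul, mk_eq_one_iff, toComplex_mul, toComplex_mul, hs,
    sub_mul, Matrix.smul_mul, hs, one_mul]
  rcases h with h | h
  · right
    rw [h]
    module
  · left
    rw [h]
    module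

lemma fixing_cases (hm : Squarefree m) (hA : A.PosDef) {g : BianchiGroup m}
    (h : hermRep m g A = A) : g = 1 ∨ (g ≠ 1 ∧ g * g = 1) ∨ (g ≠ 1 ∧ g * g * g = 1) := by
  obtain ⟨g, rfl⟩ := QuotientGroup.mk_surjective g
  by_cases hg : (QuotientGroup.mk g : BianchiGroup m) = 1
  · exact Or.inl hg
  · rcases trace_cases hm hA h hg with ht | ht
    · exact Or.inr (Or.inl ⟨hg, (mul_self_eq_one_iff hg).mpr ht⟩)
    · exact Or.inr (Or.inr ⟨hg, mul_mul_self_eq_one ht⟩)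

/-- The Hermitian matrices fixed by a nontrivial element which fixes a point of hyperbolic space form
a plane. -/
lemma exists_axis (hA : A.PosDef) {g : BianchiGroup m} (hg : g ≠ 1) (h : hermRep m g A = A) :
    ∃ D : Matrix (Fin 2) (Fin 2) ℂ, D.IsHermitian ∧ hermRep m g D = D ∧
      LinearIndependent ℝ ![A, D] ∧ ∀ B : Matrix (Fin 2) (Fin 2) ℂ, B.IsHermitian →
        hermRep m g B = B → ∃ x y : ℝ, B = x • A + y • D := by
  obtain ⟨g, rfl⟩ := QuotientGroup.mk_surjective g
  have hA0 : A ≠ 0 := fun h0 => by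
    have := hA.trace_pos
    simp [h0] at this
  refine ⟨Complex.I • (traceless (toComplex g) * A), axis_isHermitian (det_toComplex g) hA h,
    axis_fixed h, ?_, fun B hBh hB =>
      exists_real_combination (det_toComplex g) hA h (not_scalar hg) hBh hB⟩
  rw [LinearIndependent.pair_iff]
  intro s t e
  have ht : t = 0 := by
    by_contra ht
    refine axis_not_smul hA (not_scalar hg) ((-t⁻¹ * s : ℝ) : ℂ) ?_
    rw [Complex.coe_smul, mul_smul, eq_neg_of_add_eq_zero_left e, smul_neg, neg_smul, neg_neg,
      smul_smul, inv_mul_cancel₀ ht, one_smul]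
  rw [ht, zero_smul, add_zero] at e
  exact ⟨(smul_eq_zero.mp e).resolve_right hA0, ht⟩

/-- Three independent Hermitian matrices are only fixed by the identity. -/
lemma mem_span_of_fixed (hA : A.PosDef) {g : BianchiGroup m} (hg : g ≠ 1) (h : hermRep m g A = A)
    (hP : hermRep m g P = P) (hAP : LinearIndependent ℝ ![A, P]) (hPh : P.IsHermitian)
    (hBh : B.IsHermitian) (hB : hermRep m g B = B) : ∃ x y : ℝ, B = x • A + y • P := by
  obtain ⟨D, -, -, hAD, hD⟩ := exists_axis hA hg h
  obtain ⟨x, y, rfl⟩ := hD B hBh hB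
  obtain ⟨x', y', rfl⟩ := hD P hPh hP
  have hy' : y' ≠ 0 := by
    rintro rfl
    have := LinearIndependent.pair_iff.mp hAP x' (-1) (by module)
    norm_num at this
  refine ⟨x - y / y' * x', y / y', ?_⟩
  rw [smul_add, smul_smul, smul_smul, div_mul_cancel₀ _ hy']
  module

/-- If the commuting lifts of `x` and of an involution `c` fix a point, then `x` is `1` or `c`. -/
lemma eq_one_or_eq_of_commute (hm : Squarefree m) (hA : A.PosDef)
    {x c : Matrix.SpecialLinearGroup (Fin 2) (imagQuadRing m)}
    (hx : toComplex x * A * (toComplex x)ᴴ = A) (hcA : toComplex c * A * (toComplex c)ᴴ = A)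
    (hc : (QuotientGroup.mk c : BianchiGroup m) ≠ 1) (hc0 : (toComplex c).trace = 0)
    (h : toComplex x * toComplex c = toComplex c * toComplex x) :
    (QuotientGroup.mk x : BianchiGroup m) = 1 ∨
      (QuotientGroup.mk x : BianchiGroup m) = QuotientGroup.mk c := by
  by_cases hx1 : (QuotientGroup.mk x : BianchiGroup m) = 1
  · exact Or.inl hx1
  right
  obtain ⟨α, β, hαβ⟩ := exists_eq_add_smul_of_commute (not_scalar hc) h
  have hcc := sq_eq_trace_smul_sub (det_toComplex c)
  rw [hc0, zero_smul, zero_sub] at hcc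
  have htx : (toComplex x).trace = 2 * α := by
    rw [hαβ, Matrix.trace_add, Matrix.trace_smul, Matrix.trace_smul, hc0]
    simp
    ring
  -- The lift of `c` squares to `-1`, so the determinant of `α • 1 + β • c` is `α ^ 2 + β ^ 2`.
  have hsq : α ^ 2 + β ^ 2 = 1 := by
    have h1 : toComplex x * (toComplex x).adjugate = 1 := by
      rw [Matrix.mul_adjugate, det_toComplex, one_smul]
    rw [adjugate_eq_trace_sub, htx, hαβ] at h1
    have h2 : (α • 1 + β • toComplex c) * ((2 * α) • 1 - (α • 1 + β • toComplex c)) =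
        (α ^ 2 + β ^ 2) • (1 : Matrix (Fin 2) (Fin 2) ℂ) := by
      have : (2 * α) • (1 : Matrix (Fin 2) (Fin 2) ℂ) - (α • 1 + β • toComplex c) =
        α • 1 - β • toComplex c := by module
      rw [this, add_mul, mul_sub, mul_sub]
      simp only [Matrix.smul_mul, Matrix.mul_smul, one_mul, mul_one, hcc]
      module
    rw [h2] at h1
    have := congrFun (congrFun h1 0) 0
    simpa using this
  have hβ : (toComplex x * toComplex c).trace = -(2 * β) := by
    rw [hαβ, add_mul, Matrix.smul_mul, Matrix.smul_mul, one_mul, hcc, Matrix.trace_add,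
      Matrix.trace_smul, Matrix.trace_smul, hc0]
    simp
    ring
  have hxcA : toComplex (x * c) * A * (toComplex (x * c))ᴴ = A := by
    rw [toComplex_mul, Matrix.conjTranspose_mul]
    calc _ = toComplex x * (toComplex c * A * (toComplex c)ᴴ) * (toComplex x)ᴴ := by
          simp only [mul_assoc]
      _ = A := by rw [hcA, hx]
  rw [← toComplex_mul] at hβ
  rw [mk_eq_mk_iff]
  rcases trace_cases hm hA hx hx1 with ht | ht
  · have hα : α = 0 := by
      rw [htx] at ht
      simpa using ht
    rw [hα] at hsq
    have hb : β ^ 2 = 1 := by simpa using hsq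
    rw [hαβ, hα, zero_smul, zero_add]
    rcases eq_or_eq_neg_of_sq_eq_sq β 1 (by rw [hb, one_pow]) with rfl | rfl
    · left; rw [one_smul]
    · right; rw [neg_one_smul]
  -- With trace `1` or `-1` one gets `(2 * β) ^ 2 = 3`. But `-(2 * β)` is the trace of `x * c`,
  -- which also fixes `A` and so has trace `0`, `±1` or `±2`.
  · exfalso
    have hα : 4 * α ^ 2 = 1 := by
      rw [htx] at ht
      rcases ht with ht | ht
      · linear_combination (2 * α + 1) * ht
      · linear_combination (2 * α - 1) * ht
    have hb : (2 * β) ^ 2 = 3 := by linear_combination 4 * hsq - hα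
    by_cases h1 : (QuotientGroup.mk (x * c) : BianchiGroup m) = 1
    · rcases (mk_eq_one_iff _).mp h1 with h2 | h2 <;> rw [h2] at hβ <;> simp at hβ
      · have e : 2 * β = -2 := by linear_combination hβ
        rw [e] at hb
        norm_num at hb
      · rw [hβ] at hb
        norm_num at hb
    · rcases trace_cases hm hA hxcA h1 with h2 | h2 | h2 <;> rw [h2] at hβ
      · have e : 2 * β = 0 := by linear_combination hβ
        rw [e] at hb
        norm_num at hb
      · have e : 2 * β = -1 := by linear_combination hβ
        rw [e] at hb
        norm_num at hb
      · have e : 2 * β = 1 := by linear_combination hβ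
        rw [e] at hb
        norm_num at hb

end Lifts
-- Conjugacy in groups whose elements have square or cube one
section Abstract

variable {F : Type} [Group F]

/-- By `hC`, besides `1` and `x` only `y` and `x * y` commute with `x`. If `s` conjugates `y` to
`x`, then it conjugates `x` to `y` or to `x * y`, and the second case is the claim. In the first
case `s` exchanges `x` and `y`. Then `s * s` commutes with `y`, which excludes `s * s * s = 1`; and
`s` commutes with `x * y`, so an `s` of square one would lie in the four-group and commute with `y`.
-/
lemma isConj_third (h23 : ∀ g : F, g * g = 1 ∨ g * g * g = 1)
    (hC : ∀ c x y : F, c ≠ 1 → c * c = 1 → x * c = c * x → y * c = c * y → x ≠ 1 → x ≠ c →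
      y ≠ 1 → y ≠ c → x = y ∨ x = c * y)
    {x y : F} (hx : x ≠ 1) (hxx : x * x = 1) (hy : y ≠ 1) (hyy : y * y = 1) (hxy : x ≠ y)
    (hcomm : x * y = y * x) (h : IsConj y x) : IsConj (x * y) x := by
  obtain ⟨s, hs⟩ := isConj_iff.mp h
  have hs' : s * y = x * s := by rw [← hs]; group
  have hw : (s * x * s⁻¹) * x = x * (s * x * s⁻¹) := by
    calc s * x * s⁻¹ * x = s * x * s⁻¹ * (s * y * s⁻¹) := by rw [hs]
      _ = s * (x * y) * s⁻¹ := by group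
      _ = s * (y * x) * s⁻¹ := by rw [hcomm]
      _ = (s * y * s⁻¹) * (s * x * s⁻¹) := by group
      _ = x * (s * x * s⁻¹) := by rw [hs]
  have hny : ¬ s * y = y * s := fun e => hxy (by
    rw [← hs, e]
    group)
  rcases hC x (s * x * s⁻¹) y hx hxx hw hcomm.symm (by simpa using hx) (by
    intro e
    apply hxy
    have : s * x * s⁻¹ = s * y * s⁻¹ := by rw [e, hs]
    simpa using this) hy hxy.symm with e | e
  · exfalso
    have hs2 : s * x = y * s := by rw [← e]; group
    rcases h23 s with h2 | h3
    · have hz : s * (x * y) = (x * y) * s := by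
        rw [← mul_assoc, hs2, mul_assoc, hs', ← mul_assoc, hcomm]
      have hz1 : x * y ≠ 1 := fun e => hxy (by
        rw [← mul_right_inj y, ← hcomm, e, hyy])
      have hzz : (x * y) * (x * y) = 1 := by
        have : (x * y) * (x * y) = x * (y * x) * y := by group
        rw [this, ← hcomm, ← mul_assoc, hxx, one_mul, hyy]
      have hsz : s ≠ x * y := fun e' => hny (by
        rw [e', mul_assoc, hyy, mul_one, hcomm, ← mul_assoc, hyy, one_mul])
      have hs1 : s ≠ 1 := fun e' => hny (by rw [e', one_mul, mul_one])
      rcases hC (x * y) s x hz1 hzz hz (by rw [hcomm, mul_assoc, hxx, mul_one,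
        ← hcomm, ← mul_assoc, hxx, one_mul]) hs1 hsz hx (fun e' => hy (by simpa using e'.symm))
        with e' | e'
      · exact hny (by rw [e', hcomm])
      · refine hny ?_
        rw [e', hcomm, mul_assoc y x x, hxx, mul_one]
    · refine hny ?_
      have h4 : s * s * y = y * (s * s) := by
        rw [mul_assoc, hs', ← mul_assoc, hs2, mul_assoc]
      have h5 : s * s = s⁻¹ := eq_inv_of_mul_eq_one_left h3
      rw [h5] at h4
      have := congrArg (fun t => s * t * s) h4
      simpa [mul_assoc] using this.symm
  · exact (isConj_iff.mpr ⟨s, e⟩).symm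

/-- If `c * d` has cube one, then it conjugates `c` to `d`, as in a dihedral group of order six.
Otherwise `c` and `d` commute, and if they differ, then `d` is `k` or `c * k`. Each of these is
conjugate to `c` or to `d`. If one of them is conjugate to `c`, then both are by `isConj_third`; if
both are conjugate to `d`, then they are conjugate to each other, and the third involution `c` is
conjugate to them as well. -/
lemma isConj_of_involutions (h23 : ∀ g : F, g * g = 1 ∨ g * g * g = 1)
    (hC : ∀ c x y : F, c ≠ 1 → c * c = 1 → x * c = c * x → y * c = c * y → x ≠ 1 → x ≠ c →
      y ≠ 1 → y ≠ c → x = y ∨ x = c * y)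
    (hC2 : ∀ c x : F, c ≠ 1 → c * c = 1 → x * c = c * x → x * x = 1)
    {c d k : F} (hc : c ≠ 1) (hcc : c * c = 1) (hd : d ≠ 1) (hdd : d * d = 1)
    (hall : ∀ x : F, x ≠ 1 → x * x = 1 → IsConj x c ∨ IsConj x d)
    (hk : k ≠ 1) (hkc : k ≠ c) (hcomm : k * c = c * k) : IsConj c d := by
  rcases h23 (c * d) with h | h
  · have hcd : c * d = d * c := by
      have := congrArg (fun t => c * t * d) h
      simp only [mul_one] at this
      rw [← this, ← mul_assoc, ← mul_assoc, ← mul_assoc, hcc, one_mul, mul_assoc, hdd, mul_one]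
    by_cases hdc : d = c
    · rw [hdc]
    have hkk := hC2 c k hc hcc hcomm
    have hck1 : c * k ≠ 1 := fun e => hkc (by rw [← mul_right_inj c, e, hcc])
    have hckk : (c * k) * (c * k) = 1 := by
      have : (c * k) * (c * k) = c * (k * c) * k := by group
      rw [this, hcomm, ← mul_assoc, hcc, one_mul, hkk]
    have hckc : c * k ≠ c := by simpa using hk
    have hkck : k ≠ c * k := by simpa using hc
    have hcck : c * (c * k) = c * k * c := by rw [mul_assoc, hcomm]
    have hk1 : IsConj k c ∧ IsConj (c * k) c ∨ IsConj c d := by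
      rcases hall k hk hkk with h1 | h1
      · exact Or.inl ⟨h1, isConj_third h23 hC hc hcc hk hkk hkc.symm hcomm.symm h1⟩
      · rcases hall (c * k) hck1 hckk with h2 | h2
        · refine Or.inl ⟨?_, h2⟩
          have := isConj_third h23 hC hc hcc hck1 hckk hckc.symm hcck h2
          rwa [← mul_assoc, hcc, one_mul] at this
        · have h3 : IsConj (c * k) k := h2.trans h1.symm
          have := isConj_third h23 hC hk hkk hck1 hckk hkck (by
            rw [← mul_assoc, hcomm, mul_assoc]) h3
          rw [← mul_assoc, hcomm, mul_assoc, hkk, mul_one] at this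
          exact Or.inr (this.trans h1)
    rcases hk1 with ⟨h1, h2⟩ | h1
    · rcases hC c d k hc hcc hcd.symm hcomm hd hdc hk hkc with rfl | rfl
      · exact h1.symm
      · exact h2.symm
    · exact h1
  · refine isConj_iff.mpr ⟨c * d, ?_⟩
    have e1 : (c * d)⁻¹ = d * c := by
      rw [mul_inv_rev, inv_eq_of_mul_eq_one_left hcc, inv_eq_of_mul_eq_one_left hdd]
    have e2 : c * d * c * d * c = d := by
      calc c * d * c * d * c = c * d * (c * d) * (c * d) * d := by
            simp only [mul_assoc, hdd, mul_one]
        _ = d := by rw [h, one_mul]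
    rw [e1]
    simpa only [mul_assoc] using e2

/-- These are the defining relations of the tetrahedral group. They give `x * y * x = y⁻¹`, from
which the explicit conjugating element is verified. -/
lemma isConj_of_cubes {x y : F} (hx : x * x * x = 1) (hy : y * y * y = 1)
    (h : (x * y) * (x * y) = 1) : IsConj x y⁻¹ := by
  refine isConj_iff.mpr ⟨x⁻¹ * y * x⁻¹, ?_⟩
  have h1 : x * y * x = y⁻¹ := by
    rw [eq_inv_iff_mul_eq_one, ← h]; group
  have h2 : y * x = x⁻¹ * y⁻¹ := by
    rw [← h1]; group
  have hxi : x⁻¹ * x⁻¹ = x := by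
    rw [← mul_one (x⁻¹ * x⁻¹), ← hx]; group
  have hyi : y⁻¹ * y⁻¹ = y := by
    rw [← mul_one (y⁻¹ * y⁻¹), ← hy]; group
  calc x⁻¹ * y * x⁻¹ * x * (x⁻¹ * y * x⁻¹)⁻¹ = x⁻¹ * (y * x) * y⁻¹ * x := by group
    _ = (x⁻¹ * x⁻¹) * (y⁻¹ * y⁻¹) * x := by rw [h2]; group
    _ = y⁻¹ := by rw [hxi, hyi, h1]

end Abstract

/-! ### Involutions and elements of order three in the stabiliser of a point -/

section Stabilisers

variable {m : ℕ} {A P : Matrix (Fin 2) (Fin 2) ℂ}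

lemma hermRep_mul_fix {x y : BianchiGroup m} (hx : hermRep m x A = A) (hy : hermRep m y A = A) :
    hermRep m (x * y) A = A := by
  rw [map_mul, Module.End.mul_apply, hy, hx]

lemma hermRep_inv_fix {x : BianchiGroup m} (hx : hermRep m x A = A) : hermRep m x⁻¹ A = A := by
  conv_lhs => rw [← hx]
  simp

/-- The pointwise stabiliser of a geodesic contains at most one involution. -/
lemma eq_of_involutions (hm : Squarefree m) (hA : A.PosDef) (hP : P.IsHermitian)
    (hAP : LinearIndependent ℝ ![A, P]) {x y : BianchiGroup m} (hx : x ≠ 1)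
    (hy : y ≠ 1) (hyy : y * y = 1) (hxA : hermRep m x A = A) (hyA : hermRep m y A = A)
    (hxP : hermRep m x P = P) (hyP : hermRep m y P = P) (hxx : x * x = 1) : x = y := by
  obtain ⟨x, rfl⟩ := QuotientGroup.mk_surjective x
  obtain ⟨y, rfl⟩ := QuotientGroup.mk_surjective y
  have hu : IsUnit A.det := A.isUnit_iff_isUnit_det.mp hA.isUnit
  have hN : ∀ z : ℂ, P * A⁻¹ ≠ z • 1 := by
    intro z hz
    have h1 : P = z • A := by
      have := congrArg (· * A) hz
      simpa only [mul_assoc, A.nonsing_inv_mul hu, mul_one, Matrix.smul_mul, one_mul] using this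
    have hA0 : A ≠ 0 := fun h0 => by simp [h0] at hu
    have h2 := hP.eq
    rw [h1, Matrix.conjTranspose_smul, hA.isHermitian.eq] at h2
    obtain ⟨r, hr⟩ := Complex.conj_eq_iff_real.mp (smul_left_injective ℂ hA0 h2)
    have := LinearIndependent.pair_iff.mp hAP r (-1) (by
      rw [h1, hr, Complex.coe_smul]; module)
    norm_num at this
  have cx := fixes_commute (det_toComplex x) hA hxA hxP
  have cy := fixes_commute (det_toComplex y) hA hyA hyP
  obtain ⟨a, b, hab⟩ := exists_eq_add_smul_of_commute hN cx.symm
  -- Both lifts commute with the matrix `P * A⁻¹`, which is not scalar, and its commutant is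
  -- commutative.
  have hxy : toComplex x * toComplex y = toComplex y * toComplex x := by
    rw [hab, add_mul, mul_add, Matrix.smul_mul, Matrix.smul_mul, Matrix.mul_smul, Matrix.mul_smul,
      cy, one_mul, mul_one]
  exact (eq_one_or_eq_of_commute hm hA hxA hyA hy ((mul_self_eq_one_iff hy).mp hyy) hxy).resolve_left
    hx

lemma commute_lift {x c : Matrix.SpecialLinearGroup (Fin 2) (imagQuadRing m)}
    (h : (QuotientGroup.mk x : BianchiGroup m) * QuotientGroup.mk c =
      QuotientGroup.mk c * QuotientGroup.mk x) :
    toComplex x * toComplex c = toComplex c * toComplex x ∨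
      toComplex x * toComplex c = -(toComplex c * toComplex x) := by
  rw [← QuotientGroup.mk_mul, ← QuotientGroup.mk_mul, mk_eq_mk_iff] at h
  simpa only [toComplex_mul] using h

/-- The lifts commute up to sign. If they commute, then `x` is `1` or `c`; if they anticommute, then
conjugation by the lift of `c` changes the sign of the trace of `x`, so this trace is zero. -/
lemma mul_self_of_commute (hm : Squarefree m) (hA : A.PosDef) {c x : BianchiGroup m} (hc : c ≠ 1)
    (hcc : c * c = 1) (hcA : hermRep m c A = A) (hxA : hermRep m x A = A) (h : x * c = c * x) :
    x * x = 1 := by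
  by_cases hx : x = 1
  · rw [hx, one_mul]
  obtain ⟨x, rfl⟩ := QuotientGroup.mk_surjective x
  obtain ⟨c, rfl⟩ := QuotientGroup.mk_surjective c
  have hc0 := (mul_self_eq_one_iff hc).mp hcc
  rcases commute_lift h with h | h
  · rw [(eq_one_or_eq_of_commute hm hA hxA hcA hc hc0 h).resolve_left hx, hcc]
  · rw [mul_self_eq_one_iff hx]
    have h1 : toComplex x = -(toComplex c * toComplex x * toComplex c⁻¹) := by
      rw [← neg_mul, ← h, mul_assoc, ← toComplex_mul, mul_inv_cancel, toComplex_one, mul_one]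
    have h2 := congrArg Matrix.trace h1
    rw [Matrix.trace_neg, Matrix.trace_mul_comm, ← mul_assoc, ← toComplex_mul, inv_mul_cancel,
      toComplex_one, one_mul] at h2
    exact self_eq_neg.mp h2

/-- Outside `1` and `c`, a lift can commute with that of `c` only up to the sign `-1`. The signs of
`x` and `y` cancel in the product, so that `x * y` is `1` or `c`. -/
lemma eq_or_eq_mul_of_commute (hm : Squarefree m) (hA : A.PosDef) {c x y : BianchiGroup m}
    (hc : c ≠ 1) (hcc : c * c = 1) (hcA : hermRep m c A = A) (hxA : hermRep m x A = A)
    (hyA : hermRep m y A = A) (hx : x * c = c * x) (hy : y * c = c * y) (hx1 : x ≠ 1) (hxc : x ≠ c)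
    (hy1 : y ≠ 1) (hyc : y ≠ c) : x = y ∨ x = c * y := by
  have hyy := mul_self_of_commute hm hA hc hcc hcA hyA hy
  have hxyA := hermRep_mul_fix hxA hyA
  have key : x * y = 1 ∨ x * y = c := by
    obtain ⟨x, rfl⟩ := QuotientGroup.mk_surjective x
    obtain ⟨y, rfl⟩ := QuotientGroup.mk_surjective y
    obtain ⟨c, rfl⟩ := QuotientGroup.mk_surjective c
    have hc0 := (mul_self_eq_one_iff hc).mp hcc
    have hx' := (commute_lift hx).resolve_left fun h =>
      (eq_one_or_eq_of_commute hm hA hxA hcA hc hc0 h).elim hx1 hxc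
    have hy' := (commute_lift hy).resolve_left fun h =>
      (eq_one_or_eq_of_commute hm hA hyA hcA hc hc0 h).elim hy1 hyc
    refine eq_one_or_eq_of_commute (x := x * y) hm hA hxyA hcA hc hc0 ?_
    rw [toComplex_mul, mul_assoc, hy', mul_neg, ← mul_assoc, hx', neg_mul, neg_neg, mul_assoc]
  rcases key with h | h
  · left
    rw [← mul_left_inj y, h, hyy]
  · right
    rw [← h, mul_assoc, hyy, mul_one]

/-- Two elements of order three which fix a point generate conjugate subgroups of its stabiliser. -/
lemma conj_of_order_three (hm : Squarefree m) (hA : A.PosDef) {x y : BianchiGroup m}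
    (hx : x ≠ 1) (hxx : x * x * x = 1) (hy : y ≠ 1) (hyy : y * y * y = 1)
    (hxA : hermRep m x A = A) (hyA : hermRep m y A = A) :
    x = y ∨ x = y⁻¹ ∨ (x * y) * (x * y) = 1 ∨ (x * y⁻¹) * (x * y⁻¹) = 1 := by
  have hlift : ∀ z : BianchiGroup m, z ≠ 1 → z * z * z = 1 → hermRep m z A = A →
      ∃ w : Matrix.SpecialLinearGroup (Fin 2) (imagQuadRing m), QuotientGroup.mk w = z ∧
        (toComplex w).trace = -1 := by
    intro z hz hzz hzA
    obtain ⟨w, rfl⟩ := QuotientGroup.mk_surjective z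
    rcases trace_cases hm hA hzA hz with h | h | h
    · have := (mul_self_eq_one_iff hz).mpr h
      rw [this, one_mul] at hzz
      exact absurd hzz hz
    · refine ⟨-w, ?_, ?_⟩
      · rw [mk_eq_mk_iff]
        right
        ext i j
        simp [toComplex_apply]
      · have : toComplex (-w) = -toComplex w := by
          ext i j
          simp [toComplex_apply]
        rw [this, Matrix.trace_neg, h]
    · exact ⟨w, rfl, h⟩
  obtain ⟨x, rfl, hx0⟩ := hlift x hx hxx hxA
  obtain ⟨y, rfl, hy0⟩ := hlift y hy hyy hyA
  -- The lifts have trace `-1`, and the traces of `x * y` and `x * y⁻¹` add up to the product of the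
  -- two traces. If neither product is trivial, both traces are `0` or `±1`, so one of them vanishes
  -- and that product is an involution.
  have hsum : (toComplex (x * y)).trace + (toComplex (x * y⁻¹)).trace = 1 := by
    rw [← Matrix.trace_add, toComplex_mul, toComplex_mul, ← mul_add, toComplex_inv,
      add_sub_cancel, Matrix.mul_smul, mul_one, Matrix.trace_smul, hx0, hy0]
    norm_num
  by_cases h1 : (QuotientGroup.mk (x * y) : BianchiGroup m) = 1
  · right; left
    rw [QuotientGroup.mk_mul] at h1
    exact eq_inv_of_mul_eq_one_left h1
  by_cases h2 : (QuotientGroup.mk (x * y⁻¹) : BianchiGroup m) = 1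
  · left
    rw [QuotientGroup.mk_mul, QuotientGroup.mk_inv] at h2
    exact mul_inv_eq_one.mp h2
  right; right
  have e1 := mul_self_eq_one_iff h1
  have e2 := mul_self_eq_one_iff h2
  rw [QuotientGroup.mk_mul] at e1 e2
  rw [QuotientGroup.mk_inv] at e2
  rw [e1, e2]
  rcases trace_cases hm hA (g := x * y) (hermRep_mul_fix hxA hyA) h1 with h | h | h
  · exact Or.inl h
  · right
    rw [h] at hsum
    linear_combination hsum
  · exfalso
    rw [h] at hsum
    have h3 : (toComplex (x * y⁻¹)).trace = 2 := by linear_combination hsum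
    rcases trace_cases hm hA (g := x * y⁻¹) (hermRep_mul_fix hxA (hermRep_inv_fix hyA)) h2 with
      h | h | h <;> rw [h] at h3 <;> norm_num at h3

end Stabilisers
-- A uniform bound for the stabilisers of points
section Finiteness

variable {m : ℕ} {A : Matrix (Fin 2) (Fin 2) ℂ}

/-- An element which is congruent to the identity modulo `5` and fixes a point is trivial. -/
lemma eq_one_of_congruent (hm : Squarefree m) (hA : A.PosDef)
    {g : Matrix.SpecialLinearGroup (Fin 2) (imagQuadRing m)}
    (h : hermRep m (QuotientGroup.mk g) A = A)
    (hg : ∀ i j, ∃ y ∈ imagQuadRing m, toComplex g i j = (1 : Matrix (Fin 2) (Fin 2) ℂ) i j + 5 * y) :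
    (QuotientGroup.mk g : BianchiGroup m) = 1 := by
  by_contra h1
  obtain ⟨y, hy, hy'⟩ := hg 0 0
  obtain ⟨z, hz, hz'⟩ := hg 1 1
  have ht : (toComplex g).trace = 2 + 5 * (y + z) := by
    rw [Matrix.trace_fin_two, hy', hz']
    simp
    ring
  have hyz : ∀ n : ℤ, (toComplex g).trace = n → ∃ k : ℤ, n = 2 + 5 * k := by
    intro n hn
    obtain ⟨k, hk⟩ := int_of_real hm (add_mem hy hz) (by
      have := congrArg Complex.im (ht.symm.trans hn)
      simpa using this)
    refine ⟨k, ?_⟩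
    rw [hk, hn] at ht
    exact_mod_cast ht
  rcases trace_cases hm hA h h1 with h | h | h
  · obtain ⟨k, hk⟩ := hyz 0 (by simpa using h)
    omega
  · obtain ⟨k, hk⟩ := hyz 1 (by simpa using h)
    omega
  · obtain ⟨k, hk⟩ := hyz (-1) (by simpa using h)
    omega

/-- The reduction of chosen lifts modulo 5 is injective on `H`: an element congruent to the identity
has trace congruent to 2, hence not `0` or `±1`, and is trivial if it fixes a point. So the order is
at most that of `T`, and it divides the factorial. -/
lemma exists_stabilizer_bound (hm : Squarefree m) : ∃ N : ℕ, N ≠ 0 ∧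
    ∀ (H : Subgroup (BianchiGroup m)) (A : Matrix (Fin 2) (Fin 2) ℂ), A.PosDef →
      (∀ g ∈ H, hermRep m g A = A) → Finite H ∧ Nat.card H ∣ N := by
  choose a b n h1 h2 h3 using fun x : imagQuadRing m => exists_int_coords hm x.2
  -- The integral coordinates belong to `2 * x`, so they are needed modulo 10 to determine `x`
  -- modulo 5.
  let T := Fin 2 → Fin 2 → ZMod 10 × ZMod 10
  refine ⟨(Nat.card T).factorial, Nat.factorial_ne_zero _, fun H A hA hH => ?_⟩
  choose l hl using fun g : BianchiGroup m => QuotientGroup.mk_surjective g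
  let F : H → T := fun g i j => (a ((l g).1 i j), b ((l g).1 i j))
  have hF : Function.Injective F := by
    intro g k hgk
    have hdiff : ∀ i j, ∃ y ∈ imagQuadRing m,
        toComplex (l k) i j = toComplex (l g) i j + 5 * y := by
      intro i j
      have e := congrFun (congrFun hgk i) j
      simp only [F, Prod.mk.injEq, ZMod.intCast_eq_intCast_iff_dvd_sub] at e
      obtain ⟨⟨u, hu⟩, v, hv⟩ := e
      have hu' : ((a ((l k).1 i j) : ℤ) : ℂ) = a ((l g).1 i j) + 10 * u := by
        have : a ((l k).1 i j) = a ((l g).1 i j) + 10 * u := by push_cast at hu; linarith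
        exact_mod_cast this
      have hv' : ((b ((l k).1 i j) : ℤ) : ℂ) = b ((l g).1 i j) + 10 * v := by
        have : b ((l k).1 i j) = b ((l g).1 i j) + 10 * v := by push_cast at hv; linarith
        exact_mod_cast this
      refine ⟨u + v * sqrtNeg m, add_mem (intCast_mem _ u) (mul_mem (intCast_mem _ v) (sqrtNeg_mem m)),
        ?_⟩
      have e1 := h1 ((l k).1 i j)
      have e2 := h1 ((l g).1 i j)
      rw [hu', hv'] at e1
      rw [toComplex_apply, toComplex_apply]
      linear_combination (1 / 2 : ℂ) * e1 - (1 / 2 : ℂ) * e2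
    choose y hy hy' using hdiff
    have hfix : hermRep m (g.1⁻¹ * k.1) A = A :=
      hermRep_mul_fix (hermRep_inv_fix (hH _ g.2)) (hH _ k.2)
    have hmk : (QuotientGroup.mk ((l g)⁻¹ * l k) : BianchiGroup m) = g.1⁻¹ * k.1 := by
      rw [QuotientGroup.mk_mul, QuotientGroup.mk_inv, hl, hl]
    have := eq_one_of_congruent hm hA (g := (l g)⁻¹ * l k) (by rw [hmk]; exact hfix) (by
      intro i j
      refine ⟨∑ r, toComplex (l g)⁻¹ i r * y r j, sum_mem fun r _ => mul_mem ?_ (hy r j), ?_⟩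
      · exact ((l g.1)⁻¹.1 i r).2
      · rw [toComplex_mul, Matrix.mul_apply]
        simp only [hy', mul_add, Finset.sum_add_distrib]
        have h5 : ∑ r, toComplex (l g)⁻¹ i r * toComplex (l g) r j =
            (1 : Matrix (Fin 2) (Fin 2) ℂ) i j := by
          rw [← Matrix.mul_apply, ← toComplex_mul, inv_mul_cancel, toComplex_one]
        rw [h5, Finset.mul_sum]
        congr 1
        exact Finset.sum_congr rfl fun r _ => by ring)
    rw [hmk, inv_mul_eq_one] at this
    exact Subtype.ext this
  have hfin : Finite H := Finite.of_injective F hF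
  exact ⟨hfin, Nat.dvd_factorial Nat.card_pos (Nat.card_le_card_of_injective F hF)⟩

end Finiteness
-- Graphs of rotation axes
section TorsionGraph

variable {m ℓ : ℕ} {K : CellFamily (hermRep m)} {A P Q : Matrix (Fin 2) (Fin 2) ℂ}

/-- The stabiliser of a point. -/
def pointStabilizer (m : ℕ) (A : Matrix (Fin 2) (Fin 2) ℂ) : Subgroup (BianchiGroup m) where
  carrier := {g | hermRep m g A = A}
  one_mem' := by simp
  mul_mem' := hermRep_mul_fix
  inv_mem' := hermRep_inv_fix

lemma hermRep_posSemidef (g : BianchiGroup m) (hA : A.PosSemidef) :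
    (hermRep m g A).PosSemidef := by
  obtain ⟨g, rfl⟩ := QuotientGroup.mk_surjective g
  rw [hermRep_mk]
  exact hA.mul_mul_conjTranspose_same _

lemma hermRep_posDef (g : BianchiGroup m) (hA : A.PosDef) : (hermRep m g A).PosDef := by
  obtain ⟨g, rfl⟩ := QuotientGroup.mk_surjective g
  rw [hermRep_mk]
  have hdet : IsUnit (toComplex g) := by
    rw [Matrix.isUnit_iff_isUnit_det, det_toComplex]
    exact isUnit_one
  exact (Matrix.IsUnit.posDef_star_right_conjugate_iff hdet).mpr hA

lemma PosDef.ne_zero (hA : A.PosDef) : A ≠ 0 := by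
  rintro rfl
  have := hA.det_pos
  simp at this

lemma trace_pos (hA : A.PosSemidef) (h0 : A ≠ 0) : 0 < A.trace.re := by
  have h1 := hA.trace_nonneg
  rcases h1.eq_or_lt with h | h
  · exact absurd (hA.trace_eq_zero_iff.mp h.symm) h0
  · exact (Complex.lt_def.mp h).1

lemma smul_posDef (hA : A.PosDef) {t : ℝ} (ht : 0 < t) : (t • A).PosDef := by
  exact hA.smul ht

lemma smul_posSemidef (hA : A.PosSemidef) {t : ℝ} (ht : 0 < t) : (t • A).PosSemidef := by
  exact hA.smul ht.le

/-- The families of open geodesic segments and points in hyperbolic space which behave like the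
graph of the axes of rotations of order `ℓ`. -/
structure IsTorsionGraph (ℓ : ℕ) (K : CellFamily (hermRep m)) : Prop where
  shape : ∀ σ ∈ K.cells, (∃ A, A.PosDef ∧ σ = ray A) ∨
    ∃ P Q, LinearIndependent ℝ ![P, Q] ∧ P.PosSemidef ∧ Q.PosSemidef ∧ σ = seg P Q ∧
      σ ⊆ hyperbolicCone
  eq_of_span : ∀ σ ∈ K.cells, ∀ τ ∈ K.cells, Submodule.span ℝ σ = Submodule.span ℝ τ →
    (σ ∩ τ).Nonempty → σ = τ
  vertex_eq : ∀ A, ray A ∈ K.cells → ∀ σ ∈ K.cells, A ∈ σ → σ = ray A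
  torsion : ∀ σ ∈ K.cells, ∃ g : BianchiGroup m, orderOf g = ℓ ∧ hermRep m g '' σ = σ
  fixed_pointwise : ∀ g : BianchiGroup m, ∀ σ ∈ K.cells, hermRep m g '' σ = σ →
    ∀ A ∈ σ, hermRep m g A = A
  exists_edge : ∀ A, A.PosDef → ray A ∈ K.cells → ∀ g : BianchiGroup m, orderOf g = ℓ →
    hermRep m g A = A → ∀ B : Matrix (Fin 2) (Fin 2) ℂ, B.IsHermitian → hermRep m g B = B →
      LinearIndependent ℝ ![A, B] → ∃ a b : ℝ, 0 < b ∧ seg A (a • A + b • B) ∈ K.cells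

lemma fixed_ends {V : Type} [AddCommGroup V] [Module ℝ V] {f : V →ₗ[ℝ] V} {P Q : V}
    (h : ∀ x ∈ seg P Q, f x = x) : f P = P ∧ f Q = Q := by
  have h1 := h _ ⟨1, 1, one_pos, one_pos, rfl⟩
  have h2 := h _ ⟨2, 1, two_pos, one_pos, rfl⟩
  simp only [map_add, one_smul, two_smul] at h1 h2
  have hP : f P = P := by
    have := congrArg₂ (· - ·) h2 h1
    simpa using this
  refine ⟨hP, ?_⟩
  rw [hP] at h1
  exact add_left_cancel h1

lemma image_eq_of_fixed {V : Type} [AddCommGroup V] [Module ℝ V] {f : V →ₗ[ℝ] V} {P Q : V}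
    (hP : f P = P) (hQ : f Q = Q) : f '' seg P Q = seg P Q := by
  rw [image_seg, hP, hQ]

lemma indep_image {V : Type} [AddCommGroup V] [Module ℝ V] {f : V →ₗ[ℝ] V}
    (hf : Function.Injective f) {P Q : V} (h : LinearIndependent ℝ ![P, Q]) :
    LinearIndependent ℝ ![f P, f Q] := by
  rw [LinearIndependent.pair_iff] at h ⊢
  intro s t e
  refine h s t (hf ?_)
  simpa using e

namespace IsTorsionGraph

lemma eq_ray_of_finrank (hK : IsTorsionGraph ℓ K) {σ : Set (Matrix (Fin 2) (Fin 2) ℂ)}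
    (hσ : σ ∈ K.cells) (h : Module.finrank ℝ (Submodule.span ℝ σ) = 1) :
    ∃ A, A.PosDef ∧ σ = ray A := by
  rcases hK.shape σ hσ with h' | ⟨P, Q, hPQ, -, -, rfl, -⟩
  · exact h'
  · rw [finrank_span_seg hPQ] at h
    omega

lemma eq_seg_of_finrank (hK : IsTorsionGraph ℓ K) {σ : Set (Matrix (Fin 2) (Fin 2) ℂ)}
    (hσ : σ ∈ K.cells) (h : Module.finrank ℝ (Submodule.span ℝ σ) = 2) :
    ∃ P Q, LinearIndependent ℝ ![P, Q] ∧ P.PosSemidef ∧ Q.PosSemidef ∧ σ = seg P Q ∧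
      σ ⊆ hyperbolicCone := by
  rcases hK.shape σ hσ with ⟨A, hA, rfl⟩ | h'
  · rw [finrank_span_ray (PosDef.ne_zero hA)] at h
    omega
  · exact h'

lemma ray_not_seg (hA : A ≠ 0) (h : LinearIndependent ℝ ![P, Q]) : ray A ≠ seg P Q := by
  intro e
  have h1 := finrank_span_ray hA
  rw [e, finrank_span_seg h] at h1
  omega

lemma finrank_le (hK : IsTorsionGraph ℓ K) {σ : Set (Matrix (Fin 2) (Fin 2) ℂ)}
    (hσ : σ ∈ K.cells) : Module.finrank ℝ (Submodule.span ℝ σ) ≤ 2 := by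
  rcases hK.shape σ hσ with ⟨A, hA, rfl⟩ | ⟨P, Q, hPQ, -, -, rfl, -⟩
  · rw [finrank_span_ray (PosDef.ne_zero hA)]
    omega
  · rw [finrank_span_seg hPQ]

lemma isOriented (hK : IsTorsionGraph ℓ K) (p : ℕ) : IsOriented K p := by
  intro f g h
  have hfix := hK.fixed_pointwise g _ f.mem h
  have : (f.translate g).vec = f.vec := by
    funext i
    have hle : Submodule.span ℝ f.cell ≤ LinearMap.eqLocus (hermRep m g) LinearMap.id :=
      Submodule.span_le.mpr hfix
    exact hle (f.mem_span i)
  exact ⟨1, one_pos, this ▸ FramesDiffer.refl _⟩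

lemma smul_mem (hK : IsTorsionGraph ℓ K) {σ : Set (Matrix (Fin 2) (Fin 2) ℂ)}
    (hσ : σ ∈ K.cells) {t : ℝ} (ht : 0 < t) (h : A ∈ σ) : t • A ∈ σ := by
  rcases hK.shape σ hσ with ⟨B, hB, rfl⟩ | ⟨P, Q, hPQ, -, -, rfl, -⟩
  · obtain ⟨s, hs, rfl⟩ := h
    exact ⟨t * s, by positivity, by rw [smul_smul]⟩
  · obtain ⟨a, b, ha, hb, rfl⟩ := h
    exact ⟨t * a, t * b, by positivity, by positivity, by rw [smul_add, smul_smul, smul_smul]⟩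

/-- A vertex cannot lie inside the open edge by `vertex_eq`, so it is one of the ends and may serve
as the first of them. -/
lemma exists_vertex_edge (hK : IsTorsionGraph ℓ K) {v e : Set (Matrix (Fin 2) (Fin 2) ℂ)}
    (h : IsAdjacent K v e) (hv : v = ray A) (hA : A.PosDef) :
    ∃ P, LinearIndependent ℝ ![A, P] ∧ P.PosSemidef ∧ e = seg A P ∧ e ⊆ hyperbolicCone := by
  obtain ⟨⟨hvm, -⟩, ⟨hem, hed⟩, hcl⟩ := h
  obtain ⟨P, Q, hPQ, hP, hQ, rfl, hpos⟩ := hK.eq_seg_of_finrank hem hed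
  subst hv
  have hn : A ∉ seg P Q := fun hmem =>
    ray_not_seg (PosDef.ne_zero hA) hPQ (hK.vertex_eq A hvm _ hem hmem).symm
  rcases eq_end_of_mem_closure hPQ (PosDef.ne_zero hA) (hcl (mem_ray_self A)) hn with e | e
  · obtain ⟨t, ht, rfl⟩ := ray_eq_iff_mem.mp e
    refine ⟨Q, ?_, hQ, (seg_smul_left P Q ht).symm, hpos⟩
    rw [LinearIndependent.pair_iff] at hPQ ⊢
    intro x y hxy
    have := hPQ (x * t) y (by rw [mul_smul]; exact hxy)
    exact ⟨(mul_eq_zero.mp this.1).resolve_right ht.ne', this.2⟩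
  · obtain ⟨t, ht, rfl⟩ := ray_eq_iff_mem.mp e
    refine ⟨P, ?_, hP, by rw [seg_smul_left _ _ ht, seg_comm], hpos⟩
    rw [LinearIndependent.pair_iff] at hPQ ⊢
    intro x y hxy
    have := hPQ y (x * t) (by rw [mul_smul, add_comm]; exact hxy)
    exact ⟨(mul_eq_zero.mp this.2).resolve_right ht.ne', this.1⟩

end IsTorsionGraph

end TorsionGraph

/-! ### Coordinates for an edge fusion -/

section FusionFrame

variable {m ℓ : ℕ} {K : CellFamily (hermRep m)} {P Q : Matrix (Fin 2) (Fin 2) ℂ}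

/-- The coordinates of an edge fusion: the vertex `P + Q` between the opposite edges from `P` and
from `Q` on a common axis. -/
structure FusionFrame (ℓ : ℕ) (K : CellFamily (hermRep m)) (P Q : Matrix (Fin 2) (Fin 2) ℂ) :
    Prop where
  indep : LinearIndependent ℝ ![P, Q]
  left : P.PosSemidef
  right : Q.PosSemidef
  posDef : (P + Q).PosDef
  vertex : ray (P + Q) ∈ K.cells
  left_mem : seg P (P + Q) ∈ K.cells
  right_mem : seg Q (P + Q) ∈ K.cells
  left_pos : seg P (P + Q) ⊆ hyperbolicCone
  right_pos : seg Q (P + Q) ⊆ hyperbolicCone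
  not_same : ¬ SameOrbit (hermRep m) (seg P (P + Q)) (seg Q (P + Q))
  edges : ∀ e, IsAdjacent K (ray (P + Q)) e → ∃ g : BianchiGroup m,
    hermRep m g '' ray (P + Q) = ray (P + Q) ∧
      (hermRep m g '' e = seg P (P + Q) ∨ hermRep m g '' e = seg Q (P + Q))
  torsion : ∃ g : BianchiGroup m, orderOf g = ℓ ∧ hermRep m g P = P ∧ hermRep m g Q = Q

lemma SameOrbit.symm {G V : Type} [Group G] [AddCommGroup V] [Module ℝ V]
    {ρ : Representation ℝ G V} {σ τ : Set V} (h : SameOrbit ρ σ τ) : SameOrbit ρ τ σ := by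
  obtain ⟨g, rfl⟩ := h
  exact ⟨g⁻¹, image_image_inv g σ⟩

lemma SameOrbit.trans {G V : Type} [Group G] [AddCommGroup V] [Module ℝ V]
    {ρ : Representation ℝ G V} {σ τ υ : Set V} (h : SameOrbit ρ σ τ) (h' : SameOrbit ρ τ υ) :
    SameOrbit ρ σ υ := by
  obtain ⟨g, rfl⟩ := h
  obtain ⟨g', rfl⟩ := h'
  exact ⟨g' * g, image_mul g' g σ⟩

lemma SameOrbit.image {G V : Type} [Group G] [AddCommGroup V] [Module ℝ V]
    {ρ : Representation ℝ G V} (g : G) (σ : Set V) : SameOrbit ρ σ (ρ g '' σ) := ⟨g, rfl⟩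

lemma FusionFrame.symm (F : FusionFrame ℓ K P Q) : FusionFrame ℓ K Q P where
  indep := indep_symm F.indep
  left := F.right
  right := F.left
  posDef := add_comm P Q ▸ F.posDef
  vertex := add_comm P Q ▸ F.vertex
  left_mem := add_comm P Q ▸ F.right_mem
  right_mem := add_comm P Q ▸ F.left_mem
  left_pos := add_comm P Q ▸ F.right_pos
  right_pos := add_comm P Q ▸ F.left_pos
  not_same := fun h => F.not_same (add_comm Q P ▸ h.symm)
  edges := fun e he => by
    rw [add_comm Q P] at he ⊢
    obtain ⟨g, hg, h⟩ := F.edges e he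
    exact ⟨g, hg, h.symm⟩
  torsion := F.torsion.imp fun g h => ⟨h.1, h.2.2, h.2.1⟩

/-- The common rotation fixes the plane of `A` and `P`, which therefore contains the other end `Q =
x • A + y • P`. For `y > 0` the two edges would overlap and be equal. So `y < 0`, and traces give `x
> 0`; hence `A` is a positive combination of `P` and `Q`, and becomes their sum after rescaling. -/
lemma exists_fusionFrame (hℓ : ℓ.Prime) (hK : IsTorsionGraph ℓ K)
    {v e₁ e₂ : Set (Matrix (Fin 2) (Fin 2) ℂ)} (h : ExactlyTwoEdges K v e₁ e₂)
    (hg : ∃ g : BianchiGroup m, orderOf g = ℓ ∧ hermRep m g '' e₁ = e₁ ∧ hermRep m g '' e₂ = e₂) :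
    ∃ P Q, FusionFrame ℓ K P Q ∧ v = ray (P + Q) ∧ e₁ = seg P (P + Q) ∧ e₂ = seg Q (P + Q) := by
  obtain ⟨h1, h2, hns, hall⟩ := h
  obtain ⟨A, hA, rfl⟩ := hK.eq_ray_of_finrank h1.1.1 h1.1.2
  obtain ⟨P, hAP, hP, rfl, hpos1⟩ := hK.exists_vertex_edge h1 rfl hA
  obtain ⟨Q, hAQ, hQ, rfl, hpos2⟩ := hK.exists_vertex_edge h2 rfl hA
  obtain ⟨g, hord, hg1, hg2⟩ := hg
  obtain ⟨hgA, hgP⟩ := fixed_ends (hK.fixed_pointwise g _ h1.2.1.1 hg1)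
  obtain ⟨-, hgQ⟩ := fixed_ends (hK.fixed_pointwise g _ h2.2.1.1 hg2)
  have hg1 : g ≠ 1 := by
    rintro rfl
    rw [orderOf_one] at hord
    exact hℓ.one_lt.ne hord
  obtain ⟨x, y, hQe⟩ := mem_span_of_fixed hA hg1 hgA hgP hAP hP.isHermitian hQ.isHermitian hgQ
  have hy0 : y ≠ 0 := by
    rintro rfl
    have := LinearIndependent.pair_iff.mp hAQ x (-1) (by rw [hQe]; simp)
    simpa using this.2
  have hspan : Submodule.span ℝ (seg A P) = Submodule.span ℝ (seg A Q) := by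
    ext z
    rw [mem_span_seg, mem_span_seg]
    constructor
    · rintro ⟨a, b, rfl⟩
      refine ⟨a - b / y * x, b / y, ?_⟩
      rw [hQe, smul_add, smul_smul (b / y) y, div_mul_cancel₀ _ hy0]
      module
    · rintro ⟨a, b, rfl⟩
      exact ⟨a + b * x, b * y, by rw [hQe]; module⟩
  have hyneg : y < 0 := by
    rcases lt_or_gt_of_ne hy0 with h | hy
    · exact h
    · exfalso
      refine hns ⟨1, ?_⟩
      rw [map_one]
      refine (Set.image_id _).trans (hK.eq_of_span _ h1.2.1.1 _ h2.2.1.1 hspan ?_)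
      -- A large multiple of `A` makes both coordinates positive, whatever the sign of `x`.
      refine ⟨(|x| + 1) • A + (1 : ℝ) • Q, ⟨|x| + 1 + x, y, ?_, hy, ?_⟩,
        ⟨|x| + 1, 1, by positivity, one_pos, rfl⟩⟩
      · have := neg_abs_le x
        linarith
      · rw [hQe]; module
  have hAe : x • A = (-y) • P + Q := by rw [hQe]; module
  have hx : 0 < x := by
    have hS : ((-y) • P + Q).PosSemidef := (smul_posSemidef hP (by linarith)).add hQ
    have hP0 : P ≠ 0 := hAP.ne_zero 1
    have hQ0 : Q ≠ 0 := hAQ.ne_zero 1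
    have t1 := trace_pos hP hP0
    have t2 := trace_pos hQ hQ0
    have t3 := trace_pos hA.posSemidef (PosDef.ne_zero hA)
    have := congrArg (fun M => M.trace.re) hAe
    simp only [Matrix.trace_smul, Matrix.trace_add, Complex.add_re, Complex.real_smul,
      Complex.mul_re, Complex.ofReal_re, Complex.ofReal_im, zero_mul, sub_zero] at this
    by_contra hx
    nlinarith [mul_pos (neg_pos.mpr hyneg) t1, mul_nonneg (sub_nonneg.mpr (not_lt.mp hx)) t3.le]
  have hs : 0 < x⁻¹ * (-y) := mul_pos (inv_pos.mpr hx) (by linarith)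
  have hs' : 0 < x⁻¹ := inv_pos.mpr hx
  have hAe' : (x⁻¹ * (-y)) • P + x⁻¹ • Q = A := by
    rw [mul_smul, ← smul_add, ← hAe, smul_smul, inv_mul_cancel₀ hx.ne', one_smul]
  have e1 : seg ((x⁻¹ * (-y)) • P) A = seg A P := by rw [seg_smul_left _ _ hs, seg_comm]
  have e2 : seg (x⁻¹ • Q) A = seg A Q := by rw [seg_smul_left _ _ hs', seg_comm]
  refine ⟨(x⁻¹ * (-y)) • P, x⁻¹ • Q, ?_, by rw [hAe'], by rw [hAe', e1], by rw [hAe', e2]⟩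
  refine ⟨?_, smul_posSemidef hP hs, smul_posSemidef hQ hs', ?_, ?_, ?_, ?_, ?_, ?_, ?_, ?_,
    ⟨g, hord, by rw [map_smul, hgP], by rw [map_smul, hgQ]⟩⟩
  · rw [LinearIndependent.pair_iff] at hAP ⊢
    intro a b hab
    have := hAP (b * x⁻¹ * x) (a * (x⁻¹ * (-y)) + b * x⁻¹ * y) (by
      rw [← hab, hQe]; module)
    have hb : b = 0 := by
      have := this.1
      rwa [mul_assoc, inv_mul_cancel₀ hx.ne', mul_one] at this
    subst hb
    refine ⟨?_, rfl⟩
    have := this.2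
    simp only [zero_mul, add_zero] at this
    exact (mul_eq_zero.mp this).resolve_right hs.ne'
  · rwa [hAe']
  · rw [hAe']; exact h1.1.1
  · rw [hAe', e1]; exact h1.2.1.1
  · rw [hAe', e2]; exact h2.2.1.1
  · rw [hAe', e1]; exact hpos1
  · rw [hAe', e2]; exact hpos2
  · rw [hAe', e1, e2]; exact hns
  · rw [hAe', e1, e2]; exact hall

end FusionFrame
-- The two halves of a segment
section HalfSegments

variable {V : Type} [AddCommGroup V] [Module ℝ V] {P Q : V}

lemma mem_half_seg {a b : ℝ} (h : LinearIndependent ℝ ![P, Q]) :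
    a • P + b • Q ∈ seg P (P + Q) ↔ 0 < b ∧ b < a := by
  constructor
  · rintro ⟨x, y, hx, hy, e⟩
    obtain ⟨rfl, rfl⟩ := coeff_eq h (c := x + y) (d := y) (by rw [e]; module)
    exact ⟨hy, by linarith⟩
  · rintro ⟨hb, hba⟩
    exact ⟨a - b, b, by linarith, hb, by module⟩

lemma mem_half_seg' {a b : ℝ} (h : LinearIndependent ℝ ![P, Q]) :
    a • P + b • Q ∈ seg Q (P + Q) ↔ 0 < a ∧ a < b := by
  rw [add_comm (a • P), add_comm P Q]
  exact mem_half_seg (indep_symm h)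

lemma half_seg_subset : seg P (P + Q) ⊆ seg P Q := by
  rintro _ ⟨a, b, ha, hb, rfl⟩
  exact ⟨a + b, b, by positivity, hb, by module⟩

lemma half_seg_subset' : seg Q (P + Q) ⊆ seg P Q := by
  rw [add_comm P Q, seg_comm P Q]
  exact half_seg_subset

lemma ray_subset_seg : ray (P + Q) ⊆ seg P Q := by
  rintro _ ⟨t, ht, rfl⟩
  exact ⟨t, t, ht, ht, by module⟩

lemma seg_eq_union : seg P Q = seg P (P + Q) ∪ ray (P + Q) ∪ seg Q (P + Q) := by
  refine subset_antisymm ?_ (Set.union_subset (Set.union_subset half_seg_subset ray_subset_seg)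
    half_seg_subset')
  rintro _ ⟨a, b, ha, hb, rfl⟩
  rcases lt_trichotomy a b with h | rfl | h
  · exact Or.inr ⟨b - a, a, by linarith, ha, by module⟩
  · exact Or.inl (Or.inr ⟨a, ha, by module⟩)
  · exact Or.inl (Or.inl ⟨a - b, b, by linarith, hb, by module⟩)

lemma span_half_seg : Submodule.span ℝ (seg P (P + Q)) = Submodule.span ℝ (seg P Q) := by
  ext z
  rw [mem_span_seg, mem_span_seg]
  constructor
  · rintro ⟨a, b, rfl⟩
    exact ⟨a + b, b, by module⟩
  · rintro ⟨a, b, rfl⟩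
    exact ⟨a - b, b, by module⟩

lemma span_half_seg' : Submodule.span ℝ (seg Q (P + Q)) = Submodule.span ℝ (seg P Q) := by
  rw [add_comm P Q, seg_comm P Q, span_half_seg]

lemma indep_half (h : LinearIndependent ℝ ![P, Q]) : LinearIndependent ℝ ![P, P + Q] := by
  rw [LinearIndependent.pair_iff] at h ⊢
  intro s t e
  have := h (s + t) t (by rw [← e]; module)
  exact ⟨by linarith [this.1, this.2], this.2⟩

lemma indep_half' (h : LinearIndependent ℝ ![P, Q]) : LinearIndependent ℝ ![Q, P + Q] := by
  rw [add_comm]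
  exact indep_half (indep_symm h)

end HalfSegments

/-! ### The new edge and its translates -/

section Fuse

variable {m ℓ : ℕ} {K : CellFamily (hermRep m)} {P Q : Matrix (Fin 2) (Fin 2) ℂ}

namespace FusionFrame

lemma ray_ne_left (hK : IsTorsionGraph ℓ K) (F : FusionFrame ℓ K P Q) {A : Matrix (Fin 2) (Fin 2) ℂ}
    (hA : ray A ∈ K.cells) : A ∉ seg P (P + Q) := fun h => by
  have h1 := hK.vertex_eq A hA _ F.left_mem h
  have h2 := finrank_span_seg (indep_half F.indep)
  rw [h1, span_ray] at h2
  have := finrank_span_le_card (R := ℝ) ({A} : Set (Matrix (Fin 2) (Fin 2) ℂ))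
  simp at this
  omega

lemma ray_ne_right (hK : IsTorsionGraph ℓ K) (F : FusionFrame ℓ K P Q)
    {A : Matrix (Fin 2) (Fin 2) ℂ} (hA : ray A ∈ K.cells) : A ∉ seg Q (P + Q) := by
  rw [add_comm]
  exact ray_ne_left hK F.symm hA

lemma fixed_left (hK : IsTorsionGraph ℓ K) (F : FusionFrame ℓ K P Q) {g : BianchiGroup m}
    (h : hermRep m g '' seg P (P + Q) = seg P (P + Q)) :
    hermRep m g P = P ∧ hermRep m g Q = Q := by
  obtain ⟨h1, h2⟩ := fixed_ends (hK.fixed_pointwise g _ F.left_mem h)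
  rw [map_add, h1] at h2
  exact ⟨h1, add_left_cancel h2⟩

lemma fixed_right (hK : IsTorsionGraph ℓ K) (F : FusionFrame ℓ K P Q) {g : BianchiGroup m}
    (h : hermRep m g '' seg Q (P + Q) = seg Q (P + Q)) :
    hermRep m g P = P ∧ hermRep m g Q = Q := by
  rw [add_comm P Q] at h
  exact (fixed_left hK F.symm h).symm

lemma image_vertex_mem (F : FusionFrame ℓ K P Q) (g : BianchiGroup m) :
    ray (hermRep m g (P + Q)) ∈ K.cells := by
  rw [← image_ray]
  exact K.image_mem g _ F.vertex

/-- If a translate of the vertex lies in the new edge, then it is the vertex. -/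
lemma image_vertex_eq (hK : IsTorsionGraph ℓ K) (F : FusionFrame ℓ K P Q) {g : BianchiGroup m}
    (h : hermRep m g (P + Q) ∈ seg P Q) : ray (hermRep m g (P + Q)) = ray (P + Q) := by
  rw [seg_eq_union] at h
  rcases h with (h | h) | h
  · exact absurd h (F.ray_ne_left hK (F.image_vertex_mem g))
  · exact ray_eq_of_mem h
  · exact absurd h (F.ray_ne_right hK (F.image_vertex_mem g))

/-- An edge at the vertex on the axis is one of the two. -/
lemma edge_on_axis (hK : IsTorsionGraph ℓ K) (F : FusionFrame ℓ K P Q)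
    {B : Matrix (Fin 2) (Fin 2) ℂ} (hi : LinearIndependent ℝ ![P + Q, B])
    (hB : B ∈ Submodule.span ℝ (seg P Q)) (hm : seg (P + Q) B ∈ K.cells) :
    seg (P + Q) B = seg P (P + Q) ∨ seg (P + Q) B = seg Q (P + Q) := by
  obtain ⟨x, y, rfl⟩ := mem_span_seg.mp hB
  have hxy : x - y ≠ 0 := by
    intro h
    have : x = y := by linarith
    subst this
    have := LinearIndependent.pair_iff.mp hi x (-1) (by module)
    simpa using this.2
  have hspan : Submodule.span ℝ (seg (P + Q) (x • P + y • Q)) = Submodule.span ℝ (seg P Q) := by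
    ext z
    rw [mem_span_seg, mem_span_seg]
    constructor
    · rintro ⟨a, b, rfl⟩
      exact ⟨a + b * x, a + b * y, by module⟩
    · rintro ⟨a, b, rfl⟩
      refine ⟨a - (a - b) / (x - y) * x, (a - b) / (x - y), ?_⟩
      have h1 : b = a - (a - b) / (x - y) * (x - y) := by rw [div_mul_cancel₀ _ hxy]; ring
      have e2 : a • P + b • Q = a • P + (a - (a - b) / (x - y) * (x - y)) • Q := by rw [← h1]
      rw [e2]
      module
  set s := |x| + |y| + 1
  have hs : 0 < s := by positivity
  have hsx : 0 < s + x := by have := neg_abs_le x; have := abs_nonneg y; simp only [s]; linarith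
  have hsy : 0 < s + y := by have := neg_abs_le y; have := abs_nonneg x; simp only [s]; linarith
  have hmem : (s + x) • P + (s + y) • Q ∈ seg (P + Q) (x • P + y • Q) :=
    ⟨s, 1, hs, one_pos, by module⟩
  rcases lt_or_gt_of_ne hxy with h | h
  · right
    exact hK.eq_of_span _ hm _ F.right_mem (hspan.trans span_half_seg'.symm)
      ⟨_, hmem, (mem_half_seg' F.indep).mpr ⟨hsx, by linarith⟩⟩
  · left
    exact hK.eq_of_span _ hm _ F.left_mem (hspan.trans span_half_seg.symm)
      ⟨_, hmem, (mem_half_seg F.indep).mpr ⟨hsy, by linarith⟩⟩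

/-- An element which fixes the vertex and keeps the line of the new edge fixes this line. -/
lemma fixed_of_vertex (hK : IsTorsionGraph ℓ K) (F : FusionFrame ℓ K P Q) {g : BianchiGroup m}
    (hsp : hermRep m g P ∈ Submodule.span ℝ (seg P Q))
    (hv : ray (hermRep m g (P + Q)) = ray (P + Q)) :
    hermRep m g P = P ∧ hermRep m g Q = Q := by
  have he : hermRep m g '' seg P (P + Q) = seg (P + Q) (hermRep m g P) := by
    rw [image_seg, seg_comm, seg_left_of_ray_eq _ hv]
  have hmem : seg (P + Q) (hermRep m g P) ∈ K.cells := he ▸ K.image_mem g _ F.left_mem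
  have hi : LinearIndependent ℝ ![P + Q, hermRep m g P] := by
    obtain ⟨t, ht, e⟩ := ray_eq_iff_mem.mp hv
    have h1 := indep_image (rho_injective (hermRep m) g) (indep_symm (indep_half F.indep))
    rw [e] at h1
    rw [LinearIndependent.pair_iff] at h1 ⊢
    intro x y hxy
    have := h1 (x * t⁻¹) y (by rw [smul_smul, mul_assoc, inv_mul_cancel₀ ht.ne', mul_one, hxy])
    exact ⟨(mul_eq_zero.mp this.1).resolve_right (inv_pos.mpr ht).ne', this.2⟩
  rcases F.edge_on_axis hK hi hsp hmem with h | h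
  · exact F.fixed_left hK (he.trans h)
  · exact absurd ⟨g, he.trans h⟩ F.not_same

lemma left_mem_span {g : BianchiGroup m}
    (hs : Submodule.span ℝ (hermRep m g '' seg P Q) = Submodule.span ℝ (seg P Q)) :
    hermRep m g P ∈ Submodule.span ℝ (seg P Q) := by
  rw [← hs, image_seg, mem_span_seg]
  exact ⟨1, 0, by simp⟩

/-- The vertex has its image inside the new edge, and the vertex itself is the only point of its
orbit there, up to scaling. -/
lemma fixed_of_image (hK : IsTorsionGraph ℓ K) (F : FusionFrame ℓ K P Q) {g : BianchiGroup m}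
    (h : hermRep m g '' seg P Q = seg P Q) : hermRep m g P = P ∧ hermRep m g Q = Q := by
  refine F.fixed_of_vertex hK (left_mem_span (by rw [h])) (F.image_vertex_eq hK ?_)
  rw [← h]
  exact Set.mem_image_of_mem _ (ray_subset_seg (mem_ray_self _))

lemma image_eq (_F : FusionFrame ℓ K P Q) {g : BianchiGroup m} (h : hermRep m g P = P ∧
    hermRep m g Q = Q) : hermRep m g '' seg P Q = seg P Q := by
  rw [image_seg, h.1, h.2]

/-- Two translates of the new edge in the same line which meet are equal. -/
lemma image_eq_of_inter (hK : IsTorsionGraph ℓ K) (F : FusionFrame ℓ K P Q) {g : BianchiGroup m}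
    (hs : Submodule.span ℝ (hermRep m g '' seg P Q) = Submodule.span ℝ (seg P Q))
    (hne : (hermRep m g '' seg P Q ∩ seg P Q).Nonempty) :
    hermRep m g '' seg P Q = seg P Q := by
  obtain ⟨x, ⟨y, hy, rfl⟩, hx⟩ := hne
  rw [seg_eq_union] at hx hy
  have sL : Submodule.span ℝ (hermRep m g '' seg P (P + Q)) = Submodule.span ℝ (seg P Q) := by
    rw [← hs]; exact (span_image_eq_iff g).mpr span_half_seg
  have sR : Submodule.span ℝ (hermRep m g '' seg Q (P + Q)) = Submodule.span ℝ (seg P Q) := by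
    rw [← hs]; exact (span_image_eq_iff g).mpr span_half_seg'
  have mL := K.image_mem g _ F.left_mem
  have mR := K.image_mem g _ F.right_mem
  -- The meeting point lies in one of three pieces of each of the two edges. If a half meets the
  -- translate of a half, then they coincide, and the two halves are in different orbits; a half
  -- does not meet a translate of the vertex; and if the vertex is moved into the new edge, then it
  -- stays in place.
  rcases hy with (hy | hy) | hy
  · rcases hx with (hx | hx) | hx
    · exact F.image_eq (F.fixed_left hK (hK.eq_of_span _ mL _ F.left_mem
        (sL.trans span_half_seg.symm) ⟨_, Set.mem_image_of_mem _ hy, hx⟩))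
    · refine absurd (hK.vertex_eq _ F.vertex _ mL ?_) ?_
      · obtain ⟨t, ht, e⟩ := hx
        have := hK.smul_mem mL (inv_pos.mpr ht) (Set.mem_image_of_mem _ hy)
        rwa [e, smul_smul, inv_mul_cancel₀ ht.ne', one_smul] at this
      · rw [image_seg]
        exact (IsTorsionGraph.ray_not_seg (PosDef.ne_zero F.posDef) (indep_image
          (rho_injective _ g) (indep_half F.indep))).symm
    · exact absurd ⟨g, hK.eq_of_span _ mL _ F.right_mem (sL.trans span_half_seg'.symm)
        ⟨_, Set.mem_image_of_mem _ hy, hx⟩⟩ F.not_same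
  · have hv : hermRep m g (P + Q) ∈ seg P Q := by
      obtain ⟨t, ht, rfl⟩ := hy
      rw [← seg_eq_union] at hx
      obtain ⟨a, b, ha, hb, e⟩ := hx
      rw [map_smul] at e
      refine ⟨t⁻¹ * a, t⁻¹ * b, by positivity, by positivity, ?_⟩
      rw [mul_smul, mul_smul, ← smul_add, ← e, smul_smul, inv_mul_cancel₀ ht.ne', one_smul]
    exact F.image_eq (F.fixed_of_vertex hK (left_mem_span hs) (F.image_vertex_eq hK hv))
  · rcases hx with (hx | hx) | hx
    · exact absurd (SameOrbit.symm ⟨g, hK.eq_of_span _ mR _ F.left_mem (sR.trans span_half_seg.symm)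
        ⟨_, Set.mem_image_of_mem _ hy, hx⟩⟩) F.not_same
    · refine absurd (hK.vertex_eq _ F.vertex _ mR ?_) ?_
      · obtain ⟨t, ht, e⟩ := hx
        have := hK.smul_mem mR (inv_pos.mpr ht) (Set.mem_image_of_mem _ hy)
        rwa [e, smul_smul, inv_mul_cancel₀ ht.ne', one_smul] at this
      · rw [image_seg]
        exact (IsTorsionGraph.ray_not_seg (PosDef.ne_zero F.posDef) (indep_image
          (rho_injective _ g) (indep_half' F.indep))).symm
    · exact F.image_eq (F.fixed_right hK (hK.eq_of_span _ mR _ F.right_mem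
        (sR.trans span_half_seg'.symm) ⟨_, Set.mem_image_of_mem _ hy, hx⟩))

/-- The end `P` is not in the orbit of the vertex. -/
lemma left_not_vertex (hK : IsTorsionGraph ℓ K) (F : FusionFrame ℓ K P Q) (g : BianchiGroup m) :
    hermRep m g (P + Q) ∉ ray P := by
  intro h
  have hr := ray_eq_of_mem h
  have h1 : ray (hermRep m g⁻¹ P) = ray (P + Q) := by
    rw [← image_ray, ← hr, ← image_ray, image_image_inv]
  -- The first half, moved so that its end `P` comes to the vertex, is adjacent to the vertex. So an
  -- element of the stabiliser takes it to one of the halves: it cannot be the second one, and for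
  -- the first one the composite would fix `P` and at the same time move it to the vertex.
  have hadj : IsAdjacent K (ray (P + Q)) (hermRep m g⁻¹ '' seg P (P + Q)) := by
    refine ⟨⟨F.vertex, finrank_span_ray (PosDef.ne_zero F.posDef)⟩,
      ⟨K.image_mem _ _ F.left_mem, ?_⟩, ?_⟩
    · rw [finrank_span_image, finrank_span_seg (indep_half F.indep)]
    · rw [image_seg, ← h1]
      exact ray_left_subset_closure (indep_image (rho_injective _ _) (indep_half F.indep))
  obtain ⟨k, hk, h2⟩ := F.edges _ hadj
  rcases h2 with h2 | h2
  · rw [← image_mul] at h2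
    have h3 := (F.fixed_left hK h2).1
    have h4 : ray P = ray (P + Q) := by
      conv_lhs => rw [← h3]
      rw [map_mul, Module.End.mul_apply, ← image_ray, h1, hk]
    obtain ⟨t, ht, e⟩ := ray_eq_iff_mem.mp h4.symm
    have := LinearIndependent.pair_iff.mp F.indep (1 - t) 1 (by
      rw [sub_smul, one_smul, one_smul, ← e]; module)
    simp at this
  · exact F.not_same ⟨k * g⁻¹, by rw [image_mul, h2]⟩

lemma right_not_vertex (hK : IsTorsionGraph ℓ K) (F : FusionFrame ℓ K P Q) (g : BianchiGroup m) :
    hermRep m g (P + Q) ∉ ray Q := by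
  rw [add_comm]
  exact F.symm.left_not_vertex hK g

/-- The family of cells after the fusion. -/
def fuse (_F : FusionFrame ℓ K P Q) : CellFamily (hermRep m) where
  cells := {σ ∈ K.cells | ¬ SameOrbit (hermRep m) (ray (P + Q)) σ ∧
      ¬ SameOrbit (hermRep m) (seg P (P + Q)) σ ∧ ¬ SameOrbit (hermRep m) (seg Q (P + Q)) σ} ∪
    {σ | SameOrbit (hermRep m) (seg P Q) σ}
  image_mem := by
    rintro g σ (⟨h, h1, h2, h3⟩ | h)
    · refine Or.inl ⟨K.image_mem g σ h, ?_, ?_, ?_⟩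
      · exact fun h' => h1 (h'.trans (SameOrbit.image g σ).symm)
      · exact fun h' => h2 (h'.trans (SameOrbit.image g σ).symm)
      · exact fun h' => h3 (h'.trans (SameOrbit.image g σ).symm)
    · exact Or.inr (h.trans (SameOrbit.image g σ))

end FusionFrame

end Fuse
-- Torsion graphs are preserved by fusions
section FuseGraph

lemma indep_combination {V : Type} [AddCommGroup V] [Module ℝ V] {A B : V}
    (hi : LinearIndependent ℝ ![A, B]) (a : ℝ) {b : ℝ} (hb : b ≠ 0) :
    LinearIndependent ℝ ![A, a • A + b • B] := by
  rw [LinearIndependent.pair_iff] at hi ⊢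
  intro s t e
  have := hi (s + t * a) (t * b) (by rw [← e]; module)
  have ht : t = 0 := (mul_eq_zero.mp this.2).resolve_right hb
  subst ht
  simpa using this

variable {m ℓ : ℕ} {K : CellFamily (hermRep m)} {P Q : Matrix (Fin 2) (Fin 2) ℂ}

namespace FusionFrame

lemma mem_fuse_iff (F : FusionFrame ℓ K P Q) {σ : Set (Matrix (Fin 2) (Fin 2) ℂ)} :
    σ ∈ F.fuse.cells ↔ (σ ∈ K.cells ∧ ¬ SameOrbit (hermRep m) (ray (P + Q)) σ ∧
      ¬ SameOrbit (hermRep m) (seg P (P + Q)) σ ∧ ¬ SameOrbit (hermRep m) (seg Q (P + Q)) σ) ∨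
    SameOrbit (hermRep m) (seg P Q) σ := Iff.rfl

lemma fuse_symm (F : FusionFrame ℓ K P Q) : F.symm.fuse = F.fuse := by
  have : F.symm.fuse.cells = F.fuse.cells := by
    ext σ
    rw [mem_fuse_iff, mem_fuse_iff, add_comm Q P, seg_comm Q P]
    tauto
  cases h1 : F.symm.fuse
  cases h2 : F.fuse
  rw [h1, h2] at this
  simpa using this

lemma not_sameOrbit_ray {X Y A : Matrix (Fin 2) (Fin 2) ℂ} (hi : LinearIndependent ℝ ![X, Y]) :
    ¬ SameOrbit (hermRep m) (seg X Y) (ray A) := by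
  rintro ⟨g, h⟩
  have h2 := finrank_span_seg (indep_image (rho_injective (hermRep m) g) hi)
  rw [← image_seg, h, span_ray] at h2
  have := finrank_span_le_card (R := ℝ) ({A} : Set (Matrix (Fin 2) (Fin 2) ℂ))
  simp at this
  omega

lemma ray_mem_of_fuse (F : FusionFrame ℓ K P Q) {A : Matrix (Fin 2) (Fin 2) ℂ}
    (h : ray A ∈ F.fuse.cells) : ray A ∈ K.cells ∧ ¬ SameOrbit (hermRep m) (ray (P + Q)) (ray A) := by
  rcases h with h | h
  · exact ⟨h.1, h.2.1⟩
  · exact absurd h (not_sameOrbit_ray F.indep)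

lemma ray_mem_fuse (F : FusionFrame ℓ K P Q) {A : Matrix (Fin 2) (Fin 2) ℂ}
    (h : ray A ∈ K.cells) (hv : ¬ SameOrbit (hermRep m) (ray (P + Q)) (ray A)) :
    ray A ∈ F.fuse.cells :=
  Or.inl ⟨h, hv, not_sameOrbit_ray (indep_half F.indep), not_sameOrbit_ray (indep_half' F.indep)⟩

/-- A surviving cell in the line of the new edge does not meet it. -/
lemma disjoint_of_span (hK : IsTorsionGraph ℓ K) (F : FusionFrame ℓ K P Q)
    {σ : Set (Matrix (Fin 2) (Fin 2) ℂ)} (hσ : σ ∈ K.cells)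
    (h1 : ¬ SameOrbit (hermRep m) (ray (P + Q)) σ)
    (h2 : ¬ SameOrbit (hermRep m) (seg P (P + Q)) σ)
    (h3 : ¬ SameOrbit (hermRep m) (seg Q (P + Q)) σ)
    (hs : Submodule.span ℝ σ = Submodule.span ℝ (seg P Q)) : ¬ (σ ∩ seg P Q).Nonempty := by
  have one : ∀ τ, σ = τ → SameOrbit (hermRep m) τ σ := by
    rintro τ rfl
    exact ⟨1, by rw [map_one]; exact Set.image_id _⟩
  rintro ⟨x, hx, hx'⟩
  rw [seg_eq_union] at hx'
  rcases hx' with (hx' | ⟨t, ht, rfl⟩) | hx'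
  · exact h2 (one _ (hK.eq_of_span _ hσ _ F.left_mem (hs.trans span_half_seg.symm) ⟨x, hx, hx'⟩))
  · have := hK.smul_mem hσ (inv_pos.mpr ht) hx
    rw [smul_smul, inv_mul_cancel₀ ht.ne', one_smul] at this
    exact h1 (one _ (hK.vertex_eq _ F.vertex _ hσ this))
  · exact h3 (one _ (hK.eq_of_span _ hσ _ F.right_mem (hs.trans span_half_seg'.symm) ⟨x, hx, hx'⟩))

/-- The old edge from `A` towards `B` is a translate of the first half. As `A` is not in the orbit
of the vertex, it is the translate of `P`; so the translate of the whole new edge leaves `A` in the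
same direction. -/
lemma exists_edge_aux (F : FusionFrame ℓ K P Q)
    {A B : Matrix (Fin 2) (Fin 2) ℂ} (hA0 : A.PosDef)
    (hA : ¬ SameOrbit (hermRep m) (ray (P + Q)) (ray A))
    (hi : LinearIndependent ℝ ![A, B]) {a b : ℝ} (hb : 0 < b)
    (h : SameOrbit (hermRep m) (seg P (P + Q)) (seg A (a • A + b • B))) :
    ∃ a b : ℝ, 0 < b ∧ seg A (a • A + b • B) ∈ F.fuse.cells := by
  obtain ⟨g, hg⟩ := h
  rw [image_seg] at hg
  have hi' := indep_image (rho_injective (hermRep m) g) (indep_half F.indep)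
  have hiA := indep_combination hi a hb.ne'
  have hcl : A ∈ closure (seg (hermRep m g P) (hermRep m g (P + Q))) := by
    rw [hg]
    exact ray_left_subset_closure hiA (mem_ray_self A)
  have hn : A ∉ seg (hermRep m g P) (hermRep m g (P + Q)) := by
    rw [hg]
    rintro ⟨x, y, hx, hy, e⟩
    have := (coeff_eq hiA (a := 1) (b := 0) (c := x) (d := y) (by rw [← e]; module)).2
    linarith
  have hr : ray A = ray (hermRep m g P) := by
    rcases eq_end_of_mem_closure hi' (PosDef.ne_zero hA0) hcl hn with e | e
    · exact e
    · exact absurd ⟨g, by rw [image_ray, e]⟩ hA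
  obtain ⟨t, ht, hgP⟩ := ray_eq_iff_mem.mp hr.symm
  have hQ : ∃ x y : ℝ, hermRep m g Q = x • A + y • B := by
    have hsp : hermRep m g (P + Q) ∈ Submodule.span ℝ (seg A (a • A + b • B)) := by
      rw [← hg, mem_span_seg]
      exact ⟨0, 1, by simp⟩
    obtain ⟨x, y, e⟩ := mem_span_seg.mp hsp
    rw [map_add, hgP] at e
    exact ⟨x + y * a - t, y * b, by rw [eq_sub_of_add_eq' e]; module⟩
  obtain ⟨x, y, hQ⟩ := hQ
  have hy : 0 < y := by
    have h1 : A + (a • A + b • B) ∈ seg (hermRep m g P) (hermRep m g (P + Q)) := by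
      rw [hg]
      exact ⟨1, 1, one_pos, one_pos, by module⟩
    obtain ⟨u, w, hu, hw, e⟩ := h1
    rw [map_add, hgP, hQ] at e
    have := (coeff_eq hi (a := 1 + a) (b := b) (c := u * t + w * t + w * x) (d := w * y) (by
      rw [← sub_eq_zero] at e ⊢; rw [← e]; module)).2
    rw [this] at hb
    exact (mul_pos_iff_of_pos_left hw).mp hb
  refine ⟨x, y, hy, Or.inr ⟨g, ?_⟩⟩
  rw [image_seg, ← hQ, seg_left_of_ray_eq _ hr]

/-- This closure property makes the induction over a sequence of fusions possible. It rests on two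
facts: a surviving cell in the line of the new edge is disjoint from it, and an element which
preserves the new edge fixes both its ends. -/
lemma fuse_isTorsionGraph (hK : IsTorsionGraph ℓ K) (F : FusionFrame ℓ K P Q) :
    IsTorsionGraph ℓ F.fuse where
  shape := by
    rintro σ (⟨h, -⟩ | ⟨g, rfl⟩)
    · exact hK.shape σ h
    · refine Or.inr ⟨_, _, indep_image (rho_injective (hermRep m) g) F.indep,
        hermRep_posSemidef g F.left, hermRep_posSemidef g F.right, image_seg _ _ _, ?_⟩
      rintro _ ⟨x, hx, rfl⟩
      refine hermRep_posDef g ?_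
      rw [seg_eq_union] at hx
      rcases hx with (hx | ⟨t, ht, rfl⟩) | hx
      · exact F.left_pos hx
      · exact smul_posDef F.posDef ht
      · exact F.right_pos hx
  eq_of_span := by
    have key : ∀ σ ∈ K.cells, ¬ SameOrbit (hermRep m) (ray (P + Q)) σ →
        ¬ SameOrbit (hermRep m) (seg P (P + Q)) σ → ¬ SameOrbit (hermRep m) (seg Q (P + Q)) σ →
        ∀ g, Submodule.span ℝ σ = Submodule.span ℝ (hermRep m g '' seg P Q) →
        ¬ (σ ∩ hermRep m g '' seg P Q).Nonempty := by
      intro σ h h1 h2 h3 g hs hne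
      obtain ⟨σ, rfl⟩ : ∃ σ', hermRep m g '' σ' = σ := ⟨_, image_inv_image g σ⟩
      have tr := (SameOrbit.image (ρ := hermRep m) g σ)
      rw [← Set.image_inter (rho_injective _ g)] at hne
      exact F.disjoint_of_span hK ((K.image_mem_iff g).mp h) (fun h' => h1 (h'.trans tr))
        (fun h' => h2 (h'.trans tr)) (fun h' => h3 (h'.trans tr)) ((span_image_eq_iff g).mp hs)
        hne.of_image
    rintro σ (⟨h, h1, h2, h3⟩ | ⟨g, rfl⟩) τ (⟨h', h1', h2', h3'⟩ | ⟨g', rfl⟩) hs hne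
    · exact hK.eq_of_span σ h τ h' hs hne
    · exact absurd hne (key σ h h1 h2 h3 g' hs)
    · exact absurd (Set.inter_comm _ _ ▸ hne) (key τ h' h1' h2' h3' g hs.symm)
    · have e : hermRep m g '' seg P Q = hermRep m g' '' (hermRep m (g'⁻¹ * g) '' seg P Q) := by
        rw [← image_mul, mul_inv_cancel_left]
      rw [e] at hs hne ⊢
      rw [← Set.image_inter (rho_injective _ g')] at hne
      rw [F.image_eq_of_inter hK ((span_image_eq_iff g').mp hs) hne.of_image]
  vertex_eq := by
    rintro A hA σ (⟨h, -⟩ | ⟨g, rfl⟩) hmem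
    · exact hK.vertex_eq A (F.ray_mem_of_fuse hA).1 σ h hmem
    · exfalso
      obtain ⟨x, hx, rfl⟩ := hmem
      obtain ⟨h1, h2⟩ := F.ray_mem_of_fuse hA
      rw [← image_ray] at h1 h2
      rw [K.image_mem_iff] at h1
      rw [seg_eq_union] at hx
      rcases hx with (hx | hx) | hx
      · exact F.ray_ne_left hK h1 hx
      · exact h2 ⟨g, by rw [ray_eq_of_mem hx]⟩
      · exact F.ray_ne_right hK h1 hx
  torsion := by
    rintro σ (⟨h, -⟩ | ⟨g, rfl⟩)
    · exact hK.torsion σ h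
    · obtain ⟨c, hc, hP, hQ⟩ := F.torsion
      refine ⟨g * c * g⁻¹, ?_, ?_⟩
      · rw [← hc]
        exact orderOf_injective (MulAut.conj g).toMonoidHom (MulAut.conj g).injective c
      · rw [image_mul, image_image_inv, image_mul, F.image_eq ⟨hP, hQ⟩]
  fixed_pointwise := by
    rintro g σ (⟨h, -⟩ | ⟨k, rfl⟩) hg A hA
    · exact hK.fixed_pointwise g σ h hg A hA
    · have h1 : hermRep m (k⁻¹ * g * k) '' seg P Q = seg P Q := by
        rw [image_mul, image_mul, hg, image_image_inv]
      obtain ⟨hP, hQ⟩ := F.fixed_of_image hK h1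
      obtain ⟨_, ⟨a, b, ha, hb, rfl⟩, rfl⟩ := hA
      have h2 : hermRep m (k⁻¹ * g * k) (a • P + b • Q) = a • P + b • Q := by
        rw [map_add, map_smul, map_smul, hP, hQ]
      have h3 := congrArg (hermRep m k) h2
      rwa [← Module.End.mul_apply, ← map_mul, mul_assoc, mul_inv_cancel_left, map_mul,
        Module.End.mul_apply] at h3
  exists_edge := by
    intro A hA hAK g hg hgA B hB hgB hi
    obtain ⟨h1, h2⟩ := F.ray_mem_of_fuse hAK
    obtain ⟨a, b, hb, h⟩ := hK.exists_edge A hA h1 g hg hgA B hB hgB hi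
    by_cases hL : SameOrbit (hermRep m) (seg P (P + Q)) (seg A (a • A + b • B))
    · exact F.exists_edge_aux hA h2 hi hb hL
    by_cases hR : SameOrbit (hermRep m) (seg Q (P + Q)) (seg A (a • A + b • B))
    · rw [← F.fuse_symm]
      rw [add_comm] at hR h2
      exact F.symm.exists_edge_aux hA h2 hi hb hR
    · refine ⟨a, b, hb, Or.inl ⟨h, ?_, hL, hR⟩⟩
      rintro ⟨k, hk⟩
      rw [image_ray] at hk
      exact IsTorsionGraph.ray_not_seg (PosDef.ne_zero (hermRep_posDef k F.posDef))
        (indep_combination hi a hb.ne') hk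

end FusionFrame

end FuseGraph
-- Transfer along a map of `G`-sets with almost free fibres
section OrbitTransfer

variable {G : Type} [Group G] {X Y : Type} [MulAction G X] [MulAction G Y]

lemma exists_orbitMap (x₀ : X) (y₀ : Y) (hx : ∀ x : X, ∃ g : G, g • x₀ = x)
    (h : ∀ g : G, g • x₀ = x₀ → g • y₀ = y₀) :
    ∃ f : X → Y, (∀ (g : G) x, f (g • x) = g • f x) ∧ f x₀ = y₀ := by
  choose s hs using hx
  have key : ∀ g k : G, g • x₀ = k • x₀ → g • y₀ = k • y₀ := fun g k e => by
    have := h (k⁻¹ * g) (by rw [mul_smul, e, inv_smul_smul])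
    rw [mul_smul, inv_smul_eq_iff] at this
    exact this
  refine ⟨fun x => s x • y₀, fun g x => ?_, ?_⟩
  · rw [← mul_smul]
    exact key _ _ (by rw [hs, mul_smul, hs])
  · exact (key _ 1 (by rw [hs, one_smul])).trans (one_smul _ _)

lemma permModule_hom_ext_orbit (x₀ : X) (hx : ∀ x : X, ∃ g : G, g • x₀ = x) {A : Rep.{0} ℤ G}
    {a b : permModule G X ⟶ A}
    (h : a.hom (Finsupp.single x₀ 1) = b.hom (Finsupp.single x₀ 1)) : a = b := by
  refine permModule_hom_ext fun x => ?_
  obtain ⟨g, rfl⟩ := hx x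
  have e : (Finsupp.single (g • x₀) 1 : X →₀ ℤ) =
      permRepresentation G X g (Finsupp.single x₀ 1) := (permRepresentation_single g x₀ 1).symm
  rw [e]
  exact (Rep.hom_comm_apply a g _).trans ((congrArg _ h).trans (Rep.hom_comm_apply b g _).symm)

/-- Two different points in one fibre of `f`. -/
def DistinctPairs (f : X → Y) : Type := {z : X × X // z.1 ≠ z.2 ∧ f z.1 = f z.2}

instance distinctPairsAction (f : X → Y) [hf : Fact (∀ (g : G) x, f (g • x) = g • f x)] :
    MulAction G (DistinctPairs f) where
  smul g z := ⟨(g • z.1.1, g • z.1.2), fun h => z.2.1 (smul_left_cancel g h), by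
    rw [hf.out, hf.out, z.2.2]⟩
  one_smul z := Subtype.ext (Prod.ext (one_smul _ _) (one_smul _ _))
  mul_smul g h z := Subtype.ext (Prod.ext (mul_smul _ _ _) (mul_smul _ _ _))

/-- The sum over the fibre through `x`, without `x` itself, factors through the permutation module
of ordered pairs of different points in one fibre. This `G`-set is free by `hfree`, so in positive
degrees only the summand `x` survives. -/
lemma homologyMap_sum_fibre (f : X → Y) (hf : ∀ (g : G) x, f (g • x) = g • f x)
    (hfin : ∀ y, (f ⁻¹' {y}).Finite)
    (hfree : ∀ x x', x ≠ x' → f x = f x' → ∀ g : G, g • x = x → g • x' = x' → g = 1) (q : ℕ) :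
    ∃ t : permModule G Y ⟶ permModule G X,
      (∀ y, t.hom (Finsupp.single y 1) = ∑ x ∈ (hfin y).toFinset, Finsupp.single x 1) ∧
      ∀ x, homologyMap (q + 1) (permMap f hf ≫ t) x = x := by
  classical
  have : Fact (∀ (g : G) x, f (g • x) = g • f x) := ⟨hf⟩
  have himg : ∀ (g : G) y, (hfin (g • y)).toFinset = (hfin y).toFinset.image (g • ·) := by
    intro g y
    ext x
    simp only [Set.Finite.mem_toFinset, Set.mem_preimage, Set.mem_singleton_iff, Finset.mem_image]
    constructor
    · intro h
      exact ⟨g⁻¹ • x, by rw [hf, h, inv_smul_smul], smul_inv_smul g x⟩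
    · rintro ⟨x, h, rfl⟩
      rw [hf, h]
  let t : permModule G Y ⟶ permModule G X := permLift
    (fun y => ∑ x ∈ (hfin y).toFinset, Finsupp.single x 1) fun g y => by
      rw [himg, Finset.sum_image (MulAction.injective g).injOn, map_sum]
      simp only [permRepresentation_single]
  let F : X → (DistinctPairs f →₀ ℤ) := fun x => ∑ x' ∈ (hfin (f x)).toFinset,
    if h : x ≠ x' ∧ f x = f x' then Finsupp.single ⟨(x, x'), h⟩ 1 else 0
  let w : permModule G X ⟶ permModule G (DistinctPairs f) := permLift F fun g x => by
    have e0 : (hfin (f (g • x))).toFinset = (hfin (f x)).toFinset.image (g • ·) := by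
      rw [← himg]
      ext z
      simp [hf]
    simp only [F]
    rw [e0, Finset.sum_image (MulAction.injective g).injOn, map_sum]
    refine Finset.sum_congr rfl fun x' _ => ?_
    by_cases h : x ≠ x' ∧ f x = f x'
    · let z : DistinctPairs f := ⟨(x, x'), h⟩
      have h' : g • x ≠ g • x' ∧ f (g • x) = f (g • x') :=
        ⟨fun e => h.1 (smul_left_cancel g e), by rw [hf, hf, h.2]⟩
      rw [dif_pos h, dif_pos h']
      exact (permRepresentation_single g z 1).symm
    · rw [dif_neg h, dif_neg, map_zero]
      rintro ⟨h1, h2⟩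
      exact h ⟨fun e => h1 (by rw [e]), smul_left_cancel g (by rwa [hf, hf] at h2)⟩
  let s : permModule G (DistinctPairs f) ⟶ permModule G X :=
    permMap (fun z : DistinctPairs f => z.1.2) fun g z => rfl
  refine ⟨t, fun y => permLift_single _ _ y, fun x => ?_⟩
  have key : permMap f hf ≫ t = 𝟙 _ + w ≫ s := by
    refine permModule_hom_ext fun x => ?_
    have e1 : (permMap f hf ≫ t).hom (Finsupp.single x 1) =
        t.hom ((permMap f hf).hom (Finsupp.single x 1)) := rfl
    have e2 : (𝟙 (permModule G X) + w ≫ s).hom (Finsupp.single x 1) =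
        Finsupp.single x 1 + s.hom (w.hom (Finsupp.single x 1)) := rfl
    have e3 : t.hom (Finsupp.single (f x) 1) =
      ∑ x' ∈ (hfin (f x)).toFinset, Finsupp.single x' 1 := permLift_single _ _ _
    have e4 : w.hom (Finsupp.single x 1) = F x := permLift_single _ _ _
    rw [e1, e2, permMap_single, e3, e4]
    simp only [F]
    rw [map_sum]
    have hx : x ∈ (hfin (f x)).toFinset := by simp
    rw [← Finset.add_sum_erase _ _ hx, ← Finset.add_sum_erase _ _ hx]
    rw [dif_neg (fun h => h.1 rfl), map_zero]
    have : ∀ x' ∈ (hfin (f x)).toFinset.erase x, s.hom (if h : x ≠ x' ∧ f x = f x' then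
        Finsupp.single (⟨(x, x'), h⟩ : DistinctPairs f) 1 else 0) = Finsupp.single x' (1 : ℤ) := by
      intro x' hx'
      rw [Finset.mem_erase, Set.Finite.mem_toFinset] at hx'
      rw [dif_pos ⟨hx'.1.symm, hx'.2.symm⟩]
      exact permMap_single _ _ _
    rw [Finset.sum_congr rfl this]
    exact congrArg _ (zero_add _).symm
  rw [key, homologyMap_add, homologyMap_id, homologyMap_comp,
    homology_permModule_eq_zero (Y := DistinctPairs f) ?_ q (homologyMap _ w x), map_zero, add_zero]
  intro g z hz
  have := Subtype.ext_iff.mp hz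
  exact hfree _ _ z.2.1 z.2.2 g (congrArg Prod.fst this) (congrArg Prod.snd this)

lemma surjOn_primaryPart_of_nsmul {A B : Type} [AddCommGroup A] [AddCommGroup B] {ℓ n : ℕ}
    (hcop : n.Coprime ℓ) (f : A →+ B) (t : B →+ A) (h : ∀ y, f (t y) = n • y) :
    ∀ z ∈ primaryPart ℓ B, ∃ x ∈ primaryPart ℓ A, f x = z := by
  rintro z ⟨k, hk⟩
  have hco : IsCoprime (n : ℤ) ((ℓ ^ k : ℕ) : ℤ) :=
    Nat.isCoprime_iff_coprime.mpr (Nat.Coprime.pow_right k hcop)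
  obtain ⟨u, w, huw⟩ := hco
  refine ⟨t (u • z), map_mem_primaryPart _ ⟨k, ?_⟩, ?_⟩
  · rw [smul_comm, hk, smul_zero]
  · rw [h, ← natCast_zsmul, smul_smul]
    have h1 : (u * (n : ℤ) + w * ((ℓ ^ k : ℕ) : ℤ)) • z = z := by rw [huw, one_zsmul]
    rw [add_smul, mul_smul w, natCast_zsmul, hk, smul_zero, add_zero] at h1
    rw [mul_comm, h1]

/-- The sum over the fibre is a left inverse in homology, and in the other order the composite is
multiplication by the size `n` of the fibres, which is invertible on `ℓ`-primary parts. -/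
lemma primary_bijective_permMap {ℓ n : ℕ} (f : X → Y) (hf : ∀ (g : G) x, f (g • x) = g • f x)
    (hfin : ∀ y, (f ⁻¹' {y}).Finite) (hn : ∀ y, (f ⁻¹' {y}).ncard = n) (hcop : n.Coprime ℓ)
    (hfree : ∀ x x', x ≠ x' → f x = f x' → ∀ g : G, g • x = x → g • x' = x' → g = 1) (q : ℕ) :
    (∀ x, homologyMap (q + 1) (permMap f hf) x = 0 → x = 0) ∧
    ∀ z ∈ primaryPart ℓ (groupHomology (permModule G Y) (q + 1)),
      ∃ x ∈ primaryPart ℓ (groupHomology (permModule G X) (q + 1)),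
        homologyMap (q + 1) (permMap f hf) x = z := by
  obtain ⟨t, ht, hid⟩ := homologyMap_sum_fibre f hf hfin hfree q
  have key : t ≫ permMap f hf = n • 𝟙 _ := by
    refine permModule_hom_ext fun y => ?_
    have e1 : (t ≫ permMap f hf).hom (Finsupp.single y 1) =
        (permMap f hf).hom (t.hom (Finsupp.single y 1)) := rfl
    have e2 : (n • 𝟙 (permModule G Y) : permModule G Y ⟶ _).hom (Finsupp.single y 1) =
        n • Finsupp.single y (1 : ℤ) := rfl
    rw [e1, e2, ht, map_sum]
    have : ∀ x ∈ (hfin y).toFinset, (permMap f hf).hom (Finsupp.single x 1) =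
        Finsupp.single y (1 : ℤ) := fun x hx => by
      rw [permMap_single, (Set.Finite.mem_toFinset _).mp hx]
    rw [Finset.sum_congr rfl this, Finset.sum_const, ← Set.ncard_eq_toFinset_card _ (hfin y), hn]
  refine ⟨fun x hx => ?_, fun z hz => ?_⟩
  · rw [← hid x, homologyMap_comp, hx, map_zero]
  · refine surjOn_primaryPart_of_nsmul hcop (homologyMap (q + 1) (permMap f hf))
      (homologyMap (q + 1) t) (fun z => ?_) z hz
    rw [← homologyMap_comp, key, homologyMap_nsmul, homologyMap_id]

end OrbitTransfer

/-! ### The map between the homology groups of the stabilisers of an edge and of its end -/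

section SingleOrbit

variable {G V : Type} [Group G] [AddCommGroup V] [Module ℝ V] {ρ : Representation ℝ G V}
  {K L : CellFamily ρ} {p r : ℕ}

lemma exists_sign_chain {f f' : FramedCell K p} (h : f'.cell = f.cell) :
    f'.chain = f.chain ∨ f'.chain = -f.chain := by
  obtain ⟨c, hc, hd⟩ := f.exists_framesDiffer f' (by rw [h])
  rw [FramedCell.chain_eq_smul f f' hc h hd]
  rcases lt_or_gt_of_ne hc with hc | hc
  · right; simp [sign_neg hc]
  · left; simp [sign_pos hc]

/-- The cyclic group of order `ℓ` generated by `c` acts on the fibre with `x₀` as its only fixed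
point, so the size of the fibre is congruent to 1 modulo `ℓ`. -/
lemma fibre_coprime {ℓ : ℕ} (hℓ : ℓ.Prime) {X Y : Type} [MulAction G X] [MulAction G Y] (f : X → Y)
    (hf : ∀ (g : G) x, f (g • x) = g • f x) (x₀ : X) (hfin : (f ⁻¹' {f x₀}).Finite)
    (hfree : ∀ x x', x ≠ x' → f x = f x' → ∀ g : G, g • x = x → g • x' = x' → g = 1)
    {c : G} (hc : orderOf c = ℓ) (hcx : c • x₀ = x₀) : (f ⁻¹' {f x₀}).ncard.Coprime ℓ := by
  have : Fact ℓ.Prime := ⟨hℓ⟩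
  have hstab : ∀ k : Subgroup.zpowers c, (k : G) • x₀ = x₀ := by
    rintro ⟨k, n, rfl⟩
    have : c ∈ MulAction.stabilizer G x₀ := hcx
    exact Subgroup.zpow_mem _ this n
  let act : MulAction (Subgroup.zpowers c) (f ⁻¹' {f x₀}) :=
    { smul := fun k x => ⟨(k : G) • x.1, by
        have := x.2
        simp only [Set.mem_preimage, Set.mem_singleton_iff] at this ⊢
        rw [hf, this, ← hf, hstab]⟩
      one_smul := fun x => Subtype.ext (one_smul G x.1)
      mul_smul := fun k k' x => Subtype.ext (mul_smul (k : G) (k' : G) x.1) }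
  have hp : IsPGroup ℓ (Subgroup.zpowers c) :=
    IsPGroup.of_card (n := 1) (by rw [Nat.card_zpowers, hc, pow_one])
  have : Finite (f ⁻¹' {f x₀}) := hfin
  have hmod := hp.card_modEq_card_fixedPoints (f ⁻¹' {f x₀})
  have hfix : MulAction.fixedPoints (Subgroup.zpowers c) (f ⁻¹' {f x₀}) = {⟨x₀, rfl⟩} := by
    ext x
    simp only [MulAction.mem_fixedPoints, Set.mem_singleton_iff]
    constructor
    · intro h
      by_contra hne
      have h1 : c • x.1 = x.1 := congrArg Subtype.val (h ⟨c, Subgroup.mem_zpowers c⟩)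
      have := hfree x₀ x.1 (fun e => hne (Subtype.ext e.symm)) x.2.symm c hcx h1
      rw [this, orderOf_one] at hc
      exact hℓ.one_lt.ne hc
    · rintro rfl k
      exact Subtype.ext (hstab k)
  rw [hfix, Nat.card_coe_set_eq, Nat.card_coe_set_eq, Set.ncard_singleton] at hmod
  rw [Nat.coprime_comm, hℓ.coprime_iff_not_dvd]
  intro hd
  have h1 := (Nat.modEq_zero_iff_dvd.mpr hd).symm.trans hmod
  have h2 := (Nat.modEq_iff_dvd' (Nat.zero_le _)).mp h1
  exact hℓ.one_lt.ne' (Nat.dvd_one.mp h2)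

/-- A morphism between the chain modules of two single orbits, for which the stabiliser of the
second cell permutes the fibre of the first one almost freely, is bijective on `ℓ`-primary parts of
the homology in positive degrees. -/
lemma primary_bijective_of_single_orbit {ℓ : ℕ} (hℓ : ℓ.Prime) (hK : IsOriented K p)
    (hL : IsOriented L r) (f : FramedCell K p) (v : FramedCell L r)
    (φ : Rep.of (chainsRep K p) ⟶ Rep.of (chainsRep L r)) (hφ : φ.hom f.chain = v.chain)
    (hf : ∀ σ : PCell K p, ∃ g : G, ρ g '' f.cell = σ.1)
    (hv : ∀ σ : PCell L r, ∃ g : G, ρ g '' v.cell = σ.1)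
    (hstab : ∀ g : G, ρ g '' f.cell = f.cell → ρ g '' v.cell = v.cell)
    (hfin : {g : G | ρ g '' v.cell = v.cell}.Finite)
    (hfree : ∀ g : G, ρ g '' v.cell = v.cell → ρ g '' f.cell ≠ f.cell → ∀ k : G,
      ρ k '' f.cell = f.cell → ρ k '' (ρ g '' f.cell) = ρ g '' f.cell → k = 1)
    {c : G} (hc : orderOf c = ℓ) (hcf : ρ c '' f.cell = f.cell) (q : ℕ) :
    (∀ x, homologyMap (q + 1) φ x = 0 → x = 0) ∧
    ∀ z ∈ primaryPart ℓ (groupHomology (Rep.of (chainsRep L r)) (q + 1)),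
      ∃ x ∈ primaryPart ℓ (groupHomology (Rep.of (chainsRep K p)) (q + 1)),
        homologyMap (q + 1) φ x = z := by
  have smul_eq : ∀ {M : CellFamily ρ} {s : ℕ} (g : G) (σ τ : PCell M s),
      g • σ = τ ↔ ρ g '' σ.1 = τ.1 := fun g σ τ => Subtype.ext_iff
  have hx : ∀ x : PCell K p, ∃ g : G, g • f.toPCell = x := fun x =>
    (hf x).imp fun g hg => (smul_eq g _ _).mpr hg
  have hy : ∀ y : PCell L r, ∃ g : G, g • v.toPCell = y := fun y =>
    (hv y).imp fun g hg => (smul_eq g _ _).mpr hg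
  obtain ⟨F, hF, hF0⟩ := exists_orbitMap f.toPCell v.toPCell hx fun g hg =>
    (smul_eq g _ _).mpr (hstab g ((smul_eq g _ _).mp hg))
  have hfib : ∀ g : G, F (g • f.toPCell) = v.toPCell ↔ ρ g '' v.cell = v.cell := fun g => by
    rw [hF, hF0]; exact smul_eq g _ _
  have hfib0 : (F ⁻¹' {v.toPCell}).Finite := by
    refine (hfin.image (fun g => g • f.toPCell)).subset ?_
    intro x hxF
    obtain ⟨g, rfl⟩ := hx x
    exact ⟨g, (hfib g).mp hxF, rfl⟩
  have himg : ∀ g : G, F ⁻¹' {g • v.toPCell} = (g • ·) '' (F ⁻¹' {v.toPCell}) := by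
    intro g
    ext x
    simp only [Set.mem_preimage, Set.mem_singleton_iff, Set.mem_image]
    constructor
    · intro h
      exact ⟨g⁻¹ • x, by rw [hF, h, inv_smul_smul], smul_inv_smul g x⟩
    · rintro ⟨x, h, rfl⟩
      rw [hF, h]
  have hfibfin : ∀ y, (F ⁻¹' {y}).Finite := fun y => by
    obtain ⟨g, rfl⟩ := hy y
    rw [himg]
    exact hfib0.image _
  have hcard : ∀ y, (F ⁻¹' {y}).ncard = (F ⁻¹' {v.toPCell}).ncard := fun y => by
    obtain ⟨g, rfl⟩ := hy y
    rw [himg, Set.ncard_image_of_injective _ (MulAction.injective g)]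
  have hfree' : ∀ x x', x ≠ x' → F x = F x' → ∀ g : G, g • x = x → g • x' = x' → g = 1 := by
    intro x x' hne hxx k h1 h2
    obtain ⟨a, rfl⟩ := hx x
    obtain ⟨b, rfl⟩ := hx x'
    have e : F ((a⁻¹ * b) • f.toPCell) = v.toPCell := by
      rw [mul_smul, hF, ← hxx, hF, inv_smul_smul, hF0]
    have h3 := hfree (a⁻¹ * b) ((hfib _).mp e) (fun h => hne ?_) (a⁻¹ * k * a) ?_ ?_
    · have : k = a * (a⁻¹ * k * a) * a⁻¹ := by group
      rw [this, h3, mul_one, mul_inv_cancel]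
    · have := (smul_eq (a⁻¹ * b) f.toPCell f.toPCell).mpr h
      rw [mul_smul, inv_smul_eq_iff] at this
      exact this.symm
    · refine (smul_eq _ f.toPCell f.toPCell).mp ?_
      rw [mul_smul, mul_smul, h1, inv_smul_smul]
    · refine (smul_eq _ ((a⁻¹ * b) • f.toPCell) ((a⁻¹ * b) • f.toPCell)).mp ?_
      rw [mul_smul, mul_smul, mul_smul a⁻¹ b, smul_inv_smul, h2]
  have hcop := fibre_coprime hℓ F hF f.toPCell (by rw [hF0]; exact hfib0) hfree' hc
    ((smul_eq _ f.toPCell f.toPCell).mpr hcf)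
  rw [hF0] at hcop
  have hbij := primary_bijective_permMap F hF hfibfin hcard hcop hfree' q
  obtain ⟨o, e, ho, he⟩ := exists_chains_iso hK
  obtain ⟨o', e', ho', he'⟩ := exists_chains_iso hL
  -- The orientations chosen for the identification with permutation modules may differ from those
  -- of `f` and `v`, so `φ` is compared with the map of permutation modules only up to a sign.
  have hψ : (∀ x, homologyMap (q + 1) φ (homologyMap (q + 1) e.hom x) =
      homologyMap (q + 1) e'.hom (homologyMap (q + 1) (permMap F hF) x)) ∨
      ∀ x, homologyMap (q + 1) φ (homologyMap (q + 1) e.hom (-x)) =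
      homologyMap (q + 1) e'.hom (homologyMap (q + 1) (permMap F hF) x) := by
    have hcases : e.hom ≫ φ = permMap F hF ≫ e'.hom ∨ e.hom ≫ φ = -(permMap F hF ≫ e'.hom) := by
      have a1 : (e.hom ≫ φ).hom (Finsupp.single f.toPCell 1) = φ.hom (o f.toPCell).chain := by
        rw [← he]; rfl
      have a2 : (permMap F hF ≫ e'.hom).hom (Finsupp.single f.toPCell 1) =
          (o' v.toPCell).chain := by
        rw [← he', ← hF0]
        exact congrArg e'.hom.hom (permMap_single _ _ _)
      have a3 : (-(permMap F hF ≫ e'.hom)).hom (Finsupp.single f.toPCell 1) =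
          -(o' v.toPCell).chain := by
        rw [← a2]; rfl
      have b1 : φ.hom (o f.toPCell).chain = v.chain ∨ φ.hom (o f.toPCell).chain = -v.chain := by
        rcases exists_sign_chain (f := f) (f' := o f.toPCell) (ho _) with h | h
        · left; rw [h, hφ]
        · right; rw [h, map_neg, hφ]
      have b2 := exists_sign_chain (f := v) (f' := o' v.toPCell) (ho' _)
      rcases b1 with b1 | b1 <;> rcases b2 with b2 | b2
      · left; exact permModule_hom_ext_orbit _ hx (by rw [a1, a2, b1, b2])
      · right; exact permModule_hom_ext_orbit _ hx (by rw [a1, a3, b1, b2, neg_neg])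
      · right; exact permModule_hom_ext_orbit _ hx (by rw [a1, a3, b1, b2])
      · left; exact permModule_hom_ext_orbit _ hx (by rw [a1, a2, b1, b2])
    refine hcases.imp (fun h x => ?_) fun h x => ?_
    · rw [← homologyMap_comp, h, homologyMap_comp]
    · rw [map_neg, map_neg, ← homologyMap_comp, h, homologyMap_neg, neg_neg, homologyMap_comp]
  have einv : ∀ x, homologyMap (q + 1) e.hom (homologyMap (q + 1) e.inv x) = x := fun x => by
    rw [← homologyMap_comp, e.inv_hom_id, homologyMap_id]
  have einv' : ∀ x, homologyMap (q + 1) e'.hom (homologyMap (q + 1) e'.inv x) = x := fun x => by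
    rw [← homologyMap_comp, e'.inv_hom_id, homologyMap_id]
  have einv'' : ∀ x, homologyMap (q + 1) e'.inv (homologyMap (q + 1) e'.hom x) = x := fun x => by
    rw [← homologyMap_comp, e'.hom_inv_id, homologyMap_id]
  refine ⟨fun x h => ?_, fun z hz => ?_⟩
  · have h1 : homologyMap (q + 1) e'.hom
        (homologyMap (q + 1) (permMap F hF) (homologyMap (q + 1) e.inv x)) = 0 := by
      rcases hψ with hψ | hψ
      · rw [← hψ, einv, h]
      · rw [← hψ, map_neg, map_neg, einv, h, neg_zero]
    have h2 := congrArg (homologyMap (q + 1) e'.inv) h1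
    rw [einv'', map_zero] at h2
    rw [← einv x, hbij.1 _ h2, map_zero]
  · obtain ⟨x, hx, hxz⟩ := hbij.2 (homologyMap (q + 1) e'.inv z) (map_mem_primaryPart _ hz)
    rcases hψ with hψ | hψ
    · exact ⟨_, map_mem_primaryPart (homologyMap (q + 1) e.hom) hx, by rw [hψ, hxz, einv']⟩
    · exact ⟨_, map_mem_primaryPart (homologyMap (q + 1) e.hom) (neg_mem hx), by
        rw [hψ, hxz, einv']⟩

end SingleOrbit
-- Families consisting of one orbit
section OrbitFamily

variable {G V : Type} [Group G] [AddCommGroup V] [Module ℝ V] {ρ : Representation ℝ G V}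
  {K L M : CellFamily ρ} {p : ℕ}

/-- The orbit of a cell. -/
def orbitFamily (ρ : Representation ℝ G V) (σ : Set V) : CellFamily ρ where
  cells := {τ | SameOrbit ρ σ τ}
  image_mem g _ h := SameOrbit.trans h (SameOrbit.image g _)

lemma mem_orbitFamily_self (σ : Set V) : σ ∈ (orbitFamily ρ σ).cells :=
  ⟨1, by rw [map_one]; exact Set.image_id _⟩

lemma orbitFamily_subset {σ : Set V} (h : σ ∈ K.cells) :
    (orbitFamily ρ σ).cells ⊆ K.cells := by
  rintro _ ⟨g, rfl⟩
  exact K.image_mem g _ h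

lemma IsOriented.of_subset (h : L.cells ⊆ K.cells) (hK : IsOriented K p) : IsOriented L p :=
  fun f g hg => hK (f.withCell K f.cell (h f.mem) rfl) g hg

lemma move_withCell (f : FramedCell K p) {τ υ : Set V} (h : τ ∈ L.cells)
    (hs : Submodule.span ℝ τ = Submodule.span ℝ f.cell) :
    (f.withCell L τ h hs).move M υ = f.move M υ := by
  by_cases hυ : υ ∈ M.cells ∧ Submodule.span ℝ υ = Submodule.span ℝ f.cell
  · rw [f.move_of_mem hυ.1 hυ.2, FramedCell.move_of_mem _ hυ.1 (hυ.2.trans hs.symm)]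
    rfl
  · rw [f.move_of_not hυ, FramedCell.move_of_not]
    exact fun h' => hυ ⟨h'.1, h'.2.trans hs⟩

lemma restriction_move (f : FramedCell K p) {τ : Set V} (h : τ ∈ L.cells) :
    (restriction L M p).hom (f.move L τ) = f.move M τ := by
  by_cases hs : Submodule.span ℝ τ = Submodule.span ℝ f.cell
  · rw [f.move_of_mem h hs, restriction_chain]
    exact move_withCell f h hs
  · rw [f.move_of_not fun h' => hs h'.2, f.move_of_not fun h' => hs h'.2, map_zero]

end OrbitFamily

/-! ### Subdivision of the new edge and its retraction -/

section FusionMaps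

variable {m ℓ : ℕ} {K : CellFamily (hermRep m)} {P Q : Matrix (Fin 2) (Fin 2) ℂ}

lemma IsTorsionGraph.vertices_of_edge (hK : IsTorsionGraph ℓ K)
    (hPQ : LinearIndependent ℝ ![P, Q]) (h : seg P Q ∈ K.cells) :
    ∀ τ ∈ K.cells, Module.finrank ℝ (Submodule.span ℝ τ) = 1 → τ ⊆ closure (seg P Q) →
      τ = ray P ∨ τ = ray Q := by
  intro τ hτ hd hcl
  obtain ⟨A, hA, rfl⟩ := hK.eq_ray_of_finrank hτ hd
  refine eq_end_of_mem_closure hPQ (PosDef.ne_zero hA) (hcl (mem_ray_self A)) fun hmem => ?_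
  exact IsTorsionGraph.ray_not_seg (PosDef.ne_zero hA) hPQ (hK.vertex_eq A hτ _ h hmem).symm

namespace FusionFrame

/-- The vertex lies inside the new edge, whereas in a torsion graph no edge contains a vertex. -/
lemma not_sameOrbit_of_mem (hK : IsTorsionGraph ℓ K) (F : FusionFrame ℓ K P Q)
    {σ : Set (Matrix (Fin 2) (Fin 2) ℂ)} (h : σ ∈ K.cells) :
    ¬ SameOrbit (hermRep m) (seg P Q) σ := by
  rintro ⟨g, rfl⟩
  rw [K.image_mem_iff] at h
  exact IsTorsionGraph.ray_not_seg (PosDef.ne_zero F.posDef) F.indep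
    (hK.vertex_eq _ F.vertex _ h (ray_subset_seg (mem_ray_self _))).symm

lemma seg_mem_fuse (F : FusionFrame ℓ K P Q) : seg P Q ∈ F.fuse.cells :=
  Or.inr ⟨1, by rw [map_one]; exact Set.image_id _⟩

lemma left_not_mem_fuse (hK : IsTorsionGraph ℓ K) (F : FusionFrame ℓ K P Q) :
    seg P (P + Q) ∉ F.fuse.cells := by
  rintro (h | h)
  · exact h.2.2.1 (mem_orbitFamily_self _)
  · exact F.not_sameOrbit_of_mem hK F.left_mem h

lemma right_not_mem_fuse (hK : IsTorsionGraph ℓ K) (F : FusionFrame ℓ K P Q) :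
    seg Q (P + Q) ∉ F.fuse.cells := by
  rintro (h | h)
  · exact h.2.2.2 (mem_orbitFamily_self _)
  · exact F.not_sameOrbit_of_mem hK F.right_mem h

/-- An end of an edge in another orbit is not in the orbit of the vertex. -/
lemma end_not_vertex (F : FusionFrame ℓ K P Q)
    {X Y : Matrix (Fin 2) (Fin 2) ℂ} (hXY : LinearIndependent ℝ ![X, Y]) (h : seg X Y ∈ K.cells)
    (h1 : ¬ SameOrbit (hermRep m) (seg P (P + Q)) (seg X Y))
    (h2 : ¬ SameOrbit (hermRep m) (seg Q (P + Q)) (seg X Y)) :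
    ¬ SameOrbit (hermRep m) (ray (P + Q)) (ray X) := by
  rintro ⟨g, hg⟩
  have hv : ray (hermRep m g⁻¹ X) = ray (P + Q) := by
    rw [← image_ray, ← hg, image_image_inv]
  have hadj : IsAdjacent K (ray (P + Q)) (hermRep m g⁻¹ '' seg X Y) := by
    refine ⟨⟨F.vertex, finrank_span_ray (PosDef.ne_zero F.posDef)⟩, ⟨K.image_mem _ _ h, ?_⟩, ?_⟩
    · rw [finrank_span_image, finrank_span_seg hXY]
    · rw [image_seg, ← hv]
      exact ray_left_subset_closure (indep_image (rho_injective _ _) hXY)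
  obtain ⟨k, -, hk | hk⟩ := F.edges _ hadj
  · exact h1 (SameOrbit.symm ⟨k * g⁻¹, by rw [image_mul, hk]⟩)
  · exact h2 (SameOrbit.symm ⟨k * g⁻¹, by rw [image_mul, hk]⟩)

/-- The subdivision of the new edge. -/
def splitMap (F : FusionFrame ℓ K P Q) :
    Rep.of (chainsRep F.fuse 1) ⟶ Rep.of (chainsRep K 1) :=
  correspondence F.fuse K 1 (fun σ τ => τ = σ ∨ ∃ g, σ = hermRep m g '' seg P Q ∧
    (τ = hermRep m g '' seg P (P + Q) ∨ τ = hermRep m g '' seg Q (P + Q))) (by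
    rintro k σ τ (rfl | ⟨g, rfl, rfl | rfl⟩)
    · exact Or.inl rfl
    · exact Or.inr ⟨k * g, (image_mul _ _ _).symm, Or.inl (image_mul _ _ _).symm⟩
    · exact Or.inr ⟨k * g, (image_mul _ _ _).symm, Or.inr (image_mul _ _ _).symm⟩)

/-- The retraction of `splitMap` which takes the second edge to the new edge. -/
def mergeMap (F : FusionFrame ℓ K P Q) :
    Rep.of (chainsRep K 1) ⟶ Rep.of (chainsRep F.fuse 1) :=
  correspondence K F.fuse 1 (fun σ τ => τ = σ ∨ ∃ g, σ = hermRep m g '' seg Q (P + Q) ∧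
    τ = hermRep m g '' seg P Q) (by
    rintro k σ τ (rfl | ⟨g, rfl, rfl⟩)
    · exact Or.inl rfl
    · exact Or.inr ⟨k * g, (image_mul _ _ _).symm, (image_mul _ _ _).symm⟩)

/-- The chains of the first edge, as a quotient of the chains. -/
def firstEdgeMap (_F : FusionFrame ℓ K P Q) :
    Rep.of (chainsRep K 1) ⟶ Rep.of (chainsRep (orbitFamily (hermRep m) (seg P (P + Q))) 1) :=
  restriction _ _ 1 - correspondence K _ 1 (fun σ τ => ∃ g, σ = hermRep m g '' seg Q (P + Q) ∧
    τ = hermRep m g '' seg P (P + Q)) (by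
    rintro k σ τ ⟨g, rfl, rfl⟩
    exact ⟨k * g, (image_mul _ _ _).symm, (image_mul _ _ _).symm⟩)

lemma splitMap_of_mem (hK : IsTorsionGraph ℓ K) (F : FusionFrame ℓ K P Q)
    (f : FramedCell F.fuse 1) (h : f.cell ∈ K.cells) :
    F.splitMap.hom f.chain = f.move K f.cell := by
  refine correspondence_chain_single _ f (Or.inl rfl) ?_
  rintro υ - (rfl | ⟨g, hg, -⟩) -
  · rfl
  · exact absurd ⟨g, hg.symm⟩ (F.not_sameOrbit_of_mem hK h)

lemma splitMap_new (hK : IsTorsionGraph ℓ K) (F : FusionFrame ℓ K P Q)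
    (f : FramedCell F.fuse 1) (h : f.cell = seg P Q) :
    F.splitMap.hom f.chain = f.move K (seg P (P + Q)) + f.move K (seg Q (P + Q)) := by
  have one : ∀ σ : Set (Matrix (Fin 2) (Fin 2) ℂ), σ = hermRep m 1 '' σ := fun σ => by
    rw [map_one]; exact (Set.image_id _).symm
  refine correspondence_chain_pair _ f (fun e => F.not_same (e ▸ mem_orbitFamily_self _))
    (Or.inr ⟨1, h.trans (one _), Or.inl (one _)⟩) (Or.inr ⟨1, h.trans (one _), Or.inr (one _)⟩) ?_
  rintro υ hυ (rfl | ⟨g, hg, hh⟩) -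
  · exact absurd (h ▸ mem_orbitFamily_self _) (F.not_sameOrbit_of_mem hK hυ)
  · obtain ⟨hP, hQ⟩ := F.fixed_of_image hK (hg.symm.trans h)
    simpa only [image_seg, map_add, hP, hQ] using hh

lemma mergeMap_of_mem (F : FusionFrame ℓ K P Q) (f : FramedCell K 1)
    (h : ¬ SameOrbit (hermRep m) (seg Q (P + Q)) f.cell) :
    F.mergeMap.hom f.chain = f.move F.fuse f.cell := by
  refine correspondence_chain_single _ f (Or.inl rfl) ?_
  rintro υ - (rfl | ⟨g, hg, -⟩) -
  · rfl
  · exact absurd ⟨g, hg.symm⟩ h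

lemma mergeMap_right (hK : IsTorsionGraph ℓ K) (F : FusionFrame ℓ K P Q) (f : FramedCell K 1)
    (h : f.cell = seg Q (P + Q)) : F.mergeMap.hom f.chain = f.move F.fuse (seg P Q) := by
  have one : ∀ σ : Set (Matrix (Fin 2) (Fin 2) ℂ), σ = hermRep m 1 '' σ := fun σ => by
    rw [map_one]; exact (Set.image_id _).symm
  refine correspondence_chain_single _ f (Or.inr ⟨1, h.trans (one _), one _⟩) ?_
  rintro υ hυ (rfl | ⟨g, hg, hh⟩) -
  · exact absurd (h ▸ hυ) (F.right_not_mem_fuse hK)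
  · obtain ⟨hP, hQ⟩ := F.fixed_right hK (hg.symm.trans h)
    rw [hh, F.image_eq ⟨hP, hQ⟩]

lemma firstEdgeMap_of_not (F : FusionFrame ℓ K P Q) (f : FramedCell K 1)
    (h : ¬ SameOrbit (hermRep m) (seg Q (P + Q)) f.cell) :
    F.firstEdgeMap.hom f.chain =
      f.move (orbitFamily (hermRep m) (seg P (P + Q))) f.cell := by
  have e : F.firstEdgeMap.hom f.chain = (restriction K _ 1).hom f.chain -
      (correspondence K _ 1 _ _).hom f.chain := rfl
  rw [e, restriction_chain, correspondence_chain_zero, sub_zero]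
  rintro υ - ⟨g, hg, -⟩
  exact absurd ⟨g, hg.symm⟩ h

lemma firstEdgeMap_right (hK : IsTorsionGraph ℓ K) (F : FusionFrame ℓ K P Q) (f : FramedCell K 1)
    (h : f.cell = seg Q (P + Q)) : F.firstEdgeMap.hom f.chain =
      -f.move (orbitFamily (hermRep m) (seg P (P + Q))) (seg P (P + Q)) := by
  have one : ∀ σ : Set (Matrix (Fin 2) (Fin 2) ℂ), σ = hermRep m 1 '' σ := fun σ => by
    rw [map_one]; exact (Set.image_id _).symm
  have e : F.firstEdgeMap.hom f.chain = (restriction K _ 1).hom f.chain -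
      (correspondence K _ 1 _ _).hom f.chain := rfl
  rw [e, restriction_chain_of_not_mem _ (by rw [h]; exact F.not_same), correspondence_chain_single
    (τ := seg P (P + Q)) _ f ⟨1, h.trans (one _), one _⟩, zero_sub]
  rintro υ hυ ⟨g, hg, hh⟩ -
  obtain ⟨hP, hQ⟩ := F.fixed_right hK (hg.symm.trans h)
  rw [hh, image_seg, map_add, hP, hQ]

end FusionFrame

end FusionMaps
-- Invariance of the primary second page under one fusion
section FusionIso

variable {m ℓ : ℕ} {K : CellFamily (hermRep m)} {P Q : Matrix (Fin 2) (Fin 2) ℂ}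

namespace FusionFrame

lemma move_union_restriction {G V : Type} [Group G] [AddCommGroup V] [Module ℝ V]
    {ρ : Representation ℝ G V} {K L : CellFamily ρ} {p : ℕ} (f : FramedCell K p)
    (h : f.cell ∈ L.cells) : (restriction L K p).hom ((restriction K L p).hom f.chain) = f.chain := by
  rw [restriction_chain, restriction_move f h, f.move_self]

/-- A cell is in one of the three orbits or survives. -/
lemma cases_of_mem (F : FusionFrame ℓ K P Q) {σ : Set (Matrix (Fin 2) (Fin 2) ℂ)}
    (h : σ ∈ K.cells) : SameOrbit (hermRep m) (ray (P + Q)) σ ∨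
      SameOrbit (hermRep m) (seg P (P + Q)) σ ∨ SameOrbit (hermRep m) (seg Q (P + Q)) σ ∨
      (σ ∈ F.fuse.cells ∧ ¬ SameOrbit (hermRep m) (seg P (P + Q)) σ ∧
        ¬ SameOrbit (hermRep m) (seg Q (P + Q)) σ) := by
  by_cases h1 : SameOrbit (hermRep m) (ray (P + Q)) σ
  · exact Or.inl h1
  by_cases h2 : SameOrbit (hermRep m) (seg P (P + Q)) σ
  · exact Or.inr (Or.inl h2)
  by_cases h3 : SameOrbit (hermRep m) (seg Q (P + Q)) σ
  · exact Or.inr (Or.inr (Or.inl h3))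
  · exact Or.inr (Or.inr (Or.inr ⟨Or.inl ⟨h, h1, h2, h3⟩, h2, h3⟩))

lemma finrank_of_sameOrbit {σ τ : Set (Matrix (Fin 2) (Fin 2) ℂ)}
    (h : SameOrbit (hermRep m) σ τ) : Module.finrank ℝ (Submodule.span ℝ τ) =
      Module.finrank ℝ (Submodule.span ℝ σ) := by
  obtain ⟨g, rfl⟩ := h
  exact finrank_span_image g σ

lemma exists_image_eq {σ τ : Set (Matrix (Fin 2) (Fin 2) ℂ)} (h : SameOrbit (hermRep m) σ τ) :
    ∃ g, σ = hermRep m g '' τ := by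
  obtain ⟨g, hg⟩ := h.symm
  exact ⟨g, hg.symm⟩

/-- Of the two halves of the subdivided edge, the first goes to zero and the second to the whole
edge. -/
lemma mergeMap_splitMap (hK : IsTorsionGraph ℓ K) (F : FusionFrame ℓ K P Q) :
    F.splitMap ≫ F.mergeMap = 𝟙 _ := by
  refine chains_hom_ext_orbit fun σ hσ hd => ?_
  have key : ∀ f : FramedCell F.fuse 1, (f.cell ∈ K.cells ∧
      ¬ SameOrbit (hermRep m) (seg Q (P + Q)) f.cell) ∨ f.cell = seg P Q →
      F.mergeMap.hom (F.splitMap.hom f.chain) = f.chain := by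
    rintro f (⟨h, h'⟩ | h)
    · rw [F.splitMap_of_mem hK f h, f.move_of_mem h rfl, F.mergeMap_of_mem _ h']
      exact (move_withCell f h rfl).trans f.move_self
    · have s1 : Submodule.span ℝ (seg P (P + Q)) = Submodule.span ℝ f.cell := by
        rw [h, span_half_seg]
      have s2 : Submodule.span ℝ (seg Q (P + Q)) = Submodule.span ℝ f.cell := by
        rw [h, span_half_seg']
      rw [F.splitMap_new hK f h, map_add, f.move_of_mem F.left_mem s1, f.move_of_mem F.right_mem s2,
        F.mergeMap_of_mem _ (fun h' => F.not_same h'.symm), F.mergeMap_right hK _ rfl,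
        move_withCell, move_withCell, ← h, f.move_self, FramedCell.move_of_not, zero_add]
      exact fun h' => F.left_not_mem_fuse hK h'.1
  rcases hσ with h | h
  · obtain ⟨f, rfl⟩ : ∃ f : FramedCell F.fuse 1, f.cell = σ :=
      PCell.exists_framedCell (⟨σ, Or.inl h, hd⟩ : PCell F.fuse 1)
    exact ⟨1, f, by rw [map_one]; exact (Set.image_id _).symm, key _ (Or.inl ⟨h.1, h.2.2.2⟩)⟩
  · obtain ⟨g, hg⟩ := exists_image_eq h
    exact ⟨g, edgeCell _ F.indep F.seg_mem_fuse, hg, key _ (Or.inr rfl)⟩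

/-- The second half is the subdivided new edge minus the first half; the minus sign is the one in
`firstEdgeMap`. -/
lemma splitMap_mergeMap (hK : IsTorsionGraph ℓ K) (F : FusionFrame ℓ K P Q) :
    F.mergeMap ≫ F.splitMap +
      F.firstEdgeMap ≫ restriction (orbitFamily (hermRep m) (seg P (P + Q))) K 1 = 𝟙 _ := by
  refine chains_hom_ext_orbit fun σ hσ hd => ?_
  have key : ∀ f : FramedCell K 1, f.cell = seg Q (P + Q) ∨ f.cell = seg P (P + Q) ∨
      (f.cell ∈ F.fuse.cells ∧ ¬ SameOrbit (hermRep m) (seg P (P + Q)) f.cell ∧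
        ¬ SameOrbit (hermRep m) (seg Q (P + Q)) f.cell) →
      F.splitMap.hom (F.mergeMap.hom f.chain) +
        (restriction (orbitFamily (hermRep m) (seg P (P + Q))) K 1).hom
          (F.firstEdgeMap.hom f.chain) = f.chain := by
    rintro f (h | h | ⟨h, h1, h2⟩)
    · have s1 : Submodule.span ℝ (seg P Q) = Submodule.span ℝ f.cell := by
        rw [h, span_half_seg']
      rw [F.mergeMap_right hK f h, F.firstEdgeMap_right hK f h, map_neg,
        restriction_move f (mem_orbitFamily_self _), f.move_of_mem F.seg_mem_fuse s1,
        F.splitMap_new hK _ rfl, move_withCell, move_withCell, ← h, f.move_self]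
      abel
    · have h2 : ¬ SameOrbit (hermRep m) (seg Q (P + Q)) f.cell := by
        rw [h]; exact fun h' => F.not_same h'.symm
      rw [F.mergeMap_of_mem f h2, F.firstEdgeMap_of_not f h2, restriction_move f
        (by rw [h]; exact mem_orbitFamily_self _), f.move_self, FramedCell.move_of_not, map_zero,
        zero_add]
      exact fun h' => F.left_not_mem_fuse hK (h ▸ h'.1)
    · rw [F.mergeMap_of_mem f h2, F.firstEdgeMap_of_not f h2, f.move_of_not
        (L := orbitFamily (hermRep m) (seg P (P + Q))) (fun h' => h1 h'.1), map_zero, add_zero, f.move_of_mem h rfl, F.splitMap_of_mem hK _ f.mem]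
      exact (move_withCell f h rfl).trans f.move_self
  rcases F.cases_of_mem hσ with h | h | h | h
  · rw [finrank_of_sameOrbit h, finrank_span_ray (PosDef.ne_zero F.posDef)] at hd
    omega
  · obtain ⟨g, hg⟩ := exists_image_eq h
    exact ⟨g, edgeCell _ (indep_half F.indep) F.left_mem, hg, key _ (Or.inr (Or.inl rfl))⟩
  · obtain ⟨g, hg⟩ := exists_image_eq h
    exact ⟨g, edgeCell _ (indep_half' F.indep) F.right_mem, hg, key _ (Or.inl rfl)⟩
  · obtain ⟨f, rfl⟩ : ∃ f : FramedCell K 1, f.cell = σ :=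
      PCell.exists_framedCell (⟨σ, hσ, hd⟩ : PCell K 1)
    exact ⟨1, f, by rw [map_one]; exact (Set.image_id _).symm, key _ (Or.inr (Or.inr h))⟩

lemma mem_of_mem_fuse_vertex (F : FusionFrame ℓ K P Q) (f : FramedCell F.fuse 0) :
    f.cell ∈ K.cells ∧ ¬ SameOrbit (hermRep m) (ray (P + Q)) f.cell := by
  rcases f.mem with h | h
  · exact ⟨h.1, h.2.1⟩
  · have := finrank_of_sameOrbit h
    rw [f.dim, finrank_span_seg F.indep] at this
    omega

lemma restriction_fuse (F : FusionFrame ℓ K P Q) :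
    restriction F.fuse K 0 ≫ restriction K F.fuse 0 = 𝟙 _ :=
  chains_hom_ext fun f => move_union_restriction f (F.mem_of_mem_fuse_vertex f).1

lemma restriction_fuse_vertex (F : FusionFrame ℓ K P Q) :
    restriction F.fuse K 0 ≫ restriction K (orbitFamily (hermRep m) (ray (P + Q))) 0 = 0 := by
  refine chains_hom_ext fun f => ?_
  obtain ⟨h, h'⟩ := F.mem_of_mem_fuse_vertex f
  have e : (restriction K (orbitFamily (hermRep m) (ray (P + Q))) 0).hom
      ((restriction F.fuse K 0).hom f.chain) = 0 := by
    rw [restriction_chain, restriction_move f h, f.move_of_not fun h'' => h' h''.1]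
  exact e

lemma restriction_vertices (F : FusionFrame ℓ K P Q) :
    restriction K F.fuse 0 ≫ restriction F.fuse K 0 +
      restriction K (orbitFamily (hermRep m) (ray (P + Q))) 0 ≫
        restriction (orbitFamily (hermRep m) (ray (P + Q))) K 0 = 𝟙 _ := by
  refine chains_hom_ext fun f => ?_
  have key : (restriction F.fuse K 0).hom ((restriction K F.fuse 0).hom f.chain) +
      (restriction (orbitFamily (hermRep m) (ray (P + Q))) K 0).hom
        ((restriction K (orbitFamily (hermRep m) (ray (P + Q))) 0).hom f.chain) = f.chain := by
    have hd := f.dim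
    rcases F.cases_of_mem f.mem with h | h | h | h
    · have hn : f.cell ∉ F.fuse.cells := by
        rintro (h' | h')
        · exact h'.2.1 h
        · have := finrank_of_sameOrbit h'
          rw [f.dim, finrank_span_seg F.indep] at this
          omega
      rw [move_union_restriction (L := orbitFamily (hermRep m) (ray (P + Q))) f h,
        restriction_chain_of_not_mem f hn, map_zero, zero_add]
    · rw [finrank_of_sameOrbit h, finrank_span_seg (indep_half F.indep)] at hd
      omega
    · rw [finrank_of_sameOrbit h, finrank_span_seg (indep_half' F.indep)] at hd
      omega
    · have hn : f.cell ∉ (orbitFamily (hermRep m) (ray (P + Q))).cells := by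
        rcases h.1 with h' | h'
        · exact h'.2.1
        · have := finrank_of_sameOrbit h'
          rw [f.dim, finrank_span_seg F.indep] at this
          omega
      rw [move_union_restriction f h.1, restriction_chain_of_not_mem f hn, map_zero, add_zero]
  exact key

lemma indep_right_half (F : FusionFrame ℓ K P Q) : LinearIndependent ℝ ![P + Q, Q] :=
  indep_symm (indep_half' F.indep)

lemma boundary_left (hK : IsTorsionGraph ℓ K) (F : FusionFrame ℓ K P Q) (f : FramedCell K 1)
    (h : f.cell = seg P (P + Q)) (h0 : f.vec 0 = P) (h1 : f.vec 1 = Q ∨ f.vec 1 = P + Q) :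
    boundary K 0 f.chain = vertexChain K (P + Q) - vertexChain K P := by
  have e : (edgeCell K (indep_half F.indep) F.left_mem).chain = f.chain := by
    rcases h1 with h1 | h1
    · exact FramedCell.chain_eq_of_pos _ _ (c := 1 * 1 - 0 * 1) (by norm_num) h.symm
        (framesDiffer_pair (P := P) (Q := Q) 1 0 1 1 h0 h1 (by simp) (by simp))
    · exact FramedCell.chain_eq_of_pos _ _ (c := 1 * 1 - 0 * 0) (by norm_num) h.symm
        (framesDiffer_pair (P := P) (Q := P + Q) 1 0 0 1 h0 h1 (by simp) (by simp))
  rw [← e, boundary_chain]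
  exact boundaryCell_edge (hK.isOriented 0) _ (indep_half F.indep) rfl rfl rfl
    (hK.vertices_of_edge (indep_half F.indep) F.left_mem)

lemma boundary_right (hK : IsTorsionGraph ℓ K) (F : FusionFrame ℓ K P Q) (f : FramedCell K 1)
    (h : f.cell = seg Q (P + Q)) (h0 : f.vec 0 = P) (h1 : f.vec 1 = Q) :
    boundary K 0 f.chain = vertexChain K Q - vertexChain K (P + Q) := by
  have hm : seg (P + Q) Q ∈ K.cells := by rw [seg_comm]; exact F.right_mem
  have e : (edgeCell K F.indep_right_half hm).chain = f.chain :=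
    FramedCell.chain_eq_of_pos _ _ (c := 1 * 1 - 1 * 0) (by norm_num)
      ((seg_comm _ _).trans h.symm)
      (framesDiffer_pair (P := P) (Q := Q) 1 1 0 1 h0 h1 (by simp) (by simp))
  rw [← e, boundary_chain]
  exact boundaryCell_edge (hK.isOriented 0) _ F.indep_right_half rfl rfl rfl
    (hK.vertices_of_edge F.indep_right_half hm)

/-- The inner vertex cancels between the two halves. The ends of the new edge are not in its orbit,
nor are the ends of surviving edges, because all edges at the vertex belong to the two orbits. -/
lemma splitMap_boundary (hK : IsTorsionGraph ℓ K) (F : FusionFrame ℓ K P Q) :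
    F.splitMap ≫ boundaryHom K 0 = boundaryHom F.fuse 0 ≫ restriction F.fuse K 0 := by
  have hL := F.fuse_isTorsionGraph hK
  have hv : ∀ X, ¬ SameOrbit (hermRep m) (ray (P + Q)) (ray X) →
      (restriction F.fuse K 0).hom (vertexChain F.fuse X) = vertexChain K X := fun X hX =>
    restriction_vertexChain fun h => F.ray_mem_fuse h hX
  refine chains_hom_ext_orbit fun σ hσ hd => ?_
  rcases hσ with h | h
  · obtain ⟨X, Y, hXY, -, -, rfl, -⟩ := hK.eq_seg_of_finrank h.1 hd
    have hX := F.end_not_vertex hXY h.1 h.2.2.1 h.2.2.2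
    have hY := F.end_not_vertex (indep_symm hXY) (seg_comm X Y ▸ h.1) (seg_comm X Y ▸ h.2.2.1)
      (seg_comm X Y ▸ h.2.2.2)
    have h' : seg X Y ∈ F.fuse.cells := Or.inl h
    refine ⟨1, edgeCell F.fuse hXY h', by rw [map_one]; exact (Set.image_id _).symm, ?_⟩
    have key : boundary K 0 (F.splitMap.hom (edgeCell F.fuse hXY h').chain) =
        (restriction F.fuse K 0).hom
          (boundary F.fuse 0 (edgeCell F.fuse hXY h').chain) := by
      rw [F.splitMap_of_mem hK _ h.1, (edgeCell F.fuse hXY h').move_of_mem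
        (τ := (edgeCell F.fuse hXY h').cell) h.1 rfl, boundary_chain,
        boundary_chain, boundaryCell_edge (hK.isOriented 0) _ hXY rfl rfl rfl
          (hK.vertices_of_edge hXY h.1), boundaryCell_edge (hL.isOriented 0) _ hXY rfl rfl rfl
          (hL.vertices_of_edge hXY h'), map_sub, hv X hX, hv Y hY]
    exact key
  · obtain ⟨g, hg⟩ := exists_image_eq h
    refine ⟨g, edgeCell F.fuse F.indep F.seg_mem_fuse, hg, ?_⟩
    have hP : ¬ SameOrbit (hermRep m) (ray (P + Q)) (ray P) := by
      rintro ⟨g, hg⟩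
      refine F.left_not_vertex hK g ?_
      rw [← hg]
      exact Set.mem_image_of_mem _ (mem_ray_self _)
    have hQ : ¬ SameOrbit (hermRep m) (ray (P + Q)) (ray Q) := by
      rintro ⟨g, hg⟩
      refine F.right_not_vertex hK g ?_
      rw [← hg]
      exact Set.mem_image_of_mem _ (mem_ray_self _)
    have key : boundary K 0 (F.splitMap.hom (edgeCell F.fuse F.indep F.seg_mem_fuse).chain) =
        (restriction F.fuse K 0).hom
          (boundary F.fuse 0 (edgeCell F.fuse F.indep F.seg_mem_fuse).chain) := by
      rw [F.splitMap_new hK _ rfl, (edgeCell F.fuse F.indep F.seg_mem_fuse).move_of_mem F.left_mem span_half_seg,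
        (edgeCell F.fuse F.indep F.seg_mem_fuse).move_of_mem F.right_mem span_half_seg', map_add,
        F.boundary_left hK _ rfl rfl (Or.inl rfl), F.boundary_right hK _ rfl rfl rfl,
        boundary_chain, boundaryCell_edge (hL.isOriented 0) _ F.indep rfl rfl rfl
          (hL.vertices_of_edge F.indep F.seg_mem_fuse), map_sub, hv P hP, hv Q hQ]
      abel
    exact key

/-- The complement of the fused chains is the orbit of the first half in degree one and that of the
vertex in degree zero, and the boundary between them induces a bijection of `ℓ`-primary parts. The
decisive point is that no nontrivial element fixes two different edges at the vertex in the orbit of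
the first half. -/
lemma E2Primary_equiv_fuse (hm : Squarefree m) (hℓ : ℓ.Prime) (hK : IsTorsionGraph ℓ K)
    (F : FusionFrame ℓ K P Q) (p q : ℕ) (hq : 1 ≤ q) :
    Nonempty (E2Primary ℓ F.fuse p q ≃+ E2Primary ℓ K p q) := by
  obtain ⟨q, rfl⟩ : ∃ q', q = q' + 1 := ⟨q - 1, by omega⟩
  have hL := F.fuse_isTorsionGraph hK
  obtain ⟨c, hc, hcP, hcQ⟩ := F.torsion
  have hbij := primary_bijective_of_single_orbit (ℓ := ℓ) hℓ (p := 1) (r := 0)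
    (K := orbitFamily (hermRep m) (seg P (P + Q))) (L := orbitFamily (hermRep m) (ray (P + Q)))
    ((hK.isOriented 1).of_subset (orbitFamily_subset F.left_mem))
    ((hK.isOriented 0).of_subset (orbitFamily_subset F.vertex))
    (edgeCell _ (indep_half F.indep) (mem_orbitFamily_self _))
    (vertexCell _ (PosDef.ne_zero F.posDef) (mem_orbitFamily_self _))
    (restriction _ K 1 ≫ boundaryHom K 0 ≫ restriction K _ 0) ?_ (fun σ => σ.2.1) (fun σ => σ.2.1)
    (fun g hg => ?_) ?_ ?_ hc (image_eq_of_fixed hcP (by rw [map_add, hcP, hcQ])) q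
  · refine E2Primary_equiv_of_split ℓ F.splitMap (restriction F.fuse K 0) F.mergeMap
      (restriction K F.fuse 0) F.firstEdgeMap (restriction _ K 1) (restriction K _ 0)
      (restriction _ K 0) (F.splitMap_boundary hK) (F.splitMap_mergeMap hK) (F.mergeMap_splitMap hK)
      F.restriction_vertices F.restriction_fuse F.restriction_fuse_vertex (fun x _ => hbij.1 x)
      hbij.2 (fun p hp => homology_chains_eq_zero (fun σ hσ => ?_) _) fun p hp =>
        homology_chains_eq_zero (fun σ hσ => ?_) _
    · have := hK.finrank_le hσ
      omega
    · have := hL.finrank_le hσ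
      omega
  · have hP : ray P ∉ (orbitFamily (hermRep m) (ray (P + Q))).cells := by
      rintro ⟨g, hg⟩
      refine F.left_not_vertex hK g ?_
      rw [← hg]
      exact Set.mem_image_of_mem _ (mem_ray_self _)
    have key : (restriction K (orbitFamily (hermRep m) (ray (P + Q))) 0).hom (boundary K 0
        ((restriction (orbitFamily (hermRep m) (seg P (P + Q))) K 1).hom
          (edgeCell _ (indep_half F.indep) (mem_orbitFamily_self _)).chain)) =
        (vertexCell _ (PosDef.ne_zero F.posDef) (mem_orbitFamily_self _)).chain := by
      rw [restriction_chain_of_mem _ F.left_mem, F.boundary_left hK _ rfl rfl (Or.inr rfl), map_sub,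
        restriction_vertexChain_of_not_mem hP, sub_zero, restriction_vertexChain fun _ => F.vertex,
        vertexChain_of_mem (PosDef.ne_zero F.posDef) (mem_orbitFamily_self _)]
    exact key
  · obtain ⟨hP, hQ⟩ := F.fixed_left hK hg
    change hermRep m g '' ray (P + Q) = ray (P + Q)
    rw [image_ray, map_add, hP, hQ]
  · obtain ⟨N, -, hN⟩ := exists_stabilizer_bound hm
    have := (hN (pointStabilizer m (P + Q)) _ F.posDef fun g hg => hg).1
    refine (Set.toFinite (pointStabilizer m (P + Q) : Set (BianchiGroup m))).subset ?_
    intro g hg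
    exact hK.fixed_pointwise g _ F.vertex hg _ (mem_ray_self _)
  · intro g hgv hne k hk hkg
    change hermRep m g '' ray (P + Q) = ray (P + Q) at hgv
    change hermRep m k '' seg P (P + Q) = seg P (P + Q) at hk
    change hermRep m k '' (hermRep m g '' seg P (P + Q)) = hermRep m g '' seg P (P + Q) at hkg
    by_contra hk1
    obtain ⟨hP, hQ⟩ := F.fixed_left hK hk
    have hfix := hK.fixed_pointwise k _ (K.image_mem g _ F.left_mem) hkg
    rw [image_seg] at hfix
    obtain ⟨hgP, -⟩ := fixed_ends hfix
    -- If `k` is not trivial, both edges lie on its axis. Then `g` keeps this axis and cannot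
    -- reverse it, since the opposite edge is in the other orbit; so the two edges coincide.
    obtain ⟨x, y, hxy⟩ := mem_span_of_fixed F.posDef hk1 (by rw [map_add, hP, hQ]) hP
      (indep_symm (indep_half F.indep)) F.left.isHermitian
      (hermRep_isHermitian g F.left.isHermitian) hgP
    obtain ⟨h1, h2⟩ := F.fixed_of_vertex hK (g := g)
      (mem_span_seg.mpr ⟨x + y, x, by rw [hxy]; module⟩) (by rw [← image_ray, hgv])
    refine hne ?_
    change hermRep m g '' seg P (P + Q) = seg P (P + Q)
    rw [image_seg, map_add, h1, h2]

end FusionFrame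

end FusionIso
-- Opposite edges and reversals of an axis
section Existence

variable {m ℓ : ℕ} {K K' : CellFamily (hermRep m)} {A P B : Matrix (Fin 2) (Fin 2) ℂ}
  {v e₁ e₂ : Set (Matrix (Fin 2) (Fin 2) ℂ)}

lemma exists_fusion_of_axis (hℓ : ℓ.Prime) (hK : IsTorsionGraph ℓ K)
    (h : ExactlyTwoEdges K v e₁ e₂)
    (hg : ∃ g : BianchiGroup m, orderOf g = ℓ ∧ hermRep m g '' e₁ = e₁ ∧ hermRep m g '' e₂ = e₂) :
    ∃ K', IsEdgeFusionAt ℓ v K K' := by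
  obtain ⟨P, Q, F, rfl, rfl, rfl⟩ := exists_fusionFrame hℓ hK h hg
  refine ⟨F.fuse, _, _, h, hg, ?_⟩
  rw [← seg_eq_union]
  rfl

lemma exists_frame_of_fusion (hℓ : ℓ.Prime) (hK : IsTorsionGraph ℓ K)
    (h : IsEdgeFusionAt ℓ v K K') : ∃ P Q, ∃ F : FusionFrame ℓ K P Q, K' = F.fuse := by
  obtain ⟨e₁, e₂, h, hg, hcells⟩ := h
  obtain ⟨P, Q, F, rfl, rfl, rfl⟩ := exists_fusionFrame hℓ hK h hg
  refine ⟨P, Q, F, ?_⟩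
  rw [← seg_eq_union] at hcells
  have hc : K'.cells = F.fuse.cells := hcells
  cases h1 : K'
  cases h2 : F.fuse
  rw [h1, h2] at hc
  simpa using hc

namespace IsTorsionGraph

/-- Two edges which leave a vertex in the same direction are equal. -/
lemma edge_eq_of_direction (hK : IsTorsionGraph ℓ K) {x y x' y' : ℝ}
    (h : seg A (x • A + y • B) ∈ K.cells) (h' : seg A (x' • A + y' • B) ∈ K.cells)
    (hy : 0 < y * y') : seg A (x • A + y • B) = seg A (x' • A + y' • B) := by
  have hy0 : y ≠ 0 := left_ne_zero_of_mul hy.ne'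
  have hy0' : y' ≠ 0 := right_ne_zero_of_mul hy.ne'
  have aux : ∀ x y x' y' : ℝ, y ≠ 0 → Submodule.span ℝ (seg A (x' • A + y' • B)) ≤
      Submodule.span ℝ (seg A (x • A + y • B)) := by
    intro x y x' y' hy z hz
    rw [mem_span_seg] at hz ⊢
    obtain ⟨a, b, rfl⟩ := hz
    refine ⟨a + b * x' - b * y' / y * x, b * y' / y, ?_⟩
    rw [smul_add (b * y' / y), smul_smul (b * y' / y) y, div_mul_cancel₀ _ hy]
    module
  refine hK.eq_of_span _ h _ h' (le_antisymm (aux _ _ _ _ hy0') (aux _ _ _ _ hy0)) ?_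
  set s := |x| + |y' / y * x| + |x'| + 1
  have hyy : 0 < y' / y := by
    rw [div_pos_iff]
    rcases lt_or_gt_of_ne hy0 with h1 | h1
    · exact Or.inr ⟨neg_of_mul_pos_right hy h1.le, h1⟩
    · exact Or.inl ⟨(pos_iff_pos_of_mul_pos hy).mp h1, h1⟩
  refine ⟨(s + x') • A + y' • B, ⟨s + x' - y' / y * x, y' / y, ?_, hyy, ?_⟩,
    ⟨s, 1, by positivity, one_pos, by module⟩⟩
  · have h1 := neg_abs_le x'
    have h2 := le_abs_self (y' / y * x)
    have h3 := abs_nonneg x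
    simp only [s]
    linarith
  · rw [smul_add (y' / y), smul_smul (y' / y) y, div_mul_cancel₀ _ hy0]
    module

lemma fixes_of_image_ray (hK : IsTorsionGraph ℓ K) (hA : ray A ∈ K.cells) {g : BianchiGroup m}
    (h : hermRep m g '' ray A = ray A) : hermRep m g A = A :=
  hK.fixed_pointwise g _ hA h A (mem_ray_self A)

lemma isAdjacent_seg (hA : A.PosDef) (hAK : ray A ∈ K.cells) (hi : LinearIndependent ℝ ![A, B])
    (h : seg A B ∈ K.cells) : IsAdjacent K (ray A) (seg A B) :=
  ⟨⟨hAK, finrank_span_ray (PosDef.ne_zero hA)⟩, ⟨h, finrank_span_seg hi⟩,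
    ray_left_subset_closure hi⟩

end IsTorsionGraph

lemma indep_neg {V : Type} [AddCommGroup V] [Module ℝ V] {A B : V}
    (h : LinearIndependent ℝ ![A, B]) : LinearIndependent ℝ ![A, -B] := by
  have := indep_combination h 0 (b := -1) (by norm_num)
  simpa using this

/-- Either the opposite edge lies in the other orbit, so that an edge fusion can be carried out, or
the axis is reversed by an element of the stabiliser of the vertex. -/
lemma fusion_or_flip (hℓ : ℓ.Prime) (hK : IsTorsionGraph ℓ K)
    (h : ExactlyTwoEdges K (ray A) (seg A P) e₂) (hA : A.PosDef) (hP : P.PosSemidef)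
    (hi : LinearIndependent ℝ ![A, P]) {c : BianchiGroup m} (hc : orderOf c = ℓ)
    (hcA : hermRep m c A = A) (hcP : hermRep m c P = P) :
    (∃ K', IsEdgeFusionAt ℓ (ray A) K K') ∨ ∃ a b : ℝ, 0 < b ∧ seg A (a • A - b • P) ∈ K.cells ∧
      ∃ k : BianchiGroup m, hermRep m k A = A ∧
        hermRep m k '' seg A (a • A - b • P) = seg A P := by
  obtain ⟨h1, h2, hns, hall⟩ := h
  have hAK := h1.1.1
  -- The edge on the axis of `c` which leaves the vertex in the direction opposite to `P`.
  obtain ⟨a, b, hb, hm⟩ := hK.exists_edge A hA hAK c hc hcA (-P) hP.isHermitian.neg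
    (by rw [map_neg, hcP]) (indep_neg hi)
  have e : a • A + b • -P = a • A - b • P := by module
  have hadj := IsTorsionGraph.isAdjacent_seg hA hAK (indep_combination (indep_neg hi) a hb.ne') hm
  obtain ⟨k, hk, hk'⟩ := hall _ hadj
  rw [e] at hm hadj hk'
  rcases hk' with hk' | hk'
  · exact Or.inr ⟨a, b, hb, hm, k, hK.fixes_of_image_ray hAK hk, hk'⟩
  -- Here the opposite edge is in the orbit of `e₂` under the stabiliser of the vertex; it replaces
  -- `e₂` and lies on the same axis as the first edge.
  · left
    refine exists_fusion_of_axis hℓ hK (e₁ := seg A P) (e₂ := seg A (a • A - b • P))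
      ⟨h1, hadj, fun h => hns (h.trans ⟨k, hk'⟩), fun e he => ?_⟩ ⟨c, hc, image_eq_of_fixed hcA hcP,
        image_eq_of_fixed hcA (by rw [map_sub, map_smul, map_smul, hcA, hcP])⟩
    obtain ⟨g, hg, hg' | hg'⟩ := hall e he
    · exact ⟨g, hg, Or.inl hg'⟩
    · refine ⟨k⁻¹ * g, ?_, Or.inr ?_⟩
      · rw [image_mul, hg]
        nth_rewrite 1 [← hk]
        exact image_image_inv k _
      · rw [image_mul, hg', ← hk', image_image_inv]

/-- If rotations about the two edges are conjugate in the stabiliser of the vertex and the second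
axis is reversed, then the edges lie in one orbit. -/
lemma sameOrbit_of_conj (hK : IsTorsionGraph ℓ K) (hA : A.PosDef) (hB : B.PosSemidef)
    (hP : P.PosSemidef) (hiP : LinearIndependent ℝ ![A, P]) (hi : LinearIndependent ℝ ![A, B])
    (h1 : seg A P ∈ K.cells) (h2 : seg A B ∈ K.cells) {c d s k : BianchiGroup m}
    (hd1 : d ≠ 1) (hcP : hermRep m c P = P) (hdA : hermRep m d A = A)
    (hdB : hermRep m d B = B) (hsA : hermRep m s A = A)
    (hs : s * c * s⁻¹ = d ∨ s * c * s⁻¹ = d⁻¹) {a b : ℝ} (hb : 0 < b)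
    (hm : seg A (a • A - b • B) ∈ K.cells)
    (hk : hermRep m k '' seg A (a • A - b • B) = seg A B) :
    SameOrbit (hermRep m) (seg A P) (seg A B) := by
  have hfix : hermRep m d (hermRep m s P) = hermRep m s P := by
    have h3 : hermRep m (s * c * s⁻¹) (hermRep m s P) = hermRep m s P := by
      rw [← Module.End.mul_apply, ← map_mul, inv_mul_cancel_right, map_mul, Module.End.mul_apply,
        hcP]
    rcases hs with hs | hs
    · rwa [hs] at h3
    · rw [hs] at h3
      have := hermRep_inv_fix h3
      rwa [inv_inv] at this
  obtain ⟨x, y, hxy⟩ := mem_span_of_fixed hA hd1 hdA hdB hi hB.isHermitian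
    (hermRep_isHermitian s hP.isHermitian) hfix
  have himg : hermRep m s '' seg A P = seg A (x • A + y • B) := by rw [image_seg, hsA, hxy]
  have hmem : seg A (x • A + y • B) ∈ K.cells := himg ▸ K.image_mem s _ h1
  have hy : y ≠ 0 := by
    rintro rfl
    have := indep_image (rho_injective (hermRep m) s) hiP
    rw [hsA, hxy] at this
    have := LinearIndependent.pair_iff.mp this x (-1) (by module)
    linarith [this.2]
  -- The image of the first edge lies on the second axis. It is either the edge towards `B` or the
  -- opposite one, which `k` takes to the edge towards `B`.
  rcases lt_or_gt_of_ne hy with hy | hy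
  · have e : a • A - b • B = a • A + (-b) • B := by module
    rw [e] at hm hk
    have := hK.edge_eq_of_direction hmem hm (by nlinarith)
    exact ⟨k * s, by rw [image_mul, himg, this, hk]⟩
  · have e : B = (0 : ℝ) • A + (1 : ℝ) • B := by module
    rw [e] at h2
    have := hK.edge_eq_of_direction hmem h2 (by linarith)
    exact ⟨s, by rw [himg, this, ← e]⟩

end Existence
-- Existence of edge fusions
section Conjugacy

variable {m ℓ : ℕ} {K K' : CellFamily (hermRep m)} {A P Q : Matrix (Fin 2) (Fin 2) ℂ}

lemma conj_of_isConj {c d : pointStabilizer m A} (h : IsConj c d) :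
    ∃ s : BianchiGroup m, hermRep m s A = A ∧ s * c * s⁻¹ = d := by
  obtain ⟨s, hs⟩ := isConj_iff.mp h
  exact ⟨s, s.2, congrArg Subtype.val hs⟩

lemma exists_conj_of_order_three (hm : Squarefree m) (hA : A.PosDef) {c d : BianchiGroup m}
    (hc : c ≠ 1) (hccc : c * c * c = 1) (hd : d ≠ 1) (hddd : d * d * d = 1)
    (hcA : hermRep m c A = A) (hdA : hermRep m d A = A) :
    ∃ s : BianchiGroup m, hermRep m s A = A ∧ (s * c * s⁻¹ = d ∨ s * c * s⁻¹ = d⁻¹) := by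
  let c' : pointStabilizer m A := ⟨c, hcA⟩
  let d' : pointStabilizer m A := ⟨d, hdA⟩
  have h1 : c' * c' * c' = 1 := Subtype.ext hccc
  have h2 : d' * d' * d' = 1 := Subtype.ext hddd
  have h3 : d'⁻¹ * d'⁻¹ * d'⁻¹ = 1 := by
    rw [← mul_inv_rev, ← mul_inv_rev, ← mul_assoc, h2, inv_one]
  rcases conj_of_order_three hm hA hc hccc hd hddd hcA hdA with h | h | h | h
  · exact ⟨1, by simp, Or.inl (by simpa using h)⟩
  · exact ⟨1, by simp, Or.inr (by simpa using h)⟩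
  · obtain ⟨s, hs, e⟩ := conj_of_isConj (isConj_of_cubes h1 h2 (Subtype.ext h))
    exact ⟨s, hs, Or.inr e⟩
  · obtain ⟨s, hs, e⟩ := conj_of_isConj (isConj_of_cubes h1 h3 (Subtype.ext h))
    exact ⟨s, hs, Or.inl (by simpa using e)⟩

lemma exists_conj_of_involutions (hm : Squarefree m) (hA : A.PosDef) {c d k : BianchiGroup m}
    (hc : c ≠ 1) (hcc : c * c = 1) (hd : d ≠ 1) (hdd : d * d = 1)
    (hcA : hermRep m c A = A) (hdA : hermRep m d A = A) (hkA : hermRep m k A = A)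
    (hall : ∀ x : BianchiGroup m, x ≠ 1 → x * x = 1 → hermRep m x A = A →
      ∃ s : BianchiGroup m, hermRep m s A = A ∧ (s * x * s⁻¹ = c ∨ s * x * s⁻¹ = d))
    (hk : k ≠ 1) (hkc : k ≠ c) (hcomm : k * c = c * k) :
    ∃ s : BianchiGroup m, hermRep m s A = A ∧ s * c * s⁻¹ = d := by
  have e1 : ∀ {x : pointStabilizer m A}, x ≠ 1 → (x : BianchiGroup m) ≠ 1 :=
    fun hx h => hx (Subtype.ext h)
  refine conj_of_isConj (isConj_of_involutions (F := pointStabilizer m A) (c := ⟨c, hcA⟩)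
    (d := ⟨d, hdA⟩) (k := ⟨k, hkA⟩) ?_ ?_ ?_ (fun h => hc (congrArg Subtype.val h)) (Subtype.ext hcc)
    (fun h => hd (congrArg Subtype.val h)) (Subtype.ext hdd) ?_
    (fun h => hk (congrArg Subtype.val h)) (fun h => hkc (congrArg Subtype.val h))
    (Subtype.ext hcomm))
  · intro g
    rcases fixing_cases hm hA g.2 with h | h | h
    · left
      rw [show g = 1 from Subtype.ext h, one_mul]
    · exact Or.inl (Subtype.ext h.2)
    · exact Or.inr (Subtype.ext h.2)
  · intro c x y hc hcc hx hy hx1 hxc hy1 hyc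
    refine (eq_or_eq_mul_of_commute hm hA (e1 hc) (congrArg Subtype.val hcc) c.2 x.2 y.2
      (congrArg Subtype.val hx) (congrArg Subtype.val hy) (e1 hx1) (fun h => hxc (Subtype.ext h))
      (e1 hy1) (fun h => hyc (Subtype.ext h))).imp (fun h => Subtype.ext h) fun h => Subtype.ext h
  · intro c x hc hcc hx
    exact Subtype.ext (mul_self_of_commute hm hA (e1 hc) (congrArg Subtype.val hcc) c.2 x.2
      (congrArg Subtype.val hx))
  · intro x hx hxx
    obtain ⟨s, hs, h | h⟩ := hall x (e1 hx) (congrArg Subtype.val hxx) x.2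
    · exact Or.inl (isConj_iff.mpr ⟨⟨s, hs⟩, Subtype.ext h⟩)
    · exact Or.inr (isConj_iff.mpr ⟨⟨s, hs⟩, Subtype.ext h⟩)

lemma mul_self_eq_one_of_orderOf {G : Type} [Group G] {g : G} (h : orderOf g = 2) : g * g = 1 := by
  rw [← pow_two, ← h, pow_orderOf_eq_one]

lemma mul_mul_eq_one_of_orderOf {G : Type} [Group G] {g : G} (h : orderOf g = 3) :
    g * g * g = 1 := by
  have := pow_orderOf_eq_one g
  rwa [h, pow_succ, pow_two] at this

lemma ne_one_of_orderOf {G : Type} [Group G] (hℓ : ℓ.Prime) {g : G} (h : orderOf g = ℓ) :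
    g ≠ 1 := by
  rintro rfl
  rw [orderOf_one] at h
  exact hℓ.one_lt.ne h

lemma orderOf_eq_two_or_three (hm : Squarefree m) (hℓ : ℓ.Prime) (hA : A.PosDef)
    {g : BianchiGroup m} (hg : orderOf g = ℓ) (h : hermRep m g A = A) : ℓ = 2 ∨ ℓ = 3 := by
  rcases fixing_cases hm hA h with h | h | h
  · exact absurd h (ne_one_of_orderOf hℓ hg)
  · left
    have := orderOf_dvd_of_pow_eq_one (x := g) (n := 2) (by rw [pow_two, h.2])
    rw [hg] at this
    exact (Nat.prime_dvd_prime_iff_eq hℓ Nat.prime_two).mp this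
  · right
    have := orderOf_dvd_of_pow_eq_one (x := g) (n := 3) (by rw [pow_succ, pow_two, h.2])
    rw [hg] at this
    exact (Nat.prime_dvd_prime_iff_eq hℓ Nat.prime_three).mp this

/-- An involution in the stabiliser of a vertex is conjugate to the rotation about an edge to which
an edge on its axis can be transported. -/
lemma conj_of_transport (hm : Squarefree m) (hK : IsTorsionGraph 2 K) (hA : A.PosDef)
    (hP : P.PosSemidef) (hi : LinearIndependent ℝ ![A, P]) {B : Matrix (Fin 2) (Fin 2) ℂ}
    {c x s : BianchiGroup m} (hmem : seg A P ∈ K.cells)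
    (hc : c ≠ 1) (hcc : c * c = 1) (hcA : hermRep m c A = A) (hcP : hermRep m c P = P)
    (hx : x ≠ 1) (hxx : x * x = 1) (hxA : hermRep m x A = A) (hxB : hermRep m x B = B)
    (hs : hermRep m s '' seg A B = seg A P) : s * x * s⁻¹ = c := by
  have h1 : hermRep m (s * x * s⁻¹) '' seg A P = seg A P := by
    rw [← hs, image_mul, image_image_inv, image_mul, image_eq_of_fixed hxA hxB]
  obtain ⟨h2, h3⟩ := fixed_ends (hK.fixed_pointwise _ _ hmem h1)
  refine eq_of_involutions hm hA hP.isHermitian hi ?_ hc hcc h2 hcA h3 hcP ?_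
  · intro h
    have : x = s⁻¹ * (s * x * s⁻¹) * s := by group
    rw [h, mul_one, inv_mul_cancel] at this
    exact hx this
  · have : s * x * s⁻¹ * (s * x * s⁻¹) = s * (x * x) * s⁻¹ := by group
    rw [this, hxx, mul_one, mul_inv_cancel]

/-- At a vertex with exactly two edges, an edge fusion can be carried out. -/
theorem exists_fusion (hm : Squarefree m) (hℓ : ℓ.Prime) (hK : IsTorsionGraph ℓ K)
    {v e₁ e₂ : Set (Matrix (Fin 2) (Fin 2) ℂ)} (h : ExactlyTwoEdges K v e₁ e₂) :
    ∃ K', IsEdgeFusionAt ℓ v K K' := by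
  obtain ⟨A, hA, rfl⟩ := hK.eq_ray_of_finrank h.1.1.1 h.1.1.2
  obtain ⟨P, hiP, hP, rfl, -⟩ := hK.exists_vertex_edge h.1 rfl hA
  obtain ⟨Q, hiQ, hQ, rfl, -⟩ := hK.exists_vertex_edge h.2.1 rfl hA
  have hAK := h.1.1.1
  have hPK := h.1.2.1.1
  have hQK := h.2.1.2.1.1
  have hns := h.2.2.1
  obtain ⟨c, hc, hc'⟩ := hK.torsion _ hPK
  obtain ⟨d, hd, hd'⟩ := hK.torsion _ hQK
  obtain ⟨hcA, hcP⟩ := fixed_ends (hK.fixed_pointwise c _ hPK hc')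
  obtain ⟨hdA, hdQ⟩ := fixed_ends (hK.fixed_pointwise d _ hQK hd')
  have hc1 := ne_one_of_orderOf hℓ hc
  have hd1 := ne_one_of_orderOf hℓ hd
  rcases fusion_or_flip hℓ hK h hA hP hiP hc hcA hcP with h1 | ⟨a, b, hb, hbm, k, hkA, hk⟩
  · exact h1
  have h' : ExactlyTwoEdges K (ray A) (seg A Q) (seg A P) :=
    ⟨h.2.1, h.1, fun h => hns h.symm, fun e he => (h.2.2.2 e he).imp fun g hg => ⟨hg.1, hg.2.symm⟩⟩
  rcases fusion_or_flip hℓ hK h' hA hQ hiQ hd hdA hdQ with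
    h1 | ⟨a', b', hb', hbm', k', -, hk'⟩
  · exact h1
  -- Now both axes are reversed by elements of the stabiliser. A conjugation of `c` to `d` or its
  -- inverse within the stabiliser would put the two edges into one orbit.
  exfalso
  have key : ∀ s : BianchiGroup m, hermRep m s A = A → s * c * s⁻¹ = d ∨ s * c * s⁻¹ = d⁻¹ →
      False := fun s hs hsc =>
    hns (sameOrbit_of_conj hK hA hQ hP hiP hiQ hPK hQK hd1 hcP hdA hdQ hs hsc hb' hbm' hk')
  rcases orderOf_eq_two_or_three hm hℓ hA hc hcA with rfl | rfl
  · have hcc := mul_self_eq_one_of_orderOf hc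
    have hdd := mul_self_eq_one_of_orderOf hd
    -- The element `k` reverses the axis of `c`, so it is neither `1` nor `c`, and it will turn out
    -- to commute with `c`.
    have hflip : ∀ g : BianchiGroup m, hermRep m g A = A → hermRep m g P = P → g ≠ k := by
      rintro g hgA hgP rfl
      rw [image_eq_of_fixed hgA (by rw [map_sub, map_smul, map_smul, hgA, hgP])] at hk
      have hmem : A + (a • A - b • P) ∈ seg A P := by
        rw [← hk]
        exact ⟨1, 1, one_pos, one_pos, by module⟩
      obtain ⟨x, y, hx, hy, e⟩ := hmem
      have := (coeff_eq hiP (a := 1 + a) (b := -b) (c := x) (d := y) (by rw [← e]; module)).2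
      linarith
    have hcomm : k * c * k⁻¹ = c :=
      conj_of_transport hm hK hA hP hiP hPK hc1 hcc hcA hcP hc1 hcc hcA
        (by rw [map_sub, map_smul, map_smul, hcA, hcP]) hk
    -- An edge leaves the vertex along the axis of any involution `x`. It can be moved to one of the
    -- two given edges, whose pointwise stabiliser contains only one involution.
    have hall : ∀ x : BianchiGroup m, x ≠ 1 → x * x = 1 → hermRep m x A = A →
        ∃ s : BianchiGroup m, hermRep m s A = A ∧ (s * x * s⁻¹ = c ∨ s * x * s⁻¹ = d) := by
      intro x hx hxx hxA
      obtain ⟨D, hD, hxD, hiD, -⟩ := exists_axis hA hx hxA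
      obtain ⟨y, z, hz, hm'⟩ := hK.exists_edge A hA hAK x
        (orderOf_eq_prime (by rw [pow_two, hxx]) hx) hxA D hD hxD hiD
      have hxB : hermRep m x (y • A + z • D) = y • A + z • D := by
        rw [map_add, map_smul, map_smul, hxA, hxD]
      obtain ⟨s, hs, hs' | hs'⟩ := h.2.2.2 _
        (IsTorsionGraph.isAdjacent_seg hA hAK (indep_combination hiD y hz.ne') hm')
      · exact ⟨s, hK.fixes_of_image_ray hAK hs, Or.inl
          (conj_of_transport hm hK hA hP hiP hPK hc1 hcc hcA hcP hx hxx hxA hxB hs')⟩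
      · exact ⟨s, hK.fixes_of_image_ray hAK hs, Or.inr
          (conj_of_transport hm hK hA hQ hiQ hQK hd1 hdd hdA hdQ hx hxx hxA hxB hs')⟩
    obtain ⟨s, hs, hsc⟩ := exists_conj_of_involutions hm hA hc1 hcc hd1 hdd hcA hdA hkA hall
      (hflip 1 (by simp) (by simp)).symm (hflip c hcA hcP).symm (mul_inv_eq_iff_eq_mul.mp hcomm)
    exact key s hs (Or.inl hsc)
  · obtain ⟨s, hs, hsc⟩ := exists_conj_of_order_three hm hA hc1 (mul_mul_eq_one_of_orderOf hc) hd1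
      (mul_mul_eq_one_of_orderOf hd) hcA hdA
    exact key s hs hsc

end Conjugacy
-- Open polyhedral cones in a plane
section Cones

variable {A B D P Q : Matrix (Fin 2) (Fin 2) ℂ} {s : Finset (Matrix (Fin 2) (Fin 2) ℂ)}

lemma sum_eq_smul_add_smul {ι : Type} (s : Finset ι) (f : ι → Matrix (Fin 2) (Fin 2) ℂ)
    (α β t : ι → ℝ) (h : ∀ w ∈ s, f w = α w • P + β w • Q) :
    ∑ w ∈ s, t w • f w = (∑ w ∈ s, t w * α w) • P + (∑ w ∈ s, t w * β w) • Q := by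
  rw [Finset.sum_smul, Finset.sum_smul, ← Finset.sum_add_distrib]
  refine Finset.sum_congr rfl fun w hw => ?_
  rw [h w hw]
  module

lemma sum_mul_pos {α t : Matrix (Fin 2) (Fin 2) ℂ → ℝ} (ht : ∀ w ∈ s, 0 < t w)
    (hα : ∀ w ∈ s, 0 ≤ α w) (hP : P ∈ s) (hαP : 0 < α P) : 0 < ∑ w ∈ s, t w * α w :=
  Finset.sum_pos' (fun w hw => mul_nonneg (ht w hw).le (hα w hw)) ⟨P, hP, mul_pos (ht P hP) hαP⟩

lemma openCone_eq_seg (hP : P ∈ s) (hQ : Q ∈ s) (hi : LinearIndependent ℝ ![P, Q])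
    (α β : Matrix (Fin 2) (Fin 2) ℂ → ℝ) (h : ∀ w ∈ s, w = α w • P + β w • Q)
    (hα : ∀ w ∈ s, 0 ≤ α w) (hβ : ∀ w ∈ s, 0 ≤ β w) : openCone s = seg P Q := by
  have hαP : 0 < α P := by
    have := (coeff_eq hi (a := 1) (b := 0) (c := α P) (d := β P) (by rw [← h P hP]; module)).1
    rw [← this]; exact one_pos
  have hβQ : 0 < β Q := by
    have := (coeff_eq hi (a := 0) (b := 1) (c := α Q) (d := β Q) (by rw [← h Q hQ]; module)).2
    rw [← this]; exact one_pos
  have hsum := fun t : Matrix (Fin 2) (Fin 2) ℂ → ℝ => sum_eq_smul_add_smul s (fun w => w) α β t h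
  ext z
  constructor
  · rintro ⟨t, ht, rfl⟩
    exact ⟨_, _, sum_mul_pos ht hα hP hαP, sum_mul_pos ht hβ hQ hβQ, hsum t⟩
  · rintro ⟨a, b, ha, hb, rfl⟩
    have hx : 0 < ∑ w ∈ s, 1 * α w :=
      sum_mul_pos (t := fun _ => 1) (fun _ _ => one_pos) hα hP hαP
    have hy : 0 < ∑ w ∈ s, 1 * β w :=
      sum_mul_pos (t := fun _ => 1) (fun _ _ => one_pos) hβ hQ hβQ
    have he := hsum fun _ => 1
    set x := ∑ w ∈ s, 1 * α w
    set y := ∑ w ∈ s, 1 * β w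
    -- All generators need positive weights: each one gets the small weight `ε`, and `P` and `Q`
    -- carry the rest.
    set ε := min (a / (2 * x)) (b / (2 * y))
    have hε : 0 < ε := lt_min (by positivity) (by positivity)
    have h1 : ε * x < a := by
      have h2 : ε * (2 * x) ≤ a := (le_div_iff₀ (by positivity)).mp (min_le_left _ _)
      linarith
    have h1' : ε * y < b := by
      have h2 : ε * (2 * y) ≤ b := (le_div_iff₀ (by positivity)).mp (min_le_right _ _)
      linarith
    classical
    refine ⟨fun w => ε + ((if w = P then a - ε * x else 0) + if w = Q then b - ε * y else 0),
      fun w _ => ?_, ?_⟩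
    · have h3 : 0 ≤ if w = P then a - ε * x else 0 := by split_ifs <;> linarith
      have h4 : 0 ≤ if w = Q then b - ε * y else 0 := by split_ifs <;> linarith
      linarith
    · simp only [add_smul, Finset.sum_add_distrib, ite_smul, zero_smul, Finset.sum_ite_eq', hP, hQ,
        if_true]
      rw [← Finset.smul_sum]
      have he' : ∑ w ∈ s, w = x • P + y • Q := by simpa using he
      rw [he']
      module

lemma openCone_eq_ray (hP : P ∈ s) (hP0 : P ≠ 0) (α : Matrix (Fin 2) (Fin 2) ℂ → ℝ)
    (h : ∀ w ∈ s, w = α w • P) (hα : ∀ w ∈ s, 0 ≤ α w) : openCone s = ray P := by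
  have hαP : 0 < α P := by
    refine lt_of_le_of_ne (hα P hP) fun e => hP0 ?_
    rw [h P hP, ← e, zero_smul]
  have hsum : ∀ t : Matrix (Fin 2) (Fin 2) ℂ → ℝ,
      ∑ w ∈ s, t w • w = (∑ w ∈ s, t w * α w) • P := fun t => by
    rw [Finset.sum_smul]
    exact Finset.sum_congr rfl fun w hw => by nth_rewrite 2 [h w hw]; rw [smul_smul]
  ext z
  constructor
  · rintro ⟨t, ht, rfl⟩
    exact ⟨_, sum_mul_pos ht hα hP hαP, hsum t⟩
  · rintro ⟨c, hc, rfl⟩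
    have hx : 0 < ∑ w ∈ s, 1 * α w :=
      sum_mul_pos (t := fun _ => 1) (fun _ _ => one_pos) hα hP hαP
    have he := hsum fun _ => c / ∑ w ∈ s, 1 * α w
    refine ⟨fun _ => c / ∑ w ∈ s, 1 * α w, fun _ _ => by positivity, ?_⟩
    rw [he, ← Finset.mul_sum]
    congr 1
    simp only [one_mul] at hx ⊢
    rw [div_mul_cancel₀ _ hx.ne']

/-- A cone of positive semidefinite matrices in a plane is a ray or the cone over a segment. -/
lemma openCone_cases (hA : A.PosDef) (hD : D.trace = 0) (hAD : LinearIndependent ℝ ![A, D])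
    (hs : ∀ w ∈ s, w.PosSemidef) (hspan : ∀ w ∈ s, ∃ x y : ℝ, w = x • A + y • D)
    (hne : ∃ w ∈ s, w ≠ 0) : (∃ P ∈ s, P ≠ 0 ∧ openCone s = ray P) ∨
      ∃ P ∈ s, ∃ Q ∈ s, LinearIndependent ℝ ![P, Q] ∧ openCone s = seg P Q := by
  classical
  have hspan' : ∀ w : Matrix (Fin 2) (Fin 2) ℂ, ∃ x y : ℝ, w ∈ s → w = x • A + y • D := fun w => by
    by_cases hw : w ∈ s
    · obtain ⟨x, y, h⟩ := hspan w hw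
      exact ⟨x, y, fun _ => h⟩
    · exact ⟨0, 0, fun h => absurd h hw⟩
  choose x y hxy using hspan'
  have htA := trace_pos hA.posSemidef (PosDef.ne_zero hA)
  -- As `D` has trace zero, the coefficient of `A` is the trace up to a positive factor, so it is
  -- positive on nonzero generators. The slopes `y w / x w` are then defined, and the generators of
  -- smallest and largest slope are the two ends.
  have hx : ∀ w ∈ s, w ≠ 0 → 0 < x w := by
    intro w hw hw0
    have h1 := trace_pos (hs w hw) hw0
    rw [hxy w hw, Matrix.trace_add, Matrix.trace_smul, Matrix.trace_smul, hD, smul_zero, add_zero,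
      Complex.real_smul, Complex.re_ofReal_mul] at h1
    exact (pos_iff_pos_of_mul_pos h1).mpr htA
  set s' := s.filter (· ≠ 0)
  have hs' : s'.Nonempty := by
    obtain ⟨w, hw, hw0⟩ := hne
    exact ⟨w, Finset.mem_filter.mpr ⟨hw, hw0⟩⟩
  obtain ⟨P, hP, hPmin⟩ := Finset.exists_min_image s' (fun w => y w / x w) hs'
  obtain ⟨Q, hQ, hQmax⟩ := Finset.exists_max_image s' (fun w => y w / x w) hs'
  obtain ⟨hPs, hP0⟩ := Finset.mem_filter.mp hP
  obtain ⟨hQs, hQ0⟩ := Finset.mem_filter.mp hQ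
  have hxP := hx P hPs hP0
  have hxQ := hx Q hQs hQ0
  have h1 : ∀ w ∈ s, 0 ≤ x P * y w - y P * x w := by
    intro w hw
    by_cases hw0 : w = 0
    · have := (coeff_eq hAD (a := x w) (b := y w) (c := 0) (d := 0) (by
        rw [← hxy w hw, hw0]; module))
      rw [this.1, this.2]
      simp
    · have := hPmin w (Finset.mem_filter.mpr ⟨hw, hw0⟩)
      rw [div_le_div_iff₀ hxP (hx w hw hw0)] at this
      linarith
  have h2 : ∀ w ∈ s, 0 ≤ x w * y Q - y w * x Q := by
    intro w hw
    by_cases hw0 : w = 0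
    · have := (coeff_eq hAD (a := x w) (b := y w) (c := 0) (d := 0) (by
        rw [← hxy w hw, hw0]; module))
      rw [this.1, this.2]
      simp
    · have := hQmax w (Finset.mem_filter.mpr ⟨hw, hw0⟩)
      rw [div_le_div_iff₀ (hx w hw hw0) hxQ] at this
      linarith
  have hx0 : ∀ w ∈ s, 0 ≤ x w := by
    intro w hw
    by_cases hw0 : w = 0
    · exact (coeff_eq hAD (a := x w) (b := y w) (c := 0) (d := 0) (by
        rw [← hxy w hw, hw0]; module)).1.ge
    · exact (hx w hw hw0).le
  -- The determinant of the extreme generators; it vanishes exactly if all slopes agree, and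
  -- otherwise Cramer's rule gives nonnegative coordinates.
  obtain ⟨Δ, hΔ⟩ : ∃ Δ, Δ = x P * y Q - y P * x Q := ⟨_, rfl⟩
  have hΔ0 := h1 Q hQs
  rw [← hΔ] at hΔ0
  rcases hΔ0.eq_or_lt with h0 | h0
  · left
    refine ⟨P, hPs, hP0, openCone_eq_ray hPs hP0 (fun w => x w / x P) (fun w hw => ?_)
      fun w hw => div_nonneg (hx0 w hw) hxP.le⟩
    have h3 : x P * y w = y P * x w := by
      have e1 := h1 w hw
      have e2 := h2 w hw
      have e3 : 0 ≤ -(x Q * (x P * y w - y P * x w)) := by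
        have : -(x Q * (x P * y w - y P * x w)) =
            x P * (x w * y Q - y w * x Q) - x w * (x P * y Q - y P * x Q) := by ring
        rw [this, ← hΔ, ← h0]
        nlinarith
      nlinarith
    have h4 : y w = x w / x P * y P := by field_simp; linarith
    have h5 : x w = x w / x P * x P := by rw [div_mul_cancel₀ _ hxP.ne']
    have e3 := hxy w hw
    have e4 := hxy P hPs
    generalize x w / x P = u at *
    calc w = x w • A + y w • D := e3
      _ = (u * x P) • A + (u * y P) • D := by rw [← h4, ← h5]
      _ = u • (x P • A + y P • D) := by module
      _ = u • P := by rw [← e4]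
  · right
    have hi : LinearIndependent ℝ ![P, Q] := by
      rw [LinearIndependent.pair_iff]
      intro a b hab
      rw [hxy P hPs, hxy Q hQs] at hab
      have := coeff_eq hAD (a := a * x P + b * x Q) (b := a * y P + b * y Q) (c := 0) (d := 0) (by
        rw [zero_smul, zero_smul, add_zero, ← hab]; module)
      have ha : a * Δ = 0 := by
        rw [hΔ]; linear_combination y Q * this.1 - x Q * this.2
      have hb : b * Δ = 0 := by
        rw [hΔ]; linear_combination -(y P) * this.1 + x P * this.2
      exact ⟨(mul_eq_zero.mp ha).resolve_right h0.ne', (mul_eq_zero.mp hb).resolve_right h0.ne'⟩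
    refine ⟨P, hPs, Q, hQs, hi, openCone_eq_seg hPs hQs hi
      (fun w => (x w * y Q - y w * x Q) / Δ) (fun w => (x P * y w - y P * x w) / Δ)
      (fun w hw => ?_) (fun w hw => div_nonneg (h2 w hw) h0.le)
      fun w hw => div_nonneg (h1 w hw) h0.le⟩
    · have h0' := h0.ne'
      have e1 : x w = (x w * y Q - y w * x Q) / Δ * x P + (x P * y w - y P * x w) / Δ * x Q := by
        rw [div_mul_eq_mul_div, div_mul_eq_mul_div, ← add_div, eq_div_iff h0', hΔ]; ring
      have e2 : y w = (x w * y Q - y w * x Q) / Δ * y P + (x P * y w - y P * x w) / Δ * y Q := by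
        rw [div_mul_eq_mul_div, div_mul_eq_mul_div, ← add_div, eq_div_iff h0', hΔ]; ring
      have e3 := hxy w hw
      have e4 := hxy P hPs
      have e5 := hxy Q hQs
      generalize (x w * y Q - y w * x Q) / Δ = u at *
      generalize (x P * y w - y P * x w) / Δ = v at *
      calc w = x w • A + y w • D := e3
        _ = (u * x P + v * x Q) • A + (u * y P + v * y Q) • D := by rw [← e1, ← e2]
        _ = u • (x P • A + y P • D) + v • (x Q • A + y Q • D) := by module
        _ = u • P + v • Q := by rw [← e4, ← e5]

lemma posDef_of_trace_det (hA : A.IsHermitian) (ht : 0 < A.trace.re) (hd : 0 < A.det.re) :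
    A.PosDef := by
  rw [hA.posDef_iff_eigenvalues_pos]
  rw [hA.trace_eq_sum_eigenvalues, Fin.sum_univ_two] at ht
  rw [hA.det_eq_prod_eigenvalues, Fin.prod_univ_two] at hd
  simp only [Complex.coe_algebraMap, Complex.add_re, Complex.ofReal_re, Complex.re_ofReal_mul] at ht hd
  intro i
  have h0 : 0 < hA.eigenvalues 0 := by nlinarith
  have h1 : 0 < hA.eigenvalues 1 := by nlinarith
  fin_cases i
  exacts [h0, h1]

lemma eventually_posDef (hA : A.PosDef) (hB : B.IsHermitian) :
    ∀ᶠ t : ℝ in 𝓝 0, (A + t • B).PosDef := by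
  have h1 : Continuous fun t : ℝ => (A + t • B).trace.re := by fun_prop
  have h2 : Continuous fun t : ℝ => (A + t • B).det.re := by
    refine Complex.continuous_re.comp (Continuous.matrix_det ?_)
    fun_prop
  have e1 : 0 < (A + (0 : ℝ) • B).trace.re := by
    rw [zero_smul, add_zero]
    exact trace_pos hA.posSemidef (PosDef.ne_zero hA)
  have e2 : 0 < (A + (0 : ℝ) • B).det.re := by
    rw [zero_smul, add_zero]
    exact (Complex.lt_def.mp hA.det_pos).1
  filter_upwards [h1.continuousAt.eventually (lt_mem_nhds e1),
    h2.continuousAt.eventually (lt_mem_nhds e2)] with t ht1 ht2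
  refine posDef_of_trace_det (hA.isHermitian.add ?_) ht1 ht2
  rw [Matrix.IsHermitian, Matrix.conjTranspose_smul, hB.eq]
  simp

end Cones
-- The torsion subcomplex of a refined complex is a torsion graph
section Torsion

variable {m ℓ : ℕ} {Z : CellFamily (hermRep m)} {A B D P Q : Matrix (Fin 2) (Fin 2) ℂ}

lemma mem_openCone_sum (s : Finset (Matrix (Fin 2) (Fin 2) ℂ)) : ∑ w ∈ s, w ∈ openCone s :=
  ⟨fun _ => 1, fun _ _ => one_pos, by simp⟩

lemma fixed_generators {f : Matrix (Fin 2) (Fin 2) ℂ →ₗ[ℝ] Matrix (Fin 2) (Fin 2) ℂ}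
    {s : Finset (Matrix (Fin 2) (Fin 2) ℂ)} (h : ∀ x ∈ openCone s, f x = x) :
    ∀ w ∈ s, f w = w := by
  classical
  intro w hw
  have h1 := h _ (mem_openCone_sum s)
  have h2 := h (∑ v ∈ s, v + w) ⟨fun v => 1 + if v = w then 1 else 0, fun v _ => by
    dsimp only
    split_ifs <;> norm_num, by
    simp only [add_smul, one_smul, Finset.sum_add_distrib, ite_smul, zero_smul,
      Finset.sum_ite_eq', hw, if_true]⟩
  rw [map_add, h1] at h2
  exact add_left_cancel h2

/-- A multiple of `A` is subtracted from the second vector of the fixed plane, so that the trace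
reads off the coefficient of `A`. -/
lemma exists_traceless_axis (hA : A.PosDef) {g : BianchiGroup m} (hg : g ≠ 1)
    (h : hermRep m g A = A) : ∃ D : Matrix (Fin 2) (Fin 2) ℂ, D.IsHermitian ∧ D.trace = 0 ∧
      hermRep m g D = D ∧ LinearIndependent ℝ ![A, D] ∧ ∀ B : Matrix (Fin 2) (Fin 2) ℂ,
        B.IsHermitian → hermRep m g B = B → ∃ x y : ℝ, B = x • A + y • D := by
  obtain ⟨D, hD, hgD, hi, hall⟩ := exists_axis hA hg h
  have htA := trace_pos hA.posSemidef (PosDef.ne_zero hA)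
  have hreal : ∀ M : Matrix (Fin 2) (Fin 2) ℂ, M.IsHermitian → M.trace = (M.trace.re : ℂ) := by
    intro M hM
    have h1 : star M.trace = M.trace := by rw [← Matrix.trace_conjTranspose, hM.eq]
    exact (Complex.conj_eq_iff_re.mp h1).symm
  set r := D.trace.re / A.trace.re
  refine ⟨(-r) • A + (1 : ℝ) • D, ?_, ?_, by rw [map_add, map_smul, map_smul, h, hgD],
    indep_combination hi _ one_ne_zero, fun B hB hgB => ?_⟩
  · rw [Matrix.IsHermitian, Matrix.conjTranspose_add, Matrix.conjTranspose_smul,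
      Matrix.conjTranspose_smul, hA.isHermitian.eq, hD.eq]
    simp
  · rw [Matrix.trace_add, Matrix.trace_smul, Matrix.trace_smul, hreal A hA.isHermitian, hreal D hD,
      one_smul, Complex.real_smul, ← Complex.ofReal_mul, ← Complex.ofReal_add, neg_mul,
      div_mul_cancel₀ _ htA.ne', neg_add_cancel, Complex.ofReal_zero]
  · obtain ⟨x, y, rfl⟩ := hall B hB hgB
    exact ⟨x + y * r, y, by module⟩

namespace IsRefinedComplex

/-- A torsion element fixes the cell pointwise, hence each generator of the cone; so the generators
lie in the plane of its axis. -/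
lemma torsion_shape (hℓ : ℓ.Prime) (hZ : IsRefinedComplex Z)
    {σ : Set (Matrix (Fin 2) (Fin 2) ℂ)} (hσ : σ ∈ (torsionSubcomplex ℓ Z).cells) :
    (∃ A, A.PosDef ∧ σ = ray A) ∨ ∃ P Q, LinearIndependent ℝ ![P, Q] ∧ P.PosSemidef ∧
      Q.PosSemidef ∧ σ = seg P Q ∧ σ ⊆ hyperbolicCone := by
  obtain ⟨hσ, g, hg, hgσ⟩ := hσ
  have hfix := hZ.fixed_pointwise g σ hσ hgσ
  have hpos := hZ.subset σ hσ
  obtain ⟨s, hs, rfl⟩ := hZ.polyhedral σ hσ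
  have hA : (∑ w ∈ s, w).PosDef := hpos (mem_openCone_sum s)
  obtain ⟨D, -, hD, -, hi, hall⟩ := exists_traceless_axis hA (ne_one_of_orderOf hℓ hg)
    (hfix _ (mem_openCone_sum s))
  have hfix' := fixed_generators hfix
  have hne : ∃ w ∈ s, w ≠ 0 := by
    by_contra! hall0
    exact PosDef.ne_zero hA (Finset.sum_eq_zero hall0)
  rcases openCone_cases hA hD hi hs (fun w hw => hall w (hs w hw).isHermitian (hfix' w hw)) hne with
    ⟨P, -, -, e⟩ | ⟨P, hP, Q, hQ, hPQ, e⟩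
  · exact Or.inl ⟨P, hpos (e ▸ mem_ray_self P), e⟩
  · exact Or.inr ⟨P, Q, hPQ, hs P hP, hs Q hQ, e, hpos⟩

lemma eq_of_inter (hZ : IsRefinedComplex Z) {σ τ : Set (Matrix (Fin 2) (Fin 2) ℂ)}
    (hσ : σ ∈ Z.cells) (hτ : τ ∈ Z.cells) (h : A ∈ σ) (h' : A ∈ τ) : σ = τ := by
  by_contra hne
  exact Set.disjoint_left.mp (hZ.disjoint σ hσ τ hτ hne) h h'

lemma image_eq_of_fixed_point (hZ : IsRefinedComplex Z) {σ : Set (Matrix (Fin 2) (Fin 2) ℂ)}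
    (hσ : σ ∈ Z.cells) (h : A ∈ σ) {g : BianchiGroup m} (hg : hermRep m g A = A) :
    hermRep m g '' σ = σ :=
  hZ.eq_of_inter (Z.image_mem g σ hσ) hσ (hg ▸ Set.mem_image_of_mem _ h) h

/-- Some cell contains points on the line through `A` and `B` arbitrarily close to `A`. -/
lemma exists_frequent_cell (hZ : IsRefinedComplex Z) (hA : A.PosDef) (hB : B.IsHermitian) :
    ∃ σ ∈ Z.cells, ∃ᶠ n : ℕ in Filter.atTop, A + (1 / ((n : ℝ) + 1)) • B ∈ σ := by
  obtain ⟨U, hU, hfin⟩ := hZ.locally_finite A hA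
  have htend : Filter.Tendsto (fun n : ℕ => 1 / ((n : ℝ) + 1)) Filter.atTop (𝓝 0) :=
    tendsto_one_div_add_atTop_nhds_zero_nat
  have htend' : Filter.Tendsto (fun n : ℕ => A + (1 / ((n : ℝ) + 1)) • B) Filter.atTop (𝓝 A) := by
    have := tendsto_const_nhds (x := A).add (htend.smul_const B)
    simpa using this
  by_contra! hcon
  -- If each of the finitely many cells near `A` missed almost all of the sequence, then some member
  -- of the sequence near `A`, still positive definite, would lie in no cell.
  have hev : ∀ σ ∈ {σ ∈ Z.cells | (σ ∩ U).Nonempty}, ∀ᶠ n : ℕ in Filter.atTop,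
      A + (1 / ((n : ℝ) + 1)) • B ∉ σ := fun σ hσ => hcon σ hσ.1
  rw [← Filter.eventually_all_finite hfin] at hev
  obtain ⟨n, h1, h2, h3⟩ := (hev.and ((htend'.eventually hU).and
    (htend.eventually (eventually_posDef hA hB)))).exists
  obtain ⟨σ, hσ, hmem⟩ := hZ.cover _ h3
  exact h1 σ ⟨hσ, _, hmem, h2⟩ hmem

lemma isTorsionGraph (hℓ : ℓ.Prime) (hZ : IsRefinedComplex Z) :
    IsTorsionGraph ℓ (torsionSubcomplex ℓ Z) where
  shape _ := hZ.torsion_shape hℓ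
  eq_of_span := by
    rintro σ hσ τ hτ - ⟨x, hx, hx'⟩
    exact hZ.eq_of_inter hσ.1 hτ.1 hx hx'
  vertex_eq A hA σ hσ h := hZ.eq_of_inter hσ.1 hA.1 h (mem_ray_self A)
  torsion σ hσ := hσ.2
  fixed_pointwise g σ hσ h := hZ.fixed_pointwise g σ hσ.1 h
  exists_edge := by
    intro A hA hAK g hg hgA B hB hgB hi
    obtain ⟨σ, hσ, hfreq⟩ := hZ.exists_frequent_cell hA hB
    obtain ⟨n, hn⟩ := hfreq.exists
    have hσT : σ ∈ (torsionSubcomplex ℓ Z).cells :=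
      ⟨hσ, g, hg, hZ.image_eq_of_fixed_point hσ hn (by rw [map_add, map_smul, hgA, hgB])⟩
    have hpos : ∀ n : ℕ, 0 < 1 / ((n : ℝ) + 1) := fun n => by positivity
    have hcl : A ∈ closure σ := by
      have htend : Filter.Tendsto (fun n : ℕ => A + (1 / ((n : ℝ) + 1)) • B) Filter.atTop
          (𝓝 (A + (0 : ℝ) • B)) :=
        tendsto_const_nhds.add (tendsto_one_div_add_atTop_nhds_zero_nat.smul_const B)
      rw [zero_smul, add_zero] at htend
      exact mem_closure_of_frequently_of_tendsto hfreq htend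
    -- A ray contains at most one point of the sequence, whereas `σ` contains infinitely many. So
    -- `σ` is a segment with `A` in its closure but not inside, and `A` is one of its ends.
    have hray : ∀ C, σ ≠ ray C := by
      rintro C rfl
      obtain ⟨k, hk, hk'⟩ := Filter.frequently_atTop.mp hfreq (n + 1)
      obtain ⟨c, hc, e⟩ := hn
      obtain ⟨c', hc', e'⟩ := hk'
      have hkn : 1 / ((k : ℝ) + 1) < 1 / ((n : ℝ) + 1) := by
        have : (n : ℝ) + 1 ≤ k := by exact_mod_cast hk
        exact one_div_lt_one_div_of_lt (by positivity) (by linarith)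
      have h1 : c' • (A + (1 / ((n : ℝ) + 1)) • B) = c • (A + (1 / ((k : ℝ) + 1)) • B) := by
        rw [e, e', smul_smul, smul_smul, mul_comm]
      have h2 := coeff_eq hi (a := c') (b := c' * (1 / ((n : ℝ) + 1))) (c := c)
        (d := c * (1 / ((k : ℝ) + 1))) (by
          rw [mul_smul, mul_smul, ← smul_add, ← smul_add, h1])
      rw [h2.1] at h2
      have := mul_left_cancel₀ hc.ne' h2.2
      linarith
    rcases hZ.torsion_shape hℓ hσT with ⟨C, -, e⟩ | ⟨P, Q, hPQ, -, -, rfl, -⟩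
    · exact absurd e (hray C)
    have hnA : A ∉ seg P Q := fun hmem => hray A (hZ.eq_of_inter hσ hAK.1 hmem (mem_ray_self A))
    have key : ∀ Q, seg A Q ∈ (torsionSubcomplex ℓ Z).cells →
        A + (1 / ((n : ℝ) + 1)) • B ∈ seg A Q →
        ∃ a b : ℝ, 0 < b ∧ seg A (a • A + b • B) ∈ (torsionSubcomplex ℓ Z).cells := by
      rintro Q hQ ⟨x, y, hx, hy, e⟩
      have hQe : Q = ((1 - x) / y) • A + (1 / ((n : ℝ) + 1) / y) • B := by
        have : y • Q = (1 - x) • A + (1 / ((n : ℝ) + 1)) • B := by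
          rw [sub_smul, one_smul, sub_add_eq_add_sub, e]
          module
        rw [div_eq_inv_mul, div_eq_inv_mul _ y, mul_smul, mul_smul, ← smul_add, ← this, smul_smul,
          inv_mul_cancel₀ hy.ne', one_smul]
      exact ⟨_, _, div_pos (hpos n) hy, hQe ▸ hQ⟩
    rcases eq_end_of_mem_closure hPQ (PosDef.ne_zero hA) hcl hnA with e | e
    · rw [← seg_left_of_ray_eq Q e] at hσT hn
      exact key Q hσT hn
    · rw [seg_comm, ← seg_left_of_ray_eq P e] at hσT hn
      exact key P hσT hn

end IsRefinedComplex

end Torsion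

/-! ### Induction over a sequence of fusions -/

section Reduction

variable {m ℓ : ℕ} {Z : CellFamily (hermRep m)}

lemma isTorsionGraph_of_fusesTo {T K : CellFamily (hermRep m)} (hℓ : ℓ.Prime)
    (hT : IsTorsionGraph ℓ T) (h : FusesTo ℓ T K) : IsTorsionGraph ℓ K := by
  induction h with
  | refl => exact hT
  | tail _ h ih =>
    obtain ⟨v, h⟩ := h
    obtain ⟨P, Q, F, rfl⟩ := exists_frame_of_fusion hℓ ih h
    exact F.fuse_isTorsionGraph ih

theorem E2Primary_equiv_of_fusesTo (hm : Squarefree m) (hℓ : ℓ.Prime)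
    {T K : CellFamily (hermRep m)} (hT : IsTorsionGraph ℓ T) (h : FusesTo ℓ T K) (p q : ℕ)
    (hq : 1 ≤ q) : Nonempty (E2Primary ℓ T p q ≃+ E2Primary ℓ K p q) := by
  induction h with
  | refl => exact ⟨AddEquiv.refl _⟩
  | tail h' h ih =>
    obtain ⟨v, h⟩ := h
    have hK := isTorsionGraph_of_fusesTo hℓ hT h'
    obtain ⟨P, Q, F, rfl⟩ := exists_frame_of_fusion hℓ hK h
    obtain ⟨e⟩ := ih
    obtain ⟨e'⟩ := F.E2Primary_equiv_fuse hm hℓ hK p q hq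
    exact ⟨e.trans e'.symm⟩

end Reduction
-- Eigenvalues of torsion elements in the quadratic field
section Eigenvalues

variable {m ℓ : ℕ} {Z : CellFamily (hermRep m)} {A : Matrix (Fin 2) (Fin 2) ℂ}

/-- The rank one form attached to a vector; its ray is the corresponding cusp. -/
def cuspForm (w : Fin 2 → imagQuadRing m) : Matrix (Fin 2) (Fin 2) ℂ :=
  Matrix.vecMulVec (fun i => (w i : ℂ)) (fun i => star (w i : ℂ))

lemma mem_singularCusps {σ : Set (Matrix (Fin 2) (Fin 2) ℂ)} : σ ∈ singularCusps m ↔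
    ∃ w : Fin 2 → imagQuadRing m, ¬ (Ideal.span {w 0, w 1}).IsPrincipal ∧ σ = ray (cuspForm w) :=
  Iff.rfl

lemma ne_zero_of_not_isPrincipal {w : Fin 2 → imagQuadRing m}
    (h : ¬ (Ideal.span {w 0, w 1}).IsPrincipal) : ∃ i, (w i : ℂ) ≠ 0 := by
  by_contra! h0
  have h0' : ∀ i, w i = 0 := fun i => Subtype.ext (h0 i)
  refine h ⟨0, ?_⟩
  rw [h0', h0', Set.pair_eq_singleton]

lemma cuspForm_ne_zero {w : Fin 2 → imagQuadRing m} {i : Fin 2} (h : (w i : ℂ) ≠ 0) :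
    cuspForm w ≠ 0 := by
  intro h0
  have := congrFun (congrFun h0 i) i
  simp only [cuspForm, Matrix.vecMulVec_apply, Matrix.zero_apply, mul_eq_zero, star_eq_zero,
    or_self] at this
  exact h this

lemma hermRep_cuspForm (g : Matrix.SpecialLinearGroup (Fin 2) (imagQuadRing m))
    (w : Fin 2 → imagQuadRing m) :
    hermRep m (QuotientGroup.mk g) (cuspForm w) = cuspForm (g.1 *ᵥ w) := by
  rw [hermRep_mk]
  ext i j
  simp [cuspForm, toComplex, Matrix.mul_apply, Matrix.vecMulVec, Matrix.mulVec, dotProduct,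
    Fin.sum_univ_two]
  ring

lemma mem_adjoin_of_mul_eq {x y c : ℂ} (hx : x ∈ imagQuadRing m) (hy : y ∈ imagQuadRing m)
    (hx0 : x ≠ 0) (h : y = c * x) : c ∈ IntermediateField.adjoin ℚ {sqrtNeg m} := by
  rw [eq_div_of_mul_eq hx0 h.symm]
  exact div_mem (mem_imagQuadRing.mp hy).2 (mem_imagQuadRing.mp hx).2

/-- An element which stabilises a cusp has the cusp as an eigenvector. -/
lemma exists_eigenvalue {g : Matrix.SpecialLinearGroup (Fin 2) (imagQuadRing m)}
    {w : Fin 2 → imagQuadRing m} {i : Fin 2} (hi : (w i : ℂ) ≠ 0) {t : ℝ} (ht : t ≠ 0)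
    (h : hermRep m (QuotientGroup.mk g) (cuspForm w) = t • cuspForm w) :
    ∃ c ∈ IntermediateField.adjoin ℚ {sqrtNeg m}, ∀ j, ((g.1 *ᵥ w) j : ℂ) = c * w j := by
  rw [hermRep_cuspForm] at h
  set v := g.1 *ᵥ w
  have key : ∀ j k, (v j : ℂ) * star (v k : ℂ) = t * (w j * star (w k : ℂ)) := fun j k =>
    congrFun (congrFun h j) k
  have hvi : star (v i : ℂ) ≠ 0 := by
    intro h0
    have := key i i
    rw [h0, mul_zero, eq_comm, mul_eq_zero, mul_eq_zero, star_eq_zero] at this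
    rcases this with h1 | h1 | h1
    · exact ht (by exact_mod_cast h1)
    · exact hi h1
    · exact hi h1
  have hc : ∀ j, (v j : ℂ) = t * star (w i : ℂ) / star (v i : ℂ) * w j := by
    intro j
    rw [div_mul_eq_mul_div, eq_div_iff hvi, key j i]
    ring
  exact ⟨_, mem_adjoin_of_mul_eq (w i).2 (v i).2 hi (hc i), hc⟩

lemma eigenvalue_equation {M : Matrix (Fin 2) (Fin 2) ℂ} (hM : M.det = 1) {v : Fin 2 → ℂ}
    {i : Fin 2} (hi : v i ≠ 0) {c : ℂ} (h : M *ᵥ v = c • v) : c * c = M.trace * c - 1 := by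
  have h1 : (M * M) *ᵥ v = (c * c) • v := by
    rw [← Matrix.mulVec_mulVec, h, Matrix.mulVec_smul, h, smul_smul]
  rw [sq_eq_trace_smul_sub hM, Matrix.sub_mulVec, Matrix.smul_mulVec, h, Matrix.one_mulVec] at h1
  have h2 := congrFun h1 i
  simp only [Pi.sub_apply, Pi.smul_apply, smul_eq_mul] at h2
  refine mul_right_cancel₀ hi ?_
  rw [← h2]
  ring

lemma toComplex_mulVec {g : Matrix.SpecialLinearGroup (Fin 2) (imagQuadRing m)}
    (w : Fin 2 → imagQuadRing m) :
    toComplex g *ᵥ (fun i => (w i : ℂ)) = fun i => ((g.1 *ᵥ w) i : ℂ) := by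
  funext i
  simp [toComplex, Matrix.mulVec, dotProduct, Fin.sum_univ_two]

/-- Torsion elements whose eigenvalues lie in the quadratic field. -/
lemma exceptional_of_eigenvalue (hm : Squarefree m) (hℓ : ℓ.Prime) (hA : A.PosDef)
    {g : Matrix.SpecialLinearGroup (Fin 2) (imagQuadRing m)}
    (hg : orderOf (QuotientGroup.mk g : BianchiGroup m) = ℓ)
    (h : hermRep m (QuotientGroup.mk g) A = A) {c : ℂ}
    (hc : c ∈ IntermediateField.adjoin ℚ {sqrtNeg m})
    (he : c * c = (toComplex g).trace * c - 1) : (m = 1 ∧ ℓ = 2) ∨ (m = 3 ∧ ℓ = 3) := by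
  have hne := ne_one_of_orderOf hℓ hg
  have hthree : (toComplex g).trace = 1 ∨ (toComplex g).trace = -1 → m = 3 ∧ ℓ = 3 := by
    intro ht
    constructor
    -- For the trace `t = ±1` the equation gives `(2 * c - t) ^ 2 = t ^ 2 - 4 = -3`; below, for
    -- trace zero, it gives `c * c = -1`.
    · refine eq_of_sq_eq_neg hm Nat.prime_three.squarefree
        (x := 2 * c - (toComplex g).trace)
        (sub_mem (mul_mem (ofNat_mem _ 2) hc) (mem_imagQuadRing.mp (trace_toComplex_mem g)).2) ?_
      push_cast
      rcases ht with ht | ht <;> rw [ht] at he ⊢ <;> linear_combination 4 * he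
    · have h3 := mul_mul_self_eq_one ht
      rw [← hg]
      exact orderOf_eq_prime (hp := ⟨Nat.prime_three⟩) (by rw [pow_three, ← mul_assoc, h3]) hne
  rcases trace_cases hm hA h hne with ht | ht
  · left
    constructor
    · refine eq_of_sq_eq_neg hm squarefree_one hc ?_
      rw [he, ht]
      simp
    · rw [← hg]
      exact orderOf_eq_prime (by rw [sq, (mul_self_eq_one_iff hne).mpr ht]) hne
  · exact Or.inr (hthree ht)

lemma exceptional_of_fixed_cusp (hm : Squarefree m) (hℓ : ℓ.Prime) (hA : A.PosDef)
    {g : BianchiGroup m} (hg : orderOf g = ℓ) (h : hermRep m g A = A)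
    {w : Fin 2 → imagQuadRing m} (hw : ∃ i, (w i : ℂ) ≠ 0)
    (hgw : hermRep m g (cuspForm w) = cuspForm w) : (m = 1 ∧ ℓ = 2) ∨ (m = 3 ∧ ℓ = 3) := by
  obtain ⟨g, rfl⟩ := QuotientGroup.mk_surjective g
  obtain ⟨i, hi⟩ := hw
  obtain ⟨c, hc, hcv⟩ := exists_eigenvalue hi one_ne_zero (hgw.trans (one_smul ℝ _).symm)
  refine exceptional_of_eigenvalue hm hℓ hA hg h hc
    (eigenvalue_equation (det_toComplex g) (v := fun i => (w i : ℂ)) hi ?_)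
  rw [toComplex_mulVec]
  funext j
  exact hcv j

end Eigenvalues

/-! ### Torsion cells lie in the translates of the bottom facets -/

section Minimal

variable {m ℓ : ℕ} {Z : CellFamily (hermRep m)} {A : Matrix (Fin 2) (Fin 2) ℂ}

lemma formValue_nonneg (hA : A.PosSemidef) (u : Fin 2 → imagQuadRing m) : 0 ≤ formValue A u := by
  have h := hA.dotProduct_mulVec_nonneg (fun i => star (u i : ℂ))
  rw [Matrix.dotProduct_mulVec] at h
  have hstar : star (fun i => star (u i : ℂ)) = fun i => (u i : ℂ) := by
    funext i
    simp
  rw [hstar] at h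
  exact (Complex.le_def.mp h).1

lemma formValue_add_smul_neg_one (A : Matrix (Fin 2) (Fin 2) ℂ) (t : ℝ)
    (u : Fin 2 → imagQuadRing m) : formValue (A + t • (-1 : Matrix (Fin 2) (Fin 2) ℂ)) u =
      formValue A u - t * (Complex.normSq (u 0) + Complex.normSq (u 1)) := by
  simp [formValue, Matrix.vecMul, dotProduct, Fin.sum_univ_two, Complex.normSq_apply]
  ring

/-- For a small `t > 0` the form `A - t` is still positive definite, so `A` dominates `t` times the
standard norm; thus only finitely many integral rows have values below that of `![1, 0]`. -/
lemma exists_isMinimal (hm : Squarefree m) (hA : A.PosDef) :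
    ∃ u : Fin 2 → imagQuadRing m, IsMinimal A u := by
  have hev := eventually_posDef hA (B := -1) (by simp [Matrix.IsHermitian])
  obtain ⟨t, ht, htA⟩ := (hev.filter_mono nhdsWithin_le_nhds |>.and
    (self_mem_nhdsWithin (a := (0 : ℝ)) (s := Set.Ioi 0))).exists.imp fun _ h => h.symm
  have ht : 0 < t := ht
  have hle : ∀ u : Fin 2 → imagQuadRing m, ∀ i, Complex.normSq (u i) ≤ formValue A u / t := by
    intro u i
    have h := formValue_nonneg htA.posSemidef u
    rw [formValue_add_smul_neg_one] at h
    rw [le_div_iff₀ ht]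
    have h0 := mul_nonneg ht.le (Complex.normSq_nonneg (u 0))
    have h1 := mul_nonneg ht.le (Complex.normSq_nonneg (u 1))
    fin_cases i <;> simp only [Fin.zero_eta, Fin.mk_one] <;> linarith
  set e : Fin 2 → imagQuadRing m := ![1, 0]
  have hfin : {u : Fin 2 → imagQuadRing m | IsCoprime (u 0) (u 1) ∧
      formValue A u ≤ formValue A e}.Finite := by
    refine (Set.Finite.pi' fun _ => finite_bounded hm (formValue A e / t)).subset ?_
    intro u hu i
    exact (hle u i).trans (div_le_div_of_nonneg_right hu.2 ht.le)
  obtain ⟨u, hu, hmin⟩ := Set.exists_min_image _ (formValue A) hfin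
    ⟨e, by simpa [e] using isCoprime_one_left, le_refl _⟩
  refine ⟨u, hu.1, fun w hw => ?_⟩
  rcases le_total (formValue A w) (formValue A e) with h | h
  · exact hmin w ⟨hw, h⟩
  · exact hu.2.trans h

/-- The rotation `g` takes a minimal row `u` to another minimal row. If they were proportional, the
unit would be an eigenvalue of the transpose of `g` in the field, which only happens in the two
excluded cases. -/
lemma mem_bottom_of_fixed (hm : Squarefree m) (hℓ : ℓ.Prime) (h2 : ¬ (m = 1 ∧ ℓ = 2))
    (h3 : ¬ (m = 3 ∧ ℓ = 3)) (hA : A.PosDef) {g : BianchiGroup m} (hg : orderOf g = ℓ)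
    (h : hermRep m g A = A) : A ∈ bottom m := by
  obtain ⟨g, rfl⟩ := QuotientGroup.mk_surjective g
  obtain ⟨u, hu⟩ := exists_isMinimal hm hA
  have hu' := isMinimal_smul g⁻¹ A u hu
  have h' : hermRep m (QuotientGroup.mk g⁻¹) A = A := hermRep_inv_fix h
  rw [hermRep_mk] at h'
  rw [h', inv_inv] at hu'
  refine ⟨hA, u, _, hu, hu', ?_⟩
  rintro ⟨ε, hε⟩
  have hi : ∃ i, (u i : ℂ) ≠ 0 := by
    by_contra! h0
    have h0' : ∀ i, u i = 0 := fun i => Subtype.ext (h0 i)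
    have := hu.1
    rw [h0', h0', isCoprime_zero_left] at this
    exact not_isUnit_zero this
  obtain ⟨i, hi⟩ := hi
  have he := eigenvalue_equation (M := (toComplex g)ᵀ) (v := fun i => (u i : ℂ)) (i := i)
    (c := ((ε : imagQuadRing m) : ℂ)) (by rw [Matrix.det_transpose, det_toComplex]) hi (by
      rw [Matrix.mulVec_transpose]
      funext j
      have := congrArg (fun f => ((f j : imagQuadRing m) : ℂ)) hε
      simpa [toComplex, Matrix.vecMul, dotProduct, Fin.sum_univ_two] using this)
  rw [Matrix.trace_transpose] at he
  exact (exceptional_of_eigenvalue hm hℓ hA hg h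
    (mem_imagQuadRing.mp (ε : imagQuadRing m).2).2 he).elim h2 h3

lemma IsRefinedComplex.torsion_subset (hZ : IsRefinedComplex Z) (hm : Squarefree m) (hℓ : ℓ.Prime)
    (h2 : ¬ (m = 1 ∧ ℓ = 2)) (h3 : ¬ (m = 3 ∧ ℓ = 3)) :
    (torsionSubcomplex ℓ Z).cells ⊆ (floegeComplex Z).cells := by
  rintro σ ⟨hσ, g, hg, hgσ⟩
  exact Or.inl ⟨hσ, fun A hA => mem_bottom_of_fixed hm hℓ h2 h3 (hZ.subset σ hσ hA) hg
    (hZ.fixed_pointwise g σ hσ hgσ A hA)⟩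

end Minimal
-- Decomposition of chains along a subfamily
section Partition

variable {G V : Type} [Group G] [AddCommGroup V] [Module ℝ V] {ρ : Representation ℝ G V}
  {K L M : CellFamily ρ} {p : ℕ}

lemma restriction_retraction (h : L.cells ⊆ K.cells) :
    restriction L K p ≫ restriction K L p = 𝟙 _ := by
  refine chains_hom_ext fun f => ?_
  change (restriction K L p).hom ((restriction L K p).hom f.chain) = f.chain
  rw [restriction_chain, restriction_move _ (h f.mem), FramedCell.move_self]

lemma restriction_restriction_of_mem (f : FramedCell K p) (h : f.cell ∈ L.cells) :
    (restriction L K p).hom ((restriction K L p).hom f.chain) = f.chain := by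
  rw [restriction_chain, restriction_move _ h, FramedCell.move_self]

lemma restriction_restriction_of_not_mem (f : FramedCell K p) (h : f.cell ∉ L.cells) :
    (restriction L K p).hom ((restriction K L p).hom f.chain) = 0 := by
  rw [restriction_chain_of_not_mem _ h, map_zero]

/-- The cells of `K` which do not belong to `L`. -/
def cellsDiff (K L : CellFamily ρ) : CellFamily ρ where
  cells := K.cells \ L.cells
  image_mem g σ hσ := ⟨K.image_mem g σ hσ.1, fun h => hσ.2 ((L.image_mem_iff g).mp h)⟩

lemma restriction_add_diff (K L : CellFamily ρ) (p : ℕ) : restriction K L p ≫ restriction L K p +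
    restriction K (cellsDiff K L) p ≫ restriction (cellsDiff K L) K p = 𝟙 _ := by
  refine chains_hom_ext fun f => ?_
  change (restriction L K p).hom ((restriction K L p).hom f.chain) +
    (restriction (cellsDiff K L) K p).hom ((restriction K (cellsDiff K L) p).hom f.chain) = f.chain
  by_cases h : f.cell ∈ L.cells
  · have h' : f.cell ∉ (cellsDiff K L).cells := fun h' => h'.2 h
    rw [restriction_restriction_of_mem f h, restriction_restriction_of_not_mem f h', add_zero]
  · have h' : f.cell ∈ (cellsDiff K L).cells := ⟨f.mem, h⟩
    rw [restriction_restriction_of_not_mem f h, restriction_restriction_of_mem f h', zero_add]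

lemma homologyMap_restriction_retraction (h : L.cells ⊆ K.cells) (q : ℕ)
    (x : groupHomology (Rep.of (chainsRep L p)) q) :
    homologyMap q (restriction K L p) (homologyMap q (restriction L K p) x) = x := by
  rw [← homologyMap_comp, restriction_retraction h, homologyMap_id]

lemma homologyMap_restriction_add_diff (K L : CellFamily ρ) (p q : ℕ)
    (x : groupHomology (Rep.of (chainsRep K p)) q) :
    homologyMap q (restriction L K p) (homologyMap q (restriction K L p) x) +
      homologyMap q (restriction (cellsDiff K L) K p)
        (homologyMap q (restriction K (cellsDiff K L) p) x) = x := by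
  rw [← homologyMap_comp, ← homologyMap_comp, ← homologyMap_add, restriction_add_diff,
    homologyMap_id]

/-- The homology of a chain module has no `ℓ`-torsion if this holds for a subfamily and its
complement. -/
lemma primary_eq_zero_of_diff {ℓ q : ℕ} (L : CellFamily ρ)
    (h1 : ∀ x ∈ primaryPart ℓ (groupHomology (Rep.of (chainsRep L p)) q), x = 0)
    (h2 : ∀ x ∈ primaryPart ℓ (groupHomology (Rep.of (chainsRep (cellsDiff K L) p)) q), x = 0) :
    ∀ x ∈ primaryPart ℓ (groupHomology (Rep.of (chainsRep K p)) q), x = 0 := by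
  intro x hx
  rw [← homologyMap_restriction_add_diff K L p q x, h1 _ (map_mem_primaryPart _ hx),
    h2 _ (map_mem_primaryPart _ hx), map_zero, map_zero, add_zero]

variable [TopologicalSpace V] [IsTopologicalAddGroup V] [T2Space V] [ContinuousSMul ℝ V]
  [FiniteDimensional ℝ V]

/-- A subcomplex carries the `ℓ`-primary part of the second page if the complement
has no `ℓ`-torsion. -/
lemma E2Primary_equiv_of_diff {ℓ q : ℕ} (h : L.cells ⊆ K.cells)
    (hd : ∀ p, ∀ x : E1 L (p + 1) q, homologyMap q (restriction L K p) (d1 L p q x) =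
      d1 K p q (homologyMap q (restriction L K (p + 1)) x))
    (h0 : ∀ p, ∀ x ∈ primaryPart ℓ (groupHomology (Rep.of (chainsRep (cellsDiff K L) p)) q), x = 0)
    (p : ℕ) : Nonempty (E2Primary ℓ L p q ≃+ E2Primary ℓ K p q) := by
  refine E2Primary_equiv_of_bijOn ℓ (fun p => homologyMap q (restriction L K p)) hd ?_ ?_
  · intro p x _ hx
    exact (homologyMap_restriction_retraction h q x).symm.trans
      ((congrArg (homologyMap q (restriction K L p)) hx).trans (map_zero _))
  · intro p z hz
    refine ⟨homologyMap q (restriction K L p) z, map_mem_primaryPart _ hz, ?_⟩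
    have e := homologyMap_restriction_add_diff K L p q z
    have e0 := h0 p _ (map_mem_primaryPart (homologyMap q (restriction K (cellsDiff K L) p)) hz)
    refine Eq.trans ?_ e
    refine (add_zero _).symm.trans (congrArg _ ?_)
    exact ((congrArg _ e0).trans (map_zero _)).symm

end Partition

/-! ### Cells without `ℓ`-torsion in their stabilisers -/

section Stabiliser

lemma PCell.mem_stabilizer {G V : Type} [Group G] [AddCommGroup V] [Module ℝ V]
    {ρ : Representation ℝ G V} {K : CellFamily ρ} {p : ℕ} {σ : PCell K p} {g : G} :
    g ∈ MulAction.stabilizer G σ ↔ ρ g '' σ.1 = σ.1 := by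
  rw [MulAction.mem_stabilizer_iff]
  exact ⟨fun h => congrArg (fun s : PCell K p => s.1) h, fun h => Subtype.ext h⟩

lemma eq_zero_of_bezout {A : Type} [AddCommGroup A] {x : A} {a b : ℕ} {u v : ℤ} (ha : a • x = 0)
    (hb : b • x = 0) (h : u * a + v * b = 1) : x = 0 := by
  rw [← one_smul ℤ x, ← h, add_smul, mul_smul, mul_smul, natCast_zsmul, natCast_zsmul, ha, hb,
    smul_zero, smul_zero, add_zero]

end Stabiliser

section Complement

variable {m ℓ : ℕ} {Z K : CellFamily (hermRep m)}

namespace IsRefinedComplex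

lemma nonempty (hZ : IsRefinedComplex Z) {σ : Set (Matrix (Fin 2) (Fin 2) ℂ)} (h : σ ∈ Z.cells) :
    σ.Nonempty := by
  obtain ⟨s, -, rfl⟩ := hZ.polyhedral σ h
  exact ⟨_, mem_openCone_sum s⟩

lemma stabilizer_bound (hm : Squarefree m) (hZ : IsRefinedComplex Z) : ∃ N : ℕ, N ≠ 0 ∧
    ∀ (K : CellFamily (hermRep m)) (p : ℕ) (σ : PCell K p), σ.1 ∈ Z.cells →
      Finite (MulAction.stabilizer (BianchiGroup m) σ) ∧
        Nat.card (MulAction.stabilizer (BianchiGroup m) σ) ∣ N := by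
  obtain ⟨N, hN, h⟩ := exists_stabilizer_bound hm
  refine ⟨N, hN, fun K p σ hσ => ?_⟩
  obtain ⟨A, hA⟩ := hZ.nonempty hσ
  exact h _ A (hZ.subset _ hσ hA) fun g hg =>
    hZ.fixed_pointwise g _ hσ (PCell.mem_stabilizer.mp hg) A hA

lemma isOriented (hZ : IsRefinedComplex Z) (p : ℕ) : IsOriented Z p := by
  intro f g h
  have hfix := hZ.fixed_pointwise g _ f.mem h
  have : (f.translate g).vec = f.vec := by
    funext i
    have hle : Submodule.span ℝ f.cell ≤ LinearMap.eqLocus (hermRep m g) LinearMap.id :=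
      Submodule.span_le.mpr hfix
    exact hle (f.mem_span i)
  exact ⟨1, one_pos, this ▸ FramesDiffer.refl _⟩

/-- Cells without `ℓ`-torsion in their stabilisers do not contribute to the `ℓ`-primary part. -/
lemma primary_eq_zero (hm : Squarefree m) (hℓ : ℓ.Prime) (hZ : IsRefinedComplex Z)
    (hK : ∀ σ ∈ K.cells, σ ∈ Z.cells ∧ σ ∉ (torsionSubcomplex ℓ Z).cells) (p q : ℕ) :
    ∀ x ∈ primaryPart ℓ (groupHomology (Rep.of (chainsRep K p)) (q + 1)), x = 0 := by
  rintro x ⟨M, hM⟩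
  obtain ⟨N, hN, hstab⟩ := hZ.stabilizer_bound hm
  obtain ⟨N', a, u, v, hN', huv⟩ := exists_primary_decomposition ℓ hℓ N hN M
  have hx : N' • x = 0 := by
    refine nsmul_homology_chains (IsOriented.of_subset (fun σ hσ => (hK σ hσ).1)
      (hZ.isOriented p)) N' (fun σ => ?_) q x
    obtain ⟨hfin, hdvd⟩ := hstab K p σ (hK _ σ.2.1).1
    refine ⟨hfin, ?_⟩
    -- By Cauchy's theorem, a stabiliser of order divisible by `ℓ` would make the cell a torsion
    -- cell. So its order divides the part of `N` which is prime to `ℓ`.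
    have hcop : Nat.Coprime (Nat.card (MulAction.stabilizer (BianchiGroup m) σ)) (ℓ ^ a) := by
      refine Nat.Coprime.pow_right _ ((hℓ.coprime_iff_not_dvd.mpr fun hdvd => ?_).symm)
      have := Fact.mk hℓ
      obtain ⟨g, hg⟩ := exists_prime_orderOf_dvd_card' ℓ hdvd
      refine (hK _ σ.2.1).2 ⟨(hK _ σ.2.1).1, g.1, by rw [Subgroup.orderOf_coe, hg], ?_⟩
      exact PCell.mem_stabilizer.mp g.2
    rw [hN'] at hdvd
    exact hcop.dvd_of_dvd_mul_left hdvd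
  exact eq_zero_of_bezout hx hM huv

end IsRefinedComplex

end Complement
-- Units, and the principal ideal domains for `m = 1` and `m = 3`
section Arithmetic

variable {m : ℕ}

/-- Euclidean division: a nonzero element of smallest norm generates the ideal, since remainders
have smaller norm. -/
lemma isPrincipal_of_remainder (hm : Squarefree m)
    (h : ∀ z : ℂ, ∃ q ∈ imagQuadRing m, Complex.normSq (z - q) < 1)
    (I : Ideal (imagQuadRing m)) : I.IsPrincipal := by
  by_cases hI : I = ⊥
  · exact ⟨0, by rw [hI]; simp⟩
  obtain ⟨x₀, hx₀, hne⟩ := Submodule.exists_mem_ne_zero_of_ne_bot hI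
  have hfin : {x : imagQuadRing m | (x ∈ I ∧ x ≠ 0) ∧
      Complex.normSq (x : ℂ) ≤ Complex.normSq (x₀ : ℂ)}.Finite :=
    (finite_bounded hm _).subset fun x hx => hx.2
  obtain ⟨d, ⟨⟨hd, hd0⟩, hdx⟩, hmin⟩ := Set.exists_min_image _
    (fun x : imagQuadRing m => Complex.normSq (x : ℂ)) hfin ⟨x₀, ⟨hx₀, hne⟩, le_rfl⟩
  have hd0' : (d : ℂ) ≠ 0 := fun h => hd0 (Subtype.ext h)
  refine ⟨d, le_antisymm (fun x hx => ?_) ((Ideal.span_singleton_le_iff_mem I).mpr hd)⟩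
  obtain ⟨q, hq, hlt⟩ := h ((x : ℂ) / d)
  have hr : x - ⟨q, hq⟩ * d ∈ I := sub_mem hx (I.mul_mem_left _ hd)
  have hnorm : Complex.normSq ((x - ⟨q, hq⟩ * d : imagQuadRing m) : ℂ) <
      Complex.normSq (d : ℂ) := by
    have e : ((x - ⟨q, hq⟩ * d : imagQuadRing m) : ℂ) = ((x : ℂ) / d - q) * d := by
      push_cast
      field_simp
    rw [e, Complex.normSq_mul]
    exact mul_lt_of_lt_one_left (Complex.normSq_pos.mpr hd0') hlt
  have h0 : x - ⟨q, hq⟩ * d = 0 := by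
    by_contra hne'
    exact absurd (hmin _ ⟨⟨hr, hne'⟩, hnorm.le.trans hdx⟩) (not_le.mpr hnorm)
  exact Ideal.mem_span_singleton'.mpr ⟨_, (sub_eq_zero.mp h0).symm⟩

/-- Rounding first the multiple of `τ` and then the integer leaves errors of at most one half in
each direction, so the norm of the remainder is at most `1 / 2`. -/
lemma exists_remainder {τ : ℂ} (hτ : τ ∈ imagQuadRing m) (h0 : 0 < τ.im) (h1 : τ.im ≤ 1) (z : ℂ) :
    ∃ q ∈ imagQuadRing m, Complex.normSq (z - q) < 1 := by
  set b : ℤ := round (z.im / τ.im)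
  set a : ℤ := round (z.re - b * τ.re)
  refine ⟨a + b * τ, add_mem (intCast_mem _ a) (mul_mem (intCast_mem _ b) hτ), ?_⟩
  have ha := abs_sub_round (z.re - b * τ.re)
  have hb := abs_sub_round (z.im / τ.im)
  have hre : (z - (a + b * τ)).re = z.re - b * τ.re - a := by
    simp
    ring
  have him : (z - (a + b * τ)).im = τ.im * (z.im / τ.im - b) := by
    simp only [Complex.sub_im, Complex.add_im, Complex.intCast_im, Complex.mul_im,
      Complex.intCast_re]
    field_simp
    ring
  rw [Complex.normSq_apply, hre, him]
  have ha2 : (z.re - b * τ.re - a) * (z.re - b * τ.re - a) ≤ 1 / 2 * (1 / 2) := by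
    rw [← abs_mul_abs_self]
    exact mul_le_mul ha ha (abs_nonneg _) (by norm_num)
  have hb2 : (z.im / τ.im - b) * (z.im / τ.im - b) ≤ 1 / 2 * (1 / 2) := by
    rw [← abs_mul_abs_self]
    exact mul_le_mul hb hb (abs_nonneg _) (by norm_num)
  have hc : τ.im * τ.im * ((z.im / τ.im - b) * (z.im / τ.im - b)) ≤ 1 * (1 / 2 * (1 / 2)) :=
    mul_le_mul (mul_le_one₀ h1 h0.le h1) hb2 (mul_self_nonneg _) zero_le_one
  calc _ = (z.re - b * τ.re - a) * (z.re - b * τ.re - a) +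
      τ.im * τ.im * ((z.im / τ.im - b) * (z.im / τ.im - b)) := by ring
    _ < 1 := by linarith

lemma isPrincipal_of_one_or_three (h : m = 1 ∨ m = 3) (I : Ideal (imagQuadRing m)) :
    I.IsPrincipal := by
  rcases h with rfl | rfl
  · refine isPrincipal_of_remainder squarefree_one (exists_remainder (sqrtNeg_mem 1) ?_ ?_) I <;>
    simp [sqrtNeg_im]
  · have hsq := sqrtNeg_mul_self 3
    have hmem : (1 + sqrtNeg 3) / 2 ∈ imagQuadRing 3 := by
      rw [mem_imagQuadRing]
      refine ⟨⟨Polynomial.X ^ 2 - Polynomial.X + 1, by monicity!, ?_⟩,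
        div_mem (add_mem (one_mem _) (mem_imagQuadRing.mp (sqrtNeg_mem 3)).2) (ofNat_mem _ 2)⟩
      simp only [Polynomial.eval₂_add, Polynomial.eval₂_sub, Polynomial.eval₂_pow,
        Polynomial.eval₂_X, Polynomial.eval₂_one]
      push_cast at hsq
      linear_combination hsq / 4
    have him : ((1 + sqrtNeg 3) / 2).im = Real.sqrt 3 / 2 := by
      have : (1 + sqrtNeg 3) / 2 = ((1 / 2 : ℝ) : ℂ) * (1 + sqrtNeg 3) := by
        push_cast
        ring
      rw [this, Complex.im_ofReal_mul, Complex.add_im, sqrtNeg_im, Complex.one_im]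
      push_cast
      ring
    have h3 : Real.sqrt 3 ≤ 2 := by
      rw [Real.sqrt_le_left (by norm_num)]
      norm_num
    exact isPrincipal_of_remainder Nat.prime_three.squarefree
      (exists_remainder hmem (by rw [him]; positivity) (by rw [him]; linarith)) I

/-- A unit has norm one, so `a ^ 2 + m * b ^ 2 = 4`. With `b ≠ 0` this needs `m ≤ 4`; here 4 is not
squarefree, and for `m = 2` there is no solution. -/
lemma unit_eq (hm : Squarefree m) (h1 : m ≠ 1) (h3 : m ≠ 3) {x y : ℂ} (hx : x ∈ imagQuadRing m)
    (hy : y ∈ imagQuadRing m) (hxy : x * y = 1) : x = 1 ∨ x = -1 := by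
  have hx1 := one_le_normSq hm hx (left_ne_zero_of_mul_eq_one hxy)
  have hy1 := one_le_normSq hm hy (right_ne_zero_of_mul_eq_one hxy)
  have hprod : Complex.normSq x * Complex.normSq y = 1 := by
    rw [← Complex.normSq_mul, hxy, map_one]
  have hnorm : Complex.normSq x = 1 := by nlinarith
  obtain ⟨a, b, n, hab, hn, hsum⟩ := exists_int_coords hm hx
  have hn1 : n = 1 := by
    rw [hnorm] at hn
    exact_mod_cast hn.symm
  subst hn1
  have hm0 : m ≠ 0 := hm.ne_zero
  have hb : b = 0 := by
    by_contra hb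
    have hb1 : 1 ≤ b ^ 2 := by
      have := sq_nonneg b
      have : b ^ 2 ≠ 0 := pow_ne_zero 2 hb
      omega
    have hm4 : m ≤ 4 := by
      have : (m : ℤ) ≤ 4 := by nlinarith [sq_nonneg a]
      exact_mod_cast this
    have hm4' : m ≠ 4 := by
      rintro rfl
      exact absurd (hm 2 (by norm_num)) (by norm_num)
    have hm2 : m = 2 := by omega
    subst hm2
    have hb2 : b ^ 2 ≤ 2 := by
      push_cast at hsum
      nlinarith [sq_nonneg a]
    have hbl : b < 2 := by nlinarith
    have hbg : -2 < b := by nlinarith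
    have ha2 : a ^ 2 ≤ 2 := by
      push_cast at hsum
      nlinarith
    have hal : a < 2 := by nlinarith
    have hag : -2 < a := by nlinarith
    interval_cases a <;> interval_cases b <;> simp at hsum hb
  subst hb
  have ha : (a - 2) * (a + 2) = 0 := by linear_combination hsum
  simp only [Int.cast_zero, zero_mul, add_zero] at hab
  rcases mul_eq_zero.mp ha with h | h
  · left
    have : a = 2 := by omega
    rw [this] at hab
    push_cast at hab
    linear_combination hab / 2
  · right
    have : a = -2 := by omega
    rw [this] at hab
    push_cast at hab
    linear_combination hab / 2

lemma mem_imagQuadRing_of_quadratic {c t : ℂ} (hc : c ∈ IntermediateField.adjoin ℚ {sqrtNeg m})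
    (ht : t ∈ imagQuadRing m) (h : c * c = t * c - 1) : c ∈ imagQuadRing m := by
  refine mem_imagQuadRing.mpr ⟨?_, hc⟩
  set t' : integralClosure ℤ ℂ := ⟨t, (mem_imagQuadRing.mp ht).1⟩
  refine isIntegral_trans (A := integralClosure ℤ ℂ) c
    ⟨Polynomial.X ^ 2 - Polynomial.C t' * Polynomial.X + 1, by monicity!, ?_⟩
  simp only [Polynomial.eval₂_add, Polynomial.eval₂_sub, Polynomial.eval₂_pow, Polynomial.eval₂_mul,
    Polynomial.eval₂_X, Polynomial.eval₂_one, Polynomial.eval₂_C]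
  change c ^ 2 - t * c + 1 = 0
  linear_combination h

end Arithmetic
-- Stabilisers of cusps
section CuspStabiliser

variable {m : ℕ} (w : Fin 2 → imagQuadRing m)

/-- The translation lengths of the unipotent matrices over the ring of integers which fix `w`. -/
def cuspLattice : Submodule ℤ ℂ where
  carrier := {s | ∀ i j, s * (w i * w j) ∈ imagQuadRing m}
  zero_mem' i j := by
    rw [zero_mul]
    exact zero_mem _
  add_mem' hs ht i j := by
    rw [add_mul]
    exact add_mem (hs i j) (ht i j)
  smul_mem' n s hs i j := by
    rw [zsmul_eq_mul, mul_assoc]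
    exact mul_mem (intCast_mem _ n) (hs i j)

variable {w} {i : Fin 2}

/-- For `s ≠ 0` in the lattice, `s * (w i * w i)` is a nonzero quadratic integer, hence of absolute
value at least one. -/
lemma discreteTopology_cuspLattice (hm : Squarefree m) (hi : (w i : ℂ) ≠ 0) :
    DiscreteTopology (cuspLattice w) := by
  have hpos : 0 < ‖(w i * w i : ℂ)‖ := norm_pos_iff.mpr (mul_ne_zero hi hi)
  have hinv : 0 < ‖(w i * w i : ℂ)‖⁻¹ := inv_pos.mpr hpos
  refine DiscreteTopology.of_forall_le_norm (r := ‖(w i * w i : ℂ)‖⁻¹) hinv fun s hs => ?_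
  have hs0 : (s : ℂ) ≠ 0 := fun h => hs (Subtype.ext h)
  have h1 := one_le_normSq hm (s.2 i i) (mul_ne_zero hs0 (mul_ne_zero hi hi))
  rw [Complex.normSq_eq_norm_sq, norm_mul] at h1
  have h2 : 1 ≤ ‖(s : ℂ)‖ * ‖(w i * w i : ℂ)‖ := by
    by_contra! hlt
    have : (‖(s : ℂ)‖ * ‖(w i * w i : ℂ)‖) ^ 2 < 1 := pow_lt_one₀ (by positivity) hlt two_ne_zero
    linarith
  rw [inv_le_iff_one_le_mul₀ hpos]
  exact h2

/-- The lattice contains `1` and `sqrtNeg m`, because the entries of `w` are integral. -/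
lemma span_cuspLattice (hm : Squarefree m) :
    Submodule.span ℝ (cuspLattice w : Set ℂ) = ⊤ := by
  have hsqrt : Real.sqrt m ≠ 0 := by
    have := Nat.pos_of_ne_zero hm.ne_zero
    positivity
  rw [eq_top_iff]
  rintro z -
  have h1 : (1 : ℂ) ∈ cuspLattice w := fun i j => by
    rw [one_mul]
    exact mul_mem (w i).2 (w j).2
  have h2 : sqrtNeg m ∈ cuspLattice w := fun i j =>
    mul_mem (sqrtNeg_mem m) (mul_mem (w i).2 (w j).2)
  have hz : z = z.re • (1 : ℂ) + (z.im / Real.sqrt m) • sqrtNeg m := by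
    apply Complex.ext
    · simp [sqrtNeg_re]
    · simp [sqrtNeg_im, hsqrt]
  rw [hz]
  exact add_mem (Submodule.smul_mem _ _ (Submodule.subset_span h1))
    (Submodule.smul_mem _ _ (Submodule.subset_span h2))

lemma exists_cuspLattice_basis (hm : Squarefree m) (hi : (w i : ℂ) ≠ 0) :
    Nonempty (Module.Basis (Fin 2) ℤ (cuspLattice w)) := by
  have := discreteTopology_cuspLattice hm hi
  have : IsZLattice ℝ (cuspLattice w) := ⟨span_cuspLattice hm⟩
  have := ZLattice.module_finite ℝ (cuspLattice w)
  have := ZLattice.module_free ℝ (cuspLattice w)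
  exact ⟨Module.finBasisOfFinrankEq ℤ _
    ((ZLattice.rank ℝ (cuspLattice w)).trans Complex.finrank_real_complex)⟩

variable (w) in
/-- The unipotent matrix which fixes `w` with the given translation length. -/
def unipotent (s : cuspLattice w) : Matrix.SpecialLinearGroup (Fin 2) (imagQuadRing m) :=
  ⟨!![1 + ⟨_, s.2 0 1⟩, -⟨_, s.2 0 0⟩; ⟨_, s.2 1 1⟩, 1 - ⟨_, s.2 0 1⟩], by
    rw [Matrix.det_fin_two_of]
    apply Subtype.ext
    push_cast
    ring⟩

variable (w) in
/-- The nilpotent matrix with kernel and image spanned by `w`. -/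
def nilpotent : Matrix (Fin 2) (Fin 2) ℂ :=
  !![(w 0 * w 1 : ℂ), -(w 0 * w 0 : ℂ); (w 1 * w 1 : ℂ), -(w 0 * w 1 : ℂ)]

lemma nilpotent_mul_self : nilpotent w * nilpotent w = 0 := by
  ext j k
  fin_cases j <;> fin_cases k <;>
  · simp [nilpotent, Matrix.mul_apply, Fin.sum_univ_two]
    ring

lemma nilpotent_mulVec : nilpotent w *ᵥ (fun i => (w i : ℂ)) = 0 := by
  ext j
  fin_cases j <;>
  · simp [nilpotent, Matrix.mulVec, dotProduct, Fin.sum_univ_two]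
    ring

lemma nilpotent_ne_zero (hi : (w i : ℂ) ≠ 0) : nilpotent w ≠ 0 := by
  intro h
  have h0 := congrFun (congrFun h 0) 1
  have h1 := congrFun (congrFun h 1) 0
  fin_cases i <;> simp_all [nilpotent]

lemma toComplex_unipotent (s : cuspLattice w) :
    toComplex (unipotent w s) = 1 + (s : ℂ) • nilpotent w := by
  ext j k
  fin_cases j <;> fin_cases k <;> simp [toComplex, unipotent, nilpotent, sub_eq_add_neg]

lemma trace_nilpotent : (nilpotent w).trace = 0 := by
  simp [nilpotent, Matrix.trace_fin_two]

variable (w) in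
/-- The unipotent elements of the Bianchi group which fix `w`. -/
def unipotentHom : Multiplicative (cuspLattice w) →* BianchiGroup m where
  toFun s := QuotientGroup.mk (unipotent w s.toAdd)
  map_one' := by
    rw [mk_eq_one_iff, toComplex_unipotent]
    left
    simp
  map_mul' s t := by
    rw [← QuotientGroup.mk_mul, mk_eq_mk_iff]
    left
    rw [toComplex_mul, toComplex_unipotent, toComplex_unipotent, toComplex_unipotent, mul_add,
      add_mul, add_mul, smul_mul_smul_comm, nilpotent_mul_self, smul_zero, toAdd_mul,
      Submodule.coe_add, add_smul, mul_one, one_mul, add_zero, mul_one, add_assoc]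

lemma unipotentHom_injective (hi : (w i : ℂ) ≠ 0) : Function.Injective (unipotentHom w) := by
  rw [injective_iff_map_eq_one]
  intro s hs
  have hs : (QuotientGroup.mk (unipotent w s.toAdd) : BianchiGroup m) = 1 := hs
  rw [mk_eq_one_iff, toComplex_unipotent] at hs
  rcases hs with h | h
  · rw [add_eq_left, smul_eq_zero] at h
    exact congrArg Multiplicative.ofAdd (Subtype.ext (h.resolve_right (nilpotent_ne_zero hi)) :
      s.toAdd = 0)
  · have := congrArg Matrix.trace h
    rw [Matrix.trace_add, Matrix.trace_smul, trace_nilpotent, Matrix.trace_neg, smul_zero,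
      Matrix.trace_one] at this
    norm_num at this

lemma unipotentHom_fixes (s : Multiplicative (cuspLattice w)) :
    hermRep m (unipotentHom w s) (cuspForm w) = cuspForm w := by
  change hermRep m (QuotientGroup.mk (unipotent w s.toAdd)) (cuspForm w) = cuspForm w
  rw [hermRep_cuspForm]
  congr 1
  funext j
  apply Subtype.ext
  have := congrFun (toComplex_mulVec (g := unipotent w s.toAdd) w) j
  rw [← this, toComplex_unipotent, Matrix.add_mulVec, Matrix.one_mulVec, Matrix.smul_mulVec,
    nilpotent_mulVec, smul_zero, add_zero]

/-- The matrices which fix `w` are unipotent. -/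
lemma exists_eq_unipotent (hi : (w i : ℂ) ≠ 0)
    (g : Matrix.SpecialLinearGroup (Fin 2) (imagQuadRing m))
    (h : toComplex g *ᵥ (fun i => (w i : ℂ)) = fun i => (w i : ℂ)) :
    ∃ s : cuspLattice w, toComplex g = toComplex (unipotent w s) := by
  have hdet := det_toComplex g
  have hmem : ∀ j k, toComplex g j k ∈ imagQuadRing m := fun j k => (g.1 j k).2
  -- The fixed vector and the determinant determine all entries up to one parameter, which is read
  -- off by division by the square of a nonzero entry of `w`.
  have hentries : ∃ s : ℂ, toComplex g 0 0 = 1 + s * (w 0 * w 1) ∧ toComplex g 0 1 = -(s * (w 0 * w 0)) ∧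
      toComplex g 1 0 = s * (w 1 * w 1) ∧ toComplex g 1 1 = 1 - s * (w 0 * w 1) := by
    have e0 := congrFun h 0
    have e1 := congrFun h 1
    simp only [Matrix.mulVec, dotProduct, Fin.sum_univ_two] at e0 e1
    rw [Matrix.det_fin_two] at hdet
    have hx : (w 0 : ℂ) ≠ 0 ∨ (w 1 : ℂ) ≠ 0 := by
      fin_cases i
      · exact Or.inl hi
      · exact Or.inr hi
    generalize toComplex g 0 0 = a at *
    generalize toComplex g 0 1 = b at *
    generalize toComplex g 1 0 = c at *
    generalize toComplex g 1 1 = d at *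
    generalize (w 0 : ℂ) = x at *
    generalize (w 1 : ℂ) = y at *
    rcases hx with hx | hy
    · have hd : d * x = x + b * y := by linear_combination x * hdet - d * e0 + b * e1
      refine ⟨-b / (x * x), ?_, ?_, ?_, ?_⟩ <;> field_simp
      · linear_combination e0
      · linear_combination x * e1 - y * hd
      · linear_combination hd
    · have ha : a * y = y + c * x := by linear_combination y * hdet - a * e1 + c * e0
      refine ⟨c / (y * y), ?_, ?_, ?_, ?_⟩ <;> field_simp
      · linear_combination ha
      · linear_combination y * e0 - x * ha
      · linear_combination e1
  obtain ⟨s, h00, h01, h10, h11⟩ := hentries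
  have hs : s ∈ cuspLattice w := by
    have h1 : s * (w 0 * w 1) ∈ imagQuadRing m := by
      have := sub_mem (hmem 0 0) (one_mem _)
      rwa [h00, add_sub_cancel_left] at this
    intro j k
    fin_cases j <;> fin_cases k
    · have := neg_mem (hmem 0 1)
      rwa [h01, neg_neg] at this
    · exact h1
    · change s * (w 1 * w 0) ∈ _
      rwa [mul_comm (w 1 : ℂ)]
    · have := hmem 1 0
      rwa [h10] at this
  refine ⟨⟨s, hs⟩, ?_⟩
  rw [toComplex_unipotent]
  ext j k
  fin_cases j <;> fin_cases k <;> simp [nilpotent, h00, h01, h10, h11, sub_eq_add_neg]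

/-- An element which preserves the ray has `w` as an eigenvector. The eigenvalue lies in the field
and is integral, hence a unit, with inverse `trace - c`. So it is `1` or `-1`, and one of the two
lifts fixes `w`. -/
lemma image_ray_cusp_iff (hm : Squarefree m) (h1 : m ≠ 1) (h3 : m ≠ 3) (hi : (w i : ℂ) ≠ 0)
    (g : BianchiGroup m) : hermRep m g '' ray (cuspForm w) = ray (cuspForm w) ↔
      g ∈ (unipotentHom w).range := by
  constructor
  · intro h
    obtain ⟨g, rfl⟩ := QuotientGroup.mk_surjective g
    rw [image_ray] at h
    obtain ⟨t, ht, e⟩ := ray_eq_iff_mem.mp h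
    obtain ⟨c, hc, hcw⟩ := exists_eigenvalue hi ht.ne' e
    have hcv : toComplex g *ᵥ (fun i => (w i : ℂ)) = c • fun i => (w i : ℂ) := by
      rw [toComplex_mulVec]
      exact funext hcw
    have heq := eigenvalue_equation (det_toComplex g) (v := fun i => (w i : ℂ)) hi hcv
    have hcm := mem_imagQuadRing_of_quadratic hc (trace_toComplex_mem g) heq
    have hunit := unit_eq hm h1 h3 hcm (sub_mem (trace_toComplex_mem g) hcm)
      (by linear_combination -heq)
    rcases hunit with rfl | rfl
    · obtain ⟨s, hs⟩ := exists_eq_unipotent hi g (by rw [hcv, one_smul])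
      exact ⟨Multiplicative.ofAdd s, ((mk_eq_mk_iff _ _).mpr (Or.inl hs)).symm⟩
    · have hneg : toComplex (-g) = -toComplex g := by
        ext j k
        simp [toComplex]
      obtain ⟨s, hs⟩ := exists_eq_unipotent hi (-g) (by
        rw [hneg, Matrix.neg_mulVec, hcv, neg_smul, one_smul, neg_neg])
      refine ⟨Multiplicative.ofAdd s, ((mk_eq_mk_iff _ _).mpr (Or.inr ?_)).symm⟩
      change toComplex g = -toComplex (unipotent w s)
      rw [← hs, hneg, neg_neg]
  · rintro ⟨s, rfl⟩
    rw [image_ray, unipotentHom_fixes]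

end CuspStabiliser
-- The homology of the singular cusps has no `ℓ`-torsion
section CuspHomology

variable {m : ℕ}

lemma exists_cusp_stabilizer_basis (hm : Squarefree m) (h1 : m ≠ 1) (h3 : m ≠ 3)
    {w : Fin 2 → imagQuadRing m} {i : Fin 2} (hi : (w i : ℂ) ≠ 0) :
    ∃ a b : BianchiGroup m, a * b = b * a ∧
      (∀ k n : ℤ, a ^ k * b ^ n = 1 → k = 0 ∧ n = 0) ∧
      ∀ g : BianchiGroup m, hermRep m g '' ray (cuspForm w) = ray (cuspForm w) ↔
        ∃ k n : ℤ, g = a ^ k * b ^ n := by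
  obtain ⟨B⟩ := exists_cuspLattice_basis hm hi
  have hpow : ∀ k n : ℤ, unipotentHom w (Multiplicative.ofAdd (B 0)) ^ k *
      unipotentHom w (Multiplicative.ofAdd (B 1)) ^ n =
        unipotentHom w (Multiplicative.ofAdd (k • B 0 + n • B 1)) := fun k n => by
    rw [← map_zpow (unipotentHom w), ← map_zpow (unipotentHom w), ← map_mul (unipotentHom w)]
    rfl
  refine ⟨unipotentHom w (Multiplicative.ofAdd (B 0)), unipotentHom w (Multiplicative.ofAdd (B 1)),
    ?_, fun k n h => ?_, fun g => ?_⟩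
  · rw [← map_mul (unipotentHom w), ← map_mul (unipotentHom w), mul_comm]
  · rw [hpow] at h
    have h0 : k • B 0 + n • B 1 = 0 := unipotentHom_injective hi (h.trans (map_one _).symm)
    have hB : LinearIndependent ℤ ![B 0, B 1] := by
      convert B.linearIndependent using 1
      funext j
      fin_cases j <;> rfl
    exact LinearIndependent.pair_iff.mp hB k n h0
  · rw [image_ray_cusp_iff hm h1 h3 hi]
    constructor
    · rintro ⟨s, rfl⟩
      refine ⟨B.repr s.toAdd 0, B.repr s.toAdd 1, ?_⟩
      rw [hpow, ← Fin.sum_univ_two (fun j => B.repr s.toAdd j • B j), B.sum_repr]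
      rfl
    · rintro ⟨k, n, rfl⟩
      exact ⟨_, (hpow k n).symm⟩

/-- The family of the singular cusps. -/
def cuspFamily (m : ℕ) : CellFamily (hermRep m) where
  cells := singularCusps m
  image_mem g _ hσ := singularCusps_smul g hσ

lemma finrank_singularCusp {σ : Set (Matrix (Fin 2) (Fin 2) ℂ)} (h : σ ∈ singularCusps m) :
    Module.finrank ℝ (Submodule.span ℝ σ) = 1 := by
  obtain ⟨w, hw, rfl⟩ := mem_singularCusps.mp h
  obtain ⟨i, hi⟩ := ne_zero_of_not_isPrincipal hw
  exact finrank_span_ray (cuspForm_ne_zero hi)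

/-- Whatever stabilises a ray multiplies it by a positive factor, so it preserves the orientation.
-/
lemma framesDiffer_of_singularCusp {K : CellFamily (hermRep m)} (f : FramedCell K 0)
    (hf : f.cell ∈ singularCusps m) {g : BianchiGroup m} (h : hermRep m g '' f.cell = f.cell) :
    ∃ c : ℝ, 0 < c ∧ FramesDiffer f.vec (f.translate g).vec c := by
  obtain ⟨w, hw, hf⟩ := mem_singularCusps.mp hf
  rw [hf, image_ray] at h
  obtain ⟨t, ht, e⟩ := ray_eq_iff_mem.mp h
  have hmem := f.mem_span 0
  rw [hf, span_ray] at hmem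
  obtain ⟨c, hc⟩ := Submodule.mem_span_singleton.mp hmem
  refine ⟨t, ht, framesDiffer_single ?_⟩
  change hermRep m g (f.vec 0) = t • f.vec 0
  rw [← hc, map_smul, e, smul_comm]

lemma cuspFamily_isOriented : IsOriented (cuspFamily m) 0 := fun f _ h =>
  framesDiffer_of_singularCusp f f.mem h

/-- For `m = 1` and `m = 3` all ideals are principal and there are no singular cusps. Otherwise the
units are `±1`, and the stabilisers are free abelian of rank two. -/
lemma cuspFamily_primary_eq_zero (hm : Squarefree m) {ℓ : ℕ} (hℓ : ℓ.Prime) (p q : ℕ) :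
    ∀ x ∈ primaryPart ℓ (groupHomology (Rep.of (chainsRep (cuspFamily m) p)) (q + 1)), x = 0 := by
  rintro x ⟨n, hn⟩
  by_cases h13 : m = 1 ∨ m = 3
  · refine homology_chains_eq_zero (fun σ hσ => ?_) _ x
    obtain ⟨w, hw, -⟩ := mem_singularCusps.mp hσ
    exact absurd (isPrincipal_of_one_or_three h13 _) hw
  obtain _ | p := p
  swap
  · refine homology_chains_eq_zero (fun σ hσ => ?_) _ x
    rw [finrank_singularCusp hσ]
    omega
  push Not at h13
  obtain ⟨o, e, -, -⟩ := exists_chains_iso (cuspFamily_isOriented (m := m))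
  have hx : homologyMap (q + 1) e.hom (homologyMap (q + 1) e.inv x) = x := by
    rw [← homologyMap_comp, e.inv_hom_id, homologyMap_id]
  rw [← hx, torsionFree_homology_of_stabilizer_rank_two (fun y => ?_) (ℓ ^ n)
    (pow_ne_zero n hℓ.ne_zero) q (homologyMap (q + 1) e.inv x) (by rw [← map_nsmul, hn, map_zero]),
    map_zero]
  obtain ⟨w, hw, hy⟩ := mem_singularCusps.mp y.2.1
  obtain ⟨i, hi⟩ := ne_zero_of_not_isPrincipal hw
  obtain ⟨a, b, hab, hind, hstab⟩ := exists_cusp_stabilizer_basis hm h13.1 h13.2 hi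
  refine ⟨a, b, hab, hind, fun g => ?_⟩
  rw [← hstab g, ← hy]
  exact PCell.mem_stabilizer

end CuspHomology

/-! ### From the torsion subcomplex to the Flöge complex -/

section Floege

variable {m ℓ : ℕ} {Z : CellFamily (hermRep m)}

namespace IsRefinedComplex

lemma floege_isOriented (hZ : IsRefinedComplex Z) (p : ℕ) : IsOriented (floegeComplex Z) p := by
  intro f g h
  rcases f.mem with hf | hf
  · exact hZ.isOriented p ⟨f.cell, hf.1, f.dim, f.vec, f.indep, f.mem_span⟩ g h
  · have hp := (finrank_singularCusp hf).symm.trans f.dim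
    obtain rfl : p = 0 := by omega
    exact framesDiffer_of_singularCusp f hf h

/-- In the Flöge complex, the ends of an edge with `ℓ`-torsion are the rays of its end points. -/
lemma vertices_of_edge (hm : Squarefree m) (hℓ : ℓ.Prime) (h2 : ¬ (m = 1 ∧ ℓ = 2))
    (h3 : ¬ (m = 3 ∧ ℓ = 3)) (hZ : IsRefinedComplex Z) {P Q : Matrix (Fin 2) (Fin 2) ℂ}
    (hPQ : LinearIndependent ℝ ![P, Q]) (h : seg P Q ∈ (torsionSubcomplex ℓ Z).cells) :
    ∀ τ ∈ (floegeComplex Z).cells, Module.finrank ℝ (Submodule.span ℝ τ) = 1 →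
      τ ⊆ closure (seg P Q) → τ ∈ (torsionSubcomplex ℓ Z).cells ∧ (τ = ray P ∨ τ = ray Q) := by
  obtain ⟨hPQZ, g, hg, hgσ⟩ := h
  have hfix := hZ.fixed_pointwise g _ hPQZ hgσ
  obtain ⟨hgP, hgQ⟩ := fixed_ends hfix
  have hmid : P + Q ∈ seg P Q := ⟨1, 1, one_pos, one_pos, by simp⟩
  have hfixcl : ∀ A ∈ closure (seg P Q), hermRep m g A = A := by
    rw [closure_seg hPQ]
    rintro _ ⟨a, b, -, -, rfl⟩
    rw [map_add, map_smul, map_smul, hgP, hgQ]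
  rintro τ (⟨hτ, -⟩ | hτ) hd hcl
  · obtain ⟨A, hA⟩ := hZ.nonempty hτ
    have hτT : τ ∈ (torsionSubcomplex ℓ Z).cells :=
      ⟨hτ, g, hg, hZ.image_eq_of_fixed_point hτ hA (hfixcl A (hcl hA))⟩
    exact ⟨hτT, (hZ.isTorsionGraph hℓ).vertices_of_edge hPQ ⟨hPQZ, g, hg, hgσ⟩ τ hτT hd hcl⟩
  · obtain ⟨w, hw, rfl⟩ := mem_singularCusps.mp hτ
    exact ((exceptional_of_fixed_cusp hm hℓ (hZ.subset _ hPQZ hmid) hg (hfix _ hmid)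
      (ne_zero_of_not_isPrincipal hw) (hfixcl _ (hcl (mem_ray_self _)))).elim h2 h3).elim

/-- Every vertex of the Flöge complex at the end of a torsion edge is fixed by the same rotation. It
is no singular cusp outside the excluded cases, so it is itself a torsion cell, and no end is lost
in the torsion subcomplex. -/
lemma boundary_restriction (hm : Squarefree m) (hℓ : ℓ.Prime) (h2 : ¬ (m = 1 ∧ ℓ = 2))
    (h3 : ¬ (m = 3 ∧ ℓ = 3)) (hZ : IsRefinedComplex Z) :
    restriction (torsionSubcomplex ℓ Z) (floegeComplex Z) 1 ≫ boundaryHom (floegeComplex Z) 0 =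
      boundaryHom (torsionSubcomplex ℓ Z) 0 ≫
        restriction (torsionSubcomplex ℓ Z) (floegeComplex Z) 0 := by
  have hT := hZ.isTorsionGraph hℓ
  have hsub := hZ.torsion_subset hm hℓ h2 h3
  refine chains_hom_ext_orbit fun σ hσ hd => ?_
  obtain ⟨P, Q, hPQ, -, -, rfl, -⟩ := hT.eq_seg_of_finrank hσ hd
  refine ⟨1, edgeCell (torsionSubcomplex ℓ Z) hPQ hσ,
    by rw [map_one]; exact (Set.image_id _).symm, ?_⟩
  have hv := hZ.vertices_of_edge hm hℓ h2 h3 hPQ hσ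
  have hend : ∀ A : Matrix (Fin 2) (Fin 2) ℂ, A ≠ 0 → ray A ⊆ closure (seg P Q) →
      ray A ∈ (floegeComplex Z).cells → ray A ∈ (torsionSubcomplex ℓ Z).cells := fun A hA hcl hX =>
    (hv _ hX (finrank_span_ray hA) hcl).1
  have hrQ := ray_left_subset_closure (indep_symm hPQ)
  rw [seg_comm] at hrQ
  have key : boundary (floegeComplex Z) 0 ((restriction (torsionSubcomplex ℓ Z)
      (floegeComplex Z) 1).hom (edgeCell (torsionSubcomplex ℓ Z) hPQ hσ).chain) =
      (restriction (torsionSubcomplex ℓ Z) (floegeComplex Z) 0).hom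
        (boundary (torsionSubcomplex ℓ Z) 0 (edgeCell (torsionSubcomplex ℓ Z) hPQ hσ).chain) := by
    rw [restriction_chain_of_mem _ (hsub hσ), boundary_chain, boundary_chain,
      boundaryCell_edge (hZ.floege_isOriented 0) _ hPQ rfl rfl rfl
        (fun τ hτ hd hcl => (hv τ hτ hd hcl).2),
      boundaryCell_edge (hT.isOriented 0) _ hPQ rfl rfl rfl (hT.vertices_of_edge hPQ hσ), map_sub,
      restriction_vertexChain (hend P (hPQ.ne_zero 0) (ray_left_subset_closure hPQ)),
      restriction_vertexChain (hend Q (hPQ.ne_zero 1) hrQ)]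
  exact key

/-- A cell outside the torsion subcomplex is either a singular cusp or a cell of `Z` without
`ℓ`-torsion in its stabiliser, and neither kind contributes to the `ℓ`-primary part in positive
degrees. -/
theorem E2Primary_equiv_floege (hm : Squarefree m) (hℓ : ℓ.Prime) (h2 : ¬ (m = 1 ∧ ℓ = 2))
    (h3 : ¬ (m = 3 ∧ ℓ = 3)) (hZ : IsRefinedComplex Z) (p q : ℕ) (hq : 1 ≤ q) :
    Nonempty (E2Primary ℓ (torsionSubcomplex ℓ Z) p q ≃+ E2Primary ℓ (floegeComplex Z) p q) := by
  obtain ⟨q, rfl⟩ := Nat.exists_eq_add_of_le' hq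
  have hT := hZ.isTorsionGraph hℓ
  refine E2Primary_equiv_of_diff (hZ.torsion_subset hm hℓ h2 h3) (fun p x => ?_) (fun p => ?_) p
  · obtain _ | p := p
    · have h := congrArg (fun f => homologyMap (q + 1) f x) (hZ.boundary_restriction hm hℓ h2 h3)
      exact (homologyMap_comp _ _ _ x).symm.trans (h.symm.trans (homologyMap_comp _ _ _ x))
    · have hx : x = 0 := homology_chains_eq_zero (fun σ hσ => by
        have := hT.finrank_le hσ
        omega) _ x
      rw [hx, map_zero]
      exact (map_zero _).trans ((map_zero (d1 _ _ _)).symm.trans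
        (congrArg _ (map_zero (homologyMap (q + 1) _)).symm))
  · refine primary_eq_zero_of_diff (cuspFamily m) (cuspFamily_primary_eq_zero hm hℓ p q)
      (hZ.primary_eq_zero hm hℓ (fun σ hσ => ?_) p q)
    obtain ⟨⟨hσ, hσT⟩, hσS⟩ := hσ
    exact ⟨(hσ.resolve_right hσS).1, hσT⟩

/-- The source of the differential is in degree `p + 1`, where there are no cusps; so all
stabilisers involved are finite, of order dividing a common `N`. -/
theorem primaryPart_E2_floege_equiv (hm : Squarefree m) (hℓ : ℓ.Prime) (hZ : IsRefinedComplex Z)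
    (p q : ℕ) (hq : 1 ≤ q) : Nonempty (primaryPart ℓ (E2 (floegeComplex Z) p q) ≃+
      E2Primary ℓ (floegeComplex Z) p q) := by
  obtain ⟨q, rfl⟩ := Nat.exists_eq_add_of_le' hq
  obtain ⟨N, hN, hstab⟩ := hZ.stabilizer_bound hm
  refine E2Primary_equiv_primaryPart_E2 ℓ hℓ N hN fun x =>
    nsmul_homology_chains (hZ.floege_isOriented (p + 1)) N (fun σ => hstab _ _ σ ?_) q x
  rcases σ.2.1 with h | h
  · exact h.1
  · have := σ.2.2
    rw [finrank_singularCusp h] at this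
    omega

end IsRefinedComplex

end Floege

end TorsionReduction

end

/-! ### The theorem -/

open TorsionReduction in
theorem mainTheorem12 (m ℓ : ℕ) (hm : Squarefree m) (hℓ : ℓ.Prime)
    (Z : CellFamily (hermRep m)) (hZ : IsRefinedComplex Z) :
    -- an edge fusion can be carried out at each vertex with exactly two adjacent edges
    (∀ (K : CellFamily (hermRep m)) (v e₁ e₂ : Set (Matrix (Fin 2) (Fin 2) ℂ)),
      FusesTo ℓ (torsionSubcomplex ℓ Z) K → ExactlyTwoEdges K v e₁ e₂ →
        ∃ K' : CellFamily (hermRep m), IsEdgeFusionAt ℓ v K K') ∧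
    ∀ R : CellFamily (hermRep m), IsReduced ℓ (torsionSubcomplex ℓ Z) R →
      ∀ p q : ℕ, 1 ≤ q →
        Nonempty (E2Primary ℓ (torsionSubcomplex ℓ Z) p q ≃+ E2Primary ℓ R p q) ∧
        (¬ (m = 1 ∧ ℓ = 2) → ¬ (m = 3 ∧ ℓ = 3) →
          Nonempty (primaryPart ℓ (E2 (floegeComplex Z) p q) ≃+ E2Primary ℓ R p q)) := by
  have hT := hZ.isTorsionGraph hℓ
  refine ⟨fun K v e₁ e₂ hK h => exists_fusion hm hℓ (isTorsionGraph_of_fusesTo hℓ hT hK) h,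
    fun R hR p q hq => ?_⟩
  obtain ⟨e⟩ := E2Primary_equiv_of_fusesTo hm hℓ hT hR.1 p q hq
  refine ⟨⟨e⟩, fun h2 h3 => ?_⟩
  obtain ⟨e₁⟩ := hZ.primaryPart_E2_floege_equiv hm hℓ p q hq
  obtain ⟨e₂⟩ := hZ.E2Primary_equiv_floege hm hℓ h2 h3 p q hq
  exact ⟨e₁.trans (e₂.symm.trans e)⟩
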